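/- Let $g\ge 1$ and let $X$ be a compact connected Kähler manifold of complex dimension $2g$ with a holomorphic, everywhere non-degenerate $2$-form $\sigma$ (for instance an irreducible hyperkähler manifold, projective or not). Let $p\colon X\to B$ be a Lagrangian fibration: $p$ is a holomorphic map with connected fibers from $X$ to a complex manifold $P$ (for instance a projective space), $B=p(X)$, and for $b\in B^\circ$ the fiber $X_b=p^{-1}(b)$ is a complex torus of dimension $g$ on which $\sigma$ vanishes. Here $B^\circ\subset B$ is the set of points $b$ at which $B$ is smooth of dimension $g$ and such that $dp_x$ has rank $g$ for every $x\in X_b$. Let $f$ be an automorphism of $X$ with $p\circ f=p$ and $f^*\sigma=\sigma$ (for instance a suitable positive iterate of a parabolic automorphism preserving the fibration). A Betti datum consists of a simply connected open subset $V\subset B^\circ$, a holomorphic section $s\colon V\to X$ of $p$, and a basis of $H_1(X_b;\mathbb Z)$, $b\in V$, depending continuously on $b$. It determines the Betti diffeomorphism $\Phi\colon p^{-1}(V)\to V\times\mathbb R^{2g}/\mathbb Z^{2g}$ over $V$ which maps $s(b)$ to $(b,0)$, is an isomorphism of Lie groups from $X_b$, with neutral element $s(b)$, to $\{b\}\times\mathbb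 R^{2g}/\mathbb Z^{2g}$ for each $b\in V$, and maps the given basis to the canonical one. The translation vector of $f$ for this datum is a continuous map $t_f\colon V\to\mathbb R^{2g}$ such that $\Phi\circ f\circ\Phi^{-1}(u,x)=(u,x+t_f(u))$. It has maximal variation if its generic rank is $2g$, i.e. if its real differential has rank $2g$ on a dense subset of $V$. Let $\kappa$ be a Kähler form on $X$. For a complex analytic subset $W$ of dimension $m$ of an open subset of $X$ set $\mathrm{vol}_\kappa(W)=\int_W\kappa^m$. For $U\subset B$ put $X_U=p^{-1}(U)$ and let $\|\cdot\|_{X_U}$ be the uniform norm over $X_U$ of $2g$-forms, with respect to the hermitian metric defined by $\kappa$. A multisection of $p$ is a closed, connected (equivalently, irreducible) complex submanifold $M\subset X$ of dimension $g$ which is transverse to the fibers of $p$ along a dense subset of $M$. **Lemma.** Let $U$ be a non-empty open subset of $B$ whose closure is contained in $B^\circ$, and let $M$ be a multisection of $p$. Then $\mathrm{vol}_\kappa(f^n(M)\cap X_U)=O(n^{2g})$ as $n\to+\infty$, and the following properties are equivalent: (a) $t_f$ does not have maximal variation, for at least one Betti datum; (a') $t_f$ does not have maximal variation, for every Betti datum;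 (b) $\mathrm{vol}_\kappa(f^n(M)\cap X_U)=O(n^{2g-1})$ as $n\to+\infty$; (c) $\|(f^n)^*\kappa^g\|_{X_U}=O(n^{2g-1})$ as $n\to+\infty$. -/

import Mathlib

open Set Filter Topology MeasureTheory
open scoped Manifold ContDiff ENNReal NNReal

noncomputable section

namespace LagrangianFibration

/-! Complex manifolds of dimension `n` are modelled on `ℂⁿ`, holomorphic means complex
differentiable. The underlying real manifold of `X` is obtained by using the same charts with the
real model `𝓘(ℝ, Cn n)`. -/

/-- The model space `ℂⁿ`. -/
abbrev Cn (n : ℕ) : Type := Fin n → ℂ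

/-- The complex tangent space `T_x X`, with complex structure multiplication by `Complex.I`. -/
abbrev TX (n : ℕ) {X : Type*} [TopologicalSpace X] [ChartedSpace (Cn n) X] (x : X) : Type :=
  TangentSpace 𝓘(ℂ, Cn n) x

/-- The complex differential of a map from a complex manifold of dimension `m` to one of
dimension `n`. -/
abbrev holDeriv (m n : ℕ) {X Y : Type*} [TopologicalSpace X] [ChartedSpace (Cn m) X]
    [TopologicalSpace Y] [ChartedSpace (Cn n) Y] (h : X → Y) (x : X) :
    TX m x →L[ℂ] TX n (h x) :=
  mfderiv 𝓘(ℂ, Cn m) 𝓘(ℂ, Cn n) h x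

section Forms

variable {n : ℕ} {X : Type*} [TopologicalSpace X] [ChartedSpace (Cn n) X]

/-- The expression, in the chart `φ`, of a real 2-form `κ` on `X`
(the pull-back of `κ` by the inverse of `φ`). -/
def formInChart (κ : ∀ x : X, TX n x [⋀^Fin 2]→L[ℝ] ℝ) (φ : OpenPartialHomeomorph X (Cn n))
    (z : Cn n) : Cn n [⋀^Fin 2]→L[ℝ] ℝ :=
  (κ (φ.symm z)).compContinuousLinearMap ((holDeriv n n φ.symm z).restrictScalars ℝ)

/-- The expression, in the chart `φ`, of a complex 2-form of type `(2,0)` on `X`. -/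
def holFormInChart (σ : ∀ x : X, TX n x [⋀^Fin 2]→L[ℂ] ℂ) (φ : OpenPartialHomeomorph X (Cn n))
    (z : Cn n) : Cn n [⋀^Fin 2]→L[ℂ] ℂ :=
  (σ (φ.symm z)).compContinuousLinearMap (holDeriv n n φ.symm z)

/-- `κ` is a Kähler form on `X`: a smooth, closed, positive real `(1,1)`-form. -/
structure IsKahlerForm (κ : ∀ x : X, TX n x [⋀^Fin 2]→L[ℝ] ℝ) : Prop where
  smooth : ∀ φ ∈ atlas (Cn n) X, ContDiffOn ℝ ∞ (formInChart κ φ) φ.target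
  closed : ∀ φ ∈ atlas (Cn n) X, ∀ z ∈ φ.target, extDeriv (formInChart κ φ) z = 0
  type_one_one : ∀ (x : X) (v w : TX n x), κ x ![Complex.I • v, Complex.I • w] = κ x ![v, w]
  pos : ∀ (x : X) (v : TX n x), v ≠ 0 → 0 < κ x ![v, Complex.I • v]

/-- `σ` is a holomorphic 2-form on `X` which is everywhere non-degenerate (equivalently, if
`n = 2g`, the holomorphic form `σ^g` of top degree does not vanish). On a compact Kähler manifold
such a form is automatically closed. -/
structure IsHolomorphicSymplectic (σ : ∀ x : X, TX n x [⋀^Fin 2]→L[ℂ] ℂ) : Prop where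
  holomorphic : ∀ φ ∈ atlas (Cn n) X, DifferentiableOn ℂ (holFormInChart σ φ) φ.target
  nondegenerate : ∀ (x : X) (v : TX n x), v ≠ 0 → ∃ w : TX n x, σ x ![v, w] ≠ 0

/-- The value of the exterior power `κ^m = κ ∧ ⋯ ∧ κ` of an alternating 2-form on `2m` vectors:
`κ^m (v₁, …, v₂ₘ) = 2⁻ᵐ ∑_τ sgn(τ) ∏ᵢ κ (v_{τ(2i-1)}, v_{τ(2i)})`. -/
def wedgePow {V : Type*} [AddCommGroup V] [Module ℝ V] [TopologicalSpace V]
    (κ : V [⋀^Fin 2]→L[ℝ] ℝ) (m : ℕ) (v : Fin (2 * m) → V) : ℝ :=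
  (1 / 2 ^ m : ℝ) * ∑ τ : Equiv.Perm (Fin (2 * m)), ((Equiv.Perm.sign τ : ℤ) : ℝ) *
    ∏ i : Fin m, κ ![v (τ ⟨2 * i, by omega⟩), v (τ ⟨2 * i + 1, by omega⟩)]

/-- The positively oriented real basis `(e₁, i e₁, …, eₘ, i eₘ)` of `ℂᵐ`. -/
def realFrame (m : ℕ) (k : Fin (2 * m)) : Cn m :=
  Pi.single ⟨k / 2, by omega⟩ (if (k : ℕ) % 2 = 0 then 1 else Complex.I)

/-- The volume `vol_κ(W) = ∫_W κ^m` of a complex analytic subset `W`, of dimension `m`, of an open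
subset of `X`. As `κ^m` is positive on `W`, the integral (over the regular part of `W`) is the
supremum of the sums `∑ᵢ ∫_{Dᵢ} ψᵢ^* κ^m`, for all finite families of injective holomorphic maps
`ψᵢ : Dᵢ → W`, with `Dᵢ` open in `ℂᵐ`, whose images are pairwise disjoint. -/
def vol (κ : ∀ x : X, TX n x [⋀^Fin 2]→L[ℝ] ℝ) (m : ℕ) (W : Set X) : ℝ≥0∞ :=
  ⨆ (k : ℕ) (D : Fin k → Set (Cn m)) (ψ : Fin k → Cn m → X)
    (_ : ∀ i, IsOpen (D i) ∧ MDifferentiableOn 𝓘(ℂ, Cn m) 𝓘(ℂ, Cn n) (ψ i) (D i) ∧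
      InjOn (ψ i) (D i) ∧ ψ i '' D i ⊆ W)
    (_ : ∀ i j, i ≠ j → Disjoint (ψ i '' D i) (ψ j '' D j)),
    ∑ i, ∫⁻ z in D i, ENNReal.ofReal
      (wedgePow (κ (ψ i z)) m (fun k => holDeriv m n (ψ i) z (realFrame m k)))

/-- The uniform norm `‖h^*κ^m‖` over the set `S`, for a holomorphic self-map `h` of `X`: the norm
of the `2m`-form `h^*κ^m` at `x` is the supremum of its absolute values on `2m` vectors of length
at most one, the length being given by the hermitian metric associated to `κ`. -/
def pullbackNorm (κ : ∀ x : X, TX n x [⋀^Fin 2]→L[ℝ] ℝ) (m : ℕ) (h : X → X) (S : Set X) : ℝ≥0∞ :=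
  ⨆ (x ∈ S) (v : Fin (2 * m) → TX n x) (_ : ∀ i, κ x ![v i, Complex.I • v i] ≤ 1),
    ENNReal.ofReal |wedgePow (κ (h x)) m (fun i => holDeriv n n h x (v i))|

end Forms

/-- `a n = O(n^k)` as `n → +∞`, for a sequence with values in `[0, +∞]`. -/
def IsBigOPow (a : ℕ → ℝ≥0∞) (k : ℕ) : Prop :=
  ∃ C : ℝ≥0, ∀ᶠ n : ℕ in atTop, a n ≤ (C : ℝ≥0∞) * (n : ℝ≥0∞) ^ k

section Submanifolds

variable (N : ℕ) {P : Type*} [TopologicalSpace P] [ChartedSpace (Cn N) P]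

/-- `ψ : D → S` is a holomorphic local parametrization, of dimension `d`, of the subset `S` of the
complex manifold `P`: `D` is open in `ℂᵈ` and `ψ` is an injective holomorphic immersion which is a
homeomorphism from `D` to an open subset of `S`. -/
structure IsLocalParam (d : ℕ) (S : Set P) (D : Set (Cn d)) (ψ : Cn d → P) : Prop where
  isOpen : IsOpen D
  holomorphic : MDifferentiableOn 𝓘(ℂ, Cn d) 𝓘(ℂ, Cn N) ψ D
  immersion : ∀ z ∈ D, Function.Injective (holDeriv d N ψ z)
  injOn : InjOn ψ D
  isOpen_image : ∀ D' ⊆ D, IsOpen D' → ∃ W : Set P, IsOpen W ∧ ψ '' D' = S ∩ W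

end Submanifolds

section Fibrations

variable (g N : ℕ)
  {X : Type*} [TopologicalSpace X] [ChartedSpace (Cn (2 * g)) X]
  {P : Type*} [TopologicalSpace P] [ChartedSpace (Cn N) P]

/-! A fibration `X → B` onto a variety `B` embedded in a complex manifold `P` (for instance a
projective space) is given by a map `p : X → P` with image `B = range p`. -/

/-- The set `B°` of regular values of `p : X → B`: the points `b` of `B = range p` such that `B` is
smooth, of dimension `g`, at `b` and the differential of `p`, at each point of the fiber of `b`,
has rank `g` (that is, is onto the tangent space of `B`). -/
def regularValues (p : X → P) : Set P :=
  {b | (∃ (D : Set (Cn g)) (ψ : Cn g → P), IsLocalParam N g (range p) D ψ ∧ b ∈ ψ '' D) ∧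
    ∀ x : X, p x = b →
      Module.finrank ℂ (LinearMap.range (holDeriv (2 * g) N p x).toLinearMap) = g}

/-- The subset `F` of `X` is a complex torus of dimension `g`: it is the image of a holomorphic
immersion `π : ℂᵍ → X` whose fibers are the cosets of a lattice `Λ`, so that `F ≃ ℂᵍ/Λ`. -/
def IsComplexTorus (F : Set X) : Prop :=
  ∃ (Λ : Submodule ℤ (Cn g)) (π : Cn g → X),
    DiscreteTopology Λ ∧ Submodule.span ℝ (Λ : Set (Cn g)) = ⊤ ∧
    MDifferentiable 𝓘(ℂ, Cn g) 𝓘(ℂ, Cn (2 * g)) π ∧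
    (∀ z, Function.Injective (holDeriv g (2 * g) π z)) ∧
    range π = F ∧ ∀ z w, π z = π w ↔ z - w ∈ Λ

/-- `p : X → B` is a Lagrangian fibration, with respect to the holomorphic symplectic form `σ`:
it is holomorphic, with connected fibers, and its fibers over `B°` are Lagrangian tori. -/
structure IsLagrangianFibration (σ : ∀ x : X, TX (2 * g) x [⋀^Fin 2]→L[ℂ] ℂ) (p : X → P) :
    Prop where
  holomorphic : MDifferentiable 𝓘(ℂ, Cn (2 * g)) 𝓘(ℂ, Cn N) p
  connected : ∀ b ∈ range p, IsConnected (p ⁻¹' {b})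
  torus : ∀ b ∈ regularValues g N p, IsComplexTorus g (p ⁻¹' {b})
  lagrangian : ∀ x : X, p x ∈ regularValues g N p → ∀ v w : TX (2 * g) x,
    holDeriv (2 * g) N p x v = 0 → holDeriv (2 * g) N p x w = 0 → σ x ![v, w] = 0

/-- `M` is a multisection of `p`: a smooth, irreducible (that is, connected), closed complex
subvariety of `X` of dimension `g` which is generically transverse to the fibers of `p`. -/
structure IsMultisection (p : X → P) (M : Set X) : Prop where
  isClosed : IsClosed M
  connected : IsConnected M
  submanifold : ∀ x ∈ M, ∃ (D : Set (Cn g)) (ψ : Cn g → X), IsLocalParam (2 * g) g M D ψ ∧ x ∈ ψ '' D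
  transverse : M ⊆ closure {x | ∃ (D : Set (Cn g)) (ψ : Cn g → X), IsLocalParam (2 * g) g M D ψ ∧
    ∃ z ∈ D, ψ z = x ∧ Function.Injective (holDeriv g N (p ∘ ψ) z)}

/-- A Betti datum of `p` and the associated Betti diffeomorphism
`Φ : X_V → V × ℝ^{2g}/ℤ^{2g}`. Here `V` is a simply connected open subset of `B°`, and `Φ` is
described by `E : V × ℝ^{2g} → X_V`, `E u x = Φ⁻¹ (u, x mod ℤ^{2g})`. The holomorphic section is
`u ↦ E u 0`, and the basis of the first homology group of the fibers is given by the images by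
`E u` of the segments from `0` to the vectors of the canonical basis of `ℝ^{2g}`. -/
structure BettiDatum (p : X → P) where
  /-- the domain of the Betti coordinates -/
  V : Set P
  /-- the inverse of the Betti diffeomorphism -/
  E : P → (Fin (2 * g) → ℝ) → X
  subset_regular : V ⊆ regularValues g N p
  isOpen : ∃ W : Set P, IsOpen W ∧ V = range p ∩ W
  simplyConnected : SimplyConnectedSpace V
  proj : ∀ u ∈ V, ∀ x, p (E u x) = u
  surj : ∀ y : X, p y ∈ V → ∃ x, E (p y) x = y
  periodic : ∀ u ∈ V, ∀ x y, E u x = E u y ↔ ∀ i, ∃ k : ℤ, x i - y i = k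
  smooth : ∀ (D : Set (Cn g)) (ψ : Cn g → P), IsLocalParam N g (range p) D ψ → ψ '' D ⊆ V →
    ContMDiffOn 𝓘(ℝ, Cn g × (Fin (2 * g) → ℝ)) 𝓘(ℝ, Cn (2 * g)) ∞
      (fun q : Cn g × (Fin (2 * g) → ℝ) => E (ψ q.1) q.2) (D ×ˢ univ)
  section_holomorphic : ∀ (D : Set (Cn g)) (ψ : Cn g → P), IsLocalParam N g (range p) D ψ →
    ψ '' D ⊆ V → MDifferentiableOn 𝓘(ℂ, Cn g) 𝓘(ℂ, Cn (2 * g)) (fun z => E (ψ z) 0) D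
  /-- For a suitable real linear identification `A` of `ℂᵍ` with `ℝ^{2g}`, the map `E u ∘ A` is a
  holomorphic universal covering of the fiber. Thus the fiber is identified with the quotient of
  `ℂᵍ` by the lattice `A⁻¹(ℤ^{2g})` as a complex manifold, and the restriction of the Betti
  diffeomorphism to the fiber, with origin `E u 0`, is an isomorphism of Lie groups. -/
  lieGroupIso : ∀ u ∈ V, ∃ A : Cn g ≃L[ℝ] (Fin (2 * g) → ℝ),
    MDifferentiable 𝓘(ℂ, Cn g) 𝓘(ℂ, Cn (2 * g)) (fun z => E u (A z))

variable {g N}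

/-- `t : V → ℝ^{2g}` is the translation vector of `f` in the Betti coordinates given by `β`: it is
continuous and `f` is `(u, x) ↦ (u, x + t u)` in these coordinates. -/
def IsTranslationVector {p : X → P} (β : BettiDatum g N p) (f : X → X)
    (t : P → Fin (2 * g) → ℝ) : Prop :=
  ContinuousOn t β.V ∧ ∀ u ∈ β.V, ∀ x, f (β.E u x) = β.E u (x + t u)

/-- The translation vector `t : V → ℝ^{2g}` has maximal variation: its generic rank is `2g`, i.e.
its real differential (computed in holomorphic coordinates of `B°`) has rank `2g` on a dense
subset of `V`. -/
def HasMaximalVariation {p : X → P} (β : BettiDatum g N p)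
    (t : P → Fin (2 * g) → ℝ) : Prop :=
  β.V ⊆ closure {u | ∃ (D : Set (Cn g)) (ψ : Cn g → P), IsLocalParam N g (range p) D ψ ∧
    ψ '' D ⊆ β.V ∧ ∃ z ∈ D, ψ z = u ∧ Function.Surjective (fderiv ℝ (t ∘ ψ) z)}

end Fibrations

end LagrangianFibration

end

open LagrangianFibration

/-! In Betti coordinates `f` is `(u, x) ↦ (u, x + t u)`, so `f^n` is `(u, x) ↦ (u, x + n t u)` and
its differential adds to a tangent vector `a` the vertical vector `n dt(a)`. Evaluate `κ^g` on `2g`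
transported vectors and expand by multilinearity. All coefficients are taken at the moving point `x
+ n t u`, but they are bounded, by periodicity in `x` and compactness in `u`. The term of order
`n^{2g}` is the jacobian of `t`, times the determinant of the horizontal parts of the vectors, times
the value of `κ^g` on the vertical Betti frame; this last value is bounded away from zero because
the fibers are complex and `κ` is positive (`IsBettiChart.growth`). Hence `(f^n)^*κ^g` is
`O(n^{2g})` over compact subsets of `B°`, and `O(n^{2g-1})` at a point exactly when the jacobian of
`t` vanishes below it (`IsBettiChart.isSlow_iff`). The property `IsSlow` involves no Betti
coordinates: different Betti data are compared through it.

To pass from one open set to all of `B°`, the symplectic form is used to identify vertical vectors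
with covectors of the base (`theta`). Uniformizations of the fibers normalized by `theta` vary
holomorphically (`IsFiberExp.mdifferentiableOn`), so the periods `ℓ_j` are holomorphic; and `f`,
which preserves `σ` and `p`, is a translation by a holomorphic vector `α`. The relation `∑ t_j ℓ_j =
α` makes `t` real analytic, so its jacobian vanishes on a whole chart as soon as it vanishes on a
non-empty open part (`jac_eq_zero_of_eventually`). Moreover `B°` is connected, since the critical
values have real codimension at least two in local charts (`isPreconnected_regularValues`). Slow
growth over a non-empty open set thus spreads to all regular values (`forall_isSlow`).

For volumes, the norm of `(f^n)^*κ^g` bounds the volume of `f^n(M)` by a multiple of the volume of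
the compact submanifold `M` (`vol_image_le`). Conversely, if the jacobian is non-zero somewhere over
`U`, the multisection has a patch étale over a nearby open set (`IsMultisection.exists_etale`), and
the images of a compact part of this patch have volume at least `c n^{2g}`
(`IsBettiChart.exists_lower_bound`). The implications are proved in the cycle (a), (c), (b), (a'),
(a), the last one resting on the local existence of Betti data. -/

namespace LagrangianFibration

/-! ### Holomorphic functions of several variables: Cauchy estimates, identity theorem, smoothness
-/

section SeveralComplexVariables

variable {E F : Type} [NormedAddCommGroup E] [NormedSpace ℂ E] [NormedAddCommGroup F]
  [NormedSpace ℂ F]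

/-- Cauchy's estimate for the differential of a holomorphic map. -/
theorem norm_fderiv_le_of_forall_ball_norm_le {f : E → F} {z : E} {r C : ℝ} (hr : 0 < r)
    (hf : DifferentiableOn ℂ f (Metric.ball z r)) (hC : ∀ w ∈ Metric.ball z r, ‖f w‖ ≤ C) :
    ‖fderiv ℂ f z‖ ≤ C / r := by
  have hz : z ∈ Metric.ball z r := Metric.mem_ball_self hr
  have hC0 : 0 ≤ C := (norm_nonneg _).trans (hC z hz)
  refine ContinuousLinearMap.opNorm_le_bound _ (by positivity) fun v => ?_
  rcases eq_or_ne v 0 with rfl | hv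
  · simp
  have hv' : 0 < ‖v‖ := norm_pos_iff.2 hv
  -- The one-variable estimate needs a closed disc inside the open ball; the sharp constant is
  -- recovered by letting `R` increase to `r / ‖v‖`.
  have key : ∀ R : ℝ, 0 < R → R < r / ‖v‖ → ‖fderiv ℂ f z v‖ ≤ C / R := by
    intro R hR hRr
    have hmaps : ∀ ζ ∈ Metric.closedBall (0 : ℂ) R, z + ζ • v ∈ Metric.ball z r := by
      intro ζ hζ
      rw [mem_ball_iff_norm, add_sub_cancel_left, norm_smul]
      have : ‖ζ‖ ≤ R := by simpa using hζ
      calc ‖ζ‖ * ‖v‖ ≤ R * ‖v‖ := by gcongr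
        _ < r / ‖v‖ * ‖v‖ := by gcongr
        _ = r := by field_simp
    have hd : DifferentiableOn ℂ (fun ζ : ℂ => f (z + ζ • v)) (Metric.closedBall 0 R) :=
      hf.comp (by fun_prop) hmaps
    have h1 : HasDerivAt (fun ζ : ℂ => f (z + ζ • v)) (fderiv ℂ f z v) 0 := by
      have h2 : HasFDerivAt f (fderiv ℂ f z) (z + (0 : ℂ) • v) := by
        simpa using (hf.differentiableAt (Metric.isOpen_ball.mem_nhds hz)).hasFDerivAt
      have h3 : HasDerivAt (fun ζ : ℂ => z + ζ • v) v 0 := by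
        simpa using ((hasDerivAt_id (0 : ℂ)).smul_const v).const_add z
      exact h2.comp_hasDerivAt 0 h3
    rw [← h1.deriv]
    refine Complex.norm_deriv_le_of_forall_mem_sphere_norm_le hR ?_ fun ζ hζ =>
      hC _ (hmaps ζ (Metric.sphere_subset_closedBall hζ))
    exact (hd.mono Metric.closure_ball_subset_closedBall).diffContOnCl
  have hlim : Tendsto (fun R : ℝ => C / R) (𝓝[<] (r / ‖v‖)) (𝓝 (C / (r / ‖v‖))) := by
    have h0 : r / ‖v‖ ≠ 0 := by positivity
    exact ((continuousAt_const.div continuousAt_id h0).tendsto).mono_left nhdsWithin_le_nhds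
  have hpos : (0 : ℝ) < r / ‖v‖ := by positivity
  have : ‖fderiv ℂ f z v‖ ≤ C / (r / ‖v‖) := by
    refine ge_of_tendsto hlim ?_
    filter_upwards [Ioo_mem_nhdsLT hpos] with R hR using key R hR.1 hR.2
  calc _ ≤ C / (r / ‖v‖) := this
    _ = C / r * ‖v‖ := by field_simp

/-- Cauchy's estimate is used twice. It first makes `f` Lipschitz near `z`; then the increment `x ↦
f (x + (w - z)) - f x` is `O(‖w - z‖)` on a ball, and the estimate applied to this increment
controls its derivative at `z`, which is `f' w - f' z`. -/
theorem continuousOn_fderiv_of_differentiableOn {f : E → F} {s : Set E} (hs : IsOpen s)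
    (hf : DifferentiableOn ℂ f s) : ContinuousOn (fderiv ℂ f) s := by
  intro z hz
  refine ContinuousAt.continuousWithinAt ?_
  have hc : ContinuousAt f z := (hf.differentiableAt (hs.mem_nhds hz)).continuousAt
  -- Radius `4r` leaves room for balls of radius `r` centered in the ball of radius `3r`, where `f'`
  -- is bounded, and for the shifts by `w - z`.
  obtain ⟨r, hr, hrs⟩ : ∃ r > 0, Metric.ball z (4 * r) ⊆ s ∩ {w | ‖f w‖ < ‖f z‖ + 1} := by
    have : s ∩ {w | ‖f w‖ < ‖f z‖ + 1} ∈ 𝓝 z :=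
      inter_mem (hs.mem_nhds hz) (hc.norm.eventually_lt continuousAt_const (by simp))
    obtain ⟨ε, hε, h⟩ := Metric.mem_nhds_iff.1 this
    exact ⟨ε / 4, by positivity, by convert h using 2; ring⟩
  set M := ‖f z‖ + 1
  have hM : 0 < M := by positivity
  have hbd : ∀ w ∈ Metric.ball z (3 * r), ‖fderiv ℂ f w‖ ≤ M / r := by
    intro w hw
    have hsub : Metric.ball w r ⊆ Metric.ball z (4 * r) := by
      intro y hy
      rw [Metric.mem_ball] at *
      linarith [dist_triangle y w z]
    exact norm_fderiv_le_of_forall_ball_norm_le hr (hf.mono fun y hy => (hrs (hsub hy)).1)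
      fun y hy => (hrs (hsub hy)).2.le
  have hlip : ∀ x ∈ Metric.ball z (3 * r), ∀ y ∈ Metric.ball z (3 * r),
      ‖f y - f x‖ ≤ M / r * ‖y - x‖ := by
    intro x hx y hy
    refine Convex.norm_image_sub_le_of_norm_fderiv_le (𝕜 := ℂ) (s := Metric.ball z (3 * r))
      (fun w hw => ?_) hbd (convex_ball _ _) hx hy
    refine hf.differentiableAt (hs.mem_nhds (hrs ?_).1)
    exact Metric.ball_subset_ball (by linarith) hw
  have hfin : ∀ w ∈ Metric.ball z r, ‖fderiv ℂ f w - fderiv ℂ f z‖ ≤ M / r / r * ‖w - z‖ := by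
    intro w hw
    have hw' : ‖w - z‖ < r := by simpa [dist_eq_norm] using hw
    have hda : ∀ x ∈ Metric.ball z r, DifferentiableAt ℂ f (x + (w - z)) := by
      intro x hx
      refine hf.differentiableAt (hs.mem_nhds (hrs ?_).1)
      rw [Metric.mem_ball, dist_eq_norm] at hx ⊢
      calc ‖x + (w - z) - z‖ = ‖(x - z) + (w - z)‖ := by congr 1; abel
        _ ≤ ‖x - z‖ + ‖w - z‖ := norm_add_le _ _
        _ < 4 * r := by linarith
    have hdb : ∀ x ∈ Metric.ball z r, DifferentiableAt ℂ f x := fun x hx =>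
      hf.differentiableAt (hs.mem_nhds (hrs (Metric.ball_subset_ball (by linarith) hx)).1)
    have hzr : z ∈ Metric.ball z r := Metric.mem_ball_self hr
    have h1 : fderiv ℂ (fun x => f (x + (w - z)) - f x) z = fderiv ℂ f w - fderiv ℂ f z := by
      have ha := hda z hzr
      rw [fderiv_fun_sub (by
        exact DifferentiableAt.comp z ha (by fun_prop)) (hdb z hzr), fderiv_comp_add_right]
      congr 2
      abel
    rw [← h1]
    have := norm_fderiv_le_of_forall_ball_norm_le (f := fun x => f (x + (w - z)) - f x) (z := z)
      (C := M / r * ‖w - z‖) hr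
      (fun x hx => ((DifferentiableAt.comp x (hda x hx) (by fun_prop)).sub
        (hdb x hx)).differentiableWithinAt) ?_
    · calc _ ≤ _ := this
        _ = _ := by ring
    · intro x hx
      rw [Metric.mem_ball, dist_eq_norm] at hx
      have := hlip x (by rw [Metric.mem_ball, dist_eq_norm]; linarith) (x + (w - z)) (by
        rw [Metric.mem_ball, dist_eq_norm]
        calc ‖x + (w - z) - z‖ = ‖(x - z) + (w - z)‖ := by congr 1; abel
        _ ≤ ‖x - z‖ + ‖w - z‖ := norm_add_le _ _
        _ < 3 * r := by linarith)
      simpa using this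
  rw [ContinuousAt, tendsto_iff_norm_sub_tendsto_zero]
  refine squeeze_zero' (Eventually.of_forall fun _ => norm_nonneg _)
    (Filter.mem_of_superset (Metric.ball_mem_nhds z hr) hfin) ?_
  have : Tendsto (fun w => M / r / r * ‖w - z‖) (𝓝 z) (𝓝 (M / r / r * ‖z - z‖)) :=
    Continuous.tendsto (by fun_prop) z
  simpa using this

variable [CompleteSpace F]

/-- The restriction of a holomorphic function to a complex line is analytic. -/
theorem analyticOnNhd_comp_line {f : E → F} {s : Set E} (hs : IsOpen s)
    (hf : DifferentiableOn ℂ f s) (z v : E) :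
    AnalyticOnNhd ℂ (fun ζ : ℂ => f (z + ζ • v)) {ζ | z + ζ • v ∈ s} := by
  have ho : IsOpen {ζ : ℂ | z + ζ • v ∈ s} := hs.preimage (by fun_prop)
  exact DifferentiableOn.analyticOnNhd (hf.comp (by fun_prop) fun ζ hζ => hζ) ho

theorem convex_setOf_line_mem [NormedSpace ℝ E] [IsScalarTower ℝ ℂ E] {s : Set E}
    (hs : Convex ℝ s) (z v : E) : Convex ℝ {ζ : ℂ | z + ζ • v ∈ s} := by
  intro a ha b hb x y hx hy hxy
  have := hs ha hb hx hy hxy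
  simp only [Set.mem_ofPred_eq] at *
  convert this using 1
  have h1 : z = x • z + y • z := by rw [← add_smul, hxy, one_smul]
  nth_rewrite 1 [h1]
  simp only [smul_add, add_smul, smul_assoc]
  abel

/-- The identity theorem on a convex open set. -/
theorem eqOn_zero_of_convex [NormedSpace ℝ E] [IsScalarTower ℝ ℂ E] {f : E → F} {s : Set E}
    (hs : IsOpen s) (hcs : Convex ℝ s)
    (hf : DifferentiableOn ℂ f s) {z : E} (hz : z ∈ s) (h0 : ∀ᶠ w in 𝓝 z, f w = 0) :
    ∀ w ∈ s, f w = 0 := by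
  intro w hw
  have han := analyticOnNhd_comp_line hs hf z (w - z)
  have hpre := (convex_setOf_line_mem hcs z (w - z)).isPreconnected
  have h00 : (0 : ℂ) ∈ {ζ : ℂ | z + ζ • (w - z) ∈ s} := by simpa using hz
  have hev : (fun ζ : ℂ => f (z + ζ • (w - z))) =ᶠ[𝓝 0] 0 := by
    have hc : Tendsto (fun ζ : ℂ => z + ζ • (w - z)) (𝓝 0) (𝓝 z) := by
      have : Continuous (fun ζ : ℂ => z + ζ • (w - z)) := by fun_prop
      simpa using this.tendsto 0
    exact hc.eventually h0
  have := han.eqOn_zero_of_preconnected_of_eventuallyEq_zero hpre h00 hev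
    (show (1 : ℂ) ∈ _ by simpa using hw)
  simpa using this

variable [FiniteDimensional ℂ E]

/-- An integral of holomorphic functions depending continuously on a parameter is holomorphic. -/
theorem differentiableOn_intervalIntegral {f : E → ℝ → F} {s : Set E} (hs : IsOpen s) {a b : ℝ}
    (hab : a ≤ b) (hc : ContinuousOn (Function.uncurry f) (s ×ˢ Icc a b))
    (hd : ∀ t ∈ Icc a b, DifferentiableOn ℂ (fun z => f z t) s) :
    DifferentiableOn ℂ (fun z => ∫ t in a..b, f z t) s := by
  have : ProperSpace E := FiniteDimensional.proper ℂ E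
  intro z hz
  obtain ⟨r, hr, hrs⟩ : ∃ r > 0, Metric.closedBall z (2 * r) ⊆ s := by
    obtain ⟨ε, hε, h⟩ := Metric.nhds_basis_closedBall.mem_iff.1 (hs.mem_nhds hz)
    exact ⟨ε / 2, by positivity, by convert h using 2; ring⟩
  have hK : IsCompact (Metric.closedBall z (2 * r) ×ˢ Icc a b) :=
    (isCompact_closedBall z (2 * r)).prod isCompact_Icc
  have hcK := hc.mono (prod_mono_left (t := Icc a b) hrs)
  obtain ⟨M, hM⟩ := hK.exists_bound_of_continuousOn hcK
  have hball : ∀ x ∈ Metric.ball z r, Metric.ball x r ⊆ Metric.closedBall z (2 * r) := by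
    intro x hx y hy
    rw [Metric.mem_ball] at hx hy
    rw [Metric.mem_closedBall]
    linarith [dist_triangle y x z]
  have hzr : z ∈ Metric.ball z r := Metric.mem_ball_self hr
  have hslice : ∀ x ∈ s, ContinuousOn (f x) (Icc a b) := fun x hx =>
    hc.comp (f := fun t => (x, t)) (by fun_prop) fun t ht => ⟨hx, ht⟩
  have hsub : uIoc a b ⊆ Icc a b := by rw [uIoc_of_le hab]; exact Ioc_subset_Icc_self
  -- Continuity of the derivative in the parameter: uniform continuity makes `f x t' - f x t` small
  -- on the whole ball, and Cauchy's estimate passes this to the derivative.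
  have hfd : ContinuousOn (fun t => fderiv ℂ (fun x => f x t) z) (Icc a b) := by
    have hu := hK.uniformContinuousOn_of_continuous hcK
    rw [Metric.uniformContinuousOn_iff] at hu
    rw [Metric.continuousOn_iff]
    intro t ht ε hε
    obtain ⟨δ, hδ, h⟩ := hu (ε * r / 2) (by positivity)
    refine ⟨δ, hδ, fun t' ht' hlt => ?_⟩
    have hx : ∀ t ∈ Icc a b, ∀ x ∈ Metric.ball z r, DifferentiableAt ℂ (fun x => f x t) x :=
      fun t ht x hx => (hd t ht).differentiableAt (hs.mem_nhds
        (hrs (hball z hzr hx)))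
    have h1 : fderiv ℂ (fun x => f x t' - f x t) z =
        fderiv ℂ (fun x => f x t') z - fderiv ℂ (fun x => f x t) z :=
      fderiv_fun_sub (hx t' ht' z hzr) (hx t ht z hzr)
    rw [dist_eq_norm, ← h1]
    have := norm_fderiv_le_of_forall_ball_norm_le (f := fun x => f x t' - f x t) (z := z)
      (C := ε * r / 2) hr
      (fun x hxx => ((hx t' ht' x hxx).sub (hx t ht x hxx)).differentiableWithinAt) ?_
    · calc _ ≤ _ := this
        _ = ε / 2 := by field_simp
        _ < ε := by linarith
    · intro x hxx
      have := h (x, t') ⟨hball z hzr hxx, ht'⟩ (x, t) ⟨hball z hzr hxx, ht⟩ (by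
        rw [Prod.dist_eq]; simpa using max_lt hδ hlt)
      rw [dist_eq_norm] at this
      exact this.le
  refine DifferentiableAt.differentiableWithinAt ?_
  refine (intervalIntegral.hasFDerivAt_integral_of_dominated_of_fderiv_le (𝕜 := ℂ)
    (F := f) (F' := fun x t => fderiv ℂ (fun x => f x t) x) (bound := fun _ => M / r)
    (Metric.ball_mem_nhds z hr) ?_ ?_ ?_ ?_ ?_ ?_).differentiableAt
  · filter_upwards [hs.mem_nhds hz] with x hx
    exact ((hslice x hx).mono hsub).aestronglyMeasurable measurableSet_uIoc
  · exact ((hslice z hz).mono (by rw [uIcc_of_le hab])).intervalIntegrable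
  · exact (hfd.mono hsub).aestronglyMeasurable measurableSet_uIoc
  · refine Eventually.of_forall fun t ht x hx => ?_
    exact norm_fderiv_le_of_forall_ball_norm_le hr
      ((hd t (hsub ht)).mono fun y hy => hrs (hball x hx hy))
      fun y hy => hM (y, t) ⟨hball x hx hy, hsub ht⟩
  · exact intervalIntegrable_const
  · refine Eventually.of_forall fun t ht x hx => ?_
    exact ((hd t (hsub ht)).differentiableAt (hs.mem_nhds
      (hrs (Metric.ball_subset_closedBall (Metric.ball_subset_ball (by linarith) hx))))).hasFDerivAt

/-- Cauchy's formula on a circle in the complex line of direction `v` writes the directional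
derivative as an integral of values of `f`, holomorphic in the center of the circle. No theory of
power series in several variables is needed. -/
theorem differentiableOn_fderiv_apply {f : E → F} {s : Set E} (hs : IsOpen s)
    (hf : DifferentiableOn ℂ f s) (v : E) : DifferentiableOn ℂ (fun z => fderiv ℂ f z v) s := by
  intro z hz
  obtain ⟨r, hr, hrs⟩ : ∃ r > 0, Metric.ball z (2 * r) ⊆ s := by
    obtain ⟨ε, hε, h⟩ := Metric.mem_nhds_iff.1 (hs.mem_nhds hz)
    exact ⟨ε / 2, by positivity, by convert h using 2; ring⟩
  obtain ⟨R, hR, hRv⟩ : ∃ R > 0, R * ‖v‖ < r :=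
    ⟨r / (‖v‖ + 1), by positivity, by
      rw [div_mul_eq_mul_div, div_lt_iff₀ (by positivity)]; nlinarith [norm_nonneg v]⟩
  have hmem : ∀ x ∈ Metric.ball z r, ∀ ζ : ℂ, ‖ζ‖ ≤ R → x + ζ • v ∈ s := by
    intro x hx ζ hζ
    refine hrs ?_
    rw [mem_ball_iff_norm] at hx ⊢
    calc ‖x + ζ • v - z‖ = ‖(x - z) + ζ • v‖ := by congr 1; abel
      _ ≤ ‖x - z‖ + ‖ζ‖ * ‖v‖ := by rw [← norm_smul]; exact norm_add_le _ _
      _ ≤ ‖x - z‖ + R * ‖v‖ := by gcongr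
      _ < 2 * r := by linarith
  have hnorm : ∀ θ : ℝ, ‖circleMap 0 R θ‖ = R := fun θ => by simp [abs_of_pos hR]
  have key : ∀ x ∈ Metric.ball z r, fderiv ℂ f x v = (2 * Real.pi * Complex.I)⁻¹ •
      ∫ θ in (0 : ℝ)..2 * Real.pi, deriv (circleMap 0 R) θ •
        ((1 / (circleMap 0 R θ - 0) ^ 2) • f (x + circleMap 0 R θ • v)) := by
    intro x hx
    have hxs : x ∈ s := by simpa using hmem x hx 0 (by simpa using hR.le)
    have h1 : HasDerivAt (fun ζ : ℂ => f (x + ζ • v)) (fderiv ℂ f x v) 0 := by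
      have h2 : HasFDerivAt f (fderiv ℂ f x) (x + (0 : ℂ) • v) := by
        simpa using (hf.differentiableAt (hs.mem_nhds hxs)).hasFDerivAt
      have h3 : HasDerivAt (fun ζ : ℂ => x + ζ • v) v 0 := by
        simpa using ((hasDerivAt_id (0 : ℂ)).smul_const v).const_add x
      exact h2.comp_hasDerivAt 0 h3
    have h4 := DifferentiableOn.deriv_eq_smul_circleIntegral (f := fun ζ : ℂ => f (x + ζ • v))
      (c := 0) hR (hf.comp (by fun_prop) fun ζ hζ => hmem x hx ζ (by simpa using hζ))
    rw [h1.deriv, circleIntegral] at h4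
    rw [h4, smul_smul, inv_mul_cancel₀ Complex.two_pi_I_ne_zero, one_smul]
  have hzr : z ∈ Metric.ball z r := Metric.mem_ball_self hr
  have hd : DifferentiableOn ℂ (fun x => ∫ θ in (0 : ℝ)..2 * Real.pi, deriv (circleMap 0 R) θ •
        ((1 / (circleMap 0 R θ - 0) ^ 2) • f (x + circleMap 0 R θ • v))) (Metric.ball z r) := by
    refine differentiableOn_intervalIntegral Metric.isOpen_ball Real.two_pi_pos.le ?_ ?_
    · have hcirc : Continuous (circleMap 0 R) := continuous_circleMap 0 R
      have h0 : ∀ θ, circleMap 0 R θ - 0 ≠ 0 := fun θ => by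
        simpa using hR.ne'
      simp only [deriv_circleMap]
      refine ContinuousOn.smul (by fun_prop) (ContinuousOn.smul ?_ ?_)
      · refine ContinuousOn.div continuousOn_const (by fun_prop) fun p _ => pow_ne_zero _ (h0 _)
      · exact hf.continuousOn.comp (by fun_prop) fun p hp => hmem p.1 hp.1 _ (hnorm _).le
    · intro θ _
      refine DifferentiableOn.const_smul (DifferentiableOn.const_smul ?_ _) _
      exact hf.comp (by fun_prop) fun p hp => hmem p hp _ (hnorm _).le
  refine DifferentiableAt.differentiableWithinAt ?_
  have h5 : DifferentiableAt ℂ _ z :=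
    (hd.differentiableAt (Metric.isOpen_ball.mem_nhds hzr)).const_smul (2 * Real.pi * Complex.I)⁻¹
  refine h5.congr_of_eventuallyEq ?_
  filter_upwards [Metric.ball_mem_nhds z hr] with x hx using key x hx

theorem contDiffOn_of_differentiableOn {f : E → F} {s : Set E} (hs : IsOpen s)
    (hf : DifferentiableOn ℂ f s) (n : ℕ) : ContDiffOn ℂ n f s := by
  induction n generalizing f with
  | zero => exact contDiffOn_zero.2 hf.continuousOn
  | succ n ih =>
    rw [show ((n + 1 : ℕ) : WithTop ℕ∞) = (n : WithTop ℕ∞) + 1 from by norm_cast,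
      contDiffOn_succ_iff_fderiv_of_isOpen hs]
    refine ⟨hf, by simp, contDiffOn_clm_apply.2 fun v => ih (differentiableOn_fderiv_apply hs hf v)⟩

theorem contDiffOn_infty_of_differentiableOn {f : E → F} {s : Set E} (hs : IsOpen s)
    (hf : DifferentiableOn ℂ f s) : ContDiffOn ℂ ∞ f s :=
  contDiffOn_infty.2 fun n => contDiffOn_of_differentiableOn hs hf n

theorem hasStrictFDerivAt_of_differentiableOn {f : E → F} {s : Set E} (hs : IsOpen s)
    (hf : DifferentiableOn ℂ f s) {z : E} (hz : z ∈ s) : HasStrictFDerivAt f (fderiv ℂ f z) z := by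
  have h1 : ContDiffOn ℂ 1 f s := by exact_mod_cast contDiffOn_of_differentiableOn hs hf 1
  have h : ContDiffAt ℂ 1 f z := h1.contDiffAt (hs.mem_nhds hz)
  exact h.hasStrictFDerivAt (by simp)

end SeveralComplexVariables

end LagrangianFibration

namespace LagrangianFibration

/-! ### Inverse function theorem, straightening of submersions, constant rank theorem -/

section Straightening

variable {E F K : Type} [NormedAddCommGroup E] [NormedSpace ℂ E] [NormedAddCommGroup F]
  [NormedSpace ℂ F] [NormedAddCommGroup K] [NormedSpace ℂ K]
  [FiniteDimensional ℂ E] [FiniteDimensional ℂ F] [FiniteDimensional ℂ K]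

/-- A linear map has rank at least `r` if and only if it has a non-zero minor of size `r`. -/
theorem le_finrank_range_iff_exists_minor (L : E →L[ℂ] F) (r : ℕ) :
    r ≤ Module.finrank ℂ (LinearMap.range L.toLinearMap) ↔
      ∃ (a : Fin r → E) (B : F →L[ℂ] Cn r), (Matrix.of fun i j => B (L (a j)) i).det ≠ 0 := by
  constructor
  · intro hr
    set b := Module.finBasis ℂ (LinearMap.range L.toLinearMap)
    have hmem : ∀ j : Fin r, ∃ v : E, L v = b (Fin.castLE hr j) := fun j =>
      (b (Fin.castLE hr j)).2
    choose a ha using hmem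
    have hli : LinearIndependent ℂ fun j => L (a j) := by
      have h1 : LinearIndependent ℂ fun j : Fin r => b (Fin.castLE hr j) :=
        b.linearIndependent.comp _ (Fin.castLE_injective hr)
      have h2 := h1.map' (LinearMap.range L.toLinearMap).subtype (Submodule.ker_subtype _)
      have h3 : (fun j => L (a j)) = (LinearMap.range L.toLinearMap).subtype ∘
          fun j : Fin r => b (Fin.castLE hr j) := funext ha
      rw [h3]
      exact h2
    obtain ⟨B, hB⟩ := LinearMap.exists_leftInverse_of_injective
      (Fintype.linearCombination ℂ fun j => L (a j))
      (LinearMap.ker_eq_bot.2 (linearIndependent_iff_injective_fintypeLinearCombination.1 hli))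
    refine ⟨a, LinearMap.toContinuousLinearMap B, ?_⟩
    have : (Matrix.of fun i j => (LinearMap.toContinuousLinearMap B) (L (a j)) i)
        = (1 : Matrix (Fin r) (Fin r) ℂ) := by
      ext i j
      have h3 := LinearMap.congr_fun hB (Pi.single j 1)
      simp only [LinearMap.comp_apply, LinearMap.id_apply,
        Fintype.linearCombination_apply_single, one_smul] at h3
      simp [h3, Matrix.one_apply, Pi.single_apply]
    rw [this]
    simp
  · rintro ⟨a, B, hdet⟩
    have h1 : LinearIndependent ℂ (Matrix.of fun i j => B (L (a j)) i).col :=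
      Matrix.linearIndependent_cols_of_det_ne_zero hdet
    have h2 : LinearIndependent ℂ fun j => L (a j) := by
      refine LinearIndependent.of_comp B.toLinearMap ?_
      exact h1
    have h3 : LinearIndependent ℂ
        (fun j => (⟨L (a j), ⟨a j, rfl⟩⟩ : LinearMap.range L.toLinearMap)) := by
      refine LinearIndependent.of_comp (LinearMap.range L.toLinearMap).subtype ?_
      exact h2
    simpa using h3.fintype_card_le_finrank

omit [FiniteDimensional ℂ F] in
theorem differentiableOn_minor [CompleteSpace F] {h : E → F} {s : Set E} (hs : IsOpen s)
    (hh : DifferentiableOn ℂ h s) {r : ℕ} (a : Fin r → E) (B : F →L[ℂ] Cn r) :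
    DifferentiableOn ℂ (fun z => (Matrix.of fun i j => B (fderiv ℂ h z (a j)) i).det) s := by
  simp only [Matrix.det_apply, Matrix.of_apply]
  refine DifferentiableOn.fun_sum fun σ _ => DifferentiableOn.const_smul ?_ _
  suffices h : ∀ i, DifferentiableOn ℂ (fun z => B (fderiv ℂ h z (a i)) (σ i)) s from fun z hz =>
    (HasFDerivWithinAt.finsetProd fun i _ => (h i z hz).hasFDerivWithinAt).differentiableWithinAt
  intro i
  have h1 : DifferentiableOn ℂ (fun z => B (fderiv ℂ h z (a i))) s :=
    B.differentiable.comp_differentiableOn (differentiableOn_fderiv_apply hs hh _)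
  exact (differentiableOn_pi.1 h1) _

/-- The inverse function theorem for holomorphic maps. -/
theorem exists_holomorphic_inverse {f : E → F} {s : Set E} (hs : IsOpen s)
    (hf : DifferentiableOn ℂ f s) {z : E} (hz : z ∈ s) (f' : E ≃L[ℂ] F)
    (hf' : (f' : E →L[ℂ] F) = fderiv ℂ f z) :
    ∃ e : OpenPartialHomeomorph E F, z ∈ e.source ∧ e.source ⊆ s ∧ (∀ x ∈ e.source, e x = f x) ∧
      DifferentiableOn ℂ e.symm e.target := by
  have : CompleteSpace E := FiniteDimensional.complete ℂ E
  have : CompleteSpace F := FiniteDimensional.complete ℂ F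
  have hst : HasStrictFDerivAt f (f' : E →L[ℂ] F) z := by
    rw [hf']; exact hasStrictFDerivAt_of_differentiableOn hs hf hz
  -- On this open set the derivative is invertible at every point, not only at `z`, so that the
  -- inverse is differentiable on its whole domain.
  set S := s ∩ fderiv ℂ f ⁻¹' range ((↑) : (E ≃L[ℂ] F) → E →L[ℂ] F)
  have hS : IsOpen S := (continuousOn_fderiv_of_differentiableOn hs hf).isOpen_inter_preimage hs
    ContinuousLinearEquiv.isOpen
  set e := (hst.toOpenPartialHomeomorph f).restrOpen S hS
  have he : ∀ x, e x = f x := fun x => rfl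
  have hsrc : e.source ⊆ S := by
    rw [OpenPartialHomeomorph.restrOpen_source]; exact inter_subset_right
  refine ⟨e, ?_, hsrc.trans inter_subset_left, fun x _ => he x, ?_⟩
  · rw [OpenPartialHomeomorph.restrOpen_source]
    exact ⟨hst.mem_toOpenPartialHomeomorph_source, hz, f', hf'⟩
  · intro y hy
    have hmem := e.map_target hy
    obtain ⟨hxs, g', hg'⟩ := hsrc hmem
    have h1 : HasFDerivAt e (g' : E →L[ℂ] F) (e.symm y) := by
      rw [hg']
      exact (hf.differentiableAt (hs.mem_nhds hxs)).hasFDerivAt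
    exact (e.hasFDerivAt_symm hy h1).differentiableAt.differentiableWithinAt

omit [FiniteDimensional ℂ E] [FiniteDimensional ℂ F] [FiniteDimensional ℂ K] in
/-- Shrinking of a local homeomorphism, so that its target is a product of balls. -/
theorem exists_restr_target_ball {X : Type*} [TopologicalSpace X]
    (e : OpenPartialHomeomorph X (F × K)) {x : X}
    (hx : x ∈ e.source) {s : Set X} (hs : s ∈ 𝓝 x) :
    ∃ (e' : OpenPartialHomeomorph X (F × K)) (r : ℝ), 0 < r ∧ x ∈ e'.source ∧
      e'.source ⊆ e.source ∩ s ∧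
      e'.target = Metric.ball (e x).1 r ×ˢ Metric.ball (e x).2 r ∧ e'.target ⊆ e.target ∧
      (∀ y, e' y = e y) ∧ ∀ y, e'.symm y = e.symm y := by
  have h1 : e.target ∩ e.symm ⁻¹' s ∈ 𝓝 (e x) := by
    refine inter_mem (e.open_target.mem_nhds (e.map_source hx)) ?_
    have := e.tendsto_symm hx
    exact this hs
  obtain ⟨r, hr, hball⟩ := Metric.mem_nhds_iff.1 h1
  set e' := (e.symm.restrOpen (Metric.ball (e x) r) Metric.isOpen_ball).symm
  have ht : e'.target = Metric.ball (e x) r := by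
    have h2 : e'.target = e.target ∩ Metric.ball (e x) r := by
      simp [e']
    rw [h2]
    exact inter_eq_right.2 fun y hy => (hball hy).1
  have hee : ∀ y, e' y = e y := fun y => rfl
  have hes : ∀ y, e'.symm y = e.symm y := fun y => rfl
  have hsrc : ∀ y ∈ e'.source, y ∈ e.source ∩ s := by
    intro y hy
    have h3 := e'.map_source hy
    rw [ht] at h3
    have h4 := e'.left_inv hy
    rw [hes, hee] at h4
    rw [hee] at h3
    have h5 := hball h3
    rw [← h4]
    exact ⟨e.map_target h5.1, h5.2⟩
  refine ⟨e', r, hr, ?_, hsrc, ?_, ?_, hee, hes⟩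
  · have h3 : e x ∈ e'.target := by rw [ht]; exact Metric.mem_ball_self hr
    have h4 := e'.map_target h3
    rwa [hes, e.left_inv hx] at h4
  · rw [ht, ← ball_prod_same]
  · rw [ht]; exact fun y hy => (hball hy).1

/-- The straightening of a holomorphic submersion. -/
theorem exists_straightening {f : E → F} {s : Set E} (hs : IsOpen s)
    (hf : DifferentiableOn ℂ f s) {z : E} (hz : z ∈ s)
    (hsurj : Function.Surjective (fderiv ℂ f z))
    (hK : Module.finrank ℂ F + Module.finrank ℂ K = Module.finrank ℂ E) :
    ∃ (e : OpenPartialHomeomorph E (F × K)) (r : ℝ), 0 < r ∧ z ∈ e.source ∧ e.source ⊆ s ∧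
      e.target = Metric.ball (f z) r ×ˢ Metric.ball 0 r ∧ e z = (f z, 0) ∧
      (∀ x ∈ e.source, (e x).1 = f x) ∧
      DifferentiableOn ℂ e e.source ∧ DifferentiableOn ℂ e.symm e.target := by
  have hfr := LinearMap.finrank_range_add_finrank_ker (fderiv ℂ f z).toLinearMap
  rw [LinearMap.range_eq_top.2 hsurj, finrank_top] at hfr
  have hk : Module.finrank ℂ (LinearMap.ker (fderiv ℂ f z).toLinearMap) = Module.finrank ℂ K := by
    omega
  let φ := LinearEquiv.ofFinrankEq _ _ hk
  -- A projection onto the kernel of `f'`, followed by an identification of this kernel with `K`,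
  -- completes `f` to a local isomorphism.
  obtain ⟨π, hπ⟩ := LinearMap.exists_leftInverse_of_injective
    (LinearMap.ker (fderiv ℂ f z).toLinearMap).subtype (Submodule.ker_subtype _)
  set ℓ : E →L[ℂ] K := LinearMap.toContinuousLinearMap (φ.toLinearMap ∘ₗ π)
  have hℓ : ∀ v, ℓ v = φ (π v) := fun v => rfl
  set T := (fderiv ℂ f z).prod ℓ
  have hinj : Function.Injective T.toLinearMap := by
    rw [← LinearMap.ker_eq_bot, LinearMap.ker_eq_bot']
    intro v hv
    have hv1 : fderiv ℂ f z v = 0 := congrArg Prod.fst hv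
    have hv2 : ℓ v = 0 := congrArg Prod.snd hv
    rw [hℓ, LinearEquiv.map_eq_zero_iff] at hv2
    have := LinearMap.congr_fun hπ ⟨v, hv1⟩
    simp only [LinearMap.comp_apply, Submodule.subtype_apply, LinearMap.id_apply] at this
    rw [hv2] at this
    exact (congrArg Subtype.val this).symm
  let T' : E ≃L[ℂ] F × K := (LinearMap.linearEquivOfInjective T.toLinearMap hinj
    (by rw [Module.finrank_prod, hK])).toContinuousLinearEquiv
  have hd : DifferentiableOn ℂ (fun x => (f x, ℓ (x - z))) s :=
    hf.prodMk (by fun_prop)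
  have hT' : (T' : E →L[ℂ] F × K) = fderiv ℂ (fun x => (f x, ℓ (x - z))) z := by
    have h1 : HasFDerivAt (fun x => (f x, ℓ (x - z))) T z := by
      refine HasFDerivAt.prodMk (hf.differentiableAt (hs.mem_nhds hz)).hasFDerivAt ?_
      have := (ℓ.hasFDerivAt (x := z - z)).comp z (f := fun x => x - z) (((hasFDerivAt_id z).sub_const z))
      rwa [ContinuousLinearMap.comp_id] at this
    rw [h1.fderiv]
    rfl
  obtain ⟨e, hze, hes, hef, hesymm⟩ := exists_holomorphic_inverse hs hd hz T' hT'
  obtain ⟨e', r, hr, hx, hsrc, htgt, htt, h1, h2⟩ := exists_restr_target_ball e hze (hs.mem_nhds hz)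
  have hez : e z = (f z, 0) := by rw [hef z hze]; simp
  rw [hez] at htgt
  have hee : ∀ x ∈ e'.source, e' x = (f x, ℓ (x - z)) := fun x hx => by
    rw [h1, hef x (hsrc hx).1]
  refine ⟨e', r, hr, hx, fun x hx => (hsrc hx).2, htgt, by rw [h1, hez], fun x hx => ?_, ?_, ?_⟩
  · rw [hee x hx]
  · exact (hd.mono fun x hx => (hsrc hx).2).congr hee
  · exact (hesymm.mono htt).congr fun x _ => h2 x

/-- The constant rank theorem for holomorphic maps. -/
theorem exists_constant_rank {h : E → F} {s : Set E} (hs : IsOpen s)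
    (hh : DifferentiableOn ℂ h s) {z : E} (hz : z ∈ s) {r : ℕ}
    (hle : ∀ x ∈ s, Module.finrank ℂ (LinearMap.range (fderiv ℂ h x).toLinearMap) ≤ r)
    (heq : r ≤ Module.finrank ℂ (LinearMap.range (fderiv ℂ h z).toLinearMap))
    (hK : r + Module.finrank ℂ K = Module.finrank ℂ E) :
    ∃ (e : OpenPartialHomeomorph E (Cn r × K)) (B : F →L[ℂ] Cn r) (ψ : Cn r → F) (δ : ℝ), 0 < δ ∧
      z ∈ e.source ∧ e.source ⊆ s ∧
      e.target = Metric.ball (B (h z)) δ ×ˢ Metric.ball 0 δ ∧ e z = (B (h z), 0) ∧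
      (∀ x ∈ e.source, (e x).1 = B (h x)) ∧
      DifferentiableOn ℂ e e.source ∧ DifferentiableOn ℂ e.symm e.target ∧
      DifferentiableOn ℂ ψ (Metric.ball (B (h z)) δ) ∧ ∀ x ∈ e.source, h x = ψ (e x).1 := by
  obtain ⟨a, B, hdet⟩ := (le_finrank_range_iff_exists_minor _ r).1 heq
  have hBd : DifferentiableOn ℂ (fun x => B (h x)) s := B.differentiable.comp_differentiableOn hh
  have hBf : ∀ x ∈ s, fderiv ℂ (fun x => B (h x)) x = B.comp (fderiv ℂ h x) := fun x hx =>
    (B.hasFDerivAt.comp x (hh.differentiableAt (hs.mem_nhds hx)).hasFDerivAt).fderiv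
  have hsurj : Function.Surjective (fderiv ℂ (fun x => B (h x)) z) := by
    rw [hBf z hz]
    have h1 : LinearIndependent ℂ (Matrix.of fun i j => B (fderiv ℂ h z (a j)) i).col :=
      Matrix.linearIndependent_cols_of_det_ne_zero hdet
    have h2 : (⊤ : Submodule ℂ (Cn r)) ≤
        LinearMap.range (B.comp (fderiv ℂ h z)).toLinearMap := by
      rw [← h1.span_eq_top_of_card_eq_finrank' (by simp), Submodule.span_le]
      rintro _ ⟨j, rfl⟩
      exact ⟨a j, rfl⟩
    exact LinearMap.range_eq_top.1 (top_le_iff.1 h2)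
  obtain ⟨e, δ, hδ, hze, hes, htgt, hez, hfst, hed, hesd⟩ :=
    exists_straightening (K := K) hs hBd hz hsurj (by simpa using hK)
  set c := B (h z)
  have hmem : ∀ y ∈ e.target, e.symm y ∈ s := fun y hy => hes (e.map_target hy)
  set H : Cn r × K → F := fun y => h (e.symm y)
  have hHd : DifferentiableOn ℂ H e.target := hh.comp hesd hmem
  have hBH : ∀ y ∈ e.target, B (H y) = y.1 := fun y hy => by
    have := hfst _ (e.map_target hy)
    rw [e.right_inv hy] at this
    exact this.symm
  -- In the new coordinates `B ∘ H` is the first projection. So `B` maps the range of `H'` onto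
  -- `ℂʳ`; the range has dimension at most `r`, hence `B` is injective on it, and the vertical
  -- vectors, killed by `B ∘ H'`, are killed by `H'`.
  have hvert : ∀ y ∈ e.target, ∀ η : K, fderiv ℂ H y (0, η) = 0 := by
    intro y hy η
    have hHa := (hHd.differentiableAt (e.open_target.mem_nhds hy)).hasFDerivAt
    have hB' : B.comp (fderiv ℂ H y) = ContinuousLinearMap.fst ℂ (Cn r) K := by
      have h1 : HasFDerivAt (fun y => B (H y)) (B.comp (fderiv ℂ H y)) y :=
        B.hasFDerivAt.comp y hHa
      have h2 : HasFDerivAt (fun y => B (H y)) (ContinuousLinearMap.fst ℂ (Cn r) K) y := by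
        refine (ContinuousLinearMap.fst ℂ (Cn r) K).hasFDerivAt.congr_of_eventuallyEq ?_
        filter_upwards [e.open_target.mem_nhds hy] with w hw using hBH w hw
      exact h1.unique h2
    set L := fderiv ℂ H y
    have hrank : Module.finrank ℂ (LinearMap.range L.toLinearMap) ≤ r := by
      have h1 : L = (fderiv ℂ h (e.symm y)).comp (fderiv ℂ e.symm y) :=
        fderiv_comp y (hh.differentiableAt (hs.mem_nhds (hmem y hy)))
          (hesd.differentiableAt (e.open_target.mem_nhds hy))
      refine le_trans (Submodule.finrank_mono ?_) (hle _ (hmem y hy))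
      rw [h1]
      rintro _ ⟨v, rfl⟩
      exact ⟨_, rfl⟩
    let Br : LinearMap.range L.toLinearMap →ₗ[ℂ] Cn r :=
      B.toLinearMap ∘ₗ (LinearMap.range L.toLinearMap).subtype
    have hBr : Function.Surjective Br := by
      intro v
      refine ⟨⟨L (v, 0), ⟨(v, 0), rfl⟩⟩, ?_⟩
      exact congrArg (fun T => T (v, (0 : K))) hB'
    have hker := LinearMap.finrank_range_add_finrank_ker Br
    rw [LinearMap.range_eq_top.2 hBr, finrank_top, Module.finrank_fin_fun] at hker
    have hk0 : Module.finrank ℂ (LinearMap.ker Br) = 0 := by omega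
    rw [Submodule.finrank_eq_zero, LinearMap.ker_eq_bot'] at hk0
    have := hk0 ⟨L (0, η), ⟨(0, η), rfl⟩⟩ (congrArg (fun T => T ((0 : Cn r), η)) hB')
    exact congrArg Subtype.val this
  refine ⟨e, B, fun u => H (u, 0), δ, hδ, hze, hes, htgt, hez, hfst, hed, hesd, ?_, ?_⟩
  · refine hHd.comp (by fun_prop) fun u hu => ?_
    rw [htgt]
    exact ⟨hu, Metric.mem_ball_self hδ⟩
  · intro x hx
    have hex := e.map_source hx
    have hex' := hex
    rw [htgt] at hex'
    have hconst : ∀ η ∈ Metric.ball (0 : K) δ, H ((e x).1, η) = H ((e x).1, 0) := by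
      intro η hη
      have hd : ∀ w ∈ Metric.ball (0 : K) δ, HasFDerivAt (fun w => H ((e x).1, w)) (0 : K →L[ℂ] F) w := by
        intro w hw
        have hw' : ((e x).1, w) ∈ e.target := by rw [htgt]; exact ⟨hex'.1, hw⟩
        have h1 := (hHd.differentiableAt (e.open_target.mem_nhds hw')).hasFDerivAt
        have h2 := h1.comp w (hasFDerivAt_prodMk_right (𝕜 := ℂ) (e x).1 w)
        have h3 : (fderiv ℂ H ((e x).1, w)).comp (ContinuousLinearMap.inr ℂ (Cn r) K) = 0 := by
          ext1 v
          exact hvert _ hw' v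
        rw [h3] at h2
        exact h2
      let : NormedSpace ℝ K := NormedSpace.restrictScalars ℝ ℂ K
      exact (convex_ball (0 : K) δ).is_const_of_fderivWithin_eq_zero (𝕜 := ℂ)
        (fun w hw => (hd w hw).differentiableAt.differentiableWithinAt)
        (fun w hw => by
          rw [fderivWithin_of_isOpen Metric.isOpen_ball hw]; exact (hd w hw).fderiv)
        hη (Metric.mem_ball_self hδ)
    have := hconst (e x).2 hex'.2
    change h x = H ((e x).1, 0)
    rw [← this]
    simp [H, e.left_inv hx]

end Straightening

end LagrangianFibration

namespace LagrangianFibration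

/-! ### Thin sets: images of holomorphic maps of small rank, Hausdorff dimension, connectedness of
complements -/

section Thin

variable {E : Type} [NormedAddCommGroup E] [NormedSpace ℂ E]

/-- A set is thin, of dimension at most `d`, if it is contained in a countable union of images of
holomorphic maps defined on open subsets of `ℂᵈ`. -/
def Thin (d : ℕ) (S : Set E) : Prop :=
  ∃ (D : ℕ → Set (Cn d)) (h : ℕ → Cn d → E),
    (∀ i, IsOpen (D i) ∧ DifferentiableOn ℂ (h i) (D i)) ∧ S ⊆ ⋃ i, h i '' D i

theorem Thin.mono {d : ℕ} {S T : Set E} (hT : Thin d T) (h : S ⊆ T) : Thin d S := by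
  obtain ⟨D, f, h1, h2⟩ := hT
  exact ⟨D, f, h1, h.trans h2⟩

theorem Thin.image {d : ℕ} {D : Set (Cn d)} (hD : IsOpen D) {h : Cn d → E}
    (hh : DifferentiableOn ℂ h D) : Thin d (h '' D) :=
  ⟨fun _ => D, fun _ => h, fun _ => ⟨hD, hh⟩, subset_iUnion (fun _ : ℕ => h '' D) 0⟩

theorem Thin.empty {d : ℕ} : Thin d (∅ : Set E) :=
  ⟨fun _ => ∅, fun _ _ => 0, fun _ => ⟨isOpen_empty, differentiableOn_empty⟩, empty_subset _⟩

theorem Thin.iUnion_nat {d : ℕ} {S : ℕ → Set E} (hS : ∀ i, Thin d (S i)) : Thin d (⋃ i, S i) := by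
  choose D h h1 h2 using hS
  refine ⟨fun k => D k.unpair.1 k.unpair.2, fun k => h k.unpair.1 k.unpair.2,
    fun k => h1 _ _, iUnion_subset fun i x hx => ?_⟩
  obtain ⟨j, hj⟩ := mem_iUnion.1 (h2 i hx)
  exact mem_iUnion.2 ⟨Nat.pair i j, by simpa using hj⟩

theorem Thin.iUnion {ι : Type*} [Countable ι] {d : ℕ} {S : ι → Set E} (hS : ∀ i, Thin d (S i)) :
    Thin d (⋃ i, S i) := by
  rcases isEmpty_or_nonempty ι with h | h
  · simpa using Thin.empty
  obtain ⟨f, hf⟩ := exists_surjective_nat ι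
  rw [← hf.iUnion_comp]
  exact Thin.iUnion_nat fun i => hS _

theorem Thin.union {d : ℕ} {S T : Set E} (hS : Thin d S) (hT : Thin d T) : Thin d (S ∪ T) := by
  rw [union_eq_iUnion]
  exact Thin.iUnion fun b => by cases b <;> assumption

/-- Countably many of the given neighborhoods suffice, and thin sets are stable under countable
unions. -/
theorem Thin.image_of_locally {Y : Type*} [TopologicalSpace Y] [SecondCountableTopology Y]
    {d : ℕ} {S : Set Y} {f : Y → E}
    (h : ∀ y ∈ S, ∃ N ∈ 𝓝 y, Thin d (f '' (S ∩ N))) : Thin d (f '' S) := by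
  choose! N hN hT using h
  obtain ⟨t, hts, htc, hcov⟩ := TopologicalSpace.countable_cover_nhdsWithin
    (fun y hy => mem_nhdsWithin_of_mem_nhds (hN y hy) : ∀ y ∈ S, N y ∈ 𝓝[S] y)
  have := htc.to_subtype
  refine (Thin.iUnion (fun y : t => hT y (hts y.2))).mono ?_
  rintro _ ⟨y, hy, rfl⟩
  obtain ⟨z, hz, hyz⟩ := mem_iUnion₂.1 (hcov hy)
  exact mem_iUnion.2 ⟨⟨z, hz⟩, y, ⟨hy, hyz⟩, rfl⟩

theorem Thin.mono_dim {d d' : ℕ} (hd : d ≤ d') {S : Set E} (hS : Thin d S) : Thin d' S := by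
  obtain ⟨D, h, h1, h2⟩ := hS
  set π : Cn d' → Cn d := fun v i => v (Fin.castLE hd i)
  have hπ : Differentiable ℂ π := by fun_prop
  have hsurj : Function.Surjective π := by
    intro v
    refine ⟨fun i => if hi : (i : ℕ) < d then v ⟨i, hi⟩ else 0, ?_⟩
    ext i
    simp [π]
  refine ⟨fun i => π ⁻¹' D i, fun i => h i ∘ π, fun i => ⟨(h1 i).1.preimage hπ.continuous,
    (h1 i).2.comp hπ.differentiableOn fun _ h => h⟩, h2.trans (iUnion_mono fun i => ?_)⟩
  rw [image_comp, image_preimage_eq _ hsurj]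

/-- The iterated derivatives of a function in a fixed direction. -/
noncomputable def dirDeriv {n : ℕ} (φ : Cn n → ℂ) (v : Cn n) : ℕ → Cn n → ℂ
  | 0 => φ
  | k + 1 => fun z => fderiv ℂ (dirDeriv φ v k) z v

theorem differentiableOn_dirDeriv {n : ℕ} {φ : Cn n → ℂ} {s : Set (Cn n)} (hs : IsOpen s)
    (hφ : DifferentiableOn ℂ φ s) (v : Cn n) (k : ℕ) : DifferentiableOn ℂ (dirDeriv φ v k) s := by
  induction k with
  | zero => exact hφ
  | succ k ih => exact differentiableOn_fderiv_apply hs ih v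

theorem iteratedDeriv_line {n : ℕ} {φ : Cn n → ℂ} {s : Set (Cn n)} (hs : IsOpen s)
    (hφ : DifferentiableOn ℂ φ s) (z v : Cn n) (k : ℕ) :
    ∀ ζ : ℂ, z + ζ • v ∈ s →
      iteratedDeriv k (fun ζ : ℂ => φ (z + ζ • v)) ζ = dirDeriv φ v k (z + ζ • v) := by
  induction k with
  | zero => intro ζ _; simp [dirDeriv]
  | succ k ih =>
    intro ζ hζ
    rw [iteratedDeriv_succ]
    have ho : IsOpen {ζ : ℂ | z + ζ • v ∈ s} := hs.preimage (by fun_prop)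
    have hev : iteratedDeriv k (fun ζ : ℂ => φ (z + ζ • v)) =ᶠ[𝓝 ζ]
        fun ζ => dirDeriv φ v k (z + ζ • v) := by
      filter_upwards [ho.mem_nhds hζ] with w hw using ih w hw
    rw [hev.deriv_eq]
    have h1 := ((differentiableOn_dirDeriv hs hφ v k).differentiableAt
      (hs.mem_nhds hζ)).hasFDerivAt
    have h2 : HasDerivAt (fun ζ : ℂ => z + ζ • v) v ζ := by
      simpa using ((hasDerivAt_id ζ).smul_const v).const_add z
    exact (h1.comp_hasDerivAt ζ h2).deriv

/-- Otherwise the Taylor series of `φ` along the line through `z` and `z + v` would vanish, hence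
`φ` itself on the connected part of this line lying in `s`. -/
theorem exists_dirDeriv_ne_zero {n : ℕ} {φ : Cn n → ℂ} {s : Set (Cn n)} (hs : IsOpen s)
    (hcs : Convex ℝ s) (hφ : DifferentiableOn ℂ φ s) {z v : Cn n} (hz : z ∈ s) (hzv : z + v ∈ s)
    (hne : φ (z + v) ≠ 0) : ∃ k, dirDeriv φ v k z ≠ 0 := by
  by_contra! hall
  set g : ℂ → ℂ := fun ζ => φ (z + ζ • v)
  have han := analyticOnNhd_comp_line hs hφ z v
  have hpre := (convex_setOf_line_mem hcs z v).isPreconnected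
  have h00 : (0 : ℂ) ∈ {ζ : ℂ | z + ζ • v ∈ s} := by simpa using hz
  have ho : IsOpen {ζ : ℂ | z + ζ • v ∈ s} := hs.preimage (by fun_prop)
  have hev : g =ᶠ[𝓝 0] 0 := by
    obtain ⟨r, hr, hball⟩ := Metric.mem_nhds_iff.1 (ho.mem_nhds h00)
    filter_upwards [Metric.ball_mem_nhds 0 hr] with w hw
    have hd : DifferentiableOn ℂ g (Metric.ball 0 r) := (han.mono hball).differentiableOn
    have h1 := Complex.taylorSeries_eq_on_ball hd hw
    rw [← h1]
    have h2 : ∀ k, iteratedDeriv k g 0 = 0 := fun k => by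
      rw [iteratedDeriv_line hs hφ z v k 0 h00]
      simpa using hall k
    simp [h2]
  have := han.eqOn_zero_of_preconnected_of_eventuallyEq_zero hpre h00 hev
    (show (1 : ℂ) ∈ _ by simpa using hzv)
  exact hne (by simpa using this)

variable [FiniteDimensional ℂ E]

/-- The images of the analytic subsets of the open subsets of `ℂᵐ`, by the holomorphic maps of rank
at most `r` on these subsets, are thin of dimension at most `r`. -/
def ImagesThin (E : Type) [NormedAddCommGroup E] [NormedSpace ℂ E] (m r : ℕ) : Prop :=
  ∀ (Ω : Set (Cn m)) (h : Cn m → E) (Φ : Set (Cn m → ℂ)), IsOpen Ω → DifferentiableOn ℂ h Ω →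
    (∀ φ ∈ Φ, DifferentiableOn ℂ φ Ω) →
    (∀ z ∈ Ω, (∀ φ ∈ Φ, φ z = 0) →
      Module.finrank ℂ (LinearMap.range (fderiv ℂ h z).toLinearMap) ≤ r) →
    Thin r (h '' {z | z ∈ Ω ∧ ∀ φ ∈ Φ, φ z = 0})

/-- Near a point where `χ` vanishes but not its differential, the hypersurface `χ = 0` is
parametrized by an open subset of `ℂᵐ`, and the induction hypothesis applies to the pull-backs of
`h` and of the equations `Φ`. The rank condition is automatic when `m ≤ r`, which explains the
alternative. -/
theorem thin_image_of_hypersurface {m r : ℕ} (IH : ImagesThin E m r) {Ω : Set (Cn (m + 1))}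
    {h : Cn (m + 1) → E} {Φ : Set (Cn (m + 1) → ℂ)} (hΩ : IsOpen Ω) (hh : DifferentiableOn ℂ h Ω)
    (hΦ : ∀ φ ∈ Φ, DifferentiableOn ℂ φ Ω)
    (hrank : m ≤ r ∨ ∀ z ∈ Ω, (∀ φ ∈ Φ, φ z = 0) →
      Module.finrank ℂ (LinearMap.range (fderiv ℂ h z).toLinearMap) ≤ r)
    {N : Set (Cn (m + 1))} (hN : IsOpen N) (hNΩ : N ⊆ Ω) {χ : Cn (m + 1) → ℂ}
    (hχ : DifferentiableOn ℂ χ N) :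
    Thin r (h '' {z | z ∈ N ∧ (∀ φ ∈ Φ, φ z = 0) ∧ χ z = 0 ∧ fderiv ℂ χ z ≠ 0}) := by
  refine Thin.image_of_locally fun z ⟨hzN, _, hz0, hz1⟩ => ?_
  have hsurj : Function.Surjective (fderiv ℂ χ z) :=
    LinearMap.surjective (f := (fderiv ℂ χ z).toLinearMap) fun h0 => hz1 (by ext v; exact LinearMap.congr_fun h0 v)
  obtain ⟨e, δ, hδ, hze, hes, htgt, -, hfst, hed, hesd⟩ :=
    exists_straightening (K := Cn m) hN hχ hzN hsurj (by simp [add_comm])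
  refine ⟨e.source, e.open_source.mem_nhds hze, ?_⟩
  set D : Set (Cn m) := {y | ((0 : ℂ), y) ∈ e.target}
  have hD : IsOpen D := e.open_target.preimage (by fun_prop)
  set γ : Cn m → Cn (m + 1) := fun y => e.symm (0, y)
  have hγ : DifferentiableOn ℂ γ D := hesd.comp (by fun_prop) fun y hy => hy
  have hγN : ∀ y ∈ D, γ y ∈ Ω := fun y hy => hNΩ (hes (e.map_target hy))
  refine (IH D (h ∘ γ) ((fun φ => φ ∘ γ) '' Φ) hD (hh.comp hγ hγN) ?_ ?_).mono ?_
  · rintro _ ⟨φ, hφ, rfl⟩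
    exact (hΦ φ hφ).comp hγ hγN
  · intro y hy hy0
    rcases hrank with hrank | hrank
    · refine le_trans ?_ hrank
      have := LinearMap.finrank_range_le (fderiv ℂ (h ∘ γ) y).toLinearMap
      simpa using this
    · have h1 : fderiv ℂ (h ∘ γ) y = (fderiv ℂ h (γ y)).comp (fderiv ℂ γ y) :=
        fderiv_comp y (hh.differentiableAt (hΩ.mem_nhds (hγN y hy)))
          (hγ.differentiableAt (hD.mem_nhds hy))
      refine le_trans (Submodule.finrank_mono ?_) (hrank (γ y) (hγN y hy) fun φ hφ =>
        hy0 _ ⟨φ, hφ, rfl⟩)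
      rw [h1]
      rintro _ ⟨v, rfl⟩
      exact ⟨_, rfl⟩
  · rintro _ ⟨w, ⟨⟨hwN, hw0, hwχ, -⟩, hwe⟩, rfl⟩
    have h1 : e w = (0, (e w).2) := by
      ext1
      · rw [hfst w hwe, hwχ]
      · rfl
    have h2 : γ (e w).2 = w := by
      simp only [γ]
      rw [← h1, e.left_inv hwe]
    refine ⟨(e w).2, ⟨?_, ?_⟩, by simp [h2]⟩
    · show ((0 : ℂ), (e w).2) ∈ e.target
      rw [← h1]
      exact e.map_source hwe
    · rintro _ ⟨φ, hφ, rfl⟩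
      simpa [h2] using hw0 φ hφ

/-- The zero set of a non-trivial `φ` is covered by countably many smooth hypersurfaces. At a zero
`w`, some directional derivative of `φ` is non-zero; if the first one has order `k + 1`, then the
derivative of order `k` vanishes at `w` while its differential does not. Directions are taken in a
countable dense sequence. -/
theorem thin_image_of_nontrivial {m r : ℕ} (IH : ImagesThin E m r) {Ω : Set (Cn (m + 1))}
    {h : Cn (m + 1) → E} {Φ : Set (Cn (m + 1) → ℂ)} (hΩ : IsOpen Ω) (hh : DifferentiableOn ℂ h Ω)
    (hΦ : ∀ φ ∈ Φ, DifferentiableOn ℂ φ Ω)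
    (hrank : m ≤ r ∨ ∀ z ∈ Ω, (∀ φ ∈ Φ, φ z = 0) →
      Module.finrank ℂ (LinearMap.range (fderiv ℂ h z).toLinearMap) ≤ r) :
    Thin r (h '' {z | z ∈ Ω ∧ (∀ φ ∈ Φ, φ z = 0) ∧ ∃ φ ∈ Φ, ¬ ∀ᶠ w in 𝓝 z, φ w = 0}) := by
  refine Thin.image_of_locally fun z₀ ⟨hz₀, _, φ, hφ, hne⟩ => ?_
  obtain ⟨δ, hδ, hball⟩ := Metric.mem_nhds_iff.1 (hΩ.mem_nhds hz₀)
  set N := Metric.ball z₀ δ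
  have hNo : IsOpen N := Metric.isOpen_ball
  have hNc : Convex ℝ N := convex_ball z₀ δ
  have hφN := (hΦ φ hφ).mono hball
  have hne' : ∀ w ∈ N, ¬ ∀ᶠ y in 𝓝 w, φ y = 0 := by
    intro w hw h0
    have := eqOn_zero_of_convex hNo hNc hφN hw h0
    exact hne (mem_of_superset (Metric.ball_mem_nhds z₀ hδ) this)
  refine ⟨N, Metric.ball_mem_nhds z₀ hδ, ?_⟩
  have key : ∀ p : ℕ × ℕ, Thin r (h '' {z | z ∈ N ∧ (∀ φ ∈ Φ, φ z = 0) ∧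
      dirDeriv φ (TopologicalSpace.denseSeq (Cn (m + 1)) p.1) p.2 z = 0 ∧
      fderiv ℂ (dirDeriv φ (TopologicalSpace.denseSeq (Cn (m + 1)) p.1) p.2) z ≠ 0}) := fun p =>
    thin_image_of_hypersurface IH hΩ hh hΦ hrank hNo hball (differentiableOn_dirDeriv hNo hφN _ _)
  refine (Thin.iUnion key).mono ?_
  rw [← image_iUnion]
  refine image_mono ?_
  rintro w ⟨⟨-, hw0, -⟩, hwN⟩
  have hopen : IsOpen {v | w + v ∈ N ∧ φ (w + v) ≠ 0} := by
    have h1 : IsOpen (N ∩ φ ⁻¹' {0}ᶜ) :=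
      hφN.continuousOn.isOpen_inter_preimage hNo isOpen_compl_singleton
    exact h1.preimage (f := fun v => w + v) (by fun_prop)
  have hnon : {v | w + v ∈ N ∧ φ (w + v) ≠ 0}.Nonempty := by
    have h1 : ∃ᶠ y in 𝓝 w, φ y ≠ 0 := Filter.not_eventually.1 (hne' w hwN)
    obtain ⟨y, hy1, hy2⟩ := (h1.and_eventually (hNo.mem_nhds hwN)).exists
    exact ⟨y - w, by rw [add_sub_cancel]; exact hy2, by rw [add_sub_cancel]; exact hy1⟩
  obtain ⟨j, hj⟩ := (TopologicalSpace.denseRange_denseSeq (Cn (m + 1))).exists_mem_open hopen hnon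
  set v := TopologicalSpace.denseSeq (Cn (m + 1)) j
  have hex := exists_dirDeriv_ne_zero hNo hNc hφN hwN hj.1 hj.2
  -- The derivative of order zero is `φ`, which vanishes at `w`, so the first non-zero derivative
  -- has positive order.
  obtain ⟨k, hk⟩ : ∃ k, Nat.find hex = k + 1 := by
    refine Nat.exists_eq_succ_of_ne_zero fun h0 => ?_
    have := Nat.find_spec hex
    rw [h0] at this
    exact this (hw0 φ hφ)
  have h1 := Nat.find_spec hex
  have h2 : dirDeriv φ v k w = 0 := by
    have := Nat.find_min hex (m := k) (by omega)
    simpa using this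
  rw [hk] at h1
  refine mem_iUnion.2 ⟨(j, k), hwN, hw0, h2, fun h3 => h1 ?_⟩
  simp only [dirDeriv]
  rw [h3]
  rfl

/-- Induction on `r`. Points of maximal rank are handled by the constant rank theorem. The other
points either fill the domain, and the rank bound drops, or lie on the zero set of a non-trivial
minor, and the dimension drops. Convexity of the domain gives this dichotomy by the identity
theorem. -/
theorem thin_image_of_rank_le {n : ℕ} (IH : ∀ m, n = m + 1 → ∀ r, ImagesThin E m r) (r : ℕ) :
    ∀ (Ω : Set (Cn n)) (h : Cn n → E), IsOpen Ω → Convex ℝ Ω → DifferentiableOn ℂ h Ω →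
    (∀ z ∈ Ω, Module.finrank ℂ (LinearMap.range (fderiv ℂ h z).toLinearMap) ≤ r) →
    Thin r (h '' Ω) := by
  have : CompleteSpace E := FiniteDimensional.complete ℂ E
  have hreg : ∀ (r : ℕ) (Ω : Set (Cn n)) (h : Cn n → E), IsOpen Ω → DifferentiableOn ℂ h Ω →
    (∀ z ∈ Ω, Module.finrank ℂ (LinearMap.range (fderiv ℂ h z).toLinearMap) ≤ r) →
    Thin r (h '' {z | z ∈ Ω ∧
      r ≤ Module.finrank ℂ (LinearMap.range (fderiv ℂ h z).toLinearMap)}) := by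
    intro r Ω h hΩ hh hr
    refine Thin.image_of_locally fun z ⟨hz, hzr⟩ => ?_
    have hrn : r ≤ n := by
      refine hzr.trans ?_
      simpa using LinearMap.finrank_range_le (fderiv ℂ h z).toLinearMap
    obtain ⟨e, B, ψ, δ, hδ, hze, hes, htgt, -, -, -, -, hψ, hhψ⟩ :=
      exists_constant_rank (K := Cn (n - r)) hΩ hh hz hr hzr (by simp; omega)
    refine ⟨e.source, e.open_source.mem_nhds hze, (Thin.image Metric.isOpen_ball hψ).mono ?_⟩
    rintro _ ⟨w, ⟨-, hw⟩, rfl⟩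
    have := e.map_source hw
    rw [htgt] at this
    exact ⟨_, this.1, (hhψ w hw).symm⟩
  induction r with
  | zero =>
    intro Ω h hΩ _ hh hr
    convert hreg 0 Ω h hΩ hh hr using 2
    ext z
    simp
  | succ r ih =>
    intro Ω h hΩ hΩc hh hr
    set Φ : Set (Cn n → ℂ) := range fun p : (Fin (r + 1) → Cn n) × (E →L[ℂ] Cn (r + 1)) =>
      fun z => (Matrix.of fun i j => p.2 (fderiv ℂ h z (p.1 j)) i).det
    have hΦ : ∀ φ ∈ Φ, DifferentiableOn ℂ φ Ω := by
      rintro _ ⟨p, rfl⟩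
      exact differentiableOn_minor hΩ hh p.1 p.2
    have hΦr : ∀ z, (∀ φ ∈ Φ, φ z = 0) ↔
        Module.finrank ℂ (LinearMap.range (fderiv ℂ h z).toLinearMap) ≤ r := by
      intro z
      rw [← Nat.lt_succ_iff, ← not_le, Nat.succ_eq_add_one,
        le_finrank_range_iff_exists_minor (fderiv ℂ h z) (r + 1)]
      push Not
      constructor
      · intro h0 a B
        exact h0 _ ⟨(a, B), rfl⟩
      · rintro h0 _ ⟨p, rfl⟩
        exact h0 p.1 p.2
    by_cases hall : ∀ z ∈ Ω, ∀ φ ∈ Φ, φ z = 0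
    · exact (ih Ω h hΩ hΩc hh fun z hz => (hΦr z).1 (hall z hz)).mono_dim (Nat.le_succ r)
    · push Not at hall
      obtain ⟨z₁, hz₁, φ, hφ, hne⟩ := hall
      have hnt : ∀ z ∈ Ω, ¬ ∀ᶠ w in 𝓝 z, φ w = 0 := fun z hz h0 =>
        hne (eqOn_zero_of_convex hΩ hΩc (hΦ φ hφ) hz h0 z₁ hz₁)
      rcases n with _ | m
      · exfalso
        have : z₁ = 0 := Subsingleton.elim _ _
        obtain ⟨p, rfl⟩ := hφ
        have h1 := (le_finrank_range_iff_exists_minor (fderiv ℂ h z₁) (r + 1)).2 ⟨p.1, p.2, hne⟩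
        have h2 := LinearMap.finrank_range_le (fderiv ℂ h z₁).toLinearMap
        simp only [Module.finrank_fin_fun] at h2
        omega
      · have h1 := thin_image_of_nontrivial (IH m rfl (r + 1)) hΩ hh hΦ
          (Or.inr fun z hz _ => hr z hz)
        refine ((hreg (r + 1) Ω h hΩ hh hr).union h1).mono ?_
        rintro _ ⟨z, hz, rfl⟩
        by_cases hzr : r + 1 ≤ Module.finrank ℂ (LinearMap.range (fderiv ℂ h z).toLinearMap)
        · exact Or.inl ⟨z, ⟨hz, hzr⟩, rfl⟩
        · exact Or.inr ⟨z, ⟨hz, (hΦr z).2 (by omega), φ, hφ, hnt z hz⟩, rfl⟩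

/-- Where some equation is not locally trivial, the dimension drops. Where all are locally trivial,
they vanish on a ball, the rank bound holds on this ball, and `thin_image_of_rank_le` applies. Thus
no stratification of analytic sets is required. -/
theorem imagesThin (n r : ℕ) : ImagesThin E n r := by
  induction n generalizing r with
  | zero =>
    intro Ω h Φ hΩ hh hΦ hrank
    have h0 : Thin 0 (h '' Ω) := Thin.image hΩ hh
    exact (h0.mono (image_mono fun z hz => hz.1)).mono_dim (Nat.zero_le r)
  | succ n ih =>
    intro Ω h Φ hΩ hh hΦ hrank
    have h1 := thin_image_of_nontrivial (ih r) hΩ hh hΦ (Or.inr hrank)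
    have h2 : Thin r (h '' {z | z ∈ Ω ∧ (∀ φ ∈ Φ, ∀ᶠ w in 𝓝 z, φ w = 0)}) := by
      refine Thin.image_of_locally fun z ⟨hz, hz0⟩ => ?_
      obtain ⟨δ, hδ, hball⟩ := Metric.mem_nhds_iff.1 (hΩ.mem_nhds hz)
      refine ⟨Metric.ball z δ, Metric.ball_mem_nhds z hδ,
        (thin_image_of_rank_le (fun m hm r => by cases hm; exact ih r) r (Metric.ball z δ) h
          Metric.isOpen_ball (convex_ball z δ) (hh.mono hball) fun w hw => ?_).mono
          (image_mono inter_subset_right)⟩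
      exact hrank w (hball hw) fun φ hφ => eqOn_zero_of_convex Metric.isOpen_ball (convex_ball z δ)
        ((hΦ φ hφ).mono hball) (Metric.mem_ball_self hδ) (hz0 φ hφ) w hw
    refine (h1.union h2).mono ?_
    rintro _ ⟨z, ⟨hz, hz0⟩, rfl⟩
    by_cases hc : ∀ φ ∈ Φ, ∀ᶠ w in 𝓝 z, φ w = 0
    · exact Or.inr ⟨z, ⟨hz, hc⟩, rfl⟩
    · push Not at hc
      obtain ⟨φ, hφ, hc⟩ := hc
      exact Or.inl ⟨z, ⟨hz, hz0, φ, hφ, fun h => hc.and_eventually h |>.exists.elim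
        fun _ h => h.1 h.2⟩, rfl⟩

omit [FiniteDimensional ℂ E] in
/-- The zero set of a holomorphic function which does not vanish identically near any point. -/
theorem thin_zeros {n : ℕ} {Ω : Set (Cn n)} (hΩ : IsOpen Ω) {φ : Cn n → ℂ}
    (hφ : DifferentiableOn ℂ φ Ω) (hne : ∀ z ∈ Ω, ¬ ∀ᶠ w in 𝓝 z, φ w = 0) :
    Thin (n - 1) {z | z ∈ Ω ∧ φ z = 0} := by
  rcases n with _ | m
  -- In dimension zero `n - 1` is truncated, but there a function vanishing at the only point
  -- vanishes near it, and the zero set is empty.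
  · refine Thin.empty.mono fun z ⟨hz, h0⟩ => hne z hz (Eventually.of_forall fun w => ?_)
    rw [Subsingleton.elim w z, h0]
  · have := thin_image_of_nontrivial (E := Cn (m + 1)) (imagesThin m m) (h := id) (Φ := {φ}) hΩ
      differentiableOn_id (by simpa using hφ) (Or.inl le_rfl)
    refine this.mono fun z ⟨hz, h0⟩ => ⟨z, ⟨hz, by simpa using h0, φ, rfl, hne z hz⟩, rfl⟩

theorem dimH_image_le_of_contDiffOn {V W : Type*} [NormedAddCommGroup V] [NormedSpace ℝ V]
    [FiniteDimensional ℝ V] [NormedAddCommGroup W] [NormedSpace ℝ W] {f : V → W} {s : Set V}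
    (hs : IsOpen s) (hf : ContDiffOn ℝ 1 f s) : dimH (f '' s) ≤ Module.finrank ℝ V := by
  have : ProperSpace V := FiniteDimensional.proper ℝ V
  refine (dimH_image_le_of_locally_lipschitzOn fun x hx => ?_).trans
    ((dimH_mono (subset_univ s)).trans_eq (Real.dimH_univ_eq_finrank V))
  obtain ⟨C, t, ht, hl⟩ := (hf.contDiffAt (hs.mem_nhds hx)).exists_lipschitzOnWith
  exact ⟨C, t, mem_nhdsWithin_of_mem_nhds ht, hl⟩

theorem contDiffOn_real_of_differentiableOn {V W : Type} [NormedAddCommGroup V] [NormedSpace ℂ V]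
    [FiniteDimensional ℂ V] [NormedAddCommGroup W] [NormedSpace ℂ W] [CompleteSpace W]
    [NormedSpace ℝ V] [IsScalarTower ℝ ℂ V] [NormedSpace ℝ W] [IsScalarTower ℝ ℂ W]
    {f : V → W} {s : Set V} (hs : IsOpen s) (hf : DifferentiableOn ℂ f s) : ContDiffOn ℝ ∞ f s :=
  (contDiffOn_infty_of_differentiableOn hs hf).restrict_scalars ℝ

/-- Holomorphic maps are locally Lipschitz and do not increase the Hausdorff dimension, which is
`2r` for `ℂʳ`. -/
theorem Thin.dimH_le {g r : ℕ} {S : Set (Cn g)} (hS : Thin r S) : dimH S ≤ (2 * r : ℕ) := by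
  obtain ⟨D, h, h1, h2⟩ := hS
  refine (dimH_mono h2).trans ?_
  rw [dimH_iUnion]
  refine iSup_le fun i => ?_
  have := dimH_image_le_of_contDiffOn (h1 i).1
    ((contDiffOn_real_of_differentiableOn (h1 i).1 (h1 i).2).of_le (n := ∞) (m := 1) (by norm_cast))
  rwa [finrank_real_of_complex, Module.finrank_fin_fun] at this

theorem Thin.dense_compl {g r : ℕ} (hr : r < g) {S : Set (Cn g)} (hS : Thin r S) : Dense Sᶜ := by
  refine dense_compl_of_dimH_lt_finrank (hS.dimH_le.trans_lt ?_)
  rw [finrank_real_of_complex, Module.finrank_fin_fun]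
  exact_mod_cast (by omega : 2 * r < 2 * g)

/-- The union of the real lines joining `x` to points of `S` is parametrized with one more real
parameter than `S`. -/
theorem Thin.dimH_cone_le {g r : ℕ} {S : Set (Cn g)} (hS : Thin r S) (x : Cn g) :
    dimH {z | ∃ (s : ℝ), ∃ k ∈ S, z = x + s • (k - x)} ≤ (2 * r + 1 : ℕ) := by
  obtain ⟨D, h, h1, h2⟩ := hS
  have hsub : {z | ∃ (s : ℝ), ∃ k ∈ S, z = x + s • (k - x)} ⊆
      ⋃ i, (fun p : ℝ × Cn r => x + p.1 • (h i p.2 - x)) '' (univ ×ˢ D i) := by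
    rintro _ ⟨s, k, hk, rfl⟩
    obtain ⟨i, w, hw, rfl⟩ := mem_iUnion.1 (h2 hk)
    exact mem_iUnion.2 ⟨i, (s, w), ⟨trivial, hw⟩, rfl⟩
  refine (dimH_mono hsub).trans ?_
  rw [dimH_iUnion]
  refine iSup_le fun i => ?_
  have hc : ContDiffOn ℝ 1 (fun p : ℝ × Cn r => x + p.1 • (h i p.2 - x)) (univ ×ˢ D i) := by
    have h3 : ContDiffOn ℝ 1 (h i) (D i) :=
      (contDiffOn_real_of_differentiableOn (h1 i).1 (h1 i).2).of_le (n := ∞) (m := 1) (by norm_cast)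
    have h4 : ContDiffOn ℝ 1 (fun p : ℝ × Cn r => h i p.2) (univ ×ˢ D i) :=
      h3.comp contDiffOn_snd fun p hp => hp.2
    exact contDiffOn_const.add (contDiffOn_fst.smul (h4.sub contDiffOn_const))
  have := dimH_image_le_of_contDiffOn (isOpen_univ.prod (h1 i).1) hc
  rw [Module.finrank_prod, Module.finrank_self, finrank_real_of_complex,
    Module.finrank_fin_fun] at this
  rwa [add_comm] at this

/-- The complement of a thin subset in a convex open set is connected. -/
theorem Thin.isPreconnected_diff {g r : ℕ} (hr : r < g) {S : Set (Cn g)} (hS : Thin r S)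
    {Ω : Set (Cn g)} (hΩ : IsOpen Ω) (hc : Convex ℝ Ω) : IsPreconnected (Ω \ S) := by
  refine isPreconnected_of_forall_pair fun x hx y hy => ?_
  -- The two cones have real dimension at most `2r + 1 < 2g`, so some point `z` of `Ω` avoids both.
  -- The segments from `z` to `x` and `y` then avoid `S`: a point of `S` on one of them would place
  -- `z` on a cone.
  set cone : Cn g → Set (Cn g) := fun x => {z | ∃ (s : ℝ), ∃ k ∈ S, z = x + s • (k - x)}
  have hdense : Dense (cone x ∪ cone y)ᶜ := by
    refine dense_compl_of_dimH_lt_finrank ?_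
    rw [dimH_union]
    refine (max_le (hS.dimH_cone_le x) (hS.dimH_cone_le y)).trans_lt ?_
    rw [finrank_real_of_complex, Module.finrank_fin_fun]
    exact_mod_cast (by omega : 2 * r + 1 < 2 * g)
  obtain ⟨z, hzΩ, hz⟩ := hdense.inter_open_nonempty Ω hΩ ⟨x, hx.1⟩
  have hseg : ∀ x ∈ Ω \ S, z ∉ cone x → segment ℝ x z ⊆ Ω \ S := by
    intro x hx hzx k hk
    refine ⟨hc.segment_subset hx.1 hzΩ hk, fun hkS => ?_⟩
    rw [segment_eq_image'] at hk
    obtain ⟨τ, hτ, rfl⟩ := hk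
    rcases eq_or_ne τ 0 with rfl | hτ0
    · exact hx.2 (by simpa using hkS)
    · refine hzx ⟨τ⁻¹, _, hkS, ?_⟩
      simp [smul_smul, inv_mul_cancel₀ hτ0]
  simp only [mem_compl_iff, mem_union, not_or] at hz
  refine ⟨segment ℝ x z ∪ segment ℝ y z, union_subset (hseg x hx hz.1) (hseg y hy hz.2),
    Or.inl (left_mem_segment ℝ x z), Or.inr (left_mem_segment ℝ y z), ?_⟩
  exact (convex_segment x z).isPreconnected.union z (right_mem_segment ℝ x z)
    (right_mem_segment ℝ y z) (convex_segment y z).isPreconnected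

end Thin

/-- A subset of a connected set with locally connected and dense complement does not separate. -/
theorem isPreconnected_diff_of_locally {α : Type*} [TopologicalSpace α] {Y A : Set α}
    (hY : IsPreconnected Y)
    (h : ∀ y ∈ Y, ∃ N, N ⊆ Y ∧ N ∈ 𝓝[Y] y ∧ IsPreconnected (N \ A))
    (hd : Y ⊆ closure (Y \ A)) : IsPreconnected (Y \ A) := by
  rw [isPreconnected_iff_subset_of_disjoint]
  intro u v hu hv huv hdisj
  choose! N hNY hN hpre using h
  have hW : ∀ y ∈ Y, ∃ W, IsOpen W ∧ y ∈ W ∧ W ∩ Y ⊆ N y := fun y hy => by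
    obtain ⟨W, h1, h2, h3⟩ := mem_nhdsWithin.1 (hN y hy)
    exact ⟨W, h1, h2, h3⟩
  choose! W hWo hyW hWN using hW
  have hcase : ∀ y ∈ Y, N y \ A ⊆ u ∨ N y \ A ⊆ v := fun y hy =>
    isPreconnected_iff_subset_of_disjoint.1 (hpre y hy) u v hu hv
      ((diff_subset_diff_left (hNY y hy)).trans huv) (by
        refine subset_eq_empty ?_ hdisj
        exact inter_subset_inter_left _ (diff_subset_diff_left (hNY y hy)))
  -- `U'` and `V'` collect the neighborhoods whose part outside `A` lies in `u`, respectively `v`.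
  -- They cover `Y`; if both met `Y` they would meet each other in `Y`, and by density of `Y \ A` so
  -- would `u` and `v`.
  set U' := ⋃ y ∈ {y | y ∈ Y ∧ N y \ A ⊆ u}, W y
  set V' := ⋃ y ∈ {y | y ∈ Y ∧ N y \ A ⊆ v}, W y
  have hU' : IsOpen U' := isOpen_biUnion fun y hy => hWo y hy.1
  have hV' : IsOpen V' := isOpen_biUnion fun y hy => hWo y hy.1
  have hcov : Y ⊆ U' ∪ V' := fun y hy => by
    rcases hcase y hy with h1 | h1
    · exact Or.inl (mem_biUnion (show y ∈ {y | y ∈ Y ∧ N y \ A ⊆ u} from ⟨hy, h1⟩) (hyW y hy))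
    · exact Or.inr (mem_biUnion (show y ∈ {y | y ∈ Y ∧ N y \ A ⊆ v} from ⟨hy, h1⟩) (hyW y hy))
  have hin : ∀ z ∈ Y \ A, z ∈ U' → z ∈ u := by
    intro z hz hzU
    obtain ⟨y, hy, hzy⟩ := mem_iUnion₂.1 hzU
    exact hy.2 ⟨hWN y hy.1 ⟨hzy, hz.1⟩, hz.2⟩
  have hin' : ∀ z ∈ Y \ A, z ∈ V' → z ∈ v := by
    intro z hz hzU
    obtain ⟨y, hy, hzy⟩ := mem_iUnion₂.1 hzU
    exact hy.2 ⟨hWN y hy.1 ⟨hzy, hz.1⟩, hz.2⟩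
  by_cases h1 : (Y ∩ U').Nonempty
  · by_cases h2 : (Y ∩ V').Nonempty
    · obtain ⟨y, hy, hyUV⟩ := hY U' V' hU' hV' hcov h1 h2
      obtain ⟨z, hz1, hz2⟩ := mem_closure_iff.1 (hd hy) (U' ∩ V') (hU'.inter hV') hyUV
      exact absurd (show z ∈ Y \ A ∩ (u ∩ v) from ⟨hz2, hin z hz2 hz1.1, hin' z hz2 hz1.2⟩)
        (by rw [hdisj]; exact notMem_empty z)
    · refine Or.inl fun z hz => hin z hz ((hcov hz.1).resolve_right fun hzV => h2 ⟨z, hz.1, hzV⟩)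
  · refine Or.inr fun z hz => hin' z hz ((hcov hz.1).resolve_left fun hzV => h1 ⟨z, hz.1, hzV⟩)

end LagrangianFibration

namespace LagrangianFibration

/-! ### The rank of a holomorphic map between manifolds -/

section Rank

theorem finrank_range_eq_of_comp_eq {V₁ V₂ W₁ W₂ : Type*} [AddCommGroup V₁] [Module ℂ V₁]
    [AddCommGroup V₂] [Module ℂ V₂] [AddCommGroup W₁] [Module ℂ W₁] [AddCommGroup W₂] [Module ℂ W₂]
    {L : V₁ →ₗ[ℂ] V₂} {L' : W₁ →ₗ[ℂ] W₂} (A : V₂ →ₗ[ℂ] W₂) (B : W₁ →ₗ[ℂ] V₁)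
    (hA : Function.Injective A) (hB : Function.Surjective B) (h : L' = A ∘ₗ L ∘ₗ B) :
    Module.finrank ℂ (LinearMap.range L') = Module.finrank ℂ (LinearMap.range L) := by
  have h1 : LinearMap.range L' = (LinearMap.range L).map A := by
    rw [h, LinearMap.range_comp, LinearMap.range_comp, LinearMap.range_eq_top.2 hB,
      Submodule.map_top]
  rw [h1]
  exact ((Submodule.equivMapOfInjective A hA _).finrank_eq).symm

variable {n N : ℕ} {X : Type*} [TopologicalSpace X] [ChartedSpace (Cn n) X]
  [IsManifold 𝓘(ℂ, Cn n) ω X] {P : Type*} [TopologicalSpace P] [ChartedSpace (Cn N) P]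
  [IsManifold 𝓘(ℂ, Cn N) ω P]

/-- The complex rank of the differential of a map between complex manifolds. -/
noncomputable def rk (n N : ℕ) {X : Type*} [TopologicalSpace X] [ChartedSpace (Cn n) X]
    {P : Type*} [TopologicalSpace P] [ChartedSpace (Cn N) P] (p : X → P) (x : X) : ℕ :=
  Module.finrank ℂ (LinearMap.range (holDeriv n N p x).toLinearMap)

/-- The open set on which a map is expressed in the preferred charts at `x` and `p x`. -/
def repSet (n N : ℕ) {X : Type*} [TopologicalSpace X] [ChartedSpace (Cn n) X]
    {P : Type*} [TopologicalSpace P] [ChartedSpace (Cn N) P] (p : X → P) (x : X) : Set (Cn n) :=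
  (chartAt (Cn n) x).target ∩ (chartAt (Cn n) x).symm ⁻¹' (p ⁻¹' (chartAt (Cn N) (p x)).source)

/-- The expression of a map in the preferred charts at `x` and `p x`. -/
noncomputable def rep (n N : ℕ) {X : Type*} [TopologicalSpace X] [ChartedSpace (Cn n) X]
    {P : Type*} [TopologicalSpace P] [ChartedSpace (Cn N) P] (p : X → P) (x : X) :
    Cn n → Cn N :=
  chartAt (Cn N) (p x) ∘ p ∘ (chartAt (Cn n) x).symm

theorem chart_mdifferentiable (x : X) :
    (chartAt (Cn n) x).MDifferentiable 𝓘(ℂ, Cn n) 𝓘(ℂ, Cn n) :=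
  mdifferentiable_chart x

omit [IsManifold 𝓘(ℂ, Cn n) ω X] [IsManifold 𝓘(ℂ, Cn N) ω P] in
theorem isOpen_repSet {p : X → P} (hp : Continuous p) (x : X) : IsOpen (repSet n N p x) :=
  (chartAt (Cn n) x).continuousOn_symm.isOpen_inter_preimage (chartAt (Cn n) x).open_target
    ((chartAt (Cn N) (p x)).open_source.preimage hp)

omit [IsManifold 𝓘(ℂ, Cn n) ω X] [IsManifold 𝓘(ℂ, Cn N) ω P] in
theorem mem_repSet (p : X → P) (x : X) : chartAt (Cn n) x x ∈ repSet n N p x :=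
  ⟨(chartAt (Cn n) x).map_source (mem_chart_source _ x), by
    simp [(chartAt (Cn n) x).left_inv (mem_chart_source _ x)]⟩

theorem hasMFDerivAt_rep {p : X → P} (hp : MDifferentiable 𝓘(ℂ, Cn n) 𝓘(ℂ, Cn N) p) (x : X)
    {z : Cn n} (hz : z ∈ repSet n N p x) :
    HasMFDerivAt 𝓘(ℂ, Cn n) 𝓘(ℂ, Cn N) (rep n N p x) z
      ((mfderiv 𝓘(ℂ, Cn N) 𝓘(ℂ, Cn N) (chartAt (Cn N) (p x)) (p ((chartAt (Cn n) x).symm z))).comp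
        ((holDeriv n N p ((chartAt (Cn n) x).symm z)).comp
          (mfderiv 𝓘(ℂ, Cn n) 𝓘(ℂ, Cn n) (chartAt (Cn n) x).symm z))) := by
  have h1 := ((chart_mdifferentiable (n := n) x).mdifferentiableAt_symm hz.1).hasMFDerivAt
  have h2 := (hp ((chartAt (Cn n) x).symm z)).hasMFDerivAt
  have h3 := ((chart_mdifferentiable (n := N) (p x)).mdifferentiableAt hz.2).hasMFDerivAt
  exact h3.comp z (h2.comp z h1)

theorem differentiableOn_rep {p : X → P} (hp : MDifferentiable 𝓘(ℂ, Cn n) 𝓘(ℂ, Cn N) p) (x : X) :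
    DifferentiableOn ℂ (rep n N p x) (repSet n N p x) := fun z hz =>
  ((hasMFDerivAt_rep hp x hz).mdifferentiableAt.differentiableAt).differentiableWithinAt

theorem finrank_rep {p : X → P} (hp : MDifferentiable 𝓘(ℂ, Cn n) 𝓘(ℂ, Cn N) p) (x : X)
    {z : Cn n} (hz : z ∈ repSet n N p x) :
    Module.finrank ℂ (LinearMap.range (fderiv ℂ (rep n N p x) z).toLinearMap) =
      rk n N p ((chartAt (Cn n) x).symm z) := by
  have h1 := (hasMFDerivAt_rep hp x hz).mfderiv
  rw [mfderiv_eq_fderiv] at h1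
  have hs := (chart_mdifferentiable (n := n) x).symm.mfderiv_bijective
    (x := z) (by simpa using hz.1)
  have hi := (chart_mdifferentiable (n := N) (p x)).mfderiv_injective hz.2
  exact finrank_range_eq_of_comp_eq
    (L := (holDeriv n N p ((chartAt (Cn n) x).symm z)).toLinearMap)
    (L' := (fderiv ℂ (rep n N p x) z).toLinearMap)
    (mfderiv 𝓘(ℂ, Cn N) 𝓘(ℂ, Cn N) (chartAt (Cn N) (p x))
      (p ((chartAt (Cn n) x).symm z))).toLinearMap
    (mfderiv 𝓘(ℂ, Cn n) 𝓘(ℂ, Cn n) (chartAt (Cn n) x).symm z).toLinearMap hi hs.2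
    (congrArg ContinuousLinearMap.toLinearMap h1)

/-- The set of minors of size `r` of the differential of a map between vector spaces. -/
def minors {m N : ℕ} (h : Cn m → Cn N) (r : ℕ) : Set (Cn m → ℂ) :=
  range fun p : (Fin r → Cn m) × (Cn N →L[ℂ] Cn r) =>
    fun z => (Matrix.of fun i j => p.2 (fderiv ℂ h z (p.1 j)) i).det

theorem differentiableOn_of_mem_minors {m N r : ℕ} {h : Cn m → Cn N} {Ω : Set (Cn m)}
    (hΩ : IsOpen Ω) (hh : DifferentiableOn ℂ h Ω) {φ : Cn m → ℂ} (hφ : φ ∈ minors h r) :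
    DifferentiableOn ℂ φ Ω := by
  obtain ⟨p, rfl⟩ := hφ
  exact differentiableOn_minor hΩ hh p.1 p.2

theorem forall_minors_eq_zero_iff {m N r : ℕ} {h : Cn m → Cn N} {z : Cn m} :
    (∀ φ ∈ minors h r, φ z = 0) ↔
      Module.finrank ℂ (LinearMap.range (fderiv ℂ h z).toLinearMap) < r := by
  rw [← not_le, le_finrank_range_iff_exists_minor (fderiv ℂ h z) r]
  push Not
  constructor
  · intro h0 a B
    exact h0 _ ⟨(a, B), rfl⟩
  · rintro h0 _ ⟨p, rfl⟩
    exact h0 p.1 p.2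

omit [IsManifold 𝓘(ℂ, Cn n) ω X] [IsManifold 𝓘(ℂ, Cn N) ω P] in
theorem exists_ball_subset_repSet {p : X → P} (hp : Continuous p) (x : X) :
    ∃ δ > 0, Metric.ball (chartAt (Cn n) x x) δ ⊆ repSet n N p x :=
  Metric.mem_nhds_iff.1 ((isOpen_repSet hp x).mem_nhds (mem_repSet p x))

omit [IsManifold 𝓘(ℂ, Cn n) ω X] [IsManifold 𝓘(ℂ, Cn N) ω P] in
theorem image_symm_mem_nhds {p : X → P} {x : X} {δ : ℝ} (hδ : 0 < δ)
    (hsub : Metric.ball (chartAt (Cn n) x x) δ ⊆ repSet n N p x) :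
    (chartAt (Cn n) x).symm '' Metric.ball (chartAt (Cn n) x x) δ ∈ 𝓝 x := by
  have h1 := (chartAt (Cn n) x).symm.image_mem_nhds
    (x := chartAt (Cn n) x x) ((chartAt (Cn n) x).map_source (mem_chart_source _ x))
    (Metric.ball_mem_nhds _ hδ)
  rwa [(chartAt (Cn n) x).left_inv (mem_chart_source _ x)] at h1

/-- A non-zero minor of size `r` remains non-zero nearby. -/
theorem isOpen_le_rk {p : X → P} (hp : MDifferentiable 𝓘(ℂ, Cn n) 𝓘(ℂ, Cn N) p) (r : ℕ) :
    IsOpen {x | r ≤ rk n N p x} := by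
  rw [isOpen_iff_mem_nhds]
  intro x hx
  obtain ⟨δ, hδ, hsub⟩ := exists_ball_subset_repSet (n := n) (N := N) hp.continuous x
  set φ := chartAt (Cn n) x
  have hφx : φ.symm (φ x) = x := φ.left_inv (mem_chart_source _ x)
  have h1 : ∃ χ ∈ minors (rep n N p x) r, χ (φ x) ≠ 0 := by
    have := mt (forall_minors_eq_zero_iff (h := rep n N p x) (r := r) (z := φ x)).1 (by
      rw [finrank_rep hp x (mem_repSet p x), hφx]; exact not_lt.2 hx)
    push Not at this
    exact this
  obtain ⟨χ, hχ, hne⟩ := h1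
  have hcont : ContinuousAt χ (φ x) := ((differentiableOn_of_mem_minors (isOpen_repSet hp.continuous x)
    (differentiableOn_rep hp x) hχ).continuousOn).continuousAt
      ((isOpen_repSet hp.continuous x).mem_nhds (mem_repSet p x))
  have h2 : ∀ᶠ z in 𝓝 (φ x), χ z ≠ 0 ∧ z ∈ repSet n N p x :=
    (hcont.eventually_ne hne).and ((isOpen_repSet hp.continuous x).mem_nhds (mem_repSet p x))
  have h3 := (φ.continuousAt (mem_chart_source _ x)).eventually h2
  filter_upwards [h3, φ.open_source.mem_nhds (mem_chart_source _ x)] with y hy hys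
  have h4 := finrank_rep hp x hy.2
  rw [φ.left_inv hys] at h4
  rw [← h4, ← not_lt, ← forall_minors_eq_zero_iff]
  exact fun h => hy.1 (h χ hχ)

variable [ConnectedSpace X]

/-- The identity theorem for the rank of a holomorphic map. -/
theorem rk_lt_of_eventually {p : X → P} (hp : MDifferentiable 𝓘(ℂ, Cn n) 𝓘(ℂ, Cn N) p) {r : ℕ}
    {x₀ : X} (h0 : ∀ᶠ x in 𝓝 x₀, rk n N p x < r) (x : X) : rk n N p x < r := by
  set Y := {x | ∀ᶠ y in 𝓝 x, rk n N p y < r}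
  have hopen : IsOpen Y := isOpen_setOf_eventually_nhds
  have hclosed : IsClosed Y := by
    refine isClosed_of_closure_subset fun x hx => ?_
    obtain ⟨δ, hδ, hsub⟩ := exists_ball_subset_repSet (n := n) (N := N) hp.continuous x
    set φ := chartAt (Cn n) x
    have hN := image_symm_mem_nhds (p := p) hδ hsub
    obtain ⟨y, ⟨z, hz, rfl⟩, hy⟩ := mem_closure_iff_nhds.1 hx _ hN
    have h1 : ∀ᶠ w in 𝓝 z, rk n N p (φ.symm w) < r :=
      (φ.symm.continuousAt (hsub hz).1).eventually hy
    -- The minors vanish near one point of the coordinate ball, hence on the whole ball, which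
    -- contains the limit point `x` in its interior.
    have hall : ∀ χ ∈ minors (rep n N p x) r, ∀ w ∈ Metric.ball (φ x) δ, χ w = 0 := by
      intro χ hχ
      refine eqOn_zero_of_convex Metric.isOpen_ball (convex_ball _ _)
        (differentiableOn_of_mem_minors Metric.isOpen_ball
          ((differentiableOn_rep hp x).mono hsub) hχ) hz ?_
      filter_upwards [h1, Metric.isOpen_ball.mem_nhds hz] with w hw hwb
      rw [← finrank_rep hp x (hsub hwb)] at hw
      exact forall_minors_eq_zero_iff.2 hw χ hχ
    refine mem_of_superset hN ?_
    rintro _ ⟨w, hw, rfl⟩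
    rw [mem_ofPred_eq, ← finrank_rep hp x (hsub hw)]
    exact forall_minors_eq_zero_iff.1 fun χ hχ => hall χ hχ w hw
  have huniv : Y = univ := IsClopen.eq_univ ⟨hclosed, hopen⟩ ⟨x₀, h0⟩
  have : x ∈ Y := huniv ▸ mem_univ x
  exact this.self_of_nhds

theorem dense_le_rk {p : X → P} (hp : MDifferentiable 𝓘(ℂ, Cn n) 𝓘(ℂ, Cn N) p) {r : ℕ}
    {x₀ : X} (h0 : r ≤ rk n N p x₀) : Dense {x | r ≤ rk n N p x} := by
  intro x
  by_contra hx
  rw [mem_closure_iff_frequently, not_frequently] at hx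
  have h1 : ∀ᶠ y in 𝓝 x, rk n N p y < r := hx.mono fun y hy => not_le.1 hy
  exact absurd h0 (not_le.2 (rk_lt_of_eventually hp h1 x₀))

/-- The set of points at which the rank of a holomorphic map is maximal is connected. -/
theorem isPreconnected_le_rk (hn : 1 ≤ n) {p : X → P}
    (hp : MDifferentiable 𝓘(ℂ, Cn n) 𝓘(ℂ, Cn N) p) {r : ℕ}
    {x₀ : X} (h0 : r ≤ rk n N p x₀) : IsPreconnected {x | r ≤ rk n N p x} := by
  have hset : {x | r ≤ rk n N p x} = univ \ {x | rk n N p x < r} := by ext; simp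
  have hd := dense_le_rk hp h0
  rw [hset] at hd ⊢
  refine isPreconnected_diff_of_locally isPreconnected_univ (fun x _ => ?_) fun x _ => hd x
  obtain ⟨δ, hδ, hsub⟩ := exists_ball_subset_repSet (n := n) (N := N) hp.continuous x
  set φ := chartAt (Cn n) x
  set B := Metric.ball (φ x) δ
  have hN : φ.symm '' B ∈ 𝓝 x := image_symm_mem_nhds (p := p) hδ hsub
  -- If all minors vanished on the ball, the rank would be less than `r` on all of `X`. The points
  -- of small rank therefore lie in a thin set, which does not disconnect the ball.
  have hχ : ∃ χ ∈ minors (rep n N p x) r, ∃ z ∈ B, χ z ≠ 0 := by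
    by_contra! hall
    refine absurd h0 (not_le.2 (rk_lt_of_eventually hp (x₀ := x) (mem_of_superset hN ?_) x₀))
    rintro _ ⟨w, hw, rfl⟩
    rw [mem_ofPred_eq, ← finrank_rep hp x (hsub hw)]
    exact forall_minors_eq_zero_iff.1 fun χ hχ => hall χ hχ w hw
  obtain ⟨χ, hχ, z, hz, hne⟩ := hχ
  have hχd := differentiableOn_of_mem_minors Metric.isOpen_ball
    ((differentiableOn_rep hp x).mono hsub) hχ
  have hthin : Thin (n - 1) {w | w ∈ B ∧ rk n N p (φ.symm w) < r} := by
    refine (thin_zeros Metric.isOpen_ball hχd fun y hy h1 => hne (eqOn_zero_of_convex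
      Metric.isOpen_ball (convex_ball _ _) hχd hy h1 z hz)).mono ?_
    rintro w ⟨hw, hr⟩
    refine ⟨hw, ?_⟩
    rw [← finrank_rep hp x (hsub hw)] at hr
    exact forall_minors_eq_zero_iff.2 hr χ hχ
  refine ⟨φ.symm '' B, subset_univ _, by rwa [nhdsWithin_univ], ?_⟩
  have h2 := hthin.isPreconnected_diff (by omega) (Ω := B) Metric.isOpen_ball (convex_ball _ _)
  have h3 : φ.symm '' B \ {x | rk n N p x < r} =
      φ.symm '' (B \ {w | w ∈ B ∧ rk n N p (φ.symm w) < r}) := by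
    ext y
    constructor
    · rintro ⟨⟨w, hw, rfl⟩, hy⟩
      exact ⟨w, ⟨hw, fun h => hy h.2⟩, rfl⟩
    · rintro ⟨w, ⟨hw, hw2⟩, rfl⟩
      exact ⟨⟨w, hw, rfl⟩, fun h => hw2 ⟨hw, h⟩⟩
  rw [h3]
  exact h2.image _ (φ.continuousOn_symm.mono fun w hw => (hsub hw.1).1)

end Rank

end LagrangianFibration

namespace LagrangianFibration

/-! ### Regular values: charts of the base and connectedness of `B°` -/

instance finiteDimensional_tangentSpace (n : ℕ) {Y : Type*} [TopologicalSpace Y]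
    [ChartedSpace (Cn n) Y] (x : Y) : FiniteDimensional ℂ (TX n x) :=
  inferInstanceAs (FiniteDimensional ℂ (Cn n))

section RegularValues

variable {g N : ℕ} {X : Type*} [TopologicalSpace X] [ChartedSpace (Cn (2 * g)) X]
  [IsManifold 𝓘(ℂ, Cn (2 * g)) ω X] {P : Type*} [TopologicalSpace P] [ChartedSpace (Cn N) P]
  [IsManifold 𝓘(ℂ, Cn N) ω P]

/-- A change of coordinates composed with a chart. -/
theorem mdifferentiable_chart_trans {n : ℕ} {Y : Type*} [TopologicalSpace Y] [ChartedSpace (Cn n) Y]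
    [IsManifold 𝓘(ℂ, Cn n) ω Y] {V : Type} [NormedAddCommGroup V] [NormedSpace ℂ V] (x : Y)
    (e : OpenPartialHomeomorph (Cn n) V) (h1 : DifferentiableOn ℂ e e.source)
    (h2 : DifferentiableOn ℂ e.symm e.target) :
    ((chartAt (Cn n) x).trans e).MDifferentiable 𝓘(ℂ, Cn n) 𝓘(ℂ, V) :=
  (chart_mdifferentiable x).trans ⟨h1.mdifferentiableOn, h2.mdifferentiableOn⟩

/-- The rank equals `g` near `x₀`, so the constant rank theorem applies in charts; `ρ` is a linear
projection read in the chart of `P`, and `ψ` parametrizes the local image. This image may still be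
only a part of the range of `p` near `p x₀`, because other points of the fiber could produce other
branches; connectedness of the fiber excludes this later. -/
theorem exists_local_structure {p : X → P} (hp : MDifferentiable 𝓘(ℂ, Cn (2 * g)) 𝓘(ℂ, Cn N) p)
    (hle : ∀ x, rk (2 * g) N p x ≤ g) {x₀ : X} (h0 : g ≤ rk (2 * g) N p x₀) :
    ∃ (e : OpenPartialHomeomorph X (Cn g × Cn g)) (ρ : P → Cn g) (W : Set P) (ψ : Cn g → P) (δ : ℝ),
      0 < δ ∧ IsOpen W ∧ MDifferentiableOn 𝓘(ℂ, Cn N) 𝓘(ℂ, Cn g) ρ W ∧ x₀ ∈ e.source ∧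
      e.MDifferentiable 𝓘(ℂ, Cn (2 * g)) 𝓘(ℂ, Cn g × Cn g) ∧
      e.target = Metric.ball (ρ (p x₀)) δ ×ˢ Metric.ball 0 δ ∧ e x₀ = (ρ (p x₀), 0) ∧
      MDifferentiableOn 𝓘(ℂ, Cn g) 𝓘(ℂ, Cn N) ψ (Metric.ball (ρ (p x₀)) δ) ∧
      (∀ u ∈ Metric.ball (ρ (p x₀)) δ, ψ u ∈ W ∧ ρ (ψ u) = u) ∧
      (∀ x ∈ e.source, (e x).1 = ρ (p x) ∧ p x = ψ (e x).1 ∧ g ≤ rk (2 * g) N p x) := by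
  set φ := chartAt (Cn (2 * g)) x₀
  set c := chartAt (Cn N) (p x₀)
  have hφx : φ.symm (φ x₀) = x₀ := φ.left_inv (mem_chart_source _ x₀)
  set s := repSet (2 * g) N p x₀ ∩ φ.symm ⁻¹' {x | g ≤ rk (2 * g) N p x}
  have hs : IsOpen s := by
    have h1 : IsOpen (φ.target ∩ φ.symm ⁻¹' {x | g ≤ rk (2 * g) N p x}) :=
      φ.continuousOn_symm.isOpen_inter_preimage φ.open_target (isOpen_le_rk hp g)
    have h2 : s = repSet (2 * g) N p x₀ ∩ (φ.target ∩ φ.symm ⁻¹' {x | g ≤ rk (2 * g) N p x}) := by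
      ext z
      constructor
      · rintro ⟨h1, h2⟩; exact ⟨h1, h1.1, h2⟩
      · rintro ⟨h1, h2⟩; exact ⟨h1, h2.2⟩
    rw [h2]
    exact (isOpen_repSet hp.continuous x₀).inter h1
  have hz : φ x₀ ∈ s := ⟨mem_repSet p x₀, by rw [mem_preimage, hφx]; exact h0⟩
  have hd := (differentiableOn_rep hp x₀).mono (inter_subset_left : s ⊆ _)
  obtain ⟨e, B, ψ, δ, hδ, hze, hes, htgt, hez, hfst, hed, hesd, hψ, hψe⟩ :=
    exists_constant_rank (K := Cn g) (r := g) hs hd hz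
      (fun x hx => by rw [finrank_rep hp x₀ hx.1]; exact hle _)
      (by rw [finrank_rep hp x₀ hz.1, hφx]; exact h0)
      (by simp; omega)
  have hrep0 : rep (2 * g) N p x₀ (φ x₀) = c (p x₀) := by simp [rep, φ, c]
  rw [hrep0] at htgt hez hψ
  set e' := φ.trans e
  have he' : ∀ x, e' x = e (φ x) := fun x => rfl
  have hsrc : ∀ x, x ∈ e'.source ↔ x ∈ φ.source ∧ φ x ∈ e.source := fun x => by
    simp [e', OpenPartialHomeomorph.trans_source]
  have htgt' : e'.target = e.target := by
    simp only [e', OpenPartialHomeomorph.trans_target]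
    refine inter_eq_left.2 fun y hy => ?_
    exact (hes (e.map_target hy)).1.1
  have hrepx : ∀ x ∈ e'.source, rep (2 * g) N p x₀ (φ x) = c (p x) ∧ p x ∈ c.source := by
    intro x hx
    have h1 := (hsrc x).1 hx
    have h2 := (hes h1.2).1.2
    rw [mem_preimage, φ.left_inv h1.1] at h2
    refine ⟨?_, h2⟩
    simp only [rep, Function.comp_apply]
    congr 2
    exact φ.left_inv h1.1
  have hψB : ∀ u ∈ Metric.ball (B (c (p x₀))) δ, ψ u ∈ c.target ∧ B (ψ u) = u := by
    intro u hu
    have hut : (u, (0 : Cn g)) ∈ e.target := by rw [htgt]; exact ⟨hu, Metric.mem_ball_self hδ⟩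
    have h1 := e.map_target hut
    have h2 := hψe _ h1
    have h3 := hfst _ h1
    rw [e.right_inv hut] at h2 h3
    have h4 := (hes h1).1
    refine ⟨?_, by rw [← h2, ← h3]⟩
    rw [← h2]
    exact c.map_source h4.2
  refine ⟨e', fun b => B (c b), c.source, fun u => c.symm (ψ u), δ, hδ, c.open_source, ?_, ?_, ?_,
    ?_, ?_, ?_, ?_, ?_⟩
  · exact B.differentiable.mdifferentiable.comp_mdifferentiableOn
      (chart_mdifferentiable (n := N) (p x₀)).1
  · exact (hsrc x₀).2 ⟨mem_chart_source _ x₀, hze⟩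
  · exact mdifferentiable_chart_trans x₀ e hed hesd
  · rw [htgt', htgt]
  · rw [he', hez]
  · exact (chart_mdifferentiable (n := N) (p x₀)).2.comp hψ.mdifferentiableOn fun u hu =>
      (hψB u hu).1
  · intro u hu
    refine ⟨c.map_target (hψB u hu).1, ?_⟩
    show B (c (c.symm (ψ u))) = u
    rw [c.right_inv (hψB u hu).1, (hψB u hu).2]
  · intro x hx
    obtain ⟨h1, h2⟩ := hrepx x hx
    have h3 := (hsrc x).1 hx
    refine ⟨?_, ?_, ?_⟩
    · rw [he', hfst _ h3.2, h1]
    · show p x = c.symm (ψ (e' x).1)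
      rw [he', ← hψe _ h3.2, h1, c.left_inv h2]
    · have := (hes h3.2).2
      rwa [mem_preimage, φ.left_inv h3.1] at this

omit [IsManifold 𝓘(ℂ, Cn (2 * g)) ω X] [IsManifold 𝓘(ℂ, Cn N) ω P]
  [ChartedSpace (Cn (2 * g)) X] [ChartedSpace (Cn N) P] in
theorem map_nhds_eq_of_local_structure {p : X → P} {e : OpenPartialHomeomorph X (Cn g × Cn g)}
    {ψ : Cn g → P} (he : ∀ x ∈ e.source, p x = ψ (e x).1) {x : X} (hx : x ∈ e.source) :
    map p (𝓝 x) = map ψ (𝓝 (e x).1) := by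
  have h1 : map p (𝓝 x) = map (fun x => ψ (e x).1) (𝓝 x) :=
    map_congr (by filter_upwards [e.open_source.mem_nhds hx] with y hy using he y hy)
  rw [h1, show (fun x => ψ (e x).1) = ψ ∘ Prod.fst ∘ e from rfl, ← map_map, ← map_map,
    e.map_nhds_eq hx, map_fst_nhds]

variable [T2Space P] [CompactSpace X]

/-- By the local structure, the image germ `map p (𝓝 x)` depends near a given point only on `ρ (p
x)`. It is therefore locally constant along the fiber, hence constant since the fiber is connected:
all points of the fiber produce the same branch of the range. Compactness of `X` shows that this
branch is a full neighborhood in the range. -/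
theorem nhdsWithin_range_eq_map {p : X → P}
    (hp : MDifferentiable 𝓘(ℂ, Cn (2 * g)) 𝓘(ℂ, Cn N) p)
    (hle : ∀ x, rk (2 * g) N p x ≤ g) {x₀ : X} (hconn : IsPreconnected (p ⁻¹' {p x₀}))
    (hfib : ∀ x, p x = p x₀ → g ≤ rk (2 * g) N p x) :
    𝓝[range p] (p x₀) = map p (𝓝 x₀) := by
  classical
  have hcont := hp.continuous
  have hconst : ∀ x, p x = p x₀ → map p (𝓝 x) = map p (𝓝 x₀) := by
    intro x hx
    have hc : ContinuousOn (fun y => decide (map p (𝓝 y) = map p (𝓝 x₀))) (p ⁻¹' {p x₀}) := by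
      intro y hy
      have hy' : p y = p x₀ := hy
      obtain ⟨e, ρ, W, ψ, δ, -, -, -, hye, -, -, -, -, -, hall⟩ :=
        exists_local_structure hp hle (hfib y hy)
      have hev : ∀ᶠ z in 𝓝[p ⁻¹' {p x₀}] y, decide (map p (𝓝 z) = map p (𝓝 x₀)) =
          decide (map p (𝓝 y) = map p (𝓝 x₀)) := by
        filter_upwards [mem_nhdsWithin_of_mem_nhds (e.open_source.mem_nhds hye),
          self_mem_nhdsWithin] with z hz hzf
        have hz' : p z = p x₀ := hzf
        rw [map_nhds_eq_of_local_structure (fun x hx => (hall x hx).2.1) hz,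
          map_nhds_eq_of_local_structure (fun x hx => (hall x hx).2.1) hye,
          (hall z hz).1, (hall y hye).1, hz', hy']
      exact (tendsto_const_nhds.congr' (hev.mono fun z hz => hz.symm))
    have := hconn.constant hc (show x ∈ p ⁻¹' {p x₀} from hx) (show x₀ ∈ p ⁻¹' {p x₀} from rfl)
    simpa using this
  refine le_antisymm ?_ ?_
  · intro S hS
    have hV : ∀ x, p x = p x₀ → p ⁻¹' S ∈ 𝓝 x := fun x hx => by
      have : S ∈ map p (𝓝 x) := by rw [hconst x hx]; exact hS
      exact this
    -- `p ⁻¹' S` is a neighborhood of the entire fiber, so the compact image of the complement of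
    -- its interior misses `p x₀`.
    have hclosed : IsClosed (p '' (interior (p ⁻¹' S))ᶜ) :=
      (isOpen_interior.isClosed_compl.isCompact.image hcont).isClosed
    refine mem_nhdsWithin.2 ⟨(p '' (interior (p ⁻¹' S))ᶜ)ᶜ, hclosed.isOpen_compl, ?_, ?_⟩
    · rintro ⟨x, hx, hxb⟩
      exact hx (mem_interior_iff_mem_nhds.2 (hV x hxb))
    · rintro _ ⟨hb, x, rfl⟩
      by_contra hxS
      exact hb ⟨x, fun h => hxS ((interior_subset : interior (p ⁻¹' S) ⊆ _) h), rfl⟩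
  · refine tendsto_nhdsWithin_of_tendsto_nhds_of_eventually_within _ (hcont.tendsto x₀) ?_
    exact Eventually.of_forall fun x => mem_range_self x

/-- A holomorphic chart of the set of regular values: a ball `D` in `ℂᵍ`, a parametrization `ψ` of
an open subset of the range of `p` by `D`, and a holomorphic retraction `ρ`, near the image of `ψ`. -/
structure BaseChart (N : ℕ) {P : Type*} [TopologicalSpace P] [ChartedSpace (Cn N) P] {X : Type*}
    [TopologicalSpace X] [ChartedSpace (Cn (2 * g)) X]
    (p : X → P) (c : Cn g) (δ : ℝ) (ψ : Cn g → P) (ρ : P → Cn g) (W : Set P) : Prop where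
  pos : 0 < δ
  isLocalParam : IsLocalParam N g (range p) (Metric.ball c δ) ψ
  subset_regular : ψ '' Metric.ball c δ ⊆ regularValues g N p
  isOpen_W : IsOpen W
  mdiff : MDifferentiableOn 𝓘(ℂ, Cn N) 𝓘(ℂ, Cn g) ρ W
  mem_W : ∀ u ∈ Metric.ball c δ, ψ u ∈ W
  left_inv : ∀ u ∈ Metric.ball c δ, ρ (ψ u) = u

omit [IsManifold 𝓘(ℂ, Cn (2 * g)) ω X] [IsManifold 𝓘(ℂ, Cn N) ω P] [T2Space P]
  [CompactSpace X] in
theorem isLocalParam_mono {d : ℕ} {S : Set P} {D D' : Set (Cn d)} {ψ : Cn d → P}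
    (h : IsLocalParam N d S D ψ) (hD : IsOpen D') (hsub : D' ⊆ D) : IsLocalParam N d S D' ψ :=
  ⟨hD, h.holomorphic.mono hsub, fun z hz => h.immersion z (hsub hz), h.injOn.mono hsub,
    fun D'' h1 h2 => h.isOpen_image D'' (h1.trans hsub) h2⟩

omit [IsManifold 𝓘(ℂ, Cn (2 * g)) ω X] [IsManifold 𝓘(ℂ, Cn N) ω P] [T2Space P]
  [CompactSpace X] in
theorem BaseChart.mono {p : X → P} {c : Cn g} {δ : ℝ} {ψ : Cn g → P} {ρ : P → Cn g} {W : Set P}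
    (h : BaseChart N p c δ ψ ρ W) {c' : Cn g} {δ' : ℝ} (hδ' : 0 < δ')
    (hsub : Metric.ball c' δ' ⊆ Metric.ball c δ) :
    BaseChart N p c' δ' ψ ρ W :=
  ⟨hδ', isLocalParam_mono h.isLocalParam Metric.isOpen_ball hsub,
    (image_mono hsub).trans h.subset_regular, h.isOpen_W, h.mdiff, fun u hu => h.mem_W u (hsub hu),
    fun u hu => h.left_inv u (hsub hu)⟩

theorem injective_mfderiv_of_leftInverse {m n : ℕ} {Y : Type*} [TopologicalSpace Y]
    [ChartedSpace (Cn n) Y] {ψ : Cn m → Y} {ρ : Y → Cn m} {z : Cn m}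
    (h1 : MDifferentiableAt 𝓘(ℂ, Cn m) 𝓘(ℂ, Cn n) ψ z)
    (h2 : MDifferentiableAt 𝓘(ℂ, Cn n) 𝓘(ℂ, Cn m) ρ (ψ z)) (h3 : ∀ᶠ w in 𝓝 z, ρ (ψ w) = w) :
    Function.Injective (holDeriv m n ψ z) := by
  have h4 := h2.hasMFDerivAt.comp z h1.hasMFDerivAt
  have h5 : HasMFDerivAt 𝓘(ℂ, Cn m) 𝓘(ℂ, Cn m) (ρ ∘ ψ) z (ContinuousLinearMap.id ℂ (Cn m)) :=
    (hasMFDerivAt_id z).congr_of_eventuallyEq h3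
  have h6 := hasMFDerivAt_unique h4 h5
  intro v w hvw
  have h7 := fun v => congrArg (fun T => T v) h6
  have hv := h7 v
  have hw := h7 w
  change (mfderiv 𝓘(ℂ, Cn n) 𝓘(ℂ, Cn m) ρ (ψ z)) (holDeriv m n ψ z v) = v at hv
  change (mfderiv 𝓘(ℂ, Cn n) 𝓘(ℂ, Cn m) ρ (ψ z)) (holDeriv m n ψ z w) = w at hw
  rw [← hv, ← hw, hvw]

theorem isCompact_image_crit {p : X → P} (hp : MDifferentiable 𝓘(ℂ, Cn (2 * g)) 𝓘(ℂ, Cn N) p) :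
    IsCompact (p '' {x | rk (2 * g) N p x < g}) := by
  refine IsCompact.image (IsClosed.isCompact ?_) hp.continuous
  have := (isOpen_le_rk hp g).isClosed_compl
  convert this using 1
  ext x
  simp

variable {p : X → P}

/-- Every point of the range of `p` which is not a critical value lies in a base chart. -/
theorem exists_baseChart (hp : MDifferentiable 𝓘(ℂ, Cn (2 * g)) 𝓘(ℂ, Cn N) p)
    (hconn : ∀ b ∈ range p, IsConnected (p ⁻¹' {b}))
    (hle : ∀ x, rk (2 * g) N p x ≤ g) {x₀ : X}
    (hfib : ∀ x, p x = p x₀ → g ≤ rk (2 * g) N p x) :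
    ∃ (c : Cn g) (δ : ℝ) (ψ : Cn g → P) (ρ : P → Cn g) (W : Set P),
      BaseChart N p c δ ψ ρ W ∧ ψ c = p x₀ := by
  obtain ⟨e, ρ, W, ψ, δ, hδ, hW, hρ, hxe, he, htgt, hex, hψ, hψW, hall⟩ :=
    exists_local_structure hp hle (hfib x₀ rfl)
  set c := ρ (p x₀)
  have hψc : ψ c = p x₀ := by
    have := (hall x₀ hxe).2.1
    rw [hex] at this
    exact this.symm
  have hcc : c ∈ Metric.ball c δ := Metric.mem_ball_self hδ
  -- The set of critical values is compact; a smaller ball avoids it, and then every value of `ψ`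
  -- satisfies the rank condition on its whole fiber.
  have hopen : IsOpen (Metric.ball c δ ∩ ψ ⁻¹' (p '' {x | rk (2 * g) N p x < g})ᶜ) :=
    hψ.continuousOn.isOpen_inter_preimage Metric.isOpen_ball
      (isCompact_image_crit hp).isClosed.isOpen_compl
  obtain ⟨δ', hδ', hsub⟩ := Metric.mem_nhds_iff.1 (hopen.mem_nhds (x := c) ⟨hcc, by
    rintro ⟨x, hx, hxb⟩
    rw [hψc] at hxb
    exact absurd (hfib x hxb) (not_le.2 hx)⟩)
  have hsub' : Metric.ball c δ' ⊆ Metric.ball c δ := fun u hu => (hsub hu).1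
  have hlift : ∀ u ∈ Metric.ball c δ, ∃ x ∈ e.source, e x = (u, 0) ∧ p x = ψ u := by
    intro u hu
    have hut : (u, (0 : Cn g)) ∈ e.target := by rw [htgt]; exact ⟨hu, Metric.mem_ball_self hδ⟩
    have h1 := e.map_target hut
    refine ⟨_, h1, e.right_inv hut, ?_⟩
    rw [(hall _ h1).2.1, e.right_inv hut]
  have hnh : ∀ u ∈ Metric.ball c δ', 𝓝[range p] (ψ u) = map ψ (𝓝 u) := by
    intro u hu
    obtain ⟨x, hx, hexu, hpx⟩ := hlift u (hsub' hu)
    have h1 := map_nhds_eq_of_local_structure (fun x hx => (hall x hx).2.1) hx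
    rw [hexu] at h1
    rw [← h1, ← hpx]
    refine nhdsWithin_range_eq_map hp hle (hconn _ (mem_range_self x)).isPreconnected
      fun y hy => ?_
    by_contra hlt
    exact (hsub hu).2 ⟨y, not_le.1 hlt, by rw [hy, hpx]⟩
  have hparam : IsLocalParam N g (range p) (Metric.ball c δ') ψ := by
    refine ⟨Metric.isOpen_ball, hψ.mono hsub', fun z hz => ?_, ?_, ?_⟩
    · refine injective_mfderiv_of_leftInverse (ρ := ρ)
        (hψ.mdifferentiableAt (Metric.isOpen_ball.mem_nhds (hsub' hz)))
        (hρ.mdifferentiableAt (hW.mem_nhds (hψW z (hsub' hz)).1)) ?_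
      filter_upwards [Metric.isOpen_ball.mem_nhds (hsub' hz)] with w hw using (hψW w hw).2
    · intro u hu v hv huv
      rw [← (hψW u (hsub' hu)).2, ← (hψW v (hsub' hv)).2, huv]
    · intro D' hD' hD'o
      have h1 : ∀ b ∈ ψ '' D', ∃ V, IsOpen V ∧ b ∈ V ∧ V ∩ range p ⊆ ψ '' D' := by
        rintro _ ⟨u, hu, rfl⟩
        have : ψ '' D' ∈ 𝓝[range p] (ψ u) := by
          rw [hnh u (hD' hu)]
          exact image_mem_map (hD'o.mem_nhds hu)
        obtain ⟨V, h1, h2, h3⟩ := mem_nhdsWithin.1 this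
        exact ⟨V, h1, h2, h3⟩
      choose! V hV hbV hVs using h1
      refine ⟨⋃ b ∈ ψ '' D', V b, isOpen_biUnion hV, ?_⟩
      ext b
      constructor
      · intro hb
        refine ⟨?_, mem_biUnion hb (hbV b hb)⟩
        obtain ⟨u, hu, rfl⟩ := hb
        obtain ⟨x, -, -, hpx⟩ := hlift u (hsub' (hD' hu))
        exact ⟨x, hpx⟩
      · rintro ⟨hbr, hb⟩
        obtain ⟨b', hb', hbb⟩ := mem_iUnion₂.1 hb
        exact hVs b' hb' ⟨hbb, hbr⟩
  refine ⟨c, δ', ψ, ρ, W, ⟨hδ', hparam, ?_, hW, hρ, fun u hu => (hψW u (hsub' hu)).1,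
    fun u hu => (hψW u (hsub' hu)).2⟩, hψc⟩
  rintro _ ⟨u, hu, rfl⟩
  refine ⟨⟨_, ψ, hparam, u, hu, rfl⟩, fun x hx => le_antisymm (hle x) ?_⟩
  by_contra hlt
  exact (hsub hu).2 ⟨x, not_le.1 hlt, hx⟩

omit [IsManifold 𝓘(ℂ, Cn (2 * g)) ω X] [IsManifold 𝓘(ℂ, Cn N) ω P] [T2Space P]
  [CompactSpace X] in
theorem regularValues_subset_range : regularValues g N p ⊆ range p := by
  rintro b ⟨⟨D, ψ, hψ, hb⟩, -⟩
  obtain ⟨V, -, hV⟩ := hψ.isOpen_image D subset_rfl hψ.isOpen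
  rw [hV] at hb
  exact hb.1

/-- The smoothness of `B` at `b`, required in the definition, follows from the rank condition along
the whole fiber. Thus `B°` is exactly the complement of the critical values in the range. -/
theorem mem_regularValues_iff (hp : MDifferentiable 𝓘(ℂ, Cn (2 * g)) 𝓘(ℂ, Cn N) p)
    (hconn : ∀ b ∈ range p, IsConnected (p ⁻¹' {b}))
    (hle : ∀ x, rk (2 * g) N p x ≤ g) {b : P} :
    b ∈ regularValues g N p ↔ b ∈ range p ∧ ∀ x, p x = b → g ≤ rk (2 * g) N p x := by
  constructor
  · intro hb
    exact ⟨regularValues_subset_range hb, fun x hx => (hb.2 x hx).ge⟩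
  · rintro ⟨⟨x₀, rfl⟩, hfib⟩
    obtain ⟨c, δ, ψ, ρ, W, h, hc⟩ := exists_baseChart hp hconn hle hfib
    exact h.subset_regular ⟨c, Metric.mem_ball_self h.pos, hc⟩

omit [IsManifold 𝓘(ℂ, Cn N) ω P] [T2Space P] in
theorem IsLocalParam.image_mem_nhdsWithin {d : ℕ} {S : Set P} {D : Set (Cn d)} {ψ : Cn d → P}
    (h : IsLocalParam N d S D ψ) {z : Cn d} (hz : z ∈ D) {D' : Set (Cn d)} (hD' : D' ∈ 𝓝 z) :
    ψ '' D' ∈ 𝓝[S] (ψ z) := by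
  obtain ⟨V, hV, hVe⟩ := h.isOpen_image (interior D' ∩ D) inter_subset_right
    (isOpen_interior.inter h.isOpen)
  have h1 : ψ z ∈ ψ '' (interior D' ∩ D) := ⟨z, ⟨mem_interior_iff_mem_nhds.2 hD', hz⟩, rfl⟩
  rw [hVe] at h1
  refine mem_nhdsWithin.2 ⟨V, hV, h1.2, ?_⟩
  rw [inter_comm, ← hVe]
  exact image_mono (inter_subset_left.trans interior_subset)

omit [T2Space P] in
/-- A local parametrization has local holomorphic left inverses. -/
theorem IsLocalParam.exists_leftInverse {d : ℕ} {S : Set P} {D : Set (Cn d)} {ψ : Cn d → P}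
    (h : IsLocalParam N d S D ψ) {z : Cn d} (hz : z ∈ D) :
    ∃ (ρ : P → Cn d) (W : Set P) (D₀ : Set (Cn d)), IsOpen W ∧ ψ z ∈ W ∧
      MDifferentiableOn 𝓘(ℂ, Cn N) 𝓘(ℂ, Cn d) ρ W ∧ IsOpen D₀ ∧ z ∈ D₀ ∧ D₀ ⊆ D ∧
      (∀ w ∈ D₀, ρ (ψ w) = w) ∧ ∀ b ∈ S ∩ W, ρ b ∈ D₀ ∧ ψ (ρ b) = b := by
  set c := chartAt (Cn N) (ψ z)
  set D₁ := D ∩ ψ ⁻¹' c.source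
  have hD₁ : IsOpen D₁ := h.holomorphic.continuousOn.isOpen_inter_preimage h.isOpen c.open_source
  have hz₁ : z ∈ D₁ := ⟨hz, mem_chart_source _ _⟩
  set f : Cn d → Cn N := c ∘ ψ
  have hfm : ∀ w ∈ D₁, HasMFDerivAt 𝓘(ℂ, Cn d) 𝓘(ℂ, Cn N) f w
      ((mfderiv 𝓘(ℂ, Cn N) 𝓘(ℂ, Cn N) c (ψ w)).comp (holDeriv d N ψ w)) := fun w hw =>
    ((chart_mdifferentiable (n := N) (ψ z)).mdifferentiableAt hw.2).hasMFDerivAt.comp w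
      (h.holomorphic.mdifferentiableAt (h.isOpen.mem_nhds hw.1)).hasMFDerivAt
  have hfd : DifferentiableOn ℂ f D₁ := fun w hw =>
    (hfm w hw).mdifferentiableAt.differentiableAt.differentiableWithinAt
  have hinj : Function.Injective (fderiv ℂ f z) := by
    have h1 := (hfm z hz₁).mfderiv
    rw [mfderiv_eq_fderiv] at h1
    rw [h1]
    exact ((chart_mdifferentiable (n := N) (ψ z)).mfderiv_injective hz₁.2).comp (h.immersion z hz)
  obtain ⟨B, hB⟩ := LinearMap.exists_leftInverse_of_injective (fderiv ℂ f z).toLinearMap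
    (LinearMap.ker_eq_bot.2 hinj)
  set B' : Cn N →L[ℂ] Cn d := LinearMap.toContinuousLinearMap B
  have hBf : DifferentiableOn ℂ (fun w => B' (f w)) D₁ :=
    B'.differentiable.comp_differentiableOn hfd
  obtain ⟨e, hze, hes, hef, hesymm⟩ := exists_holomorphic_inverse hD₁ hBf hz₁
    (ContinuousLinearEquiv.refl ℂ (Cn d)) (by
      have h1 := (B'.hasFDerivAt.comp z (hfd.differentiableAt (hD₁.mem_nhds hz₁)).hasFDerivAt)
      rw [HasFDerivAt.fderiv (f := fun w => B' (f w)) h1]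
      ext1 v
      exact (LinearMap.congr_fun hB v).symm)
  obtain ⟨V, hV, hVe⟩ := h.isOpen_image e.source (hes.trans inter_subset_left) e.open_source
  set W := (c.source ∩ (fun b => B' (c b)) ⁻¹' e.target) ∩ V
  have hW : IsOpen W := by
    refine IsOpen.inter ?_ hV
    exact (B'.continuous.comp_continuousOn c.continuousOn).isOpen_inter_preimage c.open_source
      e.open_target
  have hleft : ∀ w ∈ e.source, e.symm (B' (c (ψ w))) = w := fun w hw => by
    have h1 := hef w hw
    have h2 := e.left_inv hw
    rwa [h1] at h2
  have hmem : ∀ w ∈ e.source, ψ w ∈ W := fun w hw => by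
    have h1 : ψ w ∈ ψ '' e.source := ⟨w, hw, rfl⟩
    rw [hVe] at h1
    refine ⟨⟨(hes hw).2, ?_⟩, h1.2⟩
    have h2 := e.map_source hw
    rwa [hef w hw] at h2
  refine ⟨fun b => e.symm (B' (c b)), W, e.source, hW, hmem z hze, ?_, e.open_source, hze,
    hes.trans inter_subset_left, hleft, ?_⟩
  · have h1 : MDifferentiableOn 𝓘(ℂ, Cn N) 𝓘(ℂ, Cn d) (fun b => B' (c b)) W :=
      B'.differentiable.mdifferentiable.comp_mdifferentiableOn
        ((chart_mdifferentiable (n := N) (ψ z)).1.mono fun b hb => hb.1.1)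
    exact hesymm.mdifferentiableOn.comp h1 fun b hb => hb.1.2
  · rintro b ⟨hbS, hbW⟩
    have h1 : b ∈ ψ '' e.source := by rw [hVe]; exact ⟨hbS, hbW.2⟩
    obtain ⟨w, hw, rfl⟩ := h1
    simp only [hleft w hw]
    exact ⟨hw, trivial⟩

theorem finrank_range_comp_le_left {V₁ V₂ V₃ : Type*} [AddCommGroup V₁] [Module ℂ V₁]
    [AddCommGroup V₂] [Module ℂ V₂] [AddCommGroup V₃] [Module ℂ V₃] [FiniteDimensional ℂ V₂]
    (A : V₂ →ₗ[ℂ] V₃) (L : V₁ →ₗ[ℂ] V₂) :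
    Module.finrank ℂ (LinearMap.range (A ∘ₗ L)) ≤ Module.finrank ℂ (LinearMap.range L) := by
  rw [LinearMap.range_comp]
  exact Submodule.finrank_map_le A _

theorem finrank_range_comp_le_right {V₁ V₂ V₃ : Type*} [AddCommGroup V₁] [Module ℂ V₁]
    [AddCommGroup V₂] [Module ℂ V₂] [AddCommGroup V₃] [Module ℂ V₃] [FiniteDimensional ℂ V₃]
    (A : V₂ →ₗ[ℂ] V₃) (L : V₁ →ₗ[ℂ] V₂) :
    Module.finrank ℂ (LinearMap.range (A ∘ₗ L)) ≤ Module.finrank ℂ (LinearMap.range A) :=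
  Submodule.finrank_mono (LinearMap.range_comp_le_range _ _)

-- Near a point where `B` is smooth of dimension `g`, the map `p` factors through an open subset of
-- `ℂᵍ`, so its rank is at most `g` on a non-empty open set; the identity theorem for the rank
-- extends this to `X`.
omit [T2Space P] [CompactSpace X] in
theorem rk_le_of_mem_regularValues [ConnectedSpace X]
    (hp : MDifferentiable 𝓘(ℂ, Cn (2 * g)) 𝓘(ℂ, Cn N) p)
    {b : P} (hb : b ∈ regularValues g N p) (x : X) : rk (2 * g) N p x ≤ g := by
  obtain ⟨x₀, rfl⟩ := regularValues_subset_range hb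
  obtain ⟨⟨D, ψ, hψ, z, hz, hzb⟩, -⟩ := hb
  obtain ⟨ρ, W, D₀, hW, hzW, hρ, hD₀, hz₀, hD₀D, -, hright⟩ := hψ.exists_leftInverse hz
  have hev : ∀ᶠ y in 𝓝 x₀, rk (2 * g) N p y < g + 1 := by
    have hpW : IsOpen (p ⁻¹' W) := hW.preimage hp.continuous
    filter_upwards [hpW.mem_nhds (show p x₀ ∈ W by rwa [← hzb])] with y hy
    have h1 : MDifferentiableAt 𝓘(ℂ, Cn (2 * g)) 𝓘(ℂ, Cn g) (ρ ∘ p) y :=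
      (hρ.mdifferentiableAt (hW.mem_nhds hy)).comp y (hp y)
    have h2 : MDifferentiableAt 𝓘(ℂ, Cn g) 𝓘(ℂ, Cn N) ψ ((ρ ∘ p) y) :=
      hψ.holomorphic.mdifferentiableAt
        (hψ.isOpen.mem_nhds (hD₀D (hright (p y) ⟨mem_range_self y, hy⟩).1))
    have h3 : HasMFDerivAt 𝓘(ℂ, Cn (2 * g)) 𝓘(ℂ, Cn N) p y _ :=
      (h2.hasMFDerivAt.comp y h1.hasMFDerivAt).congr_of_eventuallyEq (by
        filter_upwards [hpW.mem_nhds hy] with w hw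
        exact (hright (p w) ⟨mem_range_self w, hw⟩).2.symm)
    have h4 : Module.finrank ℂ (LinearMap.range (holDeriv (2 * g) N p y).toLinearMap) ≤
        Module.finrank ℂ (Cn g) := by
      have h5 := h3.mfderiv
      rw [holDeriv, h5]
      exact (finrank_range_comp_le_left (V₂ := TX g ((ρ ∘ p) y))
        (mfderiv 𝓘(ℂ, Cn g) 𝓘(ℂ, Cn N) ψ ((ρ ∘ p) y)).toLinearMap
        (mfderiv 𝓘(ℂ, Cn (2 * g)) 𝓘(ℂ, Cn g) (ρ ∘ p) y).toLinearMap).trans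
        (Submodule.finrank_le _)
    rw [Module.finrank_fin_fun] at h4
    exact Nat.lt_succ_of_le h4
  exact Nat.lt_succ_iff.1 (rk_lt_of_eventually hp hev x)

-- In charts the critical set is the common zero set of the minors of size `g`, and there `ρ ∘ p`
-- has rank at most `g - 1`: `imagesThin` applies.
omit [T2Space P] [CompactSpace X] in
theorem thin_image_crit [SecondCountableTopology X] (hg : 1 ≤ g)
    (hp : MDifferentiable 𝓘(ℂ, Cn (2 * g)) 𝓘(ℂ, Cn N) p) {ρ : P → Cn g} {W : Set P}
    (hW : IsOpen W) (hρ : MDifferentiableOn 𝓘(ℂ, Cn N) 𝓘(ℂ, Cn g) ρ W) :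
    Thin (g - 1) ((ρ ∘ p) '' ({x | rk (2 * g) N p x < g} ∩ p ⁻¹' W)) := by
  refine Thin.image_of_locally fun y ⟨hy, hyW⟩ => ?_
  set φ := chartAt (Cn (2 * g)) y
  set c := chartAt (Cn N) (p y)
  set Ω := repSet (2 * g) N p y ∩ φ.symm ⁻¹' (p ⁻¹' W)
  have hΩ : IsOpen Ω := by
    have h1 : IsOpen (φ.target ∩ φ.symm ⁻¹' (p ⁻¹' W)) :=
      φ.continuousOn_symm.isOpen_inter_preimage φ.open_target (hW.preimage hp.continuous)
    have h2 : Ω = repSet (2 * g) N p y ∩ (φ.target ∩ φ.symm ⁻¹' (p ⁻¹' W)) := by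
      ext z
      constructor
      · rintro ⟨h1, h2⟩; exact ⟨h1, h1.1, h2⟩
      · rintro ⟨h1, h2⟩; exact ⟨h1, h2.2⟩
    rw [h2]
    exact (isOpen_repSet hp.continuous y).inter h1
  have hm : ∀ z ∈ Ω, HasMFDerivAt 𝓘(ℂ, Cn (2 * g)) 𝓘(ℂ, Cn g) (ρ ∘ p ∘ φ.symm) z _ := fun z hz =>
    (hρ.mdifferentiableAt (hW.mem_nhds hz.2)).hasMFDerivAt.comp z ((hp (φ.symm z)).hasMFDerivAt.comp z
      ((chart_mdifferentiable (n := 2 * g) y).mdifferentiableAt_symm hz.1.1).hasMFDerivAt)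
  refine ⟨φ.source ∩ p ⁻¹' (c.source ∩ W), ?_, ?_⟩
  · refine inter_mem (φ.open_source.mem_nhds (mem_chart_source _ y)) ?_
    exact ((c.open_source.inter hW).preimage hp.continuous).mem_nhds ⟨mem_chart_source _ _, hyW⟩
  refine (imagesThin (2 * g) (g - 1) Ω (ρ ∘ p ∘ φ.symm) (minors (rep (2 * g) N p y) g) hΩ
    (fun z hz => (hm z hz).mdifferentiableAt.differentiableAt.differentiableWithinAt)
    (fun χ hχ => differentiableOn_of_mem_minors hΩ ((differentiableOn_rep hp y).mono
      inter_subset_left) hχ) ?_).mono ?_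
  · intro z hz h0
    rw [forall_minors_eq_zero_iff, finrank_rep hp y hz.1] at h0
    have h1 := (hm z hz).mfderiv
    rw [mfderiv_eq_fderiv] at h1
    rw [h1]
    refine le_trans ?_ (Nat.le_sub_one_of_lt h0)
    refine le_trans (finrank_range_comp_le_left (V₂ := TX N (p (φ.symm z)))
      (mfderiv 𝓘(ℂ, Cn N) 𝓘(ℂ, Cn g) ρ (p (φ.symm z))).toLinearMap _) ?_
    exact finrank_range_comp_le_right (holDeriv (2 * g) N p (φ.symm z)).toLinearMap _
  · rintro _ ⟨x, ⟨⟨hx, -⟩, hxs, hxc, hxW⟩, rfl⟩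
    have hxx : φ.symm (φ x) = x := φ.left_inv hxs
    have hxΩ : φ x ∈ Ω := by
      refine ⟨⟨φ.map_source hxs, ?_⟩, ?_⟩
      · rw [mem_preimage, hxx]; exact hxc
      · rw [mem_preimage, hxx]; exact hxW
    refine ⟨φ x, ⟨hxΩ, ?_⟩, by simp [hxx]⟩
    rw [forall_minors_eq_zero_iff, finrank_rep hp y hxΩ.1, hxx]
    exact hx

/-- The set of regular values is connected. -/
theorem isPreconnected_regularValues [SecondCountableTopology X] [ConnectedSpace X] (hg : 1 ≤ g)
    (hp : MDifferentiable 𝓘(ℂ, Cn (2 * g)) 𝓘(ℂ, Cn N) p)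
    (hconn : ∀ b ∈ range p, IsConnected (p ⁻¹' {b})) :
    IsPreconnected (regularValues g N p) := by
  rcases (regularValues g N p).eq_empty_or_nonempty with h0 | ⟨b, hb⟩
  · rw [h0]; exact isPreconnected_empty
  have hle := rk_le_of_mem_regularValues hp hb
  obtain ⟨x₀, rfl⟩ := regularValues_subset_range hb
  have hx₀ : g ≤ rk (2 * g) N p x₀ := ((mem_regularValues_iff hp hconn hle).1 hb).2 x₀ rfl
  set Y := {x | g ≤ rk (2 * g) N p x}
  set C := {x | rk (2 * g) N p x < g}
  have hY : IsPreconnected Y := isPreconnected_le_rk (by omega) hp hx₀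
  -- `B°` is the image of the set of points of maximal rank, deprived of the fibers over critical
  -- values. It suffices to see that removing these fibers does not disconnect this set.
  have hreg : regularValues g N p = p '' (Y \ p ⁻¹' (p '' C)) := by
    ext b
    rw [mem_regularValues_iff hp hconn hle]
    constructor
    · rintro ⟨⟨x, rfl⟩, h⟩
      refine ⟨x, ⟨h x rfl, ?_⟩, rfl⟩
      rintro ⟨y, hy, hyx⟩
      exact absurd (h y hyx) (not_le.2 hy)
    · rintro ⟨x, ⟨-, hx⟩, rfl⟩
      refine ⟨mem_range_self x, fun y hy => ?_⟩
      by_contra hlt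
      exact hx ⟨y, not_le.1 hlt, hy⟩
  -- In the coordinates of the local structure the removed set is a product: membership depends only
  -- on the first coordinate, which then lies in a thin set `K`.
  have hloc : ∀ y ∈ Y, ∃ e : OpenPartialHomeomorph X (Cn g × Cn g), ∃ δ : ℝ, ∃ c : Cn g,
      ∃ K : Set (Cn g), y ∈ e.source ∧ e.source ⊆ Y ∧
      e.target = Metric.ball c δ ×ˢ Metric.ball 0 δ ∧ Thin (g - 1) K ∧
      ∀ x ∈ e.source, x ∈ p ⁻¹' (p '' C) → (e x).1 ∈ K ∧
        ∀ x' ∈ e.source, (e x').1 = (e x).1 → x' ∈ p ⁻¹' (p '' C) := by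
    intro y hy
    obtain ⟨e, ρ, W, ψ, δ, hδ, hW, hρ, hxe, he, htgt, hex, hψ, hψW, hall⟩ :=
      exists_local_structure hp hle hy
    refine ⟨e, δ, _, _, hxe, fun x hx => (hall x hx).2.2, htgt, thin_image_crit hg hp hW hρ, ?_⟩
    rintro x hx ⟨y', hy', hyx⟩
    have hu : (e x).1 ∈ Metric.ball (ρ (p y)) δ := by
      have := e.map_source hx
      rw [htgt] at this
      exact this.1
    refine ⟨⟨y', ⟨hy', ?_⟩, ?_⟩, fun x' hx' h => ⟨y', hy', ?_⟩⟩
    · show p y' ∈ W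
      rw [hyx, (hall x hx).2.1]
      exact (hψW _ hu).1
    · show ρ (p y') = _
      rw [hyx, (hall x hx).1]
    · rw [hyx, (hall x hx).2.1, (hall x' hx').2.1, h]
  rw [hreg]
  refine IsPreconnected.image ?_ p hp.continuous.continuousOn
  refine isPreconnected_diff_of_locally hY (fun y hy => ?_) fun y hy => ?_
  · obtain ⟨e, δ, c, K, hye, heY, htgt, hK, hKe⟩ := hloc y hy
    refine ⟨e.source, heY, mem_nhdsWithin_of_mem_nhds (e.open_source.mem_nhds hye), ?_⟩
    set K' := {u | ∃ x ∈ e.source, x ∈ p ⁻¹' (p '' C) ∧ (e x).1 = u}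
    have hK' : Thin (g - 1) K' := hK.mono (by
      rintro u ⟨x, hx, hxC, rfl⟩
      exact (hKe x hx hxC).1)
    have h1 : e.source \ p ⁻¹' (p '' C) =
        e.symm '' ((Metric.ball c δ \ K') ×ˢ Metric.ball 0 δ) := by
      ext x
      constructor
      · rintro ⟨hx, hxC⟩
        refine ⟨e x, ?_, e.left_inv hx⟩
        have h2 := e.map_source hx
        rw [htgt] at h2
        refine ⟨⟨h2.1, ?_⟩, h2.2⟩
        rintro ⟨x', hx', hxC', h3⟩
        exact hxC ((hKe x' hx' hxC').2 x hx h3.symm)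
      · rintro ⟨v, ⟨⟨hv1, hv2⟩, hv3⟩, rfl⟩
        have hv : v ∈ e.target := by rw [htgt]; exact ⟨hv1, hv3⟩
        refine ⟨e.map_target hv, fun hC => hv2 ⟨_, e.map_target hv, hC, ?_⟩⟩
        rw [e.right_inv hv]
    rw [h1]
    refine IsPreconnected.image ?_ _ (e.continuousOn_symm.mono ?_)
    · exact (hK'.isPreconnected_diff (by omega) Metric.isOpen_ball (convex_ball _ _)).prod
        (convex_ball _ _).isPreconnected
    · rw [htgt]
      exact prod_mono_left diff_subset
  · obtain ⟨e, δ, c, K, hye, heY, htgt, hK, hKe⟩ := hloc y hy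
    rw [mem_closure_iff]
    intro V hV hyV
    have h1 : e '' (e.source ∩ V) ∈ 𝓝 (e y) :=
      e.image_mem_nhds hye (inter_mem (e.open_source.mem_nhds hye) (hV.mem_nhds hyV))
    rw [nhds_prod_eq, mem_prod_iff] at h1
    obtain ⟨t₁, ht₁, t₂, ht₂, hsub⟩ := h1
    obtain ⟨u, huK, hu⟩ := ((hK.dense_compl (by omega)).inter_nhds_nonempty ht₁)
    obtain ⟨x, ⟨hxe, hxV⟩, hxu⟩ := hsub (show (u, (e y).2) ∈ t₁ ×ˢ t₂ from
      ⟨hu, mem_of_mem_nhds ht₂⟩)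
    refine ⟨x, hxV, heY hxe, fun hxC => huK ?_⟩
    have := (hKe x hxe hxC).1
    rwa [hxu] at this

end RegularValues

end LagrangianFibration

namespace LagrangianFibration

/-! ### Two-forms evaluated on pairs, and differentials of maps to and from vector spaces -/

section Pairing

variable {𝕜 V G : Type*} [NontriviallyNormedField 𝕜] [AddCommGroup V] [Module 𝕜 V]
  [TopologicalSpace V] [AddCommGroup G] [Module 𝕜 G] [TopologicalSpace G]

theorem pair_add_left (η : V [⋀^Fin 2]→L[𝕜] G) (a b c : V) :
    η ![a + b, c] = η ![a, c] + η ![b, c] := by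
  have := η.toMultilinearMap.cons_add ![c] a b
  exact this

theorem pair_smul_left (η : V [⋀^Fin 2]→L[𝕜] G) (k : 𝕜) (a c : V) :
    η ![k • a, c] = k • η ![a, c] := by
  have := η.toMultilinearMap.cons_smul ![c] k a
  exact this

theorem pair_swap (η : V [⋀^Fin 2]→L[𝕜] G) (a b : V) : η ![a, b] = -η ![b, a] := by
  have h := η.toAlternatingMap.map_swap ![a, b] (i := 0) (j := 1) (by decide)
  have h2 : (![a, b] ∘ Equiv.swap (0 : Fin 2) 1 : Fin 2 → V) = ![b, a] := by
    ext i; fin_cases i <;> simp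
  rw [h2] at h
  exact (neg_eq_iff_eq_neg.2 h).symm

theorem pair_add_right (η : V [⋀^Fin 2]→L[𝕜] G) (a b c : V) :
    η ![c, a + b] = η ![c, a] + η ![c, b] := by
  rw [pair_swap, pair_add_left, pair_swap η c a, pair_swap η c b, neg_add]

theorem pair_smul_right (η : V [⋀^Fin 2]→L[𝕜] G) (k : 𝕜) (a c : V) :
    η ![c, k • a] = k • η ![c, a] := by
  rw [pair_swap, pair_smul_left, pair_swap η c a, smul_neg]

theorem pair_sum_right {ι : Type*} (s : Finset ι) (η : V [⋀^Fin 2]→L[𝕜] G) (a : ι → V) (c : V) :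
    η ![c, ∑ i ∈ s, a i] = ∑ i ∈ s, η ![c, a i] := by
  classical
  induction s using Finset.induction_on with
  | empty => simpa using pair_smul_right η 0 0 c
  | insert i s hi ih => rw [Finset.sum_insert hi, Finset.sum_insert hi, pair_add_right, ih]

end Pairing

section Derivatives

variable {n : ℕ} {X : Type*} [TopologicalSpace X] [ChartedSpace (Cn n) X]
  {V W : Type} [NormedAddCommGroup V] [NormedSpace ℂ V] [NormedAddCommGroup W] [NormedSpace ℂ W]

/-- The differential of a function on a manifold, with values in a vector space. -/
noncomputable def vderiv (n : ℕ) {X : Type*} [TopologicalSpace X] [ChartedSpace (Cn n) X]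
    (e : X → V) (x : X) : TX n x →L[ℂ] V :=
  mfderiv 𝓘(ℂ, Cn n) 𝓘(ℂ, V) e x

/-- The differential of a map from a vector space to a manifold. -/
noncomputable def pderiv (n : ℕ) {X : Type*} [TopologicalSpace X] [ChartedSpace (Cn n) X]
    (H : W → X) (w : W) : W →L[ℂ] TX n (H w) :=
  mfderiv 𝓘(ℂ, W) 𝓘(ℂ, Cn n) H w

theorem hasFDerivAt_comp {e : X → V} {H : W → X} {w : W}
    (he : MDifferentiableAt 𝓘(ℂ, Cn n) 𝓘(ℂ, V) e (H w))
    (hH : MDifferentiableAt 𝓘(ℂ, W) 𝓘(ℂ, Cn n) H w) :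
    HasFDerivAt (fun w => e (H w)) ((vderiv n e (H w)).comp (pderiv n H w)) w :=
  (he.hasMFDerivAt.comp w hH.hasMFDerivAt).hasFDerivAt

theorem pderiv_comp {H : V → X} {k : W → V} {w : W} {k' : W →L[ℂ] V}
    (hH : MDifferentiableAt 𝓘(ℂ, V) 𝓘(ℂ, Cn n) H (k w)) (hk : HasFDerivAt k k' w) :
    pderiv n (fun w => H (k w)) w = (pderiv n H (k w)).comp k' :=
  (hH.hasMFDerivAt.comp w hk.hasMFDerivAt).mfderiv

theorem vderiv_symm_pderiv (e : OpenPartialHomeomorph X V)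
    (he : e.MDifferentiable 𝓘(ℂ, Cn n) 𝓘(ℂ, V)) {y : V} (hy : y ∈ e.target) (b : V) :
    vderiv n e (e.symm y) (pderiv n e.symm y b) = b := by
  have h := hasFDerivAt_comp (n := n) (e := e) (H := e.symm) (w := y)
    (he.mdifferentiableAt (e.map_target hy)) (he.mdifferentiableAt_symm hy)
  have h2 : HasFDerivAt (fun w => e (e.symm w)) (ContinuousLinearMap.id ℂ V) y :=
    (hasFDerivAt_id y).congr_of_eventuallyEq (by
      filter_upwards [e.open_target.mem_nhds hy] with w hw using e.right_inv hw)
  exact congrArg (fun T => T b) (h.unique h2)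

theorem vderiv_injective (e : OpenPartialHomeomorph X V)
    (he : e.MDifferentiable 𝓘(ℂ, Cn n) 𝓘(ℂ, V)) {x : X} (hx : x ∈ e.source) :
    Function.Injective (vderiv n e x) := he.mfderiv_injective hx

end Derivatives

/-! ### The symplectic form on vertical vectors -/

section Theta

variable {g : ℕ} {X : Type*} [TopologicalSpace X] [ChartedSpace (Cn (2 * g)) X]
  {W : Type} [NormedAddCommGroup W] [NormedSpace ℂ W]

/-- A holomorphic submersion `q : O → D`, the fibres of which are Lagrangian complex tori. -/
structure IsTorusFibration (σ : ∀ x : X, TX (2 * g) x [⋀^Fin 2]→L[ℂ] ℂ) (O : Set X)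
    (D : Set (Cn g)) (q : X → Cn g) : Prop where
  isOpen : IsOpen O
  isOpen_base : IsOpen D
  mdiff : MDifferentiableOn 𝓘(ℂ, Cn (2 * g)) 𝓘(ℂ, Cn g) q O
  mapsTo : MapsTo q O D
  submersion : ∀ x ∈ O, Function.Surjective (vderiv (2 * g) q x)
  torus : ∀ u ∈ D, IsComplexTorus g (O ∩ q ⁻¹' {u})
  lagrangian : ∀ x ∈ O, ∀ v w, vderiv (2 * g) q x v = 0 → vderiv (2 * g) q x w = 0 →
    σ x ![v, w] = 0

/-- The isomorphism from the vertical tangent space to the dual of the tangent space of the base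
given by the symplectic form. -/
noncomputable def theta (σ : ∀ x : X, TX (2 * g) x [⋀^Fin 2]→L[ℂ] ℂ) (q : X → Cn g) (x : X) :
    TX (2 * g) x →ₗ[ℂ] Cn g where
  toFun v i := σ x ![v, Function.invFun (vderiv (2 * g) q x) (Pi.single i 1)]
  map_add' a b := by ext i; exact pair_add_left _ _ _ _
  map_smul' a b := by ext i; exact pair_smul_left _ _ _ _

/-- The pull-back of `theta` by a map. -/
noncomputable def pullTheta (σ : ∀ x : X, TX (2 * g) x [⋀^Fin 2]→L[ℂ] ℂ) (q : X → Cn g)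
    (H : W → X) (w : W) : W →ₗ[ℂ] Cn g :=
  theta σ q (H w) ∘ₗ (pderiv (2 * g) H w).toLinearMap

theorem pullTheta_apply (σ : ∀ x : X, TX (2 * g) x [⋀^Fin 2]→L[ℂ] ℂ) (q : X → Cn g)
    (H : W → X) (w a : W) :
    pullTheta σ q H w a = theta σ q (H w) (pderiv (2 * g) H w a) := rfl

variable {σ : ∀ x : X, TX (2 * g) x [⋀^Fin 2]→L[ℂ] ℂ} {O : Set X} {D : Set (Cn g)} {q : X → Cn g}

theorem pullTheta_comp {V : Type} [NormedAddCommGroup V] [NormedSpace ℂ V] {H : V → X} {k : W → V}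
    {w : W} {k' : W →L[ℂ] V}
    (hH : MDifferentiableAt 𝓘(ℂ, V) 𝓘(ℂ, Cn (2 * g)) H (k w)) (hk : HasFDerivAt k k' w) (a : W) :
    pullTheta σ q (fun w => H (k w)) w a = pullTheta σ q H (k w) (k' a) := by
  rw [pullTheta_apply, pderiv_comp hH hk]
  rfl

/-- The choice of the lift of a basis vector is irrelevant: two lifts differ by a vertical vector,
and `σ` vanishes on pairs of vertical vectors. -/
theorem IsTorusFibration.theta_eq (T : IsTorusFibration σ O D q) {x : X} (hx : x ∈ O)
    {v : TX (2 * g) x} (hv : vderiv (2 * g) q x v = 0) {i : Fin g} {w : TX (2 * g) x}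
    (hw : vderiv (2 * g) q x w = Pi.single i 1) : theta σ q x v i = σ x ![v, w] := by
  set r := Function.invFun (vderiv (2 * g) q x) (Pi.single i 1)
  have hr : vderiv (2 * g) q x r = Pi.single i 1 :=
    Function.invFun_eq (T.submersion x hx _)
  have h1 : w = r + (w - r) := by abel
  have h2 := T.lagrangian x hx v (w - r) hv (by rw [map_sub, hw, hr, sub_self])
  rw [h1, pair_add_right, h2, add_zero]
  rfl

/-- A vertical vector in the kernel of `theta` is orthogonal to lifts of a basis of the base and,
the fibers being Lagrangian, to vertical vectors, hence to everything; `σ` is non-degenerate. -/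
theorem IsTorusFibration.eq_zero_of_theta (T : IsTorusFibration σ O D q)
    (hσ : IsHolomorphicSymplectic σ) {x : X} (hx : x ∈ O)
    {v : TX (2 * g) x} (hv : vderiv (2 * g) q x v = 0) (h0 : theta σ q x v = 0) : v = 0 := by
  by_contra hne
  obtain ⟨w, hw⟩ := hσ.nondegenerate x v hne
  set r : Fin g → TX (2 * g) x := fun i => Function.invFun (vderiv (2 * g) q x) (Pi.single i 1)
  have hr : ∀ i, vderiv (2 * g) q x (r i) = Pi.single i 1 := fun i =>
    Function.invFun_eq (T.submersion x hx _)
  set w' := ∑ i, (vderiv (2 * g) q x w) i • r i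
  have hw' : vderiv (2 * g) q x w' = vderiv (2 * g) q x w := by
    simp only [w', map_sum, map_smul, hr]
    ext j
    simp [Finset.sum_apply, Pi.single_apply]
  have h1 : σ x ![v, w'] = 0 := by
    rw [pair_sum_right]
    refine Finset.sum_eq_zero fun i _ => ?_
    rw [pair_smul_right, ← T.theta_eq hx hv (hr i), h0]
    simp
  have h2 := T.lagrangian x hx v (w - w') hv (by rw [map_sub, hw', sub_self])
  have h3 : w = w' + (w - w') := by abel
  exact hw (by rw [h3, pair_add_right, h1, h2, add_zero])

end Theta

end LagrangianFibration

namespace LagrangianFibration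

/-! ### Coordinates adapted to the fibration -/

section Charts

variable {g : ℕ} {X : Type*} [TopologicalSpace X] [ChartedSpace (Cn (2 * g)) X]
  [IsManifold 𝓘(ℂ, Cn (2 * g)) ω X]
  {W : Type} [NormedAddCommGroup W] [NormedSpace ℂ W]
  {σ : ∀ x : X, TX (2 * g) x [⋀^Fin 2]→L[ℂ] ℂ} {O : Set X} {D : Set (Cn g)} {q : X → Cn g}

theorem differentiableOn_pullback_form {n : ℕ} {Y : Type*} [TopologicalSpace Y]
    [ChartedSpace (Cn n) Y] [IsManifold 𝓘(ℂ, Cn n) ω Y]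
    {τ : ∀ x : Y, TX n x [⋀^Fin 2]→L[ℂ] ℂ} {V : Type} [NormedAddCommGroup V] [NormedSpace ℂ V]
    [FiniteDimensional ℂ V]
    (hτ : ∀ φ ∈ atlas (Cn n) Y, DifferentiableOn ℂ (holFormInChart τ φ) φ.target) (x₀ : Y)
    {S : Set V} (hS : IsOpen S) {K : V → Cn n} (hK : DifferentiableOn ℂ K S)
    (hKS : MapsTo K S (chartAt (Cn n) x₀).target) (a b : V) :
    DifferentiableOn ℂ (fun y => τ ((chartAt (Cn n) x₀).symm (K y))
      ![pderiv n (fun y => (chartAt (Cn n) x₀).symm (K y)) y a,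
        pderiv n (fun y => (chartAt (Cn n) x₀).symm (K y)) y b]) S := by
  set φ := chartAt (Cn n) x₀
  have h1 : DifferentiableOn ℂ (fun y => holFormInChart τ φ (K y)) S :=
    (hτ φ (chart_mem_atlas _ _)).comp hK hKS
  have h2 : ∀ i, DifferentiableOn ℂ
      ((![fun y => fderiv ℂ K y a, fun y => fderiv ℂ K y b] : Fin 2 → V → Cn n) i) S := by
    intro i
    fin_cases i
    · exact differentiableOn_fderiv_apply hS hK a
    · exact differentiableOn_fderiv_apply hS hK b
  refine (h1.continuousAlternatingMap_apply h2).congr fun y hy => ?_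
  have h3 := pderiv_comp (n := n) (H := φ.symm) (k := K) (w := y)
    ((chart_mdifferentiable x₀).mdifferentiableAt_symm (hKS hy))
    (hK.differentiableAt (hS.mem_nhds hy)).hasFDerivAt
  rw [h3]
  refine congrArg (τ (φ.symm (K y))) (funext fun i => ?_)
  fin_cases i <;> rfl

/-- A submersion is a projection in suitable coordinates, in which `theta` is holomorphic. -/
theorem IsTorusFibration.exists_vertical_chart (T : IsTorusFibration σ O D q)
    (hσ : IsHolomorphicSymplectic σ) {x₀ : X} (hx₀ : x₀ ∈ O) :
    ∃ (e : OpenPartialHomeomorph X (Cn g × Cn g)) (r : ℝ) (c : Fin g → Cn g × Cn g → Cn g),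
      0 < r ∧ x₀ ∈ e.source ∧ e.source ⊆ O ∧ e.MDifferentiable 𝓘(ℂ, Cn (2 * g)) 𝓘(ℂ, Cn g × Cn g) ∧
      e.target = Metric.ball (q x₀) r ×ˢ Metric.ball 0 r ∧ e x₀ = (q x₀, 0) ∧
      (∀ x ∈ e.source, (e x).1 = q x) ∧ (∀ j, DifferentiableOn ℂ (c j) e.target) ∧
      ∀ x ∈ e.source, ∀ v, vderiv (2 * g) q x v = 0 →
        theta σ q x v = ∑ j, (vderiv (2 * g) e x v).2 j • c j (e x) := by
  set φ := chartAt (Cn (2 * g)) x₀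
  have hφx : φ.symm (φ x₀) = x₀ := φ.left_inv (mem_chart_source _ x₀)
  set s := φ.target ∩ φ.symm ⁻¹' O
  have hs : IsOpen s := φ.continuousOn_symm.isOpen_inter_preimage φ.open_target T.isOpen
  have hz : φ x₀ ∈ s := ⟨φ.map_source (mem_chart_source _ x₀), by rw [mem_preimage, hφx]; exact hx₀⟩
  have hder : ∀ z ∈ s, HasFDerivAt (fun z => q (φ.symm z))
      ((vderiv (2 * g) q (φ.symm z)).comp (pderiv (2 * g) φ.symm z)) z := fun z hz =>
    hasFDerivAt_comp (T.mdiff.mdifferentiableAt (T.isOpen.mem_nhds hz.2))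
      ((chart_mdifferentiable x₀).mdifferentiableAt_symm hz.1)
  have hd : DifferentiableOn ℂ (fun z => q (φ.symm z)) s := fun z hz =>
    (hder z hz).differentiableAt.differentiableWithinAt
  have hsurj : Function.Surjective (fderiv ℂ (fun z => q (φ.symm z)) (φ x₀)) := by
    rw [(hder _ hz).fderiv]
    refine (T.submersion _ hz.2).comp ?_
    exact ((chart_mdifferentiable (n := 2 * g) x₀).symm.mfderiv_bijective
      (x := φ x₀) (by simpa using hz.1)).2
  obtain ⟨e', r, hr, hze, hes, htgt, hez, hfst, hed, hesd⟩ :=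
    exists_straightening (K := Cn g) hs hd hz hsurj (by simp; omega)
  set e := φ.trans e'
  have hsrc : ∀ x, x ∈ e.source ↔ x ∈ φ.source ∧ φ x ∈ e'.source := fun x => by
    simp [e, OpenPartialHomeomorph.trans_source]
  have htgt' : e.target = e'.target := by
    simp only [e, OpenPartialHomeomorph.trans_target]
    refine inter_eq_left.2 fun y hy => ?_
    exact (hes (e'.map_target hy)).1
  have hdiff : e.MDifferentiable 𝓘(ℂ, Cn (2 * g)) 𝓘(ℂ, Cn g × Cn g) :=
    mdifferentiable_chart_trans x₀ e' hed hesd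
  have hsub : e.source ⊆ O := fun x hx => by
    have h1 := (hsrc x).1 hx
    have h2 := (hes h1.2).2
    rwa [mem_preimage, φ.left_inv h1.1] at h2
  have hq : ∀ x ∈ e.source, (e x).1 = q x := fun x hx => by
    have h1 := (hsrc x).1 hx
    have h2 := hfst _ h1.2
    rwa [φ.left_inv h1.1] at h2
  have hex : e x₀ = (q x₀, 0) := by
    show e' (φ x₀) = _
    rw [hez, hφx]
  rw [hφx] at htgt
  have hqd : ∀ x ∈ e.source, ∀ v, vderiv (2 * g) q x v = (vderiv (2 * g) e x v).1 := by
    intro x hx v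
    have h1 : mfderiv 𝓘(ℂ, Cn (2 * g)) 𝓘(ℂ, Cn g) q x =
        mfderiv 𝓘(ℂ, Cn (2 * g)) 𝓘(ℂ, Cn g) ((ContinuousLinearMap.fst ℂ (Cn g) (Cn g)) ∘ e) x := by
      refine EventuallyEq.mfderiv_eq ?_
      filter_upwards [e.open_source.mem_nhds hx] with y hy using (hq y hy).symm
    have h2 := ((ContinuousLinearMap.fst ℂ (Cn g) (Cn g)).hasFDerivAt.hasMFDerivAt.comp x
      (hdiff.mdifferentiableAt hx).hasMFDerivAt).mfderiv
    rw [h2] at h1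
    exact congrArg (fun L : Cn (2 * g) →L[ℂ] Cn g => L v) h1
  -- The values of `σ` on a vertical and a horizontal coordinate vector: these are the coefficients
  -- of `theta` in the chart, and they are holomorphic because `σ` is.
  set s' : Cn g → Cn g → Cn g × Cn g → ℂ := fun a b y => σ (φ.symm (e'.symm y))
      ![pderiv (2 * g) (fun y => φ.symm (e'.symm y)) y (0, a),
        pderiv (2 * g) (fun y => φ.symm (e'.symm y)) y (b, 0)]
  have hs' : ∀ a b, DifferentiableOn ℂ (s' a b) e'.target := fun a b =>
    differentiableOn_pullback_form hσ.holomorphic x₀ e'.open_target hesd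
      (fun y hy => (hes (e'.map_target hy)).1) _ _
  refine ⟨e, r, fun j y i => s' (Pi.single j 1) (Pi.single i 1) y, hr,
    (hsrc x₀).2 ⟨mem_chart_source _ x₀, hze⟩, hsub, hdiff, by rw [htgt', htgt], hex, hq, ?_, ?_⟩
  · intro j
    rw [htgt', differentiableOn_pi]
    exact fun i => hs' _ _
  · intro x hx v hv
    have hy := e.map_source hx
    have hxy : e.symm (e x) = x := e.left_inv hx
    obtain ⟨y, hyt, rfl⟩ : ∃ y ∈ e.target, e.symm y = x := ⟨e x, hy, hxy⟩
    have hey : e (e.symm y) = y := e.right_inv hyt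
    rw [hey]
    set P : (Cn g × Cn g) →L[ℂ] TX (2 * g) (e.symm y) := pderiv (2 * g) e.symm y
    have hP : ∀ b, vderiv (2 * g) e (e.symm y) (P b) = b := vderiv_symm_pderiv e hdiff hyt
    have hvP : v = P (vderiv (2 * g) e (e.symm y) v) :=
      vderiv_injective e hdiff hx (hP _).symm
    set b := vderiv (2 * g) e (e.symm y) v
    have hb1 : b.1 = 0 := by rw [← hqd _ hx, hv]
    have hb : b = ∑ j, b.2 j • ((0 : Cn g), (Pi.single j 1 : Cn g)) := by
      ext k
      · simp [hb1, Prod.fst_sum]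
      · simp [Prod.snd_sum, Finset.sum_apply, Pi.single_apply]
    have hv2 : v = ∑ j, b.2 j • P ((0 : Cn g), (Pi.single j 1 : Cn g)) := by
      rw [hvP]
      conv_lhs => rw [hb]
      rw [map_sum]
      simp only [map_smul]
    rw [hv2, map_sum]
    refine Finset.sum_congr rfl fun j _ => ?_
    rw [map_smul]
    congr 1
    ext i
    refine T.theta_eq (hsub hx) (w := P (Pi.single i 1, 0)) ?_ ?_
    · rw [hqd _ hx, hP]
    · rw [hqd _ hx, hP]

end Charts

end LagrangianFibration

namespace LagrangianFibration

/-! ### Uniformization of the fibers, normalized by the symplectic form -/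

section FiberExp

variable {g : ℕ} {X : Type*} [TopologicalSpace X] [ChartedSpace (Cn (2 * g)) X]
  {W : Type} [NormedAddCommGroup W] [NormedSpace ℂ W]
  {σ : ∀ x : X, TX (2 * g) x [⋀^Fin 2]→L[ℂ] ℂ} {O : Set X} {D : Set (Cn g)} {q : X → Cn g}

theorem IsTorusFibration.vderiv_pderiv_eq_zero (T : IsTorusFibration σ O D q) {H : W → X} {w : W}
    (hH : MDifferentiableAt 𝓘(ℂ, W) 𝓘(ℂ, Cn (2 * g)) H w) (hO : H w ∈ O) {u : Cn g}
    (hu : ∀ᶠ w' in 𝓝 w, q (H w') = u) (a : W) :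
    vderiv (2 * g) q (H w) (pderiv (2 * g) H w a) = 0 := by
  have h1 := hasFDerivAt_comp (n := 2 * g) (T.mdiff.mdifferentiableAt (T.isOpen.mem_nhds hO)) hH
  have h2 : HasFDerivAt (fun w => q (H w)) (0 : W →L[ℂ] Cn g) w :=
    (hasFDerivAt_const u w).congr_of_eventuallyEq hu
  exact congrArg (fun L => L a) (h1.unique h2)

theorem IsTorusFibration.pullTheta_eq_of_chart (T : IsTorusFibration σ O D q) {H : W → X} {w : W}
    (hH : MDifferentiableAt 𝓘(ℂ, W) 𝓘(ℂ, Cn (2 * g)) H w) (hO : H w ∈ O) {u : Cn g}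
    (hu : ∀ᶠ w' in 𝓝 w, q (H w') = u) {e : OpenPartialHomeomorph X (Cn g × Cn g)}
    (he : e.MDifferentiable 𝓘(ℂ, Cn (2 * g)) 𝓘(ℂ, Cn g × Cn g)) (hw : H w ∈ e.source)
    {c : Fin g → Cn g × Cn g → Cn g}
    (hc : ∀ x ∈ e.source, ∀ v, vderiv (2 * g) q x v = 0 →
        theta σ q x v = ∑ j, (vderiv (2 * g) e x v).2 j • c j (e x)) (a : W) :
    pullTheta σ q H w a = ∑ j, (fderiv ℂ (fun w => e (H w)) w a).2 j • c j (e (H w)) := by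
  rw [pullTheta_apply, hc _ hw _ (T.vderiv_pderiv_eq_zero hH hO hu a),
    (hasFDerivAt_comp (n := 2 * g) (he.mdifferentiableAt hw) hH).fderiv]
  rfl

theorem differentiableOn_chart_comp {V : Type} [NormedAddCommGroup V] [NormedSpace ℂ V]
    {e : OpenPartialHomeomorph X V} (he : e.MDifferentiable 𝓘(ℂ, Cn (2 * g)) 𝓘(ℂ, V))
    {H : W → X} {S : Set W} (hS : IsOpen S)
    (hH : MDifferentiableOn 𝓘(ℂ, W) 𝓘(ℂ, Cn (2 * g)) H S) (hm : MapsTo H S e.source) :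
    DifferentiableOn ℂ (fun w => e (H w)) S := fun _ hw =>
  (hasFDerivAt_comp (n := 2 * g) (he.mdifferentiableAt (hm hw))
    (hH.mdifferentiableAt (hS.mem_nhds hw))).differentiableAt.differentiableWithinAt

variable [IsManifold 𝓘(ℂ, Cn (2 * g)) ω X]

/-- A consequence of the theorem of Liouville: holomorphic parametrizations of the fibres which are
periodic are translations. -/
theorem IsTorusFibration.pullTheta_const (T : IsTorusFibration σ O D q)
    (hσ : IsHolomorphicSymplectic σ) {H : Cn g → X}
    (hH : MDifferentiable 𝓘(ℂ, Cn g) 𝓘(ℂ, Cn (2 * g)) H) {u : Cn g}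
    (hu : ∀ z, H z ∈ O ∧ q (H z) = u) {K : Set (Cn g)} (hK : IsCompact K)
    (hper : ∀ z, ∃ k ∈ K, ∀ w, H (z + w) = H (k + w)) (z a : Cn g) :
    pullTheta σ q H z a = pullTheta σ q H 0 a := by
  have hshift : ∀ z, pullTheta σ q H z a = pullTheta σ q (fun w => H (z + w)) 0 a := by
    intro z
    rw [pullTheta_comp (k := fun w => z + w) (k' := ContinuousLinearMap.id ℂ (Cn g)) (hH _)
      ((hasFDerivAt_id 0).const_add z)]
    simp
  have hdiff : Differentiable ℂ fun z => pullTheta σ q H z a := by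
    intro z₀
    obtain ⟨e, r, c, hr, hxe, heO, he, htgt, hex, hfst, hc, hθ⟩ :=
      T.exists_vertical_chart hσ (hu z₀).1
    have hS : IsOpen (H ⁻¹' e.source) := e.open_source.preimage hH.continuous
    have hd := differentiableOn_chart_comp he hS hH.mdifferentiableOn (fun w hw => hw)
    have h1 : DifferentiableOn ℂ (fun z => ∑ j, (fderiv ℂ (fun w => e (H w)) z a).2 j • c j (e (H z)))
        (H ⁻¹' e.source) := by
      refine DifferentiableOn.fun_sum fun j _ => DifferentiableOn.fun_smul ?_ ?_
      · exact differentiableOn_pi.1 (differentiableOn_fderiv_apply hS hd a).snd j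
      · exact (hc j).comp hd fun w hw => e.map_source hw
    refine ((h1.differentiableAt (hS.mem_nhds hxe)).congr_of_eventuallyEq ?_)
    filter_upwards [hS.mem_nhds hxe] with w hw
    exact T.pullTheta_eq_of_chart (hH w) (hu w).1 (Eventually.of_forall fun w => (hu w).2) he hw hθ a
  -- By periodicity all values are attained on the compact set `K`: the entire function is bounded,
  -- and constant by Liouville's theorem.
  refine hdiff.apply_eq_apply_of_bounded ?_ z 0
  refine ((hK.image hdiff.continuous).isBounded).subset ?_
  rintro _ ⟨z, rfl⟩
  obtain ⟨k, hk, hkz⟩ := hper z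
  refine ⟨k, hk, ?_⟩
  simp only
  rw [hshift, hshift z]
  congr 2
  exact (funext hkz).symm

/-- The uniformization of a fibre, normalized by `theta`. -/
theorem IsTorusFibration.exists_fiberExp (T : IsTorusFibration σ O D q)
    (hσ : IsHolomorphicSymplectic σ) {x : X} (hx : x ∈ O) :
    ∃ (h : Cn g → X) (b : Module.Basis (Fin (2 * g)) ℝ (Cn g)),
      MDifferentiable 𝓘(ℂ, Cn g) 𝓘(ℂ, Cn (2 * g)) h ∧ h 0 = x ∧ (∀ z, h z ∈ O ∧ q (h z) = q x) ∧
      (∀ y ∈ O, q y = q x → ∃ z, h z = y) ∧ (∀ z a, pullTheta σ q h z a = a) ∧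
      ∀ z w, h z = h w ↔ ∃ k : Fin (2 * g) → ℤ, z - w = ∑ i, k i • b i := by
  obtain ⟨Λ, π, hΛ, hspan, hπ, hinj, hrange, hker⟩ := T.torus (q x) (T.mapsTo hx)
  have : IsZLattice ℝ Λ := ⟨hspan⟩
  have hmem : ∀ z, π z ∈ O ∧ q (π z) = q x := fun z => by
    have h1 : π z ∈ range π := mem_range_self z
    rwa [hrange] at h1
  have : Module.Free ℤ Λ := ZLattice.module_free ℝ Λ
  have : Module.Finite ℤ Λ := ZLattice.module_finite ℝ Λ
  set b₁ := (Module.Free.chooseBasis ℤ Λ).ofZLatticeBasis ℝ Λ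
  have hcard : Fintype.card (Module.Free.ChooseBasisIndex ℤ Λ) = 2 * g := by
    rw [← Module.finrank_eq_card_basis b₁, Module.finrank_pi_fintype]
    simp [mul_comm]
  set b₀ := b₁.reindex (Fintype.equivFinOfCardEq hcard)
  have hb₀ : ∀ z, z ∈ Λ ↔ ∃ k : Fin (2 * g) → ℤ, z = ∑ i, k i • b₀ i := by
    intro z
    have h1 : Submodule.span ℤ (range b₀) = Λ := by
      rw [Module.Basis.range_reindex]
      exact Module.Basis.ofZLatticeBasis_span ℝ Λ _
    conv_lhs => rw [← h1]
    rw [Submodule.mem_span_range_iff_exists_fun]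
    exact ⟨fun ⟨k, hk⟩ => ⟨k, hk.symm⟩, fun ⟨k, hk⟩ => ⟨k, hk.symm⟩⟩
  have hK : IsCompact (closure (ZSpan.fundamentalDomain b₀)) :=
    Metric.isCompact_of_isClosed_isBounded isClosed_closure
      (ZSpan.fundamentalDomain_isBounded b₀).closure
  have hper : ∀ z, ∃ k ∈ closure (ZSpan.fundamentalDomain b₀), ∀ w, π (z + w) = π (k + w) := by
    intro z
    refine ⟨ZSpan.fract b₀ z, subset_closure (ZSpan.fract_mem_fundamentalDomain b₀ z), fun w => ?_⟩
    rw [hker]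
    have h1 : z + w - (ZSpan.fract b₀ z + w) = ZSpan.floor b₀ z := by
      rw [ZSpan.fract_apply]; abel
    rw [h1, hb₀]
    have h2 := (ZSpan.floor b₀ z).2
    rw [Submodule.mem_span_range_iff_exists_fun] at h2
    obtain ⟨k, hk⟩ := h2
    exact ⟨k, hk.symm⟩
  have hconst := T.pullTheta_const hσ hπ hmem hK hper
  -- The constant linear map `π^*θ` is invertible because `theta` is injective on vertical vectors
  -- and `π` is immersive. Composing `π` with its inverse normalizes the pull-back to the identity,
  -- and the shift by `a₀` moves the origin to `x`.
  have hLinj : Function.Injective (pullTheta σ q π 0) := by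
    rw [← LinearMap.ker_eq_bot, LinearMap.ker_eq_bot']
    intro a ha
    have h1 := T.vderiv_pderiv_eq_zero (hπ 0) (hmem 0).1 (Eventually.of_forall fun w => (hmem w).2) a
    have h2 := T.eq_zero_of_theta hσ (hmem 0).1 h1 ha
    exact hinj 0 (h2.trans (map_zero (pderiv (2 * g) π 0)).symm)
  set L : Cn g ≃ₗ[ℂ] Cn g := LinearEquiv.ofInjectiveEndo _ hLinj
  have hL : ∀ a, pullTheta σ q π 0 a = L a := fun a => rfl
  set L' : Cn g ≃L[ℂ] Cn g := L.toContinuousLinearEquiv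
  obtain ⟨a₀, ha₀⟩ : x ∈ range π := by rw [hrange]; exact ⟨hx, rfl⟩
  have hk : ∀ z, HasFDerivAt (fun z => L'.symm z + a₀) (L'.symm : Cn g →L[ℂ] Cn g) z := fun z =>
    (L'.symm.hasFDerivAt).add_const a₀
  refine ⟨fun z => π (L'.symm z + a₀), b₀.map (L.restrictScalars ℝ), fun z => ?_, ?_, fun z => hmem _,
    ?_, ?_, ?_⟩
  · exact (hπ _).comp z (hk z).differentiableAt.mdifferentiableAt
  · simp only [map_zero, zero_add, ha₀]
  · intro y hy hyx
    obtain ⟨z, rfl⟩ : y ∈ range π := by rw [hrange]; exact ⟨hy, hyx⟩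
    exact ⟨L' (z - a₀), by simp⟩
  · intro z a
    rw [pullTheta_comp (hπ _) (hk z), hconst, hL]
    exact L.apply_symm_apply a
  · intro z w
    rw [hker, add_sub_add_right_eq_sub, ← map_sub, hb₀]
    refine exists_congr fun k => ?_
    have h1 : ∑ i, k i • (b₀.map (L.restrictScalars ℝ)) i = L (∑ i, k i • b₀ i) := by
      rw [map_sum]
      refine Finset.sum_congr rfl fun i _ => ?_
      rw [map_zsmul]
      rfl
    rw [h1]
    exact L'.symm_apply_eq

end FiberExp

end LagrangianFibration

namespace LagrangianFibration

/-! ### Coordinates in which `theta` is the differential of the fiber coordinate -/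

section SpecialCharts

variable {g : ℕ} {X : Type*} [TopologicalSpace X] [ChartedSpace (Cn (2 * g)) X]
  {W : Type} [NormedAddCommGroup W] [NormedSpace ℂ W]
  {σ : ∀ x : X, TX (2 * g) x [⋀^Fin 2]→L[ℂ] ℂ} {O : Set X} {D : Set (Cn g)} {q : X → Cn g}

theorem vderiv_fst_eq {e : OpenPartialHomeomorph X (Cn g × Cn g)}
    (he : e.MDifferentiable 𝓘(ℂ, Cn (2 * g)) 𝓘(ℂ, Cn g × Cn g)) (hq : ∀ x ∈ e.source, (e x).1 = q x)
    {x : X} (hx : x ∈ e.source) (v : TX (2 * g) x) :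
    (vderiv (2 * g) e x v).1 = vderiv (2 * g) q x v := by
  have h1 : mfderiv 𝓘(ℂ, Cn (2 * g)) 𝓘(ℂ, Cn g) q x =
      mfderiv 𝓘(ℂ, Cn (2 * g)) 𝓘(ℂ, Cn g) ((ContinuousLinearMap.fst ℂ (Cn g) (Cn g)) ∘ e) x := by
    refine EventuallyEq.mfderiv_eq ?_
    filter_upwards [e.open_source.mem_nhds hx] with y hy using (hq y hy).symm
  have h2 := ((ContinuousLinearMap.fst ℂ (Cn g) (Cn g)).hasFDerivAt.hasMFDerivAt.comp x
    (he.mdifferentiableAt hx).hasMFDerivAt).mfderiv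
  rw [h2] at h1
  exact (congrArg (fun L : Cn (2 * g) →L[ℂ] Cn g => L v) h1).symm

theorem vderiv_comp_eq {V V' : Type} [NormedAddCommGroup V] [NormedSpace ℂ V]
    [NormedAddCommGroup V'] [NormedSpace ℂ V'] {e : X → V} {ψ : V → V'} {ψ' : V →L[ℂ] V'} {x : X}
    (he : MDifferentiableAt 𝓘(ℂ, Cn (2 * g)) 𝓘(ℂ, V) e x) (hψ : HasFDerivAt ψ ψ' (e x)) {E : X → V'}
    (hE : E =ᶠ[𝓝 x] fun x => ψ (e x)) (v : TX (2 * g) x) :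
    vderiv (2 * g) E x v = ψ' (vderiv (2 * g) e x v) := by
  have h1 : mfderiv 𝓘(ℂ, Cn (2 * g)) 𝓘(ℂ, V') E x =
      mfderiv 𝓘(ℂ, Cn (2 * g)) 𝓘(ℂ, V') (ψ ∘ e) x := EventuallyEq.mfderiv_eq hE
  have h2 := (hψ.hasMFDerivAt.comp x he.hasMFDerivAt).mfderiv
  rw [h2] at h1
  exact congrArg (fun L : Cn (2 * g) →L[ℂ] V' => L v) h1

/-- Coordinates `(q, ζ)` such that the restriction of `dζ` to the fibres is `theta`. -/
structure IsSpecialChart (σ : ∀ x : X, TX (2 * g) x [⋀^Fin 2]→L[ℂ] ℂ) (O : Set X) (q : X → Cn g)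
    (e : OpenPartialHomeomorph X (Cn g × Cn g)) : Prop where
  subset : e.source ⊆ O
  mdiff : e.MDifferentiable 𝓘(ℂ, Cn (2 * g)) 𝓘(ℂ, Cn g × Cn g)
  fst_eq : ∀ x ∈ e.source, (e x).1 = q x
  theta_eq : ∀ x ∈ e.source, ∀ v, vderiv (2 * g) q x v = 0 →
    theta σ q x v = (vderiv (2 * g) e x v).2

variable [IsManifold 𝓘(ℂ, Cn (2 * g)) ω X]

/-- Holomorphic primitives with parameters. -/
theorem exists_primitive {u₀ : Cn g} {r : ℝ} {c : Fin g → Cn g × Cn g → Cn g}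
    (hc : ∀ j, DifferentiableOn ℂ (c j) (Metric.ball u₀ r ×ˢ Metric.ball 0 r))
    (hloc : ∀ u ∈ Metric.ball u₀ r, ∀ y ∈ Metric.ball (0 : Cn g) r, ∃ Z : Cn g → Cn g,
      ∀ᶠ y' in 𝓝 y, HasFDerivAt Z
        (∑ j, (ContinuousLinearMap.proj (R := ℂ) (φ := fun _ : Fin g => ℂ) j).smulRight
          (c j (u, y'))) y') :
    ∃ Z : Cn g × Cn g → Cn g, DifferentiableOn ℂ Z (Metric.ball u₀ r ×ˢ Metric.ball 0 r) ∧
      ∀ u ∈ Metric.ball u₀ r, ∀ y ∈ Metric.ball (0 : Cn g) r,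
        HasFDerivAt (fun y => Z (u, y))
          (∑ j, (ContinuousLinearMap.proj (R := ℂ) (φ := fun _ : Fin g => ℂ) j).smulRight
          (c j (u, y))) y := by
  set ϑ : Cn g × Cn g → Cn g →L[ℂ] Cn g := fun w =>
    ∑ j, (ContinuousLinearMap.proj (R := ℂ) (φ := fun _ : Fin g => ℂ) j).smulRight (c j w)
  have hϑ : DifferentiableOn ℂ ϑ (Metric.ball u₀ r ×ˢ Metric.ball 0 r) := by
    refine DifferentiableOn.fun_sum fun j _ => ?_
    exact ((ContinuousLinearMap.smulRightL ℂ (Cn g) (Cn g)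
      (ContinuousLinearMap.proj (R := ℂ) (φ := fun _ : Fin g => ℂ) j)).differentiable.comp_differentiableOn
        (hc j))
  have hmem : ∀ (y : Cn g) (t : ℝ), y ∈ Metric.ball (0 : Cn g) r → t ∈ Icc (0 : ℝ) 1 →
      t • y ∈ Metric.ball (0 : Cn g) r := by
    intro y t hy ht
    rw [mem_ball_zero_iff] at hy ⊢
    rw [norm_smul, Real.norm_of_nonneg ht.1]
    exact lt_of_le_of_lt (mul_le_of_le_one_left (norm_nonneg _) ht.2) hy
  -- Integration along the radii of the fiber coordinate, as in the Poincaré lemma; this choice is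
  -- holomorphic in the parameter.
  refine ⟨fun w => ∫ t in (0 : ℝ)..1, ϑ (w.1, t • w.2) w.2, ?_, ?_⟩
  · refine differentiableOn_intervalIntegral (Metric.isOpen_ball.prod Metric.isOpen_ball) zero_le_one
      ?_ fun t ht => ?_
    · refine ContinuousOn.clm_apply (f := fun p : (Cn g × Cn g) × ℝ => ϑ (p.1.1, p.2 • p.1.2))
        (hϑ.continuousOn.comp (by fun_prop) fun p hp => ?_) (by fun_prop)
      exact ⟨hp.1.1, hmem _ _ hp.1.2 hp.2⟩
    · refine DifferentiableOn.clm_apply (hϑ.comp (f := fun w : Cn g × Cn g => (w.1, t • w.2)) ?_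
        fun p hp => ⟨hp.1, hmem _ _ hp.2 ht⟩) (by fun_prop)
      fun_prop
  · intro u hu y hy
    have h0 : (0 : Cn g) ∈ Metric.ball (0 : Cn g) r :=
      Metric.mem_ball_self (lt_of_le_of_lt dist_nonneg (Metric.mem_ball.1 hy))
    have hd : ∀ y ∈ Metric.ball (0 : Cn g) r, DifferentiableAt ℂ (fun y => ϑ (u, y)) y := by
      intro y hy
      refine DifferentiableAt.comp (f := fun y : Cn g => (u, y)) y (hϑ.differentiableAt
        ((Metric.isOpen_ball.prod Metric.isOpen_ball).mem_nhds ⟨hu, hy⟩)) (by fun_prop)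
    have h1 := Convex.hasFDerivWithinAt_curveIntegral_segment_of_hasFDerivWithinAt_symmetric
      (𝕜 := ℂ) (s := Metric.ball (0 : Cn g) r)
      (dω := fun y => (fderiv ℂ (fun y => ϑ (u, y)) y).restrictScalars ℝ) (convex_ball _ _)
      (fun y hy => ((hd y hy).hasFDerivAt.restrictScalars ℝ).hasFDerivWithinAt)
      -- The local primitives serve only to show that the derivative of the form is symmetric, that
      -- is, that the form is closed along the fibers.
      (fun y hy a _ b _ => by
        obtain ⟨Z, hZ⟩ := hloc u hu y hy
        exact second_derivative_symmetric_of_eventually hZ (hd y hy).hasFDerivAt a b) h0 hy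
    refine (h1.hasFDerivAt (Metric.isOpen_ball.mem_nhds hy)).congr_of_eventuallyEq ?_
    refine Eventually.of_forall fun y => ?_
    simp only
    rw [curveIntegral_segment]
    simp [AffineMap.lineMap_apply]

/-- In a vertical chart, `theta` is a family of forms `∑ c_j dy_j` on the fibers. The uniformization
`h` of a fiber pulls it back to `dz`, so a local inverse of `h` is a primitive on this fiber;
closedness along the fibers comes from there, not from `dσ = 0`. Integrating with parameters gives
`Z`, and `(u, Z)` are the desired coordinates. -/
theorem IsTorusFibration.exists_special_chart (T : IsTorusFibration σ O D q)
    (hσ : IsHolomorphicSymplectic σ) {x₀ : X} (hx₀ : x₀ ∈ O) :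
    ∃ (e : OpenPartialHomeomorph X (Cn g × Cn g)) (r : ℝ), IsSpecialChart σ O q e ∧ 0 < r ∧
      x₀ ∈ e.source ∧ e.target = Metric.ball (q x₀) r ×ˢ Metric.ball (e x₀).2 r := by
  obtain ⟨e, r, c, hr, hxe, heO, he, htgt, hex, hfst, hc, hθ⟩ := T.exists_vertical_chart hσ hx₀
  set ϑ : Cn g × Cn g → Cn g →L[ℂ] Cn g := fun w =>
    ∑ j, (ContinuousLinearMap.proj (R := ℂ) (φ := fun _ : Fin g => ℂ) j).smulRight (c j w)
  have hϑ : ∀ w a, ϑ w a = ∑ j, a j • c j w := fun w a => by simp [ϑ]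
  have hloc : ∀ u ∈ Metric.ball (q x₀) r, ∀ y ∈ Metric.ball (0 : Cn g) r,
      Function.Injective (ϑ (u, y)) ∧
      ∃ Z : Cn g → Cn g, ∀ᶠ y' in 𝓝 y, HasFDerivAt Z (ϑ (u, y')) y' := by
    intro u hu y hy
    have huy : (u, y) ∈ e.target := by rw [htgt]; exact ⟨hu, hy⟩
    have hxs := e.map_target huy
    obtain ⟨h, b, hh, h0, hmem, -, hhθ, -⟩ := T.exists_fiberExp hσ (heO hxs)
    have hqx : q (e.symm (u, y)) = u := by rw [← hfst _ hxs, e.right_inv huy]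
    rw [hqx] at hmem
    set S := h ⁻¹' e.source
    have hS : IsOpen S := e.open_source.preimage hh.continuous
    have h0S : (0 : Cn g) ∈ S := by rw [mem_preimage, h0]; exact hxs
    have hd := differentiableOn_chart_comp he hS hh.mdifferentiableOn (fun w hw => hw)
    set Y : Cn g → Cn g := fun z => (e (h z)).2
    have hY : DifferentiableOn ℂ Y S := hd.snd
    have heY : ∀ z ∈ S, e (h z) = (u, Y z) := fun z hz => by
      ext1
      · rw [hfst _ hz, (hmem z).2]
      · rfl
    -- The normalization of `h` read in the chart: `ϑ` is inverse to the differential of `Y`, and is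
    -- therefore the differential of a local inverse of `Y`.
    have hid : ∀ z ∈ S, ∀ a, ϑ (u, Y z) (fderiv ℂ Y z a) = a := by
      intro z hz a
      have h1 := T.pullTheta_eq_of_chart (hh z) (hmem z).1
        (Eventually.of_forall fun w => (hmem w).2) he hz hθ a
      rw [hhθ, ← hϑ, heY z hz] at h1
      have h2 : fderiv ℂ Y z = (ContinuousLinearMap.snd ℂ _ _).comp (fderiv ℂ (fun w => e (h w)) z) :=
        ((hd.differentiableAt (hS.mem_nhds hz)).hasFDerivAt.snd).fderiv
      rw [h2]
      exact h1.symm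
    have hY0 : Y 0 = y := by
      show (e (h 0)).2 = y
      rw [h0, e.right_inv huy]
    have hinj : Function.Injective (fderiv ℂ Y 0).toLinearMap :=
      Function.LeftInverse.injective (g := ϑ (u, Y 0)) (hid 0 h0S)
    constructor
    · have h1 : Function.Surjective (ϑ (u, y)).toLinearMap := fun a =>
        ⟨fderiv ℂ Y 0 a, by have := hid 0 h0S a; rwa [hY0] at this⟩
      exact LinearMap.injective_iff_surjective.2 h1
    obtain ⟨E, h0E, hES, hEY, hEsymm⟩ := exists_holomorphic_inverse hS hY h0S
      (LinearEquiv.ofInjectiveEndo _ hinj).toContinuousLinearEquiv (by ext1 a; rfl)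
    refine ⟨E.symm, ?_⟩
    have hyt : y ∈ E.target := by
      have := E.map_source h0E
      rwa [hEY 0 h0E, hY0] at this
    filter_upwards [E.open_target.mem_nhds hyt] with y' hy'
    have h1 := (hEsymm.differentiableAt (E.open_target.mem_nhds hy')).hasFDerivAt
    have hz := E.map_target hy'
    have hYE : Y (E.symm y') = y' := by rw [← hEY _ hz, E.right_inv hy']
    have h2 := ((hY.differentiableAt (hS.mem_nhds (hES hz))).hasFDerivAt).comp y' h1
    have h3 : HasFDerivAt (Y ∘ E.symm) (ContinuousLinearMap.id ℂ (Cn g)) y' :=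
      (hasFDerivAt_id y').congr_of_eventuallyEq (by
        filter_upwards [E.open_target.mem_nhds hy'] with w hw
        show Y (E.symm w) = w
        rw [← hEY _ (E.map_target hw), E.right_inv hw])
    have h4 := h2.unique h3
    suffices hE : fderiv ℂ E.symm y' = ϑ (u, y') by rwa [hE] at h1
    ext1 a
    have h5 := congrArg (fun L => L a) h4
    have h6 := hid _ (hES hz) (fderiv ℂ E.symm y' a)
    rw [hYE] at h6
    rw [← h6]
    exact congrArg _ h5
  obtain ⟨Z, hZ, hZd⟩ := exists_primitive (u₀ := q x₀) (r := r) (c := c) (by rwa [← htgt])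
    fun u hu y hy => (hloc u hu y hy).2
  rw [← htgt] at hZ
  have hZ2 : ∀ w ∈ e.target, ∀ b, fderiv ℂ Z w (0, b) = ϑ w b := by
    rintro ⟨u, y⟩ hw b
    have h1 := (hZ.differentiableAt (e.open_target.mem_nhds hw)).hasFDerivAt
    have h2 := HasFDerivAt.comp (f := fun y : Cn g => (u, y)) y h1
      ((hasFDerivAt_const u y).prodMk (hasFDerivAt_id y))
    have hw' := hw
    rw [htgt] at hw'
    have h3 := h2.unique (hZd u hw'.1 y hw'.2)
    exact congrArg (fun L => L b) h3
  set ψ : Cn g × Cn g → Cn g × Cn g := fun w => (w.1, Z w)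
  have hψ : ∀ w ∈ e.target, HasFDerivAt ψ ((ContinuousLinearMap.fst ℂ _ _).prod (fderiv ℂ Z w)) w :=
    fun w hw => hasFDerivAt_fst.prodMk (hZ.differentiableAt (e.open_target.mem_nhds hw)).hasFDerivAt
  have hx0t : e x₀ ∈ e.target := e.map_source hxe
  have hinj : Function.Injective
      ((ContinuousLinearMap.fst ℂ (Cn g) (Cn g)).prod (fderiv ℂ Z (e x₀))).toLinearMap := by
    rw [← LinearMap.ker_eq_bot, LinearMap.ker_eq_bot']
    rintro ⟨a, b⟩ hab
    have h1 : a = 0 := congrArg Prod.fst hab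
    have h2 : fderiv ℂ Z (e x₀) (a, b) = 0 := congrArg Prod.snd hab
    rw [h1, hZ2 _ hx0t, hex] at h2
    have h3 := (hloc (q x₀) (Metric.mem_ball_self hr) 0 (Metric.mem_ball_self hr)).1
    rw [h1, h3 (h2.trans (map_zero _).symm)]
    rfl
  obtain ⟨e₂, hxe₂, he₂s, he₂, he₂symm⟩ := exists_holomorphic_inverse e.open_target
    (fun w hw => (hψ w hw).differentiableAt.differentiableWithinAt) hx0t
    (LinearEquiv.ofInjectiveEndo _ hinj).toContinuousLinearEquiv
    (by rw [(hψ _ hx0t).fderiv]; exact ContinuousLinearMap.ext fun _ => rfl)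
  have he₂d : DifferentiableOn ℂ e₂ e₂.source := fun w hw =>
    (((hψ w (he₂s hw)).congr_of_eventuallyEq (by
      filter_upwards [e₂.open_source.mem_nhds hw] with w' hw' using he₂ w' hw')).differentiableAt
      ).differentiableWithinAt
  set e₃ := e.trans e₂
  have he₃ : e₃.MDifferentiable 𝓘(ℂ, Cn (2 * g)) 𝓘(ℂ, Cn g × Cn g) :=
    he.trans ⟨he₂d.mdifferentiableOn, he₂symm.mdifferentiableOn⟩
  have hsrc : ∀ x, x ∈ e₃.source ↔ x ∈ e.source ∧ e x ∈ e₂.source := fun x => by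
    simp [e₃, OpenPartialHomeomorph.trans_source]
  have he₃ψ : ∀ x ∈ e₃.source, e₃ x = ψ (e x) := fun x hx => he₂ _ ((hsrc x).1 hx).2
  obtain ⟨e₄, r', hr', hx₄, hs₄, ht₄, htt₄, hee, hees⟩ :=
    exists_restr_target_ball e₃ ((hsrc x₀).2 ⟨hxe, hxe₂⟩) (univ_mem (α := X))
  have hfun : (e₄ : X → Cn g × Cn g) = e₃ := funext hee
  have hfun' : (e₄.symm : Cn g × Cn g → X) = e₃.symm := funext hees
  have hs₄' : ∀ x ∈ e₄.source, x ∈ e₃.source := fun x hx => (hs₄ hx).1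
  have h43 : ∀ x ∈ e₄.source, e₄ x = ψ (e x) := fun x hx => by rw [hee, he₃ψ x (hs₄' x hx)]
  refine ⟨e₄, r', ⟨fun x hx => heO ((hsrc x).1 (hs₄' x hx)).1, ⟨?_, ?_⟩, fun x hx => ?_, ?_⟩, hr',
    hx₄, ?_⟩
  · rw [hfun]
    exact he₃.1.mono hs₄'
  · rw [hfun']
    exact he₃.2.mono htt₄
  · rw [h43 x hx]
    exact hfst x ((hsrc x).1 (hs₄' x hx)).1
  · intro x hx v hv
    have hxs := ((hsrc x).1 (hs₄' x hx)).1
    have h1 := vderiv_comp_eq (he.mdifferentiableAt hxs) (hψ _ (e.map_source hxs)) (E := e₄) (by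
      filter_upwards [e₄.open_source.mem_nhds hx] with y hy using h43 y hy) v
    rw [h1, hθ x hxs v hv, ← hϑ, ← hZ2 _ (e.map_source hxs)]
    have h2 := vderiv_fst_eq he hfst hxs v
    rw [hv] at h2
    have h3 : vderiv (2 * g) e x v = (0, (vderiv (2 * g) e x v).2) := by ext1; exacts [h2, rfl]
    conv_rhs => rw [h3]
    rfl
  · rw [ht₄, hee, he₃ψ _ (hs₄' _ hx₄)]
    show Metric.ball (e x₀).1 r' ×ˢ _ = _
    rw [hfst x₀ hxe]

end SpecialCharts

end LagrangianFibration

namespace LagrangianFibration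

/-! ### Holomorphic dependence of the uniformizations on the fiber -/

section Families

variable {g : ℕ} {X : Type*} [TopologicalSpace X] [ChartedSpace (Cn (2 * g)) X]
  {W : Type} [NormedAddCommGroup W] [NormedSpace ℂ W]
  {σ : ∀ x : X, TX (2 * g) x [⋀^Fin 2]→L[ℂ] ℂ} {O : Set X} {D : Set (Cn g)} {q : X → Cn g}

theorem IsTorusFibration.fderiv_special (T : IsTorusFibration σ O D q) {H : W → X} {w : W}
    (hH : MDifferentiableAt 𝓘(ℂ, W) 𝓘(ℂ, Cn (2 * g)) H w) (hO : H w ∈ O) {u : Cn g}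
    (hu : ∀ᶠ w' in 𝓝 w, q (H w') = u) {e : OpenPartialHomeomorph X (Cn g × Cn g)}
    (he : IsSpecialChart σ O q e) (hw : H w ∈ e.source) (a : W) :
    fderiv ℂ (fun w => (e (H w)).2) w a = pullTheta σ q H w a := by
  rw [pullTheta_apply, he.theta_eq _ hw _ (T.vderiv_pderiv_eq_zero hH hO hu a)]
  have h1 := (hasFDerivAt_comp (n := 2 * g) (he.mdiff.mdifferentiableAt hw) hH).snd.fderiv
  rw [h1]
  rfl

/-- Holomorphic maps to a fibre are determined by their value at a point and the pull-back of
`theta`. -/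
theorem IsTorusFibration.eqOn_of_pullTheta_eq [IsManifold 𝓘(ℂ, Cn (2 * g)) ω X] [T2Space X]
    (T : IsTorusFibration σ O D q)
    (hσ : IsHolomorphicSymplectic σ) {S : Set W} (hS : IsOpen S) (hSc : IsPreconnected S)
    {H₁ H₂ : W → X} (hH₁ : MDifferentiableOn 𝓘(ℂ, W) 𝓘(ℂ, Cn (2 * g)) H₁ S)
    (hH₂ : MDifferentiableOn 𝓘(ℂ, W) 𝓘(ℂ, Cn (2 * g)) H₂ S) {u : Cn g}
    (h₁ : ∀ w ∈ S, H₁ w ∈ O ∧ q (H₁ w) = u) (h₂ : ∀ w ∈ S, H₂ w ∈ O ∧ q (H₂ w) = u)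
    (hθ : ∀ w ∈ S, ∀ a, pullTheta σ q H₁ w a = pullTheta σ q H₂ w a) {w₀ : W} (hw₀ : w₀ ∈ S)
    (heq : H₁ w₀ = H₂ w₀) : EqOn H₁ H₂ S := by
  classical
  have hloc : ∀ w ∈ S, ∀ᶠ w' in 𝓝[S] w, decide (H₁ w' = H₂ w') = decide (H₁ w = H₂ w) := by
    intro w hw
    have hc₁ := (hH₁.continuousOn.continuousAt (hS.mem_nhds hw))
    have hc₂ := (hH₂.continuousOn.continuousAt (hS.mem_nhds hw))
    -- The truth value of the equality is locally constant. At a point of agreement, the two maps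
    -- have the same differential in a special chart, hence agree nearby; disagreement is an open
    -- condition because `X` is Hausdorff.
    by_cases hww : H₁ w = H₂ w
    · obtain ⟨e, r, he, hr, hxe, -⟩ := T.exists_special_chart hσ (h₁ w hw).1
      have hn : S ∩ (H₁ ⁻¹' e.source ∩ H₂ ⁻¹' e.source) ∈ 𝓝 w :=
        inter_mem (hS.mem_nhds hw) (inter_mem (hc₁ (e.open_source.mem_nhds hxe))
          (hc₂ (e.open_source.mem_nhds (hww ▸ hxe))))
      obtain ⟨ε, hε, hball⟩ := Metric.mem_nhds_iff.1 hn
      have hsub : Metric.ball w ε ⊆ S := fun y hy => (hball hy).1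
      have hd₁ := differentiableOn_chart_comp he.mdiff Metric.isOpen_ball (hH₁.mono hsub)
        (fun y hy => (hball hy).2.1)
      have hd₂ := differentiableOn_chart_comp he.mdiff Metric.isOpen_ball (hH₂.mono hsub)
        (fun y hy => (hball hy).2.2)
      have hev : ∀ {H : W → X}, (∀ w ∈ S, H w ∈ O ∧ q (H w) = u) → ∀ y ∈ Metric.ball w ε,
          ∀ᶠ w' in 𝓝 y, q (H w') = u := fun hH y hy => by
        filter_upwards [hS.mem_nhds (hsub hy)] with w' hw' using (hH w' hw').2
      have key := IsOpen.eqOn_of_fderiv_eq (𝕜 := ℂ) Metric.isOpen_ball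
        (Metric.isPreconnected_ball (x := w) (r := ε)) hd₁.snd hd₂.snd (fun y hy => by
          ext1 a
          rw [T.fderiv_special (hH₁.mdifferentiableAt (hS.mem_nhds (hsub hy))) (h₁ y (hsub hy)).1
            (hev h₁ y hy) he (hball hy).2.1, T.fderiv_special
            (hH₂.mdifferentiableAt (hS.mem_nhds (hsub hy))) (h₂ y (hsub hy)).1
            (hev h₂ y hy) he (hball hy).2.2, hθ y (hsub hy)]) (Metric.mem_ball_self hε)
          (by simp only [hww])
      filter_upwards [mem_nhdsWithin_of_mem_nhds (Metric.ball_mem_nhds w hε)] with y hy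
      simp only [hww, decide_true, decide_eq_true_eq]
      refine e.injOn (hball hy).2.1 (hball hy).2.2 ?_
      ext1
      · rw [he.fst_eq _ (hball hy).2.1, he.fst_eq _ (hball hy).2.2, (h₁ y (hsub hy)).2,
          (h₂ y (hsub hy)).2]
      · exact key hy
    · filter_upwards [mem_nhdsWithin_of_mem_nhds ((hc₁.prodMk hc₂).eventually
        (isClosed_diagonal.isOpen_compl.mem_nhds hww))] with y hy
      have : ¬ H₁ y = H₂ y := hy
      simp [this, hww]
  have hcont : ContinuousOn (fun w => decide (H₁ w = H₂ w)) S := fun w hw =>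
    tendsto_const_nhds.congr' ((hloc w hw).mono fun _ h => h.symm)
  intro w hw
  have := hSc.constant hcont hw hw₀
  simpa [heq] using this

/-- A family of normalized uniformizations of the fibres over `B`. -/
structure IsFiberExp (σ : ∀ x : X, TX (2 * g) x [⋀^Fin 2]→L[ℂ] ℂ) (O : Set X) (q : X → Cn g)
    (B : Set (Cn g)) (h : Cn g → Cn g → X) : Prop where
  isOpen : IsOpen B
  mdiff : ∀ u ∈ B, MDifferentiable 𝓘(ℂ, Cn g) 𝓘(ℂ, Cn (2 * g)) (h u)
  mem : ∀ u ∈ B, ∀ z, h u z ∈ O ∧ q (h u z) = u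
  surj : ∀ u ∈ B, ∀ y ∈ O, q y = u → ∃ z, h u z = y
  theta_eq : ∀ u ∈ B, ∀ z a, pullTheta σ q (h u) z a = a
  lattice : ∀ u ∈ B, ∃ b : Module.Basis (Fin (2 * g)) ℝ (Cn g),
    ∀ z w, h u z = h u w ↔ ∃ k : Fin (2 * g) → ℤ, z - w = ∑ i, k i • b i
  mdiff_zero : MDifferentiableOn 𝓘(ℂ, Cn g) 𝓘(ℂ, Cn (2 * g)) (fun u => h u 0) B

variable {B : Set (Cn g)} {h : Cn g → Cn g → X}

theorem mdifferentiableAt_symm_comp {e : OpenPartialHomeomorph X (Cn g × Cn g)}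
    (he : IsSpecialChart σ O q e) {k : W → Cn g × Cn g} {w : W} (hk : DifferentiableAt ℂ k w)
    (hw : k w ∈ e.target) :
    MDifferentiableAt 𝓘(ℂ, W) 𝓘(ℂ, Cn (2 * g)) (fun w => e.symm (k w)) w :=
  (he.mdiff.mdifferentiableAt_symm hw).comp w hk.mdifferentiableAt

variable [IsManifold 𝓘(ℂ, Cn (2 * g)) ω X] [T2Space X]

/-- In a special chart the fiber coordinate of `h u z` is `z` up to a constant, so `h u z` is
determined by `h u z₁`. The radius `δ` does not depend on `z₁`: this lets regularity in `u` travel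
from one `z₁` to a ball of fixed size. -/
theorem IsFiberExp.exists_step (F : IsFiberExp σ O q B h) (T : IsTorusFibration σ O D q)
    (hσ : IsHolomorphicSymplectic σ) {u₁ : Cn g} (hu₁ : u₁ ∈ B) (z₀ : Cn g) :
    ∃ e : OpenPartialHomeomorph X (Cn g × Cn g), IsSpecialChart σ O q e ∧ h u₁ z₀ ∈ e.source ∧
      ∃ δ > 0, ∀ z₁ ∈ Metric.ball z₀ δ, ContinuousAt (fun u => h u z₁) u₁ →
        ∀ᶠ u in 𝓝 u₁, h u z₁ ∈ e.source ∧ ∀ z ∈ Metric.ball z₀ δ,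
          (u, (e (h u z₁)).2 + (z - z₁)) ∈ e.target ∧
            h u z = e.symm (u, (e (h u z₁)).2 + (z - z₁)) := by
  obtain ⟨e, r, he, hr, hxe, htgt⟩ := T.exists_special_chart hσ (F.mem u₁ hu₁ z₀).1
  rw [(F.mem u₁ hu₁ z₀).2] at htgt
  obtain ⟨δ', hδ', hball⟩ := Metric.mem_nhds_iff.1
    ((F.mdiff u₁ hu₁).continuous.continuousAt (x := z₀) (e.open_source.mem_nhds hxe))
  -- A quarter of the radius of the chart is reserved for the displacement `z - z₀`, another for the
  -- variation with `u` of the coordinate of `h u z₁`.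
  set δ := min δ' (r / 4)
  have hδ : 0 < δ := lt_min hδ' (by positivity)
  have hsrc : ∀ z ∈ Metric.ball z₀ δ, h u₁ z ∈ e.source := fun z hz =>
    hball (Metric.ball_subset_ball (min_le_left _ _) hz)
  have hζ : ∀ z ∈ Metric.ball z₀ δ, (e (h u₁ z)).2 = (e (h u₁ z₀)).2 + (z - z₀) := by
    have hd := differentiableOn_chart_comp he.mdiff Metric.isOpen_ball
      ((F.mdiff u₁ hu₁).mdifferentiableOn (s := Metric.ball z₀ δ)) hsrc
    have := IsOpen.eqOn_of_fderiv_eq (𝕜 := ℂ) Metric.isOpen_ball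
      (Metric.isPreconnected_ball (x := z₀) (r := δ)) hd.snd
      (g := fun z => (e (h u₁ z₀)).2 + (z - z₀)) (by fun_prop) (fun z hz => by
        ext1 a
        rw [T.fderiv_special (F.mdiff u₁ hu₁ z) (F.mem u₁ hu₁ z).1
          (Eventually.of_forall fun w => (F.mem u₁ hu₁ w).2) he (hsrc z hz), F.theta_eq u₁ hu₁]
        simp [fderiv_sub_const]) (Metric.mem_ball_self hδ) (by simp)
    exact this
  refine ⟨e, he, hxe, δ, hδ, fun z₁ hz₁ hcont => ?_⟩
  have hc1 : ContinuousAt (fun u => (e (h u z₁)).2) u₁ :=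
    continuous_snd.continuousAt.comp
      (ContinuousAt.comp (f := fun u => h u z₁) (e.continuousAt (hsrc z₁ hz₁)) hcont)
  filter_upwards [hcont (e.open_source.mem_nhds (hsrc z₁ hz₁)),
    hc1 (Metric.ball_mem_nhds _ (by positivity : 0 < r / 4)), F.isOpen.mem_nhds hu₁,
    Metric.ball_mem_nhds u₁ hr] with u hus huζ huB hur
  have htm : ∀ z ∈ Metric.ball z₀ δ, (u, (e (h u z₁)).2 + (z - z₁)) ∈ e.target := by
    intro z hz
    rw [htgt]
    refine ⟨hur, ?_⟩
    have h1 : ‖(e (h u z₁)).2 - (e (h u₁ z₁)).2‖ < r / 4 := by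
      rw [← dist_eq_norm]; exact huζ
    have h2 : ‖z - z₀‖ < r / 4 := by
      rw [← dist_eq_norm]; exact lt_of_lt_of_le hz (min_le_right _ _)
    rw [hζ z₁ hz₁] at h1
    have h3 : (e (h u z₁)).2 + (z - z₁) - (e (h u₁ z₀)).2 =
      ((e (h u z₁)).2 - ((e (h u₁ z₀)).2 + (z₁ - z₀))) + (z - z₀) := by abel
    rw [Metric.mem_ball, dist_eq_norm, h3]
    refine lt_of_le_of_lt (norm_add_le _ _) ?_
    linarith
  refine ⟨hus, fun z hz => ⟨htm z hz, ?_⟩⟩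
  have hk : ∀ z, HasFDerivAt (fun z => (u, (e (h u z₁)).2 + (z - z₁)))
      (ContinuousLinearMap.inr ℂ (Cn g) (Cn g)) z := fun z => by
    refine (hasFDerivAt_const u z).prodMk ?_
    exact ((hasFDerivAt_id z).sub_const z₁).const_add _
  have hmd : ∀ z ∈ Metric.ball z₀ δ, MDifferentiableAt 𝓘(ℂ, Cn g) 𝓘(ℂ, Cn (2 * g))
      (fun z => e.symm (u, (e (h u z₁)).2 + (z - z₁))) z := fun z hz =>
    mdifferentiableAt_symm_comp he (hk z).differentiableAt (htm z hz)
  have hmem : ∀ z ∈ Metric.ball z₀ δ, e.symm (u, (e (h u z₁)).2 + (z - z₁)) ∈ O ∧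
      q (e.symm (u, (e (h u z₁)).2 + (z - z₁))) = u := fun z hz => by
    have h1 := e.map_target (htm z hz)
    refine ⟨he.subset h1, ?_⟩
    rw [← he.fst_eq _ h1, e.right_inv (htm z hz)]
  refine T.eqOn_of_pullTheta_eq hσ Metric.isOpen_ball (Metric.isPreconnected_ball (x := z₀) (r := δ))
    (F.mdiff u huB).mdifferentiableOn (fun z hz => (hmd z hz).mdifferentiableWithinAt)
    (fun w _ => F.mem u huB w) hmem (fun w hw a => ?_) hz₁ ?_ hz
  · rw [F.theta_eq u huB, ← T.fderiv_special (hmd w hw) (hmem w hw).1 (by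
      filter_upwards [Metric.isOpen_ball.mem_nhds hw] with w' hw' using (hmem w' hw').2) he
      (e.map_target (htm w hw))]
    have h1 : HasFDerivAt (fun z => (e (e.symm (u, (e (h u z₁)).2 + (z - z₁)))).2)
        (ContinuousLinearMap.id ℂ (Cn g)) w := by
      refine (((hasFDerivAt_id w).sub_const z₁).const_add (e (h u z₁)).2).congr_of_eventuallyEq ?_
      filter_upwards [Metric.isOpen_ball.mem_nhds hw] with w' hw'
      rw [e.right_inv (htm w' hw')]
      rfl
    rw [h1.fderiv]
    rfl
  · simp only [sub_self, add_zero]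
    refine e.injOn hus (e.map_target (by simpa using htm z₁ hz₁)) ?_
    rw [e.right_inv (by simpa using htm z₁ hz₁)]
    ext1
    · rw [he.fst_eq _ hus, (F.mem u huB z₁).2]
    · rfl

/-- Normalized uniformizations depend holomorphically on the fibre. -/
theorem IsFiberExp.eventually_mdifferentiableAt (F : IsFiberExp σ O q B h)
    (T : IsTorusFibration σ O D q)
    (hσ : IsHolomorphicSymplectic σ) {u₁ : Cn g} (hu₁ : u₁ ∈ B) (z : Cn g) :
    ∀ᶠ u in 𝓝 u₁, MDifferentiableAt 𝓘(ℂ, Cn g) 𝓘(ℂ, Cn (2 * g)) (fun u => h u z) u := by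
  -- This set contains `0`, where `h` is a holomorphic section by hypothesis, and the uniform steps
  -- make it open and closed in `ℂᵍ`.
  set R := {z | ∀ᶠ u in 𝓝 u₁, MDifferentiableAt 𝓘(ℂ, Cn g) 𝓘(ℂ, Cn (2 * g)) (fun u => h u z) u}
  have hstep : ∀ z₀, ∃ δ > 0, ∀ z₁ ∈ Metric.ball z₀ δ, z₁ ∈ R → ∀ z ∈ Metric.ball z₀ δ, z ∈ R := by
    intro z₀
    obtain ⟨e, he, -, δ, hδ, hall⟩ := F.exists_step T hσ hu₁ z₀
    refine ⟨δ, hδ, fun z₁ hz₁ hR z hz => ?_⟩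
    have hR' : ∀ᶠ u in 𝓝 u₁, MDifferentiableAt 𝓘(ℂ, Cn g) 𝓘(ℂ, Cn (2 * g)) (fun u => h u z₁) u := hR
    have h1 := hall z₁ hz₁ hR'.self_of_nhds.continuousAt
    filter_upwards [hR', h1.eventually_nhds] with u hu1 hu2
    have hus := hu2.self_of_nhds.1
    have hut := (hu2.self_of_nhds.2 z hz).1
    have hd := (hasFDerivAt_comp (n := 2 * g) (H := fun u => h u z₁)
      (he.mdiff.mdifferentiableAt hus) hu1).differentiableAt
    refine (mdifferentiableAt_symm_comp he (k := fun u => (u, (e (h u z₁)).2 + (z - z₁)))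
      (differentiableAt_id.prodMk (hd.snd.add_const _)) hut).congr_of_eventuallyEq ?_
    filter_upwards [hu2] with u' hu' using (hu'.2 z hz).2
  have hopen : IsOpen R := by
    rw [Metric.isOpen_iff]
    intro z₀ hz₀
    obtain ⟨δ, hδ, hall⟩ := hstep z₀
    exact ⟨δ, hδ, hall z₀ (Metric.mem_ball_self hδ) hz₀⟩
  have hclosed : IsClosed R := by
    refine isClosed_of_closure_subset fun z₀ hz₀ => ?_
    obtain ⟨δ, hδ, hall⟩ := hstep z₀
    obtain ⟨z₁, hz₁, hR⟩ := mem_closure_iff_nhds.1 hz₀ _ (Metric.ball_mem_nhds z₀ hδ)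
    exact hall z₁ hz₁ hR z₀ (Metric.mem_ball_self hδ)
  have h0 : (0 : Cn g) ∈ R := by
    show ∀ᶠ u in 𝓝 u₁, _
    filter_upwards [F.isOpen.mem_nhds hu₁] with u hu
    exact F.mdiff_zero.mdifferentiableAt (F.isOpen.mem_nhds hu)
  have := IsClopen.eq_univ ⟨hclosed, hopen⟩ ⟨0, h0⟩
  have hz : z ∈ R := this ▸ mem_univ z
  exact hz

/-- The local form of the uniformizations of the fibres. -/
theorem IsFiberExp.exists_local_form (F : IsFiberExp σ O q B h) (T : IsTorusFibration σ O D q)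
    (hσ : IsHolomorphicSymplectic σ) {u₁ : Cn g} (hu₁ : u₁ ∈ B) (z₁ : Cn g) :
    ∃ (e : OpenPartialHomeomorph X (Cn g × Cn g)) (ζ : Cn g → Cn g) (ε : ℝ),
      IsSpecialChart σ O q e ∧ 0 < ε ∧
      Metric.ball u₁ ε ⊆ B ∧ DifferentiableOn ℂ ζ (Metric.ball u₁ ε) ∧
      ∀ u ∈ Metric.ball u₁ ε, ∀ z ∈ Metric.ball z₁ ε,
        (u, ζ u + (z - z₁)) ∈ e.target ∧ h u z = e.symm (u, ζ u + (z - z₁)) := by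
  obtain ⟨e, he, -, δ, hδ, hall⟩ := F.exists_step T hσ hu₁ z₁
  have hR := F.eventually_mdifferentiableAt T hσ hu₁ z₁
  have h1 := hall z₁ (Metric.mem_ball_self hδ) hR.self_of_nhds.continuousAt
  obtain ⟨ε, hε, hball⟩ := Metric.mem_nhds_iff.1 (h1.and (hR.and (F.isOpen.mem_nhds hu₁)))
  refine ⟨e, fun u => (e (h u z₁)).2, min ε δ, he, lt_min hε hδ, fun u hu => ?_, fun u hu => ?_,
    fun u hu z hz => ?_⟩
  · exact (hball (Metric.ball_subset_ball (min_le_left _ _) hu)).2.2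
  · have h2 := hball (Metric.ball_subset_ball (min_le_left _ _) hu)
    exact (hasFDerivAt_comp (n := 2 * g) (H := fun u => h u z₁)
      (he.mdiff.mdifferentiableAt h2.1.1) h2.2.1).differentiableAt.snd.differentiableWithinAt
  · exact (hball (Metric.ball_subset_ball (min_le_left _ _) hu)).1.2 z
      (Metric.ball_subset_ball (min_le_right _ _) hz)

theorem IsFiberExp.mdifferentiableOn (F : IsFiberExp σ O q B h) (T : IsTorusFibration σ O D q)
    (hσ : IsHolomorphicSymplectic σ) :
    MDifferentiableOn 𝓘(ℂ, Cn g × Cn g) 𝓘(ℂ, Cn (2 * g)) (fun w : Cn g × Cn g => h w.1 w.2)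
      (B ×ˢ univ) := by
  rintro ⟨u₁, z₁⟩ ⟨hu₁, -⟩
  obtain ⟨e, ζ, ε, he, hε, hB, hζ, hall⟩ := F.exists_local_form T hσ hu₁ z₁
  refine MDifferentiableAt.mdifferentiableWithinAt ?_
  have hu := Metric.mem_ball_self (x := u₁) hε
  have hz := Metric.mem_ball_self (x := z₁) hε
  refine (mdifferentiableAt_symm_comp he (k := fun w : Cn g × Cn g => (w.1, ζ w.1 + (w.2 - z₁)))
    ?_ (hall u₁ hu z₁ hz).1).congr_of_eventuallyEq ?_
  · refine DifferentiableAt.prodMk (by fun_prop) (DifferentiableAt.add ?_ (by fun_prop))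
    exact (hζ.differentiableAt (Metric.isOpen_ball.mem_nhds hu)).comp (u₁, z₁) differentiableAt_fst
  · filter_upwards [prod_mem_nhds (Metric.ball_mem_nhds u₁ hε) (Metric.ball_mem_nhds z₁ hε)]
      with w hw using (hall w.1 hw.1 w.2 hw.2).2

/-- Holomorphic sections lift to the universal covering of the fibres. -/
theorem IsFiberExp.exists_lift (F : IsFiberExp σ O q B h) (T : IsTorusFibration σ O D q)
    (hσ : IsHolomorphicSymplectic σ) {u₁ : Cn g} (hu₁ : u₁ ∈ B) {s : Cn g → X}
    (hs : ∀ᶠ u in 𝓝 u₁, MDifferentiableAt 𝓘(ℂ, Cn g) 𝓘(ℂ, Cn (2 * g)) s u)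
    (hsq : ∀ᶠ u in 𝓝 u₁, q (s u) = u) {a : Cn g} (ha : h u₁ a = s u₁) :
    ∃ (α : Cn g → Cn g) (ε : ℝ), 0 < ε ∧ Metric.ball u₁ ε ⊆ B ∧
      DifferentiableOn ℂ α (Metric.ball u₁ ε) ∧ α u₁ = a ∧
      ∀ u ∈ Metric.ball u₁ ε, h u (α u) = s u := by
  obtain ⟨e, ζ, ε, he, hε, hB, hζ, hall⟩ := F.exists_local_form T hσ hu₁ a
  have hu := Metric.mem_ball_self (x := u₁) hε
  have hz := Metric.mem_ball_self (x := a) hε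
  have hes : ∀ u ∈ Metric.ball u₁ ε, ∀ z ∈ Metric.ball a ε,
      h u z ∈ e.source ∧ e (h u z) = (u, ζ u + (z - a)) := fun u hu z hz => by
    have h1 := hall u hu z hz
    rw [h1.2]
    exact ⟨e.map_target h1.1, e.right_inv h1.1⟩
  have hsc := hs.self_of_nhds.continuousAt
  have hsu : s u₁ ∈ e.source := ha ▸ (hes u₁ hu a hz).1
  -- The special coordinate of `h u z` is `ζ u + (z - a)`; solving for the coordinate of `s u` gives
  -- the lift.
  set α : Cn g → Cn g := fun u => a + ((e (s u)).2 - ζ u)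
  have hα₁ : α u₁ = a := by
    simp only [α]
    rw [← ha, (hes u₁ hu a hz).2]
    simp
  have hαc : ContinuousAt α u₁ := by
    refine continuousAt_const.add (ContinuousAt.sub ?_ ?_)
    · exact continuous_snd.continuousAt.comp ((e.continuousAt hsu).comp hsc)
    · exact hζ.continuousOn.continuousAt (Metric.isOpen_ball.mem_nhds hu)
  have hev := (hsc.eventually (e.open_source.mem_nhds hsu)).and (hs.and (hsq.and
    ((hαc.eventually (Metric.ball_mem_nhds _ hε)).and (Metric.ball_mem_nhds u₁ hε))))
  obtain ⟨ε', hε', hball⟩ := Metric.mem_nhds_iff.1 hev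
  refine ⟨α, ε', hε', fun u hu => hB (hball hu).2.2.2.2, fun u hu => ?_, hα₁, fun u hu => ?_⟩
  · obtain ⟨h1, h2, h3, h4, h5⟩ := hball hu
    refine DifferentiableAt.differentiableWithinAt ?_
    refine (DifferentiableAt.sub ?_ ?_).const_add _
    · exact (hasFDerivAt_comp (n := 2 * g) (he.mdiff.mdifferentiableAt h1) h2).differentiableAt.snd
    · exact hζ.differentiableAt (Metric.isOpen_ball.mem_nhds h5)
  · obtain ⟨h1, h2, h3, h4, h5⟩ := hball hu
    have h4' : α u ∈ Metric.ball a ε := by rw [← hα₁]; exact h4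
    obtain ⟨h6, h7⟩ := hes u h5 _ h4'
    refine e.injOn h6 h1 ?_
    rw [h7]
    ext1
    · rw [he.fst_eq _ h1, h3]
    · simp [α]

end Families

end LagrangianFibration

namespace LagrangianFibration

/-! ### Translations of the fibers and their periods -/

section Periods

variable {g : ℕ} {X : Type*} [TopologicalSpace X] [ChartedSpace (Cn (2 * g)) X]
  {σ : ∀ x : X, TX (2 * g) x [⋀^Fin 2]→L[ℂ] ℂ} {O : Set X} {D : Set (Cn g)} {q : X → Cn g}

/-- The restriction of a Lagrangian fibration to a base chart. -/
theorem BaseChart.isTorusFibration {N : ℕ} {P : Type*} [TopologicalSpace P]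
    [ChartedSpace (Cn N) P] {p : X → P} {c : Cn g} {δ : ℝ} {ψ : Cn g → P} {ρ : P → Cn g} {S : Set P}
    (hp : IsLagrangianFibration g N σ p) (h : BaseChart N p c δ ψ ρ S) :
    IsTorusFibration σ (p ⁻¹' (ψ '' Metric.ball c δ)) (Metric.ball c δ) (ρ ∘ p) := by
  obtain ⟨V, hV, hVe⟩ := h.isLocalParam.isOpen_image _ subset_rfl Metric.isOpen_ball
  have hO : IsOpen (p ⁻¹' (ψ '' Metric.ball c δ)) := by
    rw [hVe, preimage_inter, preimage_range, univ_inter]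
    exact hV.preimage hp.holomorphic.continuous
  have hWp : MapsTo p (p ⁻¹' (ψ '' Metric.ball c δ)) S := by
    rintro x ⟨u, hu, hux⟩
    rw [← hux]
    exact h.mem_W u hu
  have hq : MDifferentiableOn 𝓘(ℂ, Cn (2 * g)) 𝓘(ℂ, Cn g) (ρ ∘ p) (p ⁻¹' (ψ '' Metric.ball c δ)) :=
    h.mdiff.comp hp.holomorphic.mdifferentiableOn hWp
  have hqm : MapsTo (ρ ∘ p) (p ⁻¹' (ψ '' Metric.ball c δ)) (Metric.ball c δ) := by
    rintro x ⟨u, hu, hux⟩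
    show ρ (p x) ∈ _
    rwa [← hux, h.left_inv u hu]
  have hψq : ∀ x ∈ p ⁻¹' (ψ '' Metric.ball c δ), p x = ψ ((ρ ∘ p) x) := by
    rintro x ⟨u, hu, hux⟩
    show p x = ψ (ρ (p x))
    rw [← hux, h.left_inv u hu]
  have hdp : ∀ x ∈ p ⁻¹' (ψ '' Metric.ball c δ), ∀ v, holDeriv (2 * g) N p x v =
      mfderiv 𝓘(ℂ, Cn g) 𝓘(ℂ, Cn N) ψ ((ρ ∘ p) x) (vderiv (2 * g) (ρ ∘ p) x v) := by
    intro x hx v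
    have h1 := ((h.isLocalParam.holomorphic.mdifferentiableAt
      (Metric.isOpen_ball.mem_nhds (hqm hx))).hasMFDerivAt.comp x
      (hq.mdifferentiableAt (hO.mem_nhds hx)).hasMFDerivAt).congr_of_eventuallyEq (f₁ := p) (by
        filter_upwards [hO.mem_nhds hx] with y hy using hψq y hy)
    exact congrArg (fun L : Cn (2 * g) →L[ℂ] Cn N => L v) h1.mfderiv
  refine ⟨hO, Metric.isOpen_ball, hq, hqm, fun x hx => ?_, fun u hu => ?_, fun x hx v w hv hw => ?_⟩
  · have h1 := (h.subset_regular hx).2 x rfl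
    set L : Cn (2 * g) →ₗ[ℂ] Cn g := (vderiv (2 * g) (ρ ∘ p) x).toLinearMap
    set A : Cn g →ₗ[ℂ] Cn N := (mfderiv 𝓘(ℂ, Cn g) 𝓘(ℂ, Cn N) ψ ((ρ ∘ p) x)).toLinearMap
    have h2 : (holDeriv (2 * g) N p x).toLinearMap = A ∘ₗ L := LinearMap.ext (hdp x hx)
    rw [h2] at h1
    have h3 : Module.finrank ℂ (LinearMap.range L) = Module.finrank ℂ (Cn g) := by
      refine le_antisymm (Submodule.finrank_le _) ?_
      rw [Module.finrank_fin_fun]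
      exact h1.symm.le.trans (finrank_range_comp_le_left A L)
    exact LinearMap.range_eq_top.1 (Submodule.eq_top_of_finrank_eq h3)
  · have h1 : p ⁻¹' (ψ '' Metric.ball c δ) ∩ (ρ ∘ p) ⁻¹' {u} = p ⁻¹' {ψ u} := by
      ext x
      constructor
      · rintro ⟨hx, hxu⟩
        have hxu' : (ρ ∘ p) x = u := hxu
        show p x = ψ u
        rw [hψq x hx, hxu']
      · intro hx
        have hx' : p x = ψ u := hx
        refine ⟨⟨u, hu, hx'.symm⟩, ?_⟩
        show ρ (p x) = u
        rw [hx', h.left_inv u hu]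
    rw [h1]
    exact hp.torus _ (h.subset_regular ⟨u, hu, rfl⟩)
  · refine hp.lagrangian x (h.subset_regular hx) v w ?_ ?_
    · rw [hdp x hx, hv]
      exact map_zero _
    · rw [hdp x hx, hw]
      exact map_zero _

/-- Since `q ∘ f = q`, the differential of `f` sends lifts of a vector of the base to lifts of the
same vector; the invariance of `σ` concludes. -/
theorem IsTorusFibration.theta_mfderiv (T : IsTorusFibration σ O D q) {f : X → X} {x : X}
    (hx : x ∈ O) (hfx : f x ∈ O)
    (hf : MDifferentiableAt 𝓘(ℂ, Cn (2 * g)) 𝓘(ℂ, Cn (2 * g)) f x)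
    (hqf : ∀ᶠ y in 𝓝 x, q (f y) = q y)
    (hfσ : (σ (f x)).compContinuousLinearMap (holDeriv (2 * g) (2 * g) f x) = σ x)
    {v : TX (2 * g) x} (hv : vderiv (2 * g) q x v = 0) :
    theta σ q (f x) (holDeriv (2 * g) (2 * g) f x v) = theta σ q x v := by
  have hd : ∀ w, vderiv (2 * g) q (f x) (holDeriv (2 * g) (2 * g) f x w) = vderiv (2 * g) q x w := by
    intro w
    have h1 := ((T.mdiff.mdifferentiableAt (T.isOpen.mem_nhds hfx)).hasMFDerivAt.comp x
      hf.hasMFDerivAt).congr_of_eventuallyEq (f₁ := q) (by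
        filter_upwards [hqf] with y hy using hy.symm)
    exact (congrArg (fun L : Cn (2 * g) →L[ℂ] Cn g => L w) h1.mfderiv).symm
  ext i
  obtain ⟨w, hw⟩ := T.submersion x hx (Pi.single i 1)
  rw [T.theta_eq hx hv hw, T.theta_eq hfx (w := holDeriv (2 * g) (2 * g) f x w) (by rw [hd, hv])
    (by rw [hd, hw]), ← hfσ, ContinuousAlternatingMap.compContinuousLinearMap_apply]
  refine congrArg (σ (f x)) (funext fun j => ?_)
  fin_cases j <;> rfl

variable [IsManifold 𝓘(ℂ, Cn (2 * g)) ω X] {B : Set (Cn g)} {h : Cn g → Cn g → X}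

/-- Only the origins `h u 0` are chosen holomorphically, as a section that is constant in a special
chart. The uniformizations are chosen fiber by fiber; the normalization leaves no freedom, and their
holomorphic dependence on `u` is automatic. -/
theorem IsTorusFibration.exists_isFiberExp (T : IsTorusFibration σ O D q)
    (hσ : IsHolomorphicSymplectic σ) {u₀ : Cn g} (hu₀ : u₀ ∈ D) :
    ∃ (B : Set (Cn g)) (h : Cn g → Cn g → X), IsFiberExp σ O q B h ∧ u₀ ∈ B := by
  obtain ⟨Λ, π, -, -, -, -, hrange, -⟩ := T.torus u₀ hu₀
  have hx₀ : π 0 ∈ O ∩ q ⁻¹' {u₀} := hrange ▸ mem_range_self 0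
  obtain ⟨e, r, he, hr, hxe, htgt⟩ := T.exists_special_chart hσ hx₀.1
  have hqx : q (π 0) = u₀ := hx₀.2
  rw [hqx] at htgt
  have htm : ∀ u ∈ Metric.ball u₀ r, (u, (e (π 0)).2) ∈ e.target := fun u hu => by
    rw [htgt]; exact ⟨hu, Metric.mem_ball_self hr⟩
  set s : Cn g → X := fun u => e.symm (u, (e (π 0)).2)
  have hs : ∀ u ∈ Metric.ball u₀ r, s u ∈ O ∧ q (s u) = u := fun u hu => by
    have h1 := e.map_target (htm u hu)
    refine ⟨he.subset h1, ?_⟩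
    rw [← he.fst_eq _ h1, e.right_inv (htm u hu)]
  have hex : ∀ u, ∃ h : Cn g → X, u ∈ Metric.ball u₀ r → ∃ b : Module.Basis (Fin (2 * g)) ℝ (Cn g),
      MDifferentiable 𝓘(ℂ, Cn g) 𝓘(ℂ, Cn (2 * g)) h ∧ h 0 = s u ∧ (∀ z, h z ∈ O ∧ q (h z) = u) ∧
      (∀ y ∈ O, q y = u → ∃ z, h z = y) ∧ (∀ z a, pullTheta σ q h z a = a) ∧
      ∀ z w, h z = h w ↔ ∃ k : Fin (2 * g) → ℤ, z - w = ∑ i, k i • b i := by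
    intro u
    by_cases hu : u ∈ Metric.ball u₀ r
    · obtain ⟨h, b, hh⟩ := T.exists_fiberExp hσ (hs u hu).1
      rw [(hs u hu).2] at hh
      exact ⟨h, fun _ => ⟨b, hh⟩⟩
    · exact ⟨π, fun h => absurd h hu⟩
  choose h hh using hex
  refine ⟨Metric.ball u₀ r, h, ⟨Metric.isOpen_ball, fun u hu => ?_, fun u hu => ?_, fun u hu => ?_,
    fun u hu => ?_, fun u hu => ?_, ?_⟩, Metric.mem_ball_self hr⟩
  · obtain ⟨b, h1, h2, h3, h4, h5, h6⟩ := hh u hu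
    exact h1
  · obtain ⟨b, h1, h2, h3, h4, h5, h6⟩ := hh u hu
    exact h3
  · obtain ⟨b, h1, h2, h3, h4, h5, h6⟩ := hh u hu
    exact h4
  · obtain ⟨b, h1, h2, h3, h4, h5, h6⟩ := hh u hu
    exact h5
  · obtain ⟨b, h1, h2, h3, h4, h5, h6⟩ := hh u hu
    exact ⟨b, h6⟩
  · have h1 : MDifferentiableOn 𝓘(ℂ, Cn g) 𝓘(ℂ, Cn (2 * g)) s (Metric.ball u₀ r) := fun u hu =>
      (mdifferentiableAt_symm_comp he (k := fun u => (u, (e (π 0)).2)) (by fun_prop)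
        (htm u hu)).mdifferentiableWithinAt
    refine h1.congr fun u hu => ?_
    obtain ⟨b, -, h2, -⟩ := hh u hu
    exact h2

variable [T2Space X]

/-- Symplectic automorphisms over the base are translations of the fibres. -/
theorem IsFiberExp.map_eq (F : IsFiberExp σ O q B h) (T : IsTorusFibration σ O D q)
    (hσ : IsHolomorphicSymplectic σ) {f : X → X}
    (hf : MDifferentiable 𝓘(ℂ, Cn (2 * g)) 𝓘(ℂ, Cn (2 * g)) f) (hfO : MapsTo f O O)
    (hqf : ∀ y ∈ O, q (f y) = q y)
    (hfσ : ∀ x, (σ (f x)).compContinuousLinearMap (holDeriv (2 * g) (2 * g) f x) = σ x)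
    {u : Cn g} (hu : u ∈ B) {a : Cn g} (ha : h u a = f (h u 0)) (z : Cn g) :
    f (h u z) = h u (z + a) := by
  have hk : ∀ z, HasFDerivAt (fun z => z + a) (ContinuousLinearMap.id ℂ (Cn g)) z := fun z =>
    (hasFDerivAt_id z).add_const a
  -- Both maps pull `theta` back to the identity, because `f` preserves `theta`, and they agree at
  -- `z = 0`.
  refine T.eqOn_of_pullTheta_eq hσ isOpen_univ isPreconnected_univ (H₁ := fun z => f (h u z))
    (H₂ := fun z => h u (z + a)) (u := u) (fun z _ => ?_) (fun z _ => ?_) (fun z _ => ?_)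
    (fun z _ => F.mem u hu _) (fun z _ b => ?_) (mem_univ 0) (by simp [ha]) (mem_univ z)
  · exact ((hf _).comp z (F.mdiff u hu z)).mdifferentiableWithinAt
  · exact ((F.mdiff u hu _).comp z (hk z).differentiableAt.mdifferentiableAt).mdifferentiableWithinAt
  · exact ⟨hfO (F.mem u hu z).1, by rw [hqf _ (F.mem u hu z).1, (F.mem u hu z).2]⟩
  · rw [pullTheta_comp (F.mdiff u hu _) (hk z), F.theta_eq u hu, ContinuousLinearMap.id_apply]
    have h1 : pderiv (2 * g) (fun z => f (h u z)) z =
        (holDeriv (2 * g) (2 * g) f (h u z)).comp (pderiv (2 * g) (h u) z) :=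
      ((hf _).hasMFDerivAt.comp z (F.mdiff u hu z).hasMFDerivAt).mfderiv
    rw [pullTheta_apply, h1]
    have h2 := T.theta_mfderiv (F.mem u hu z).1 (hfO (F.mem u hu z).1) (hf _) (by
      filter_upwards [T.isOpen.mem_nhds (F.mem u hu z).1] with y hy using hqf y hy) (hfσ _)
      (T.vderiv_pderiv_eq_zero (F.mdiff u hu z) (F.mem u hu z).1
        (Eventually.of_forall fun w => (F.mem u hu w).2) b)
    refine h2.trans ?_
    rw [← pullTheta_apply, F.theta_eq u hu]

omit [IsManifold 𝓘(ℂ, Cn (2 * g)) ω X] [T2Space X] in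
theorem IsFiberExp.exists_submodule (F : IsFiberExp σ O q B h) {u : Cn g} (hu : u ∈ B) :
    ∃ Λ : Submodule ℤ (Cn g), ∀ z w, h u z = h u w ↔ z - w ∈ Λ := by
  obtain ⟨b, hb⟩ := F.lattice u hu
  refine ⟨Submodule.span ℤ (range b), fun z w => ?_⟩
  rw [hb, Submodule.mem_span_range_iff_exists_fun]
  exact ⟨fun ⟨k, hk⟩ => ⟨k, hk.symm⟩, fun ⟨k, hk⟩ => ⟨k, hk.symm⟩⟩

/-- The periods of the fibres. -/
theorem IsFiberExp.exists_periods (F : IsFiberExp σ O q B h) (T : IsTorusFibration σ O D q)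
    (hσ : IsHolomorphicSymplectic σ) {u₀ : Cn g} (hu₀ : u₀ ∈ B) :
    ∃ (ℓ : Fin (2 * g) → Cn g → Cn g), ∀ᶠ u in 𝓝 u₀, u ∈ B ∧ (∀ j, DifferentiableAt ℂ (ℓ j) u) ∧
      LinearIndependent ℝ (fun j => ℓ j u) ∧
      ∀ z w, h u z = h u w ↔ ∃ k : Fin (2 * g) → ℤ, z - w = ∑ i, k i • ℓ i u := by
  obtain ⟨b, hb⟩ := F.lattice u₀ hu₀
  -- A period of the fiber over `u₀` is a lift of the origin; it extends to a holomorphic lift of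
  -- the section of origins, which is a period of each nearby fiber.
  have hlift : ∀ j, ∃ α : Cn g → Cn g, α u₀ = b j ∧
      ∀ᶠ u in 𝓝 u₀, DifferentiableAt ℂ α u ∧ h u (α u) = h u 0 := by
    intro j
    have hs : ∀ᶠ u in 𝓝 u₀, u ∈ B := F.isOpen.mem_nhds hu₀
    obtain ⟨α, ε, hε, hsub, hα, hα0, hall⟩ := F.exists_lift T hσ hu₀ (s := fun u => h u 0) (a := b j)
      (hs.mono fun u hu => F.mdiff_zero.mdifferentiableAt (F.isOpen.mem_nhds hu))
      (hs.mono fun u hu => (F.mem u hu 0).2)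
      ((hb _ _).2 ⟨Pi.single j 1, by
        rw [Finset.sum_eq_single j (fun i _ hij => by simp [hij]) (by simp)]; simp⟩)
    refine ⟨α, hα0, ?_⟩
    filter_upwards [Metric.ball_mem_nhds u₀ hε] with u hu
    exact ⟨hα.differentiableAt (Metric.isOpen_ball.mem_nhds hu), hall u hu⟩
  choose ℓ hℓ0 hℓ using hlift
  have hℓ' : ∀ᶠ u in 𝓝 u₀, ∀ j, DifferentiableAt ℂ (ℓ j) u ∧ h u (ℓ j u) = h u 0 :=
    eventually_all.2 hℓ
  have hℓc : ∀ j, ContinuousAt (ℓ j) u₀ := fun j => (hℓ j).self_of_nhds.1.continuousAt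
  have hind : ∀ᶠ u in 𝓝 u₀, LinearIndependent ℝ (fun j => ℓ j u) := by
    have h1 : ContinuousAt (fun u => (b.toMatrix (fun j => ℓ j u)).det) u₀ := by
      refine Continuous.matrix_det continuous_id |>.continuousAt.comp ?_
      refine continuousAt_pi.2 fun i => continuousAt_pi.2 fun j => ?_
      exact (b.coord i).continuous_of_finiteDimensional.continuousAt.comp (hℓc j)
    have h2 : (b.toMatrix (fun j => ℓ j u₀)).det ≠ 0 := by
      simp [hℓ0]
    filter_upwards [h1.eventually_ne h2] with u hu
    exact (b.is_basis_iff_det.2 (by rw [Module.Basis.det_apply]; exact isUnit_iff_ne_zero.2 hu)).1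
  have hsumc : ∀ x : Fin (2 * g) → ℝ, ContinuousAt
      (fun w : Cn g × (Fin (2 * g) → ℝ) => ∑ j, w.2 j • ℓ j w.1) (u₀, x) := by
    intro x
    refine tendsto_finsetSum _ fun j _ => ?_
    refine Tendsto.smul (f := fun w : Cn g × (Fin (2 * g) → ℝ) => w.2 j)
      (g := fun w : Cn g × (Fin (2 * g) → ℝ) => ℓ j w.1) ?_ ?_
    · exact ((continuous_apply j).comp continuous_snd).continuousAt
    · exact ContinuousAt.comp (f := Prod.fst) (x := (u₀, x)) (hℓc j) continuousAt_fst
  -- No additional period appears in the centered unit cube for `u` near `u₀`: near `x = 0` by local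
  -- injectivity of `h u`, uniformly in `u`; elsewhere because `h u₀` takes there a value other than
  -- `h u₀ 0`, an open condition. Compactness of the cube makes the neighborhood of `u₀` uniform.
  have hcube : ∀ᶠ u in 𝓝 u₀, ∀ x ∈ Icc (fun _ => -(1 / 2) : Fin (2 * g) → ℝ) (fun _ => 1 / 2),
      h u (∑ j, x j • ℓ j u) = h u 0 → x = 0 := by
    refine isCompact_Icc.eventually_forall_of_forall_eventually fun x hx => ?_
    have hs := hsumc x
    by_cases hx0 : x = 0
    · subst hx0
      obtain ⟨e, ζ, ε, he, hε, hB, hζ, hall⟩ := F.exists_local_form T hσ hu₀ 0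
      have h1 : ∀ᶠ w : Cn g × (Fin (2 * g) → ℝ) in 𝓝 (u₀, 0),
          ∑ j, w.2 j • ℓ j w.1 ∈ Metric.ball (0 : Cn g) ε := by
        refine hs.eventually (Metric.isOpen_ball.mem_nhds ?_)
        simpa using hε
      have hfst : Tendsto Prod.fst (𝓝 (u₀, (0 : Fin (2 * g) → ℝ))) (𝓝 u₀) := continuousAt_fst
      filter_upwards [h1, hfst.eventually (Metric.ball_mem_nhds u₀ hε), hfst.eventually hind]
        with w hw1 hw2 hw3 heq
      have h2 := hall _ hw2 _ hw1
      have h3 := hall _ hw2 0 (Metric.mem_ball_self hε)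
      rw [h2.2, h3.2] at heq
      have h4 := e.symm.injOn h2.1 h3.1 heq
      have h5 : ∑ j, w.2 j • ℓ j w.1 = 0 := by
        have := congrArg Prod.snd h4
        simpa using this
      exact funext (Fintype.linearIndependent_iff.1 hw3 _ h5)
    · have hne : h u₀ (∑ j, x j • ℓ j u₀) ≠ h u₀ 0 := by
        intro heq
        obtain ⟨k, hk⟩ := (hb _ _).1 heq
        simp only [sub_zero, hℓ0] at hk
        have hk' : ∑ i, (x i - k i) • b i = 0 := by
          simp only [sub_smul, Finset.sum_sub_distrib, hk, Int.cast_smul_eq_zsmul, sub_self]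
        have h1 := Fintype.linearIndependent_iff.1 b.linearIndependent _ hk'
        refine hx0 (funext fun i => ?_)
        have h2 : x i = k i := sub_eq_zero.1 (h1 i)
        have h3 := hx.1 i
        have h4 := hx.2 i
        simp only [h2] at h3 h4
        have h5 : k i = 0 := by
          have h6 : (-1 : ℝ) < k i := by linarith
          have h7 : (k i : ℝ) < 1 := by linarith
          have h8 : -1 < k i := by exact_mod_cast h6
          have h9 : k i < 1 := by exact_mod_cast h7
          omega
        simp [h2, h5]
      have hF := F.mdifferentiableOn T hσ
      have hFc : ∀ z, ContinuousAt (fun w : Cn g × Cn g => h w.1 w.2) (u₀, z) := fun z =>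
        (hF.mdifferentiableAt ((F.isOpen.prod isOpen_univ).mem_nhds ⟨hu₀, mem_univ _⟩)).continuousAt
      have h1 : ContinuousAt (fun w : Cn g × (Fin (2 * g) → ℝ) =>
          (h w.1 (∑ j, w.2 j • ℓ j w.1), h w.1 0)) (u₀, x) := by
        refine ContinuousAt.prodMk ?_ ?_
        · exact ContinuousAt.comp (f := fun w : Cn g × (Fin (2 * g) → ℝ) =>
            (w.1, ∑ j, w.2 j • ℓ j w.1)) (hFc _) (continuousAt_fst.prodMk hs)
        · exact ContinuousAt.comp (g := fun w : Cn g × Cn g => h w.1 w.2)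
            (f := fun w : Cn g × (Fin (2 * g) → ℝ) => (w.1, (0 : Cn g))) (x := (u₀, x))
            (hFc 0) (continuousAt_fst.prodMk continuousAt_const)
      filter_upwards [h1.eventually (isClosed_diagonal.isOpen_compl.mem_nhds hne)] with w hw heq
      exact absurd heq hw
  refine ⟨ℓ, ?_⟩
  filter_upwards [hℓ', hind, hcube, F.isOpen.mem_nhds hu₀] with u h1 h2 h3 hu
  refine ⟨hu, fun j => (h1 j).1, h2, fun z w => ?_⟩
  obtain ⟨Λ, hΛ⟩ := F.exists_submodule hu
  have hmem : ∀ k : Fin (2 * g) → ℤ, ∑ i, k i • ℓ i u ∈ Λ := fun k =>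
    Λ.sum_mem fun i _ => Λ.smul_mem _ (by have := (hΛ _ _).1 (h1 i).2; rwa [sub_zero] at this)
  rw [hΛ]
  constructor
  · intro hzw
    have hspan : z - w ∈ Submodule.span ℝ (range fun j => ℓ j u) := by
      rw [h2.span_eq_top_of_card_eq_finrank' (by simp [Module.finrank_pi_fintype, mul_comm])]
      trivial
    obtain ⟨x, hx⟩ := (Submodule.mem_span_range_iff_exists_fun ℝ).1 hspan
    -- Rounding the coordinates moves a period into the centered cube, where only zero is left: the
    -- `ℓ_j` generate the lattice.
    refine ⟨fun i => round (x i), ?_⟩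
    have h4 : ∑ i, (x i - round (x i)) • ℓ i u = (z - w) - ∑ i, round (x i) • ℓ i u := by
      simp only [sub_smul, Finset.sum_sub_distrib, hx, Int.cast_smul_eq_zsmul]
    have h5 := h3 (fun i => x i - round (x i)) ⟨fun i => ?_, fun i => ?_⟩ ((hΛ _ _).2 (by
      rw [h4, sub_zero]; exact Λ.sub_mem hzw (hmem _)))
    · have h6 : ∑ i, (x i - round (x i)) • ℓ i u = 0 :=
        Finset.sum_eq_zero fun i _ => by rw [show x i - round (x i) = 0 from congrFun h5 i, zero_smul]
      exact sub_eq_zero.1 (h4.symm.trans h6)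
    · exact (abs_le.1 (abs_sub_round (x i))).1
    · exact (abs_le.1 (abs_sub_round (x i))).2
  · rintro ⟨k, hk⟩
    rw [hk]
    exact hmem k

end Periods

end LagrangianFibration

namespace LagrangianFibration

/-! ### Real differentials and smoothness of holomorphic maps -/

section RealDerivatives

theorem HasMFDerivAt.real {V W : Type*} [NormedAddCommGroup V] [NormedSpace ℂ V] [NormedSpace ℝ V]
    [IsScalarTower ℝ ℂ V] [NormedAddCommGroup W] [NormedSpace ℂ W] [NormedSpace ℝ W]
    [IsScalarTower ℝ ℂ W] {Y Z : Type*} [TopologicalSpace Y]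
    [ChartedSpace V Y] [TopologicalSpace Z] [ChartedSpace W Z] {F : Y → Z} {y : Y}
    {F' : V →L[ℂ] W} (h : HasMFDerivAt 𝓘(ℂ, V) 𝓘(ℂ, W) F y F') :
    HasMFDerivAt 𝓘(ℝ, V) 𝓘(ℝ, W) F y (F'.restrictScalars ℝ) :=
  ⟨h.1, HasFDerivWithinAt.restrictScalars ℝ h.2⟩

variable {n : ℕ} {X : Type*} [TopologicalSpace X] [ChartedSpace (Cn n) X]
  {V W : Type} [NormedAddCommGroup V] [NormedSpace ℝ V] [NormedAddCommGroup W] [NormedSpace ℝ W]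

/-- The real differential of a map from a real vector space to a complex manifold. -/
noncomputable def rderiv (n : ℕ) {X : Type*} [TopologicalSpace X] [ChartedSpace (Cn n) X]
    (H : W → X) (w : W) : W →L[ℝ] TX n (H w) :=
  mfderiv 𝓘(ℝ, W) 𝓘(ℝ, Cn n) H w

theorem rderiv_eq_pderiv {V : Type} [NormedAddCommGroup V] [NormedSpace ℂ V] [NormedSpace ℝ V]
    [IsScalarTower ℝ ℂ V] {H : V → X} {w : V} (hH : MDifferentiableAt 𝓘(ℂ, V) 𝓘(ℂ, Cn n) H w) (a : V) :
    rderiv n H w a = pderiv n H w a :=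
  congrArg (fun L : V →L[ℝ] Cn n => L a) (HasMFDerivAt.real hH.hasMFDerivAt).mfderiv

theorem rderiv_comp {H : V → X} {k : W → V} {w : W} {k' : W →L[ℝ] V}
    (hH : MDifferentiableAt 𝓘(ℝ, V) 𝓘(ℝ, Cn n) H (k w)) (hk : HasFDerivAt k k' w) :
    rderiv n (fun w => H (k w)) w = (rderiv n H (k w)).comp k' :=
  (hH.hasMFDerivAt.comp w hk.hasMFDerivAt).mfderiv

theorem hasFDerivAt_real_comp {V : Type} [NormedAddCommGroup V] [NormedSpace ℂ V] [NormedSpace ℝ V]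
    [IsScalarTower ℝ ℂ V] {e : X → V} {H : W → X} {w : W}
    (he : MDifferentiableAt 𝓘(ℂ, Cn n) 𝓘(ℂ, V) e (H w))
    (hH : MDifferentiableAt 𝓘(ℝ, W) 𝓘(ℝ, Cn n) H w) :
    HasFDerivAt (fun w => e (H w)) (((vderiv n e (H w)).restrictScalars ℝ).comp (rderiv n H w)) w :=
  ((HasMFDerivAt.real he.hasMFDerivAt).comp w hH.hasMFDerivAt).hasFDerivAt

theorem rderiv_map {f : X → X} {H : W → X} {w : W}
    (hf : MDifferentiableAt 𝓘(ℂ, Cn n) 𝓘(ℂ, Cn n) f (H w))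
    (hH : MDifferentiableAt 𝓘(ℝ, W) 𝓘(ℝ, Cn n) H w) (a : W) :
    rderiv n (fun w => f (H w)) w a = holDeriv n n f (H w) (rderiv n H w a) :=
  congrArg (fun L : W →L[ℝ] Cn n => L a)
    ((HasMFDerivAt.real hf.hasMFDerivAt).comp w hH.hasMFDerivAt).mfderiv

theorem contDiffAt_chart_comp {H : W → X} {w : W} {m : WithTop ℕ∞}
    (hH : ContMDiffAt 𝓘(ℝ, W) 𝓘(ℝ, Cn n) m H w) {x : X} (hx : H w = x) :
    ContDiffAt ℝ m (fun w => chartAt (Cn n) x (H w)) w := by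
  subst hx
  have h : ContDiffWithinAt ℝ m (fun y => chartAt (Cn n) (H w) (H y)) (range 𝓘(ℝ, W)) w :=
    (contMDiffAt_iff.1 hH).2
  rw [modelWithCornersSelf_coe, range_id] at h
  exact contDiffWithinAt_univ.1 h

/-- Holomorphic maps to a complex manifold are smooth. -/
theorem contMDiffAt_of_mdifferentiableOn [IsManifold 𝓘(ℂ, Cn n) ω X] {V : Type}
    [NormedAddCommGroup V] [NormedSpace ℂ V] [FiniteDimensional ℂ V] [NormedSpace ℝ V]
    [IsScalarTower ℝ ℂ V] {H : V → X} {S : Set V}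
    (hS : IsOpen S) (hH : MDifferentiableOn 𝓘(ℂ, V) 𝓘(ℂ, Cn n) H S) {w : V} (hw : w ∈ S) :
    ContMDiffAt 𝓘(ℝ, V) 𝓘(ℝ, Cn n) ∞ H w := by
  rw [contMDiffAt_iff]
  refine ⟨(hH.mdifferentiableAt (hS.mem_nhds hw)).continuousAt, ?_⟩
  set φ := chartAt (Cn n) (H w)
  have hS' : IsOpen (S ∩ H ⁻¹' φ.source) := hH.continuousOn.isOpen_inter_preimage hS φ.open_source
  have h1 : DifferentiableOn ℂ (fun w => φ (H w)) (S ∩ H ⁻¹' φ.source) := fun y hy =>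
    (hasFDerivAt_comp (n := n) ((chart_mdifferentiable (H w)).mdifferentiableAt hy.2)
      (hH.mdifferentiableAt (hS.mem_nhds hy.1))).differentiableAt.differentiableWithinAt
  have h2 := (contDiffOn_infty_of_differentiableOn hS' h1).restrict_scalars ℝ
  exact (h2.contDiffAt (hS'.mem_nhds ⟨hw, mem_chart_source _ _⟩)).contDiffWithinAt

theorem contMDiff_real_of_mdifferentiable [IsManifold 𝓘(ℂ, Cn n) ω X] {f : X → X}
    (hf : MDifferentiable 𝓘(ℂ, Cn n) 𝓘(ℂ, Cn n) f) : ContMDiff 𝓘(ℝ, Cn n) 𝓘(ℝ, Cn n) ∞ f := by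
  intro x
  rw [contMDiffAt_iff]
  refine ⟨hf.continuous.continuousAt, ?_⟩
  have h1 := contDiffOn_real_of_differentiableOn (isOpen_repSet hf.continuous x)
    (differentiableOn_rep hf x)
  exact (h1.contDiffAt ((isOpen_repSet hf.continuous x).mem_nhds
    (mem_repSet f x))).contDiffWithinAt

end RealDerivatives

/-! ### Betti coordinates over a chart of the base -/

section BettiCharts

variable {g : ℕ} {X : Type*} [TopologicalSpace X] [ChartedSpace (Cn (2 * g)) X]
  {σ : ∀ x : X, TX (2 * g) x [⋀^Fin 2]→L[ℂ] ℂ} {O : Set X} {D : Set (Cn g)} {q : X → Cn g}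

/-- Betti coordinates over an open subset `D` of `ℂᵍ`. -/
structure IsBettiChart (O : Set X) (D : Set (Cn g)) (q : X → Cn g) (f : X → X)
    (E : Cn g → (Fin (2 * g) → ℝ) → X) (t : Cn g → Fin (2 * g) → ℝ) : Prop where
  isOpen : IsOpen D
  smooth : ContMDiffOn 𝓘(ℝ, Cn g × (Fin (2 * g) → ℝ)) 𝓘(ℝ, Cn (2 * g)) ∞
      (fun w : Cn g × (Fin (2 * g) → ℝ) => E w.1 w.2) (D ×ˢ univ)
  mem : ∀ u ∈ D, ∀ x, E u x ∈ O ∧ q (E u x) = u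
  surj : ∀ u ∈ D, ∀ y ∈ O, q y = u → ∃ x, E u x = y
  periodic : ∀ u ∈ D, ∀ x y, E u x = E u y ↔ ∀ i, ∃ k : ℤ, x i - y i = k
  immersion : ∀ u ∈ D, ∀ x, Function.Injective
    (rderiv (2 * g) (fun w : Cn g × (Fin (2 * g) → ℝ) => E w.1 w.2) (u, x))
  map_eq : ∀ u ∈ D, ∀ x, f (E u x) = E u (x + t u)
  contDiffAt : ∀ u ∈ D, ContDiffAt ℝ ∞ t u

variable [IsManifold 𝓘(ℂ, Cn (2 * g)) ω X] [T2Space X]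

/-- By Liouville the pull-back of `theta` is constant, so a vector killed at one point is killed
everywhere and the map is constant along the complex line it spans. This contradicts the fact that
it identifies only points differing by integral vectors. -/
theorem IsTorusFibration.injective_of_periodic (T : IsTorusFibration σ O D q)
    (hσ : IsHolomorphicSymplectic σ) {u : Cn g} {F : (Fin (2 * g) → ℝ) → X}
    (hmem : ∀ x, F x ∈ O ∧ q (F x) = u)
    (hper : ∀ x y, F x = F y ↔ ∀ i, ∃ k : ℤ, x i - y i = k)
    (A : Cn g ≃L[ℝ] (Fin (2 * g) → ℝ))
    (hA : MDifferentiable 𝓘(ℂ, Cn g) 𝓘(ℂ, Cn (2 * g)) (fun z => F (A z))) {z a : Cn g}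
    (ha : pderiv (2 * g) (fun z => F (A z)) z a = 0) : a = 0 := by
  set H : Cn g → X := fun z => F (A z)
  have hHm : ∀ z, H z ∈ O ∧ q (H z) = u := fun z => hmem _
  have hconst := T.pullTheta_const hσ hA hHm
    (K := A.symm '' Icc (fun _ => (0 : ℝ)) (fun _ => 1)) (isCompact_Icc.image A.symm.continuous)
    (fun z => ⟨A.symm (fun i => Int.fract (A z i)), ⟨_, ⟨fun i => Int.fract_nonneg _,
      fun i => (Int.fract_lt_one _).le⟩, rfl⟩, fun w => by
      refine (hper _ _).2 fun i => ⟨⌊A z i⌋, ?_⟩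
      simp [Int.self_sub_fract]⟩)
  have h0 : ∀ w, pderiv (2 * g) H w a = 0 := by
    intro w
    refine T.eq_zero_of_theta hσ (hHm w).1 (T.vderiv_pderiv_eq_zero (hA w) (hHm w).1
      (Eventually.of_forall fun w => (hHm w).2) a) ?_
    rw [← pullTheta_apply, hconst w, ← hconst z, pullTheta_apply, ha, map_zero]
  have hk : ∀ s : ℂ, HasFDerivAt (fun s : ℂ => s • a) ((ContinuousLinearMap.id ℂ ℂ).smulRight a) s :=
    fun s => (hasFDerivAt_id s).smul_const a
  have hline : ∀ s : ℂ, H (s • a) = H ((0 : ℂ) • a) := by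
    intro s
    have hd : ∀ s : ℂ, MDifferentiableAt 𝓘(ℂ, ℂ) 𝓘(ℂ, Cn (2 * g)) (fun s : ℂ => H (s • a)) s :=
      fun s => (hA _).comp s (hk s).differentiableAt.mdifferentiableAt
    refine T.eqOn_of_pullTheta_eq hσ isOpen_univ isPreconnected_univ
      (H₁ := fun s : ℂ => H (s • a)) (H₂ := fun _ => H ((0 : ℂ) • a))
      (fun s _ => (hd s).mdifferentiableWithinAt) mdifferentiableOn_const (fun s _ => hHm _)
      (fun s _ => hHm _) (fun s _ b => ?_) (mem_univ 0) rfl (mem_univ s)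
    have h1 : pullTheta σ q (fun _ : ℂ => H ((0 : ℂ) • a)) s b = 0 := by
      have : pderiv (2 * g) (fun _ : ℂ => H ((0 : ℂ) • a)) s = 0 := mfderiv_const
      rw [pullTheta_apply, this]
      exact map_zero _
    rw [h1, pullTheta_comp (hA _) (hk s), pullTheta_apply]
    have h2 : ((ContinuousLinearMap.id ℂ ℂ).smulRight a) b = b • a := rfl
    rw [h2, map_smul, h0, smul_zero, map_zero]
  by_contra hne
  have hAa : A a ≠ 0 := fun h => hne (A.map_eq_zero_iff.1 h)
  obtain ⟨i, hi⟩ := Function.ne_iff.1 hAa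
  have hi' : A a i ≠ 0 := hi
  -- With this parameter the `i`-th Betti coordinate moves by one half, which is not an integer.
  have h1 := hline ((1 / (2 * A a i) : ℝ) : ℂ)
  obtain ⟨k, hk⟩ := (hper _ _).1 h1 i
  rw [zero_smul, map_zero, Complex.coe_smul, map_smul] at hk
  simp only [Pi.smul_apply, smul_eq_mul, Pi.zero_apply, sub_zero] at hk
  have h2 : (1 / (2 * A a i)) * A a i = 1 / 2 := by field_simp
  rw [h2] at hk
  have h3 : (1 : ℝ) = 2 * k := by linarith
  have h4 : (1 : ℤ) = 2 * k := by exact_mod_cast h3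
  omega

/-- The translation vector is smooth. -/
theorem contDiffAt_translation {f : X → X} (hf : MDifferentiable 𝓘(ℂ, Cn (2 * g)) 𝓘(ℂ, Cn (2 * g)) f)
    {E : Cn g → (Fin (2 * g) → ℝ) → X} {t : Cn g → Fin (2 * g) → ℝ} (hD : IsOpen D)
    (hE : ContMDiffOn 𝓘(ℝ, Cn g × (Fin (2 * g) → ℝ)) 𝓘(ℝ, Cn (2 * g)) ∞
      (fun w : Cn g × (Fin (2 * g) → ℝ) => E w.1 w.2) (D ×ˢ univ))
    (himm : ∀ u ∈ D, ∀ x, Function.Injective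
      (rderiv (2 * g) (fun w : Cn g × (Fin (2 * g) → ℝ) => E w.1 w.2) (u, x)))
    (ht : ContinuousOn t D) (hft : ∀ u ∈ D, f (E u 0) = E u (t u)) {u : Cn g} (hu : u ∈ D) :
    ContDiffAt ℝ ∞ t u := by
  set E' : Cn g × (Fin (2 * g) → ℝ) → X := fun w => E w.1 w.2
  have hDo : IsOpen (D ×ˢ (univ : Set (Fin (2 * g) → ℝ))) := hD.prod isOpen_univ
  have hEat : ∀ x, ContMDiffAt 𝓘(ℝ, Cn g × (Fin (2 * g) → ℝ)) 𝓘(ℝ, Cn (2 * g)) ∞ E' (u, x) := fun x =>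
    hE.contMDiffAt (hDo.mem_nhds ⟨hu, mem_univ _⟩)
  set φ := chartAt (Cn (2 * g)) (E' (u, t u))
  have hk : ContDiffAt ℝ ∞ (fun w => φ (E' w)) (u, t u) :=
    contDiffAt_chart_comp (hEat (t u)) rfl
  have hk' := hasFDerivAt_real_comp (n := 2 * g) (H := E') (w := (u, t u)) (e := φ)
    ((chart_mdifferentiable _).mdifferentiableAt (mem_chart_source _ _))
    ((hEat (t u)).mdifferentiableAt (by simp))
  -- The real dimensions agree, so the immersion `E` has a smooth local inverse at `(u, t u)`.
  -- Continuity of `t` keeps `(v, t v)` in its domain, and `t` is read off from `f (E v 0)`.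
  set L := ((vderiv (2 * g) φ (E' (u, t u))).restrictScalars ℝ).comp (rderiv (2 * g) E' (u, t u))
  have hLinj : Function.Injective L.toLinearMap :=
    Function.Injective.comp (g := vderiv (2 * g) φ (E' (u, t u)))
      (vderiv_injective φ (chart_mdifferentiable _) (mem_chart_source _ _)) (himm u hu (t u))
  have hrank : Module.finrank ℝ (Cn g × (Fin (2 * g) → ℝ)) = Module.finrank ℝ (Cn (2 * g)) := by
    simp [Module.finrank_pi_fintype]
    ring
  set Le : (Cn g × (Fin (2 * g) → ℝ)) ≃L[ℝ] Cn (2 * g) :=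
    (LinearEquiv.ofInjectiveOfFinrankEq _ hLinj hrank).toContinuousLinearEquiv
  have hk'' : HasFDerivAt (fun w => φ (E' w)) (Le : _ →L[ℝ] _) (u, t u) := by
    refine hk'.congr_fderiv ?_
    exact ContinuousLinearMap.ext fun _ => rfl
  set R := hk.localInverse hk'' (by simp)
  have hR : ContDiffAt ℝ ∞ R (φ (E' (u, t u))) := hk.to_localInverse hk'' (by simp)
  have hleft : ∀ᶠ w in 𝓝 (u, t u), R (φ (E' w)) = w :=
    (hk.hasStrictFDerivAt' hk'' (by simp)).eventually_left_inverse
  have hm : ContDiffAt ℝ ∞ (fun u => φ (f (E' (u, 0)))) u := by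
    have h1 : ContMDiffAt 𝓘(ℝ, Cn g) 𝓘(ℝ, Cn (2 * g)) ∞ (fun u => f (E' (u, 0))) u := by
      refine ((contMDiff_real_of_mdifferentiable hf) _).comp u ?_
      refine (hEat 0).comp u (f := fun u => (u, (0 : Fin (2 * g) → ℝ))) ?_
      exact (contDiff_prodMk_left (0 : Fin (2 * g) → ℝ)).contDiffAt.contMDiffAt
    exact contDiffAt_chart_comp h1 (hft u hu)
  have htu : ContinuousAt (fun v => (v, t v)) u :=
    continuousAt_id.prodMk (ht.continuousAt (hD.mem_nhds hu))
  have hfin : ContDiffAt ℝ ∞ (fun v => (R (φ (f (E' (v, 0))))).2) u := by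
    refine contDiffAt_snd.comp u (ContDiffAt.comp u ?_ hm)
    have h3 : f (E' (u, 0)) = E' (u, t u) := hft u hu
    rwa [h3]
  refine hfin.congr_of_eventuallyEq ?_
  filter_upwards [htu.eventually hleft, hD.mem_nhds hu] with v hv hvD
  have h3 : f (E' (v, 0)) = E' (v, t v) := hft v hvD
  rw [h3, hv]

/-- A Betti datum and a translation vector, in a base chart. -/
theorem IsTranslationVector.isBettiChart {N : ℕ} {P : Type*} [TopologicalSpace P]
    [ChartedSpace (Cn N) P] {p : X → P} {c : Cn g} {δ : ℝ} {ψ : Cn g → P} {ρ : P → Cn g} {S : Set P}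
    (hp : IsLagrangianFibration g N σ p) (hσ : IsHolomorphicSymplectic σ)
    (hb : BaseChart N p c δ ψ ρ S) {f : X → X}
    (hf : MDifferentiable 𝓘(ℂ, Cn (2 * g)) 𝓘(ℂ, Cn (2 * g)) f) {β : BettiDatum g N p}
    {t : P → Fin (2 * g) → ℝ} (ht : IsTranslationVector β f t) (hV : ψ '' Metric.ball c δ ⊆ β.V) :
    IsBettiChart (p ⁻¹' (ψ '' Metric.ball c δ)) (Metric.ball c δ) (ρ ∘ p) f (fun u => β.E (ψ u))
      (t ∘ ψ) := by
  have T := hb.isTorusFibration hp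
  have hVu : ∀ u ∈ Metric.ball c δ, ψ u ∈ β.V := fun u hu => hV ⟨u, hu, rfl⟩
  have hmem : ∀ u ∈ Metric.ball c δ, ∀ x, β.E (ψ u) x ∈ p ⁻¹' (ψ '' Metric.ball c δ) ∧
      (ρ ∘ p) (β.E (ψ u) x) = u := fun u hu x => by
    have h1 := β.proj _ (hVu u hu) x
    refine ⟨⟨u, hu, h1.symm⟩, ?_⟩
    show ρ (p _) = u
    rw [h1, hb.left_inv u hu]
  have hsm := β.smooth _ ψ hb.isLocalParam hV
  -- The horizontal part of a vector in the kernel is detected by the projection to the base; the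
  -- vertical part is excluded by `IsTorusFibration.injective_of_periodic`.
  have himm : ∀ u ∈ Metric.ball c δ, ∀ x, Function.Injective
      (rderiv (2 * g) (fun w : Cn g × (Fin (2 * g) → ℝ) => β.E (ψ w.1) w.2) (u, x)) := by
    intro u hu x
    have hux : (u, x) ∈ Metric.ball c δ ×ˢ (univ : Set (Fin (2 * g) → ℝ)) := ⟨hu, mem_univ x⟩
    have hE := (hsm.contMDiffAt ((Metric.isOpen_ball.prod isOpen_univ).mem_nhds
      hux)).mdifferentiableAt (by simp)
    obtain ⟨A, hA⟩ := β.lieGroupIso _ (hVu u hu)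
    rw [injective_iff_map_eq_zero]
    rintro ⟨υ, ξ⟩ h0
    have hq := hasFDerivAt_real_comp (n := 2 * g) (w := (u, x)) (e := ρ ∘ p)
      (T.mdiff.mdifferentiableAt (T.isOpen.mem_nhds (hmem u hu x).1)) hE
    have hq2 : HasFDerivAt (fun w : Cn g × (Fin (2 * g) → ℝ) => (ρ ∘ p) (β.E (ψ w.1) w.2))
        (ContinuousLinearMap.fst ℝ _ _) (u, x) := by
      refine hasFDerivAt_fst.congr_of_eventuallyEq ?_
      filter_upwards [(Metric.isOpen_ball.prod isOpen_univ).mem_nhds hux] with w hw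
      exact (hmem w.1 hw.1 w.2).2
    have h1 : υ = 0 := by
      have h2 := congrArg (fun L => L (υ, ξ)) (hq2.unique hq)
      refine Eq.trans (show υ = _ from h2) ?_
      exact (congrArg (vderiv (2 * g) (ρ ∘ p) (β.E (ψ u) x)) h0).trans (map_zero _)
    subst h1
    obtain ⟨z, rfl⟩ := A.surjective x
    obtain ⟨a, rfl⟩ := A.surjective ξ
    have hk : HasFDerivAt (fun z => (u, A z))
        ((0 : Cn g →L[ℝ] Cn g).prod (A : Cn g →L[ℝ] (Fin (2 * g) → ℝ))) z :=
      (hasFDerivAt_const u z).prodMk A.hasFDerivAt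
    have h2 := rderiv_comp (n := 2 * g) (k := fun z => (u, A z)) hE hk
    have h3 := rderiv_eq_pderiv (n := 2 * g) (hA z) a
    have h4 : pderiv (2 * g) (fun z => β.E (ψ u) (A z)) z a = 0 := by
      rw [← h3]
      exact (congrArg (fun L => L a) h2).trans h0
    have h5 := T.injective_of_periodic hσ (hmem u hu) (β.periodic _ (hVu u hu)) A hA h4
    simp [h5]
  have htc : ContinuousOn (t ∘ ψ) (Metric.ball c δ) :=
    ht.1.comp hb.isLocalParam.holomorphic.continuousOn hVu
  refine ⟨Metric.isOpen_ball, hsm, hmem, ?_, fun u hu => β.periodic _ (hVu u hu), himm,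
    fun u hu => ht.2 _ (hVu u hu), fun u hu => ?_⟩
  · rintro u hu y hy rfl
    have h1 : ψ ((ρ ∘ p) y) = p y := by
      obtain ⟨v, hv, hvy⟩ := hy
      show ψ (ρ (p y)) = p y
      rw [← hvy, hb.left_inv v hv]
    simp only [h1]
    exact β.surj y (by rw [← h1]; exact hVu _ hu)
  · refine contDiffAt_translation (E := fun u => β.E (ψ u)) hf Metric.isOpen_ball hsm himm htc (fun u hu => ?_) hu
    simpa using ht.2 _ (hVu u hu) 0

end BettiCharts

end LagrangianFibration

namespace LagrangianFibration

/-! ### Real frames, the jacobian of the translation vector, and its identity theorem -/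

section Frames

theorem span_realFrame (g : ℕ) : ⊤ ≤ Submodule.span ℝ (range (realFrame g)) := by
  intro v _
  have h1 : v = ∑ i : Fin g, ((v i).re • realFrame g ⟨2 * i, by omega⟩ +
      (v i).im • realFrame g ⟨2 * i + 1, by omega⟩) := by
    have h0 : ∀ i : Fin g, (v i).re • realFrame g ⟨2 * i, by omega⟩ +
        (v i).im • realFrame g ⟨2 * i + 1, by omega⟩ = Pi.single i (v i) := by
      intro i
      have e1 : (⟨2 * (i : ℕ) / 2, by omega⟩ : Fin g) = i := by ext; simp
      have e2 : (⟨(2 * (i : ℕ) + 1) / 2, by omega⟩ : Fin g) = i := by ext; simp; omega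
      have e3 : ¬ (2 * (i : ℕ) + 1) % 2 = 0 := by omega
      simp only [realFrame, e1, e2, e3, if_false, Nat.mul_mod_right, if_true]
      rw [← Pi.single_smul, ← Pi.single_smul, ← Pi.single_add]
      congr 1
      simp [Complex.re_add_im]
    simp only [h0]
    exact (Finset.univ_sum_single v).symm
  rw [h1]
  exact Submodule.sum_mem _ fun i _ => Submodule.add_mem _
    (Submodule.smul_mem _ _ (Submodule.subset_span (mem_range_self _)))
    (Submodule.smul_mem _ _ (Submodule.subset_span (mem_range_self _)))

/-- The real basis `(e₁, i e₁, …, eₘ, i eₘ)` of `ℂᵐ`. -/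
noncomputable def realBasis (g : ℕ) : Module.Basis (Fin (2 * g)) ℝ (Cn g) :=
  basisOfTopLeSpanOfCardEqFinrank (realFrame g) (span_realFrame g)
    (by simp [Module.finrank_pi_fintype, mul_comm])

@[simp] theorem realBasis_apply (g : ℕ) (k : Fin (2 * g)) : realBasis g k = realFrame g k := by
  simp [realBasis]

/-- The real jacobian determinant. -/
noncomputable def jac {g : ℕ} (t : Cn g → Fin (2 * g) → ℝ) (u : Cn g) : ℝ :=
  Matrix.det (Matrix.of fun i k => fderiv ℝ t u (realFrame g k) i)

theorem jac_ne_zero_iff {g : ℕ} {t : Cn g → Fin (2 * g) → ℝ} {u : Cn g} :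
    jac t u ≠ 0 ↔ Function.Surjective (fderiv ℝ t u) := by
  set J : (Fin (2 * g) → ℝ) ≃ₗ[ℝ] Cn g := (realBasis g).equivFun.symm
  set A : (Fin (2 * g) → ℝ) →ₗ[ℝ] (Fin (2 * g) → ℝ) := (fderiv ℝ t u).toLinearMap ∘ₗ J.toLinearMap
  have h1 : LinearMap.toMatrix' A = Matrix.of fun i k => fderiv ℝ t u (realFrame g k) i := by
    ext i k
    have hJ : J (Pi.single k 1) = realFrame g k := by
      simp only [J, Module.Basis.equivFun_symm_apply]
      rw [Finset.sum_eq_single k (fun i _ hik => by simp [hik]) (by simp)]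
      simp
    rw [LinearMap.toMatrix'_apply, Matrix.of_apply, ← hJ]
    rfl
  have h2 : jac t u = LinearMap.det A := by rw [jac, ← h1, LinearMap.det_toMatrix']
  rw [h2, ← isUnit_iff_ne_zero, ← LinearMap.isUnit_iff_isUnit_det, LinearMap.isUnit_iff_range_eq_top,
    LinearMap.range_eq_top]
  constructor
  · intro h y
    obtain ⟨x, hx⟩ := h y
    exact ⟨J x, hx⟩
  · exact fun h => h.comp J.surjective

/-- The linear map defined by a system of periods. -/
noncomputable def periodMap {g : ℕ} (ℓ : Fin (2 * g) → Cn g) : (Fin (2 * g) → ℝ) →L[ℝ] Cn g :=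
  ∑ j, (ContinuousLinearMap.proj (R := ℝ) (φ := fun _ : Fin (2 * g) => ℝ) j).smulRight (ℓ j)

theorem periodMap_apply {g : ℕ} (ℓ : Fin (2 * g) → Cn g) (x : Fin (2 * g) → ℝ) :
    periodMap ℓ x = ∑ j, x j • ℓ j := by simp [periodMap]

theorem exists_periodEquiv {g : ℕ} {ℓ : Fin (2 * g) → Cn g} (h : LinearIndependent ℝ ℓ) :
    ∃ e : (Fin (2 * g) → ℝ) ≃L[ℝ] Cn g, (e : (Fin (2 * g) → ℝ) →L[ℝ] Cn g) = periodMap ℓ := by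
  have hinj : Function.Injective (periodMap ℓ).toLinearMap := by
    rw [← LinearMap.ker_eq_bot, LinearMap.ker_eq_bot']
    intro x hx
    have hx' : periodMap ℓ x = 0 := hx
    rw [periodMap_apply] at hx'
    exact funext (Fintype.linearIndependent_iff.1 h x hx')
  exact ⟨(LinearEquiv.ofInjectiveOfFinrankEq _ hinj
    (by simp [Module.finrank_pi_fintype, mul_comm])).toContinuousLinearEquiv,
    ContinuousLinearMap.ext fun _ => rfl⟩

/-- The real coordinates of `α` in the basis of periods. Inversion of operators is analytic, so that
one statement serves for continuity (`m = 0`) and for real analyticity (`m = ω`). -/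
theorem contDiffAt_inverse_periodMap {g : ℕ} {V : Type*} [NormedAddCommGroup V] [NormedSpace ℝ V]
    {ℓ : Fin (2 * g) → V → Cn g} {α : V → Cn g} {m : WithTop ℕ∞} {u : V}
    (hℓ : ∀ j, ContDiffAt ℝ m (ℓ j) u) (hα : ContDiffAt ℝ m α u)
    (h : LinearIndependent ℝ fun j => ℓ j u) :
    ContDiffAt ℝ m (fun u => ContinuousLinearMap.inverse (periodMap fun j => ℓ j u) (α u)) u := by
  obtain ⟨e, he⟩ := exists_periodEquiv h
  refine ContDiffAt.clm_apply ?_ hα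
  have h1 : ContDiffAt ℝ m (fun u => periodMap fun j => ℓ j u) u := by
    refine ContDiffAt.sum fun j _ => ?_
    exact (ContinuousLinearMap.smulRightL ℝ (Fin (2 * g) → ℝ) (Cn g)
      (ContinuousLinearMap.proj (R := ℝ) (φ := fun _ : Fin (2 * g) => ℝ) j)).contDiff.contDiffAt.comp u
        (hℓ j)
  have h2 := contDiffAt_map_inverse (𝕜 := ℝ) (n := m) e
  rw [he] at h2
  exact h2.comp u h1

/-- Real analyticity of the jacobian along lines, and the identity theorem. -/
theorem jac_eq_zero_of_eventually {g : ℕ} {u₀ : Cn g} {ε : ℝ} {ℓ : Fin (2 * g) → Cn g → Cn g}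
    {α : Cn g → Cn g} (hℓ : ∀ j, DifferentiableOn ℂ (ℓ j) (Metric.ball u₀ ε))
    (hα : DifferentiableOn ℂ α (Metric.ball u₀ ε))
    (hind : ∀ u ∈ Metric.ball u₀ ε, LinearIndependent ℝ fun j => ℓ j u)
    {t : Cn g → Fin (2 * g) → ℝ} (ht : ∀ u ∈ Metric.ball u₀ ε, DifferentiableAt ℝ t u)
    (heq : ∀ u ∈ Metric.ball u₀ ε, ∑ j, t u j • ℓ j u = α u) {u₁ : Cn g}
    (hu₁ : u₁ ∈ Metric.ball u₀ ε) (h0 : ∀ᶠ u in 𝓝 u₁, jac t u = 0) :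
    ∀ u ∈ Metric.ball u₀ ε, jac t u = 0 := by
  intro u₂ hu₂
  set B := Metric.ball u₀ ε
  have hB : IsOpen B := Metric.isOpen_ball
  set v := u₂ - u₁
  -- Restriction to a real segment turns the holomorphic data into real analytic functions of one
  -- variable, for which the identity theorem is available.
  set γ : ℝ → Cn g := fun s => u₁ + s • v
  set S : Set ℝ := γ ⁻¹' B
  have hγ : Continuous γ := by fun_prop
  have hS : IsOpen S := hB.preimage hγ
  have hSc : Convex ℝ S := by
    have : S = (AffineMap.lineMap u₁ u₂ : ℝ →ᵃ[ℝ] Cn g) ⁻¹' B := by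
      ext s
      simp only [S, γ, mem_preimage, AffineMap.lineMap_apply, vsub_eq_sub, vadd_eq_add, v]
      rw [add_comm]
    rw [this]
    exact (convex_ball _ _).affine_preimage _
  have han : ∀ {F : Cn g → Cn g}, DifferentiableOn ℂ F B → ∀ s ∈ S,
      ContDiffAt ℝ ω (fun s => F (γ s)) s := by
    intro F hF s hs
    have h1 := analyticOnNhd_comp_line hB hF u₁ v (s : ℂ) (by
      simpa [γ, S] using hs)
    have h2 : AnalyticAt ℝ (fun s : ℝ => F (u₁ + (s : ℂ) • v)) s :=
      AnalyticAt.comp (f := fun s : ℝ => (s : ℂ)) (h1.restrictScalars (𝕜 := ℝ))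
        (Complex.ofRealCLM.analyticAt s)
    refine AnalyticAt.contDiffAt (h2.congr (Eventually.of_forall fun s => ?_))
    simp [γ]
  have htinv : ∀ u ∈ B, t u = ContinuousLinearMap.inverse (periodMap fun j => ℓ j u) (α u) := by
    intro u hu
    obtain ⟨e, he⟩ := exists_periodEquiv (hind u hu)
    rw [← he, ContinuousLinearMap.inverse_equiv, ← heq u hu, ← periodMap_apply, ← he]
    simp
  have htan : ∀ s ∈ S, ContDiffAt ℝ ω (fun s => t (γ s)) s := by
    intro s hs
    refine (contDiffAt_inverse_periodMap (ℓ := fun j s => ℓ j (γ s)) (α := fun s => α (γ s))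
      (fun j => han (hℓ j) s hs) (han hα s hs) (hind _ hs)).congr_of_eventuallyEq ?_
    filter_upwards [hS.mem_nhds hs] with s hs using htinv _ hs
  -- Differentiating `∑ t_j ℓ_j = α` and solving for `dt`: the derivatives of `t` are again given by
  -- analytic expressions.
  have hder : ∀ u ∈ B, ∀ a, fderiv ℝ t u a = ContinuousLinearMap.inverse (periodMap fun j => ℓ j u)
      (fderiv ℂ α u a - ∑ j, t u j • fderiv ℂ (ℓ j) u a) := by
    intro u hu a
    obtain ⟨e, he⟩ := exists_periodEquiv (hind u hu)
    have h1 : HasFDerivAt α ((fderiv ℂ α u).restrictScalars ℝ) u :=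
      ((hα.differentiableAt (hB.mem_nhds hu)).hasFDerivAt).restrictScalars ℝ
    have h2 : HasFDerivAt (fun u => ∑ j, t u j • ℓ j u) _ u :=
      HasFDerivAt.fun_sum fun j _ => (hasFDerivAt_pi'.1 (ht u hu).hasFDerivAt j).smul
        (((hℓ j).differentiableAt (hB.mem_nhds hu)).hasFDerivAt.restrictScalars ℝ)
    have h3 := (h2.congr_of_eventuallyEq (f₁ := α) (by
      filter_upwards [hB.mem_nhds hu] with w hw using (heq w hw).symm)).unique h1
    have h4 := congrArg (fun L => L a) h3
    simp only [ContinuousLinearMap.sum_apply, ContinuousLinearMap.add_apply,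
      ContinuousLinearMap.smul_apply, ContinuousLinearMap.smulRight_apply,
      ContinuousLinearMap.comp_apply, ContinuousLinearMap.proj_apply,
      ContinuousLinearMap.coe_restrictScalars', Finset.sum_add_distrib] at h4
    rw [← h4, add_sub_cancel_left, ← periodMap_apply, ← he, ContinuousLinearMap.inverse_equiv]
    simp
  have hdan : ∀ a, ∀ s ∈ S, ContDiffAt ℝ ω (fun s => fderiv ℝ t (γ s) a) s := by
    intro a s hs
    refine (contDiffAt_inverse_periodMap (ℓ := fun j s => ℓ j (γ s))
      (α := fun s => fderiv ℂ α (γ s) a - ∑ j, t (γ s) j • fderiv ℂ (ℓ j) (γ s) a)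
      (fun j => han (hℓ j) s hs) ?_ (hind _ hs)).congr_of_eventuallyEq ?_
    · refine (han (differentiableOn_fderiv_apply hB hα a) s hs).sub (ContDiffAt.sum fun j _ => ?_)
      exact (contDiffAt_pi.1 (htan s hs) j).smul (han (differentiableOn_fderiv_apply hB (hℓ j) a) s hs)
    · filter_upwards [hS.mem_nhds hs] with s hs using hder _ hs a
  have hjac : AnalyticOnNhd ℝ (fun s => jac t (γ s)) S := by
    intro s hs
    refine ContDiffAt.analyticAt ?_
    simp only [jac, Matrix.det_apply]
    refine ContDiffAt.sum fun τ _ => ContDiffAt.const_smul _ (contDiffAt_prod fun i _ => ?_)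
    exact contDiffAt_pi.1 (hdan _ s hs) _
  have h0S : (0 : ℝ) ∈ S := by simpa [S, γ] using hu₁
  have h1S : (1 : ℝ) ∈ S := by simpa [S, γ, v] using hu₂
  have hev : (fun s => jac t (γ s)) =ᶠ[𝓝 0] 0 := by
    have hγ0 : Tendsto γ (𝓝 0) (𝓝 u₁) := by
      have := hγ.tendsto 0
      simpa [γ] using this
    exact hγ0.eventually h0
  have := hjac.eqOn_zero_of_preconnected_of_eventuallyEq_zero hSc.isPreconnected h0S hev h1S
  simpa [γ, v] using this

end Frames

end LagrangianFibration

namespace LagrangianFibration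

/-! ### Local existence of Betti data with holomorphic periods -/

section Existence

variable {g N : ℕ} {X : Type*} [TopologicalSpace X] [ChartedSpace (Cn (2 * g)) X]
  [IsManifold 𝓘(ℂ, Cn (2 * g)) ω X] [T2Space X]
  {σ : ∀ x : X, TX (2 * g) x [⋀^Fin 2]→L[ℂ] ℂ} {P : Type*} [TopologicalSpace P]
  [ChartedSpace (Cn N) P] {p : X → P} {c : Cn g} {δ : ℝ} {ψ : Cn g → P} {ρ : P → Cn g} {S : Set P}

-- `ψ` and `ρ` are inverse homeomorphisms between the image and a ball, which is contractible.
omit [IsManifold 𝓘(ℂ, Cn (2 * g)) ω X] [T2Space X] in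
theorem BaseChart.simplyConnectedSpace (hb : BaseChart N p c δ ψ ρ S) :
    SimplyConnectedSpace (ψ '' Metric.ball c δ) := by
  have hψ := hb.isLocalParam.holomorphic.continuousOn
  have hρ : ContinuousOn ρ (ψ '' Metric.ball c δ) := hb.mdiff.continuousOn.mono (by
    rintro _ ⟨u, hu, rfl⟩
    exact hb.mem_W u hu)
  have hm : ∀ b : ψ '' Metric.ball c δ, ρ b ∈ Metric.ball c δ := by
    rintro ⟨_, u, hu, rfl⟩
    exact (congrArg (· ∈ Metric.ball c δ) (hb.left_inv u hu)).mpr hu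
  let e : Metric.ball c δ ≃ₜ ψ '' Metric.ball c δ :=
    { toFun := fun u => ⟨ψ u, u, u.2, rfl⟩
      invFun := fun b => ⟨ρ b, hm b⟩
      left_inv := fun u => Subtype.ext (hb.left_inv u u.2)
      right_inv := fun b => Subtype.ext (by
        obtain ⟨u, hu, hub⟩ := b.2
        simp only
        rw [← hub, hb.left_inv u hu])
      continuous_toFun := (continuousOn_iff_continuous_restrict.1 hψ).subtype_mk _
      continuous_invFun := Continuous.subtype_mk (f := fun b : ψ '' Metric.ball c δ => ρ b)
        (continuousOn_iff_continuous_restrict.1 hρ) hm }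
  have h1 : ContractibleSpace (Metric.ball c δ) :=
    (convex_ball c δ).contractibleSpace ⟨c, Metric.mem_ball_self hb.pos⟩
  have h2 : ContractibleSpace (ψ '' Metric.ball c δ) := e.symm.contractibleSpace
  exact SimplyConnectedSpace.ofContractible _

/-- Betti data exist locally. -/
theorem BaseChart.exists_bettiDatum (hp : IsLagrangianFibration g N σ p)
    (hσ : IsHolomorphicSymplectic σ) (hb : BaseChart N p c δ ψ ρ S) {f : X → X}
    (hf : MDifferentiable 𝓘(ℂ, Cn (2 * g)) 𝓘(ℂ, Cn (2 * g)) f) (hpf : ∀ x, p (f x) = p x)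
    (hfσ : ∀ x, (σ (f x)).compContinuousLinearMap (holDeriv (2 * g) (2 * g) f x) = σ x)
    {u₀ : Cn g} (hu₀ : u₀ ∈ Metric.ball c δ) :
    ∃ ε > 0, Metric.ball u₀ ε ⊆ Metric.ball c δ ∧
      ∃ (β : BettiDatum g N p) (t : P → Fin (2 * g) → ℝ), β.V = ψ '' Metric.ball u₀ ε ∧
        IsTranslationVector β f t ∧ ∃ (ℓ : Fin (2 * g) → Cn g → Cn g) (α : Cn g → Cn g),
          (∀ j, DifferentiableOn ℂ (ℓ j) (Metric.ball u₀ ε)) ∧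
          DifferentiableOn ℂ α (Metric.ball u₀ ε) ∧
          (∀ u ∈ Metric.ball u₀ ε, LinearIndependent ℝ fun j => ℓ j u) ∧
          ∀ u ∈ Metric.ball u₀ ε, ∑ j, t (ψ u) j • ℓ j u = α u := by
  have T := hb.isTorusFibration hp
  obtain ⟨B, h, F, hu₀B⟩ := T.exists_isFiberExp hσ hu₀
  obtain ⟨ℓ, hℓ⟩ := F.exists_periods T hσ hu₀B
  have hfO : MapsTo f (p ⁻¹' (ψ '' Metric.ball c δ)) (p ⁻¹' (ψ '' Metric.ball c δ)) := fun x hx => by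
    rw [mem_preimage, hpf]; exact hx
  have hqf : ∀ y, (ρ ∘ p) (f y) = (ρ ∘ p) y := fun y => congrArg ρ (hpf y)
  have hBn : ∀ᶠ u in 𝓝 u₀, u ∈ B := F.isOpen.mem_nhds hu₀B
  obtain ⟨a₀, ha₀⟩ := F.surj u₀ hu₀B (f (h u₀ 0)) (hfO (F.mem u₀ hu₀B 0).1)
    (by rw [hqf, (F.mem u₀ hu₀B 0).2])
  -- `α` lifts the image by `f` of the section of origins; since `f` acts by translations, this
  -- determines `f`.
  obtain ⟨α, ε₁, hε₁, hε₁B, hα, -, hαs⟩ := F.exists_lift T hσ hu₀B (s := fun u => f (h u 0))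
    (hBn.mono fun u hu => (hf _).comp u (F.mdiff_zero.mdifferentiableAt (F.isOpen.mem_nhds hu)))
    (hBn.mono fun u hu => by rw [hqf, (F.mem u hu 0).2]) ha₀
  obtain ⟨ε, hε, hball⟩ := Metric.mem_nhds_iff.1 ((hℓ.and (Metric.ball_mem_nhds u₀ hε₁)).and
    (Metric.isOpen_ball.mem_nhds hu₀))
  have hsub : Metric.ball u₀ ε ⊆ Metric.ball c δ := fun u hu => (hball hu).2
  have hbε := hb.mono hε hsub
  have hB : ∀ u ∈ Metric.ball u₀ ε, u ∈ B := fun u hu => (hball hu).1.1.1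
  have hℓd : ∀ j, DifferentiableOn ℂ (ℓ j) (Metric.ball u₀ ε) := fun j u hu =>
    ((hball hu).1.1.2.1 j).differentiableWithinAt
  have hind : ∀ u ∈ Metric.ball u₀ ε, LinearIndependent ℝ fun j => ℓ j u := fun u hu =>
    (hball hu).1.1.2.2.1
  have hlat : ∀ u ∈ Metric.ball u₀ ε, ∀ z w, h u z = h u w ↔
      ∃ k : Fin (2 * g) → ℤ, z - w = ∑ i, k i • ℓ i u := fun u hu => (hball hu).1.1.2.2.2
  have hαd : DifferentiableOn ℂ α (Metric.ball u₀ ε) := hα.mono fun u hu => (hball hu).1.2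
  have hp' : ∀ u ∈ Metric.ball u₀ ε, ∀ z, p (h u z) = ψ u := by
    intro u hu z
    obtain ⟨⟨v, hv, hvz⟩, h2⟩ := F.mem u (hB u hu) z
    have h3 : ρ (p (h u z)) = u := h2
    rw [← hvz, hb.left_inv v hv] at h3
    rw [← hvz, h3]
  have hEq : ∀ u ∈ Metric.ball u₀ ε, ∃ e : (Fin (2 * g) → ℝ) ≃L[ℝ] Cn g, ∀ x,
      e x = ∑ j, x j • ℓ j u := fun u hu => by
    obtain ⟨e, he⟩ := exists_periodEquiv (hind u hu)
    exact ⟨e, fun x => by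
      rw [← periodMap_apply]; exact congrArg (fun L => L x) he⟩
  -- Betti coordinates are the real coordinates in the basis of periods of the universal covering of
  -- the fiber.
  set E : P → (Fin (2 * g) → ℝ) → X := fun b x => h (ρ b) (∑ j, x j • ℓ j (ρ b))
  have hEψ : ∀ u ∈ Metric.ball u₀ ε, ∀ x, E (ψ u) x = h u (∑ j, x j • ℓ j u) := fun u hu x => by
    simp only [E, hbε.left_inv u hu]
  have hr : ∀ (D : Set (Cn g)) (ψ' : Cn g → P), IsLocalParam N g (range p) D ψ' →
      ψ' '' D ⊆ ψ '' Metric.ball u₀ ε → DifferentiableOn ℂ (fun v => ρ (ψ' v)) D ∧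
      MapsTo (fun v => ρ (ψ' v)) D (Metric.ball u₀ ε) := by
    intro D ψ' hψ' hD
    have h1 : ∀ v ∈ D, ψ' v ∈ S ∧ ρ (ψ' v) ∈ Metric.ball u₀ ε := fun v hv => by
      obtain ⟨u, hu, huv⟩ := hD ⟨v, hv, rfl⟩
      rw [← huv, hbε.left_inv u hu]
      exact ⟨hbε.mem_W u hu, hu⟩
    exact ⟨(hb.mdiff.comp hψ'.holomorphic fun v hv => (h1 v hv).1).differentiableOn,
      fun v hv => (h1 v hv).2⟩
  let β : BettiDatum g N p :=
    { V := ψ '' Metric.ball u₀ ε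
      E := E
      subset_regular := hbε.subset_regular
      isOpen := hbε.isLocalParam.isOpen_image _ subset_rfl Metric.isOpen_ball
      simplyConnected := hbε.simplyConnectedSpace
      proj := by
        rintro _ ⟨u, hu, rfl⟩ x
        rw [hEψ u hu, hp' u hu]
      surj := by
        rintro y ⟨u, hu, huy⟩
        have h1 : (ρ ∘ p) y = u := by
          show ρ (p y) = u
          rw [← huy, hbε.left_inv u hu]
        obtain ⟨z, hz⟩ := F.surj u (hB u hu) y ⟨u, hsub hu, huy⟩ h1
        obtain ⟨e, he⟩ := hEq u hu
        refine ⟨e.symm z, ?_⟩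
        rw [← huy, hEψ u hu, ← he, e.apply_symm_apply, hz]
      periodic := by
        rintro _ ⟨u, hu, rfl⟩ x y
        rw [hEψ u hu, hEψ u hu, hlat u hu]
        have h1 : ∀ k : Fin (2 * g) → ℤ, (∑ j, x j • ℓ j u - ∑ j, y j • ℓ j u = ∑ i, k i • ℓ i u) ↔
            ∀ i, x i - y i = k i := by
          intro k
          rw [← Finset.sum_sub_distrib, ← sub_eq_zero, ← Finset.sum_sub_distrib]
          simp only [← sub_smul, ← Int.cast_smul_eq_zsmul ℝ]
          constructor
          · intro h0 i
            exact sub_eq_zero.1 (Fintype.linearIndependent_iff.1 (hind u hu) _ h0 i)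
          · intro h0
            exact Finset.sum_eq_zero fun i _ => by rw [h0 i, sub_self, zero_smul]
        simp only [h1]
        exact ⟨fun ⟨k, hk⟩ i => ⟨k i, hk i⟩, fun h0 => by choose k hk using h0; exact ⟨k, hk⟩⟩
      smooth := by
        intro D ψ' hψ' hD
        obtain ⟨hrd, hrm⟩ := hr D ψ' hψ' hD
        rintro ⟨v, x⟩ ⟨hv, -⟩
        refine ContMDiffAt.contMDiffWithinAt ?_
        have h1 : ContMDiffAt 𝓘(ℝ, Cn g × Cn g) 𝓘(ℝ, Cn (2 * g)) ∞
            (fun w : Cn g × Cn g => h w.1 w.2) (ρ (ψ' v), ∑ j, x j • ℓ j (ρ (ψ' v))) :=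
          contMDiffAt_of_mdifferentiableOn (F.isOpen.prod isOpen_univ) (F.mdifferentiableOn T hσ)
            ⟨hB _ (hrm hv), mem_univ _⟩
        have hC : ∀ {G : Cn g → Cn g}, DifferentiableOn ℂ G D → ContDiffAt ℝ ∞
            (fun w : Cn g × (Fin (2 * g) → ℝ) => G w.1) (v, x) := fun hG =>
          ((contDiffOn_real_of_differentiableOn hψ'.isOpen hG).contDiffAt
            (hψ'.isOpen.mem_nhds hv)).comp (v, x) contDiffAt_fst
        refine ContMDiffAt.comp (v, x) (f := fun w : Cn g × (Fin (2 * g) → ℝ) =>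
          (ρ (ψ' w.1), ∑ j, w.2 j • ℓ j (ρ (ψ' w.1)))) h1 (ContDiffAt.contMDiffAt ?_)
        refine (hC hrd).prodMk (ContDiffAt.sum fun j _ =>
          ContDiffAt.smul (f := fun w : Cn g × (Fin (2 * g) → ℝ) => w.2 j)
          (g := fun w : Cn g × (Fin (2 * g) → ℝ) => ℓ j (ρ (ψ' w.1))) ?_
          (hC ((hℓd j).comp hrd hrm)))
        exact (contDiff_apply ℝ ℝ j).contDiffAt.comp (v, x) contDiffAt_snd
      section_holomorphic := by
        intro D ψ' hψ' hD
        obtain ⟨hrd, hrm⟩ := hr D ψ' hψ' hD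
        refine (F.mdiff_zero.comp hrd.mdifferentiableOn fun v hv => hB _ (hrm hv)).congr fun v hv => ?_
        simp [E]
      lieGroupIso := by
        rintro _ ⟨u, hu, rfl⟩
        obtain ⟨e, he⟩ := hEq u hu
        refine ⟨e.symm, ?_⟩
        have h1 : (fun z => E (ψ u) (e.symm z)) = h u := funext fun z => by
          rw [hEψ u hu, ← he, e.apply_symm_apply]
        rw [h1]
        exact F.mdiff u (hB u hu) }
  -- The translation vector is the vector of real coordinates of `α` in the basis of periods.
  set τ : Cn g → Fin (2 * g) → ℝ := fun u =>
    ContinuousLinearMap.inverse (periodMap fun j => ℓ j u) (α u)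
  have hτ : ∀ u ∈ Metric.ball u₀ ε, ∑ j, τ u j • ℓ j u = α u := by
    intro u hu
    obtain ⟨e, he⟩ := exists_periodEquiv (hind u hu)
    rw [← periodMap_apply]
    simp only [τ]
    rw [← he, ContinuousLinearMap.inverse_equiv]
    simp
  have hτc : ContinuousOn τ (Metric.ball u₀ ε) := fun u hu => by
    have hR : ∀ {G : Cn g → Cn g}, DifferentiableOn ℂ G (Metric.ball u₀ ε) → ContDiffAt ℝ 0 G u :=
      fun hG => ((contDiffOn_real_of_differentiableOn Metric.isOpen_ball hG).contDiffAt
        (Metric.isOpen_ball.mem_nhds hu)).of_le (by simp)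
    exact (contDiffAt_inverse_periodMap (m := 0) (fun j => hR (hℓd j)) (hR hαd)
      (hind u hu)).continuousAt.continuousWithinAt
  refine ⟨ε, hε, hsub, β, fun b => τ (ρ b), rfl, ⟨?_, ?_⟩, ℓ, α, hℓd, hαd, hind, fun u hu => ?_⟩
  · refine hτc.comp (hb.mdiff.continuousOn.mono ?_) ?_
    · rintro _ ⟨u, hu, rfl⟩
      exact hbε.mem_W u hu
    · rintro _ ⟨u, hu, rfl⟩
      rw [hbε.left_inv u hu]
      exact hu
  · rintro _ ⟨u, hu, rfl⟩ x
    show f (E (ψ u) x) = E (ψ u) (x + τ (ρ (ψ u)))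
    rw [hEψ u hu, hEψ u hu, hbε.left_inv u hu, F.map_eq T hσ hf hfO (fun y _ => hqf y) hfσ (hB u hu)
      (hαs u (hball hu).1.2), ← hτ u hu, ← Finset.sum_add_distrib]
    simp [add_smul]
  · simp only [hbε.left_inv u hu]
    exact hτ u hu

end Existence

end LagrangianFibration

namespace LagrangianFibration

/-! ### The exterior power `κ^m` as an alternating map -/

section Wedge

variable {V : Type*} [AddCommGroup V] [Module ℝ V] [TopologicalSpace V]

/-- The `k`-th vector occurs in exactly one factor of the product, so the product is linear in it.
-/
theorem exists_pairProd_update (κ : V [⋀^Fin 2]→L[ℝ] ℝ) (m : ℕ) [DecidableEq (Fin (2 * m))] (v : Fin (2 * m) → V)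
    (k : Fin (2 * m)) : ∃ (a : ℝ) (w : V), ∀ x : V,
      ∏ i : Fin m, κ ![Function.update v k x ⟨2 * i, by omega⟩,
        Function.update v k x ⟨2 * i + 1, by omega⟩] = a * κ ![x, w] := by
  set j : Fin m := ⟨k / 2, by omega⟩
  have hne : ∀ (x : V) (i : Fin m), i ∈ ({j} : Finset (Fin m))ᶜ →
      κ ![Function.update v k x ⟨2 * i, by omega⟩, Function.update v k x ⟨2 * i + 1, by omega⟩] =
        κ ![v ⟨2 * i, by omega⟩, v ⟨2 * i + 1, by omega⟩] := by
    intro x i hi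
    have hi' : (i : ℕ) ≠ k / 2 := fun h => by
      simp only [Finset.mem_compl, Finset.mem_singleton] at hi
      exact hi (Fin.ext h)
    rw [Function.update_of_ne (fun h => hi' (by simp [← h]; try omega)),
      Function.update_of_ne (fun h => hi' (by simp [← h]; try omega))]
  set q : ℝ := ∏ i ∈ ({j} : Finset (Fin m))ᶜ, κ ![v ⟨2 * i, by omega⟩, v ⟨2 * i + 1, by omega⟩]
  rcases Nat.mod_two_eq_zero_or_one k with hk | hk
  · refine ⟨q, v ⟨2 * (j : ℕ) + 1, by omega⟩, fun x => ?_⟩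
    rw [Fintype.prod_eq_mul_prod_compl j, Finset.prod_congr rfl (hne x)]
    have h1 : (⟨2 * (j : ℕ), by omega⟩ : Fin (2 * m)) = k := Fin.ext (by simp only [j]; omega)
    have h2 : (⟨2 * (j : ℕ) + 1, by omega⟩ : Fin (2 * m)) ≠ k := fun h => by
      have := congrArg Fin.val h; simp only [j] at this; omega
    rw [h1, Function.update_self, Function.update_of_ne h2]
    ring
  · refine ⟨-q, v ⟨2 * (j : ℕ), by omega⟩, fun x => ?_⟩
    rw [Fintype.prod_eq_mul_prod_compl j, Finset.prod_congr rfl (hne x)]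
    have h1 : (⟨2 * (j : ℕ) + 1, by omega⟩ : Fin (2 * m)) = k := Fin.ext (by simp only [j]; omega)
    have h2 : (⟨2 * (j : ℕ), by omega⟩ : Fin (2 * m)) ≠ k := fun h => by
      have := congrArg Fin.val h; simp only [j] at this; omega
    rw [h1, Function.update_self, Function.update_of_ne h2, pair_swap κ x]
    ring

/-- The multilinear map whose alternatization is a multiple of `κ^m`. -/
noncomputable def pairProd (κ : V [⋀^Fin 2]→L[ℝ] ℝ) (m : ℕ) : MultilinearMap ℝ (fun _ : Fin (2 * m) => V) ℝ where
  toFun v := ∏ i : Fin m, κ ![v ⟨2 * i, by omega⟩, v ⟨2 * i + 1, by omega⟩]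
  map_update_add' v k x y := by
    obtain ⟨a, w, h⟩ := exists_pairProd_update κ m v k
    simp only [h, pair_add_left, mul_add]
  map_update_smul' v k c x := by
    obtain ⟨a, w, h⟩ := exists_pairProd_update κ m v k
    simp only [h, pair_smul_left, smul_eq_mul]
    ring

/-- `κ^m` as an alternating map. -/
noncomputable def wedgeAlt (κ : V [⋀^Fin 2]→L[ℝ] ℝ) (m : ℕ) : V [⋀^Fin (2 * m)]→ₗ[ℝ] ℝ :=
  (1 / 2 ^ m : ℝ) • MultilinearMap.alternatization (pairProd κ m)

theorem wedgeAlt_apply (κ : V [⋀^Fin 2]→L[ℝ] ℝ) (m : ℕ) (v : Fin (2 * m) → V) :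
    wedgeAlt κ m v = wedgePow κ m v := by
  rw [wedgeAlt, AlternatingMap.smul_apply, MultilinearMap.alternatization_apply, wedgePow,
    smul_eq_mul]
  congr 1
  refine Finset.sum_congr rfl fun τ _ => ?_
  rw [MultilinearMap.domDomCongr_apply, Units.smul_def, zsmul_eq_mul]
  rfl

theorem wedgePow_eq_zero_of_not_linearIndependent (κ : V [⋀^Fin 2]→L[ℝ] ℝ) {m : ℕ}
    {v : Fin (2 * m) → V} (h : ¬ LinearIndependent ℝ v) : wedgePow κ m v = 0 := by
  rw [← wedgeAlt_apply]
  exact AlternatingMap.map_linearDependent _ v h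

/-- On a space of real dimension `2m`, alternating `2m`-forms are proportional to the determinant.
-/
theorem wedgePow_comp_basis (κ : V [⋀^Fin 2]→L[ℝ] ℝ) {m : ℕ} {W : Type*} [AddCommGroup W]
    [Module ℝ W] (b : Module.Basis (Fin (2 * m)) ℝ W) (A : W →ₗ[ℝ] V) (w : Fin (2 * m) → W) :
    wedgePow κ m (fun k => A (w k)) = b.det w * wedgePow κ m (fun k => A (b k)) := by
  have h := ((wedgeAlt κ m).compLinearMap A).eq_smul_basis_det b
  have h2 := congrArg (fun L : W [⋀^Fin (2 * m)]→ₗ[ℝ] ℝ => L w) h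
  simp only [AlternatingMap.compLinearMap_apply, AlternatingMap.smul_apply] at h2
  rw [← wedgeAlt_apply, ← wedgeAlt_apply]
  refine h2.trans ?_
  rw [smul_eq_mul, mul_comm]

/-- The standard symplectic form on the standard frame. -/
noncomputable def stdPair (a b : ℕ) : ℝ :=
  if a / 2 = b / 2 then (if a % 2 = b % 2 then 0 else if a % 2 = 0 then 1 else -1) else 0

/-- The value of the `m`-th power of the standard symplectic form on the standard frame. -/
noncomputable def stdVolume (m : ℕ) : ℝ :=
  (1 / 2 ^ m : ℝ) * ∑ τ : Equiv.Perm (Fin (2 * m)), ((Equiv.Perm.sign τ : ℤ) : ℝ) *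
    ∏ i : Fin m, stdPair (τ ⟨2 * i, by omega⟩) (τ ⟨2 * i + 1, by omega⟩)

/-- The elements `0, …, 2m-1` come in `m` pairs. -/
def pairEquiv (m : ℕ) : Fin m × Fin 2 ≃ Fin (2 * m) where
  toFun x := ⟨2 * x.1 + x.2, by omega⟩
  invFun k := (⟨k / 2, by omega⟩, ⟨k % 2, by omega⟩)
  left_inv x := by
    ext <;> simp <;> omega
  right_inv k := Fin.ext (by simp; omega)

/-- A term is non-zero only if `τ` sends each pair onto a pair. Then `τ` is a permutation of the
pairs, of even sign since it acts identically on both entries, composed with swaps inside some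
pairs; each swap changes both the sign of `τ` and that of one factor. -/
theorem stdVolume_term_nonneg (m : ℕ) (τ : Equiv.Perm (Fin (2 * m))) :
    0 ≤ ((Equiv.Perm.sign τ : ℤ) : ℝ) *
      ∏ i : Fin m, stdPair (τ ⟨2 * i, by omega⟩) (τ ⟨2 * i + 1, by omega⟩) := by
  by_cases h0 : ∀ i : Fin m, stdPair (τ ⟨2 * i, by omega⟩) (τ ⟨2 * i + 1, by omega⟩) ≠ 0
  swap
  · push Not at h0
    obtain ⟨i, hi⟩ := h0
    rw [Finset.prod_eq_zero (Finset.mem_univ i) hi, mul_zero]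
  set ρ : Equiv.Perm (Fin m × Fin 2) := (pairEquiv m).symm.permCongr τ with hρ
  have hρs : Equiv.Perm.sign ρ = Equiv.Perm.sign τ := Equiv.Perm.sign_permCongr _ _
  have hτ : ∀ (i : Fin m) (j : Fin 2), ((τ ⟨2 * (i : ℕ) + (j : ℕ), by omega⟩ : Fin (2 * m)) : ℕ) =
      2 * (ρ (i, j)).1 + (ρ (i, j)).2 := by
    intro i j
    have h1 : τ ⟨2 * (i : ℕ) + (j : ℕ), by omega⟩ = pairEquiv m (ρ (i, j)) := by
      rw [hρ, Equiv.permCongr_apply, Equiv.apply_symm_apply]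
      rfl
    rw [h1]
    rfl
  have h01 : ∀ i : Fin m, stdPair (τ ⟨2 * i, by omega⟩) (τ ⟨2 * i + 1, by omega⟩) =
      stdPair (2 * (ρ (i, 0)).1 + (ρ (i, 0)).2) (2 * (ρ (i, 1)).1 + (ρ (i, 1)).2) := by
    intro i
    have h2 := hτ i 0
    have h3 := hτ i 1
    simp only [Fin.val_zero, add_zero, Fin.val_one] at h2 h3
    rw [h2, h3]
  have hfst : ∀ i : Fin m, (ρ (i, 0)).1 = (ρ (i, 1)).1 ∧ (ρ (i, 0)).2 ≠ (ρ (i, 1)).2 := by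
    intro i
    have h2 := h0 i
    rw [h01, stdPair] at h2
    have h3 : (2 * ((ρ (i, 0)).1 : ℕ) + (ρ (i, 0)).2) / 2 =
        (2 * ((ρ (i, 1)).1 : ℕ) + (ρ (i, 1)).2) / 2 := by
      by_contra h
      rw [if_neg h] at h2
      exact h2 rfl
    refine ⟨Fin.ext (by omega), fun h => h2 ?_⟩
    rw [if_pos h3, if_pos (by rw [h]; omega)]
  have hinj : Function.Injective fun i : Fin m => (ρ (i, 0)).1 := by
    intro i i' hii
    simp only at hii
    have h2 : (ρ (i', 0)).2 = (ρ (i, 0)).2 ∨ (ρ (i', 0)).2 = (ρ (i, 1)).2 := by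
      have := (hfst i).2
      omega
    rcases h2 with h2 | h2
    · exact (congrArg Prod.fst (ρ.injective (Prod.ext hii.symm h2 : ρ (i', 0) = ρ (i, 0)))).symm
    · exact (congrArg Prod.fst (ρ.injective (Prod.ext (hii.symm.trans (hfst i).1) h2 :
        ρ (i', 0) = ρ (i, 1)))).symm
  set π : Equiv.Perm (Fin m) := Equiv.ofBijective _ (Finite.injective_iff_bijective.1 hinj) with hπ
  set s : Fin m → Equiv.Perm (Fin 2) := fun i => if (ρ (i, 0)).2 = 0 then 1 else Equiv.swap 0 1
  -- The factorization into the permutation `π` of the pairs and the swaps `s` inside them.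
  have hρ2 : ρ = Equiv.prodCongrLeft (fun _ : Fin 2 => π) * Equiv.prodCongrRight s := by
    ext1 ⟨i, j⟩
    have h2 : (Equiv.prodCongrLeft (fun _ : Fin 2 => π) * Equiv.prodCongrRight s) (i, j) =
        ((ρ (i, 0)).1, s i j) := rfl
    rw [h2]
    obtain ⟨h3, h4⟩ := hfst i
    fin_cases j
    · refine Prod.ext rfl ?_
      simp only [s]
      split_ifs with h
      · exact h
      · simp; omega
    · refine Prod.ext h3.symm ?_
      simp only [s]
      split_ifs with h
      · simp; omega
      · simp; omega
  have hsign : ((Equiv.Perm.sign τ : ℤ) : ℝ) = ∏ i, (((Equiv.Perm.sign (s i) : ℤˣ) : ℤ) : ℝ) := by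
    rw [← hρs, hρ2, Equiv.Perm.sign_mul, Equiv.Perm.sign_prodCongrRight,
      Equiv.Perm.sign_prodCongrLeft, Fin.prod_univ_two, Int.units_mul_self, one_mul]
    push_cast
    rfl
  rw [hsign, ← Finset.prod_mul_distrib]
  refine Finset.prod_nonneg fun i _ => ?_
  rw [h01, stdPair]
  obtain ⟨h3, h4⟩ := hfst i
  have h5 : (2 * ((ρ (i, 0)).1 : ℕ) + (ρ (i, 0)).2) / 2 =
        (2 * ((ρ (i, 1)).1 : ℕ) + (ρ (i, 1)).2) / 2 := by rw [h3]; omega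
  rw [if_pos h5, if_neg (by omega)]
  simp only [s]
  by_cases h : (ρ (i, 0)).2 = 0
  · rw [if_pos h, if_pos (by rw [h]; simp)]; simp
  · rw [if_neg h, if_neg (by omega)]; simp

theorem stdVolume_pos (m : ℕ) : 0 < stdVolume m := by
  refine mul_pos (by positivity) (Finset.sum_pos' (fun τ _ => stdVolume_term_nonneg m τ)
    ⟨1, Finset.mem_univ _, ?_⟩)
  have h : ∀ i : Fin m, stdPair (2 * i) (2 * i + 1) = 1 := fun i => by
    rw [stdPair, if_pos (by omega), if_neg (by omega), if_pos (by omega)]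
  simp [h]

theorem wedgePow_eq_stdVolume {κ : V [⋀^Fin 2]→L[ℝ] ℝ} {m : ℕ} {v : Fin (2 * m) → V}
    (h : ∀ k l, κ ![v k, v l] = stdPair k l) : wedgePow κ m v = stdVolume m := by
  simp only [wedgePow, stdVolume, h]

end Wedge

/-! ### Positive `(1,1)`-forms: unitary frames and comparison of volumes -/

section Positive

variable {V : Type*} [AddCommGroup V] [Module ℂ V] [TopologicalSpace V]
  {V' : Type*} [AddCommGroup V'] [Module ℝ V'] [TopologicalSpace V']

theorem exists_orthonormal_basis {F : Type*} [AddCommGroup F] [Module ℂ F] [FiniteDimensional ℂ F]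
    (cd : InnerProductSpace.Core ℂ F) {m : ℕ} (hm : Module.finrank ℂ F = m) :
    ∃ b : Module.Basis (Fin m) ℂ F, ∀ i j, cd.inner (b i) (b j) = if i = j then 1 else 0 := by
  letI : NormedAddCommGroup F := cd.toNormedAddCommGroup
  letI : InnerProductSpace ℂ F := InnerProductSpace.ofCore cd.toCore
  let b := (stdOrthonormalBasis ℂ F).reindex (finCongr hm)
  refine ⟨b.toBasis, fun i j => ?_⟩
  have h := orthonormal_iff_ite.1 b.orthonormal i j
  rw [← b.coe_toBasis] at h
  exact h

/-- `κ(v, iw) + iκ(v, w)` is a hermitian inner product, whose pull-back by the injective map `A` has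
an orthonormal basis; in it the pull-back of `κ` is the standard form. -/
theorem exists_unitary {κ : V [⋀^Fin 2]→L[ℝ] ℝ}
    (h11 : ∀ v w : V, κ ![Complex.I • v, Complex.I • w] = κ ![v, w])
    (hpos : ∀ v : V, v ≠ 0 → 0 < κ ![v, Complex.I • v]) {m : ℕ} {A : Cn m →ₗ[ℂ] V}
    (hA : Function.Injective A) : ∃ T : Cn m ≃ₗ[ℂ] Cn m,
      ∀ k l, κ ![A (T (realFrame m k)), A (T (realFrame m l))] = stdPair k l := by
  have hI : ∀ v w : V, κ ![Complex.I • v, w] = -κ ![v, Complex.I • w] := fun v w => by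
    rw [← h11, smul_smul, Complex.I_mul_I, neg_one_smul, ← neg_one_smul ℝ, pair_smul_left]
    simp
  have hz : ∀ v : V, κ ![v, v] = 0 := fun v => by
    have := pair_swap κ v v
    linarith
  have hc : ∀ (r : ℂ) (v : V), r • v = r.re • v + r.im • Complex.I • v := fun r v => by
    conv_lhs => rw [← Complex.re_add_im r]
    rw [add_smul, mul_smul]
    rfl
  let cd : InnerProductSpace.Core ℂ (Cn m) :=
    { inner := fun v w => (κ ![A v, Complex.I • A w] : ℂ) + Complex.I * (κ ![A v, A w] : ℂ)
      conj_inner_symm := fun v w => by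
        rw [map_add, map_mul, Complex.conj_I, Complex.conj_ofReal, Complex.conj_ofReal,
          pair_swap κ (A w) (Complex.I • A v), hI, pair_swap κ (A w)]
        push_cast
        ring
      re_inner_nonneg := fun v => by
        rw [hz]
        by_cases h : A v = 0
        · rw [h, smul_zero, hz]
          simp
        · simpa using (hpos _ h).le
      add_left := fun x y z => by
        rw [map_add, pair_add_left, pair_add_left]
        push_cast
        ring
      smul_left := fun x y r => by
        have h1 : (starRingEnd ℂ) r = (r.re : ℂ) - r.im * Complex.I := by
          apply Complex.ext <;> simp
        rw [map_smul, hc r (A x), pair_add_left, pair_add_left, pair_smul_left, pair_smul_left,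
          pair_smul_left, pair_smul_left, h11, hI, h1]
        simp only [smul_eq_mul]
        push_cast
        linear_combination ((r.im : ℂ) * (κ ![A x, A y] : ℂ)) * Complex.I_mul_I
      definite := fun v hv => by
        by_contra h
        have h2 := hpos (A v) fun h0 => h (hA (h0.trans (map_zero A).symm))
        rw [hz] at hv
        have h3 := congrArg Complex.re hv
        simp at h3
        exact h2.ne' h3 }
  obtain ⟨b, hb⟩ := exists_orthonormal_basis cd (m := m) (by simp)
  have hcd : ∀ v w, cd.inner v w =
    (κ ![A v, Complex.I • A w] : ℂ) + Complex.I * (κ ![A v, A w] : ℂ) := fun _ _ => rfl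
  have hb1 : ∀ i j, κ ![A (b i), Complex.I • A (b j)] = if i = j then 1 else 0 := fun i j => by
    have := congrArg Complex.re (hb i j)
    rw [hcd] at this
    split_ifs at this ⊢ <;> simpa using this
  have hb2 : ∀ i j, κ ![A (b i), A (b j)] = 0 := fun i j => by
    have := congrArg Complex.im (hb i j)
    rw [hcd] at this
    split_ifs at this <;> simpa using this
  refine ⟨b.equivFun.symm, fun k l => ?_⟩
  have hT : ∀ k : Fin (2 * m), A (b.equivFun.symm (realFrame m k)) =
      (if (k : ℕ) % 2 = 0 then 1 else Complex.I : ℂ) • A (b ⟨k / 2, by omega⟩) := fun k => by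
    rw [← map_smul, Module.Basis.equivFun_symm_apply, realFrame,
      Finset.sum_eq_single (⟨k / 2, by omega⟩ : Fin m) (fun i _ hi => by simp [hi]) (by simp)]
    simp
  have hn : ∀ v w : V, κ ![v, -w] = -κ ![v, w] := fun v w => by
    rw [← neg_one_smul ℝ, pair_smul_right, neg_one_smul]
  rw [hT, hT, stdPair]
  rcases Nat.mod_two_eq_zero_or_one k with hk | hk <;>
    rcases Nat.mod_two_eq_zero_or_one l with hl | hl <;>
    by_cases he : (k : ℕ) / 2 = l / 2 <;>
    simp [hk, hl, he, hb1, hb2, hI, hn, smul_smul]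

/-- The real determinant of a complex linear map is the squared modulus of its complex determinant.
-/
theorem wedgePow_frame_comp (κ : V' [⋀^Fin 2]→L[ℝ] ℝ) {m : ℕ} (A : Cn m →ₗ[ℝ] V')
    (S : Cn m →ₗ[ℂ] Cn m) : wedgePow κ m (fun k => A (S (realFrame m k))) =
      Complex.normSq (LinearMap.det S) * wedgePow κ m (fun k => A (realFrame m k)) := by
  have h := wedgePow_comp_basis κ (realBasis m) A fun k => S (realFrame m k)
  have h2 : (realBasis m).det (fun k => S (realFrame m k)) = Complex.normSq (LinearMap.det S) := by
    have h3 := (realBasis m).det_comp (S.restrictScalars ℝ) (realBasis m)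
    rw [Module.Basis.det_self, mul_one, LinearMap.det_restrictScalars,
      Algebra.norm_complex_apply] at h3
    rw [← h3]
    congr 1
    funext k
    simp
  rw [h, h2]
  simp only [realBasis_apply]

/-- The frame carried by `A` is exchanged for a unitary frame `v`. The factor `d` is the same for
every form `κ'` pulled back by any `B`, so a bound on unit vectors becomes a comparison with `κ^m`
on the original frame. -/
theorem exists_unitary_wedgePow {κ : V [⋀^Fin 2]→L[ℝ] ℝ}
    (h11 : ∀ v w : V, κ ![Complex.I • v, Complex.I • w] = κ ![v, w])
    (hpos : ∀ v : V, v ≠ 0 → 0 < κ ![v, Complex.I • v]) {m : ℕ} {A : Cn m →ₗ[ℂ] V}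
    (hA : Function.Injective A) : ∃ (v : Fin (2 * m) → V) (d : ℝ), 0 < d ∧
      (∀ k, κ ![v k, Complex.I • v k] = 1) ∧
      wedgePow κ m (fun k => A (realFrame m k)) = d * stdVolume m ∧
      ∀ (κ' : V' [⋀^Fin 2]→L[ℝ] ℝ) (B : V →ₗ[ℝ] V'),
        wedgePow κ' m (fun k => B (A (realFrame m k))) = d * wedgePow κ' m fun k => B (v k) := by
  obtain ⟨T, hT⟩ := exists_unitary h11 hpos hA
  have hd : 0 < Complex.normSq (LinearMap.det (T.symm : Cn m →ₗ[ℂ] Cn m)) :=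
    Complex.normSq_pos.2 (LinearEquiv.isUnit_det' T.symm).ne_zero
  refine ⟨fun k => A (T (realFrame m k)), _, hd, fun k => ?_, ?_, fun κ' B => ?_⟩
  · have key : ∀ k : Fin (2 * m), (k : ℕ) % 2 = 0 →
        κ ![A (T (realFrame m k)), Complex.I • A (T (realFrame m k))] = 1 := fun k hk => by
      have h1 : realFrame m ⟨k + 1, by omega⟩ = Complex.I • realFrame m k := by
        rw [realFrame, realFrame, ← Pi.single_smul, if_neg (by simp only; omega), if_pos hk,
          smul_eq_mul, mul_one]
        congr 1
        exact Fin.ext (by simp only; omega)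
      have h2 := hT k ⟨k + 1, by omega⟩
      rw [h1, map_smul, map_smul, stdPair, if_pos (by simp only; omega),
        if_neg (by simp only; omega), if_pos hk] at h2
      exact h2
    rcases Nat.mod_two_eq_zero_or_one k with hk | hk
    · exact key k hk
    · have h1 : realFrame m k = Complex.I • realFrame m ⟨k - 1, by omega⟩ := by
        rw [realFrame, realFrame, ← Pi.single_smul, if_neg (by omega),
          if_pos (by simp only; omega), smul_eq_mul, mul_one]
        congr 1
        exact Fin.ext (by simp only; omega)
      simp only
      rw [h1, map_smul, map_smul, h11]
      exact key _ (by simp only; omega)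
  · have h := wedgePow_frame_comp κ (A.restrictScalars ℝ ∘ₗ (T : Cn m →ₗ[ℂ] Cn m).restrictScalars ℝ)
      (T.symm : Cn m →ₗ[ℂ] Cn m)
    simp only [LinearMap.comp_apply, LinearMap.coe_restrictScalars, LinearEquiv.coe_coe,
      LinearEquiv.apply_symm_apply] at h
    rw [h, wedgePow_eq_stdVolume hT]
  · have h := wedgePow_frame_comp κ' (B ∘ₗ A.restrictScalars ℝ ∘ₗ
      (T : Cn m →ₗ[ℂ] Cn m).restrictScalars ℝ) (T.symm : Cn m →ₗ[ℂ] Cn m)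
    simp only [LinearMap.comp_apply, LinearMap.coe_restrictScalars, LinearEquiv.coe_coe,
      LinearEquiv.apply_symm_apply] at h
    exact h

/-- The powers of a positive `(1,1)`-form do not vanish on independent real frames of complex
subspaces. -/
theorem wedgePow_ne_zero {κ : V [⋀^Fin 2]→L[ℝ] ℝ}
    (h11 : ∀ v w : V, κ ![Complex.I • v, Complex.I • w] = κ ![v, w])
    (hpos : ∀ v : V, v ≠ 0 → 0 < κ ![v, Complex.I • v]) {m : ℕ} {A : Cn m →ₗ[ℂ] V}
    (hA : Function.Injective A) {ζ : Fin (2 * m) → Cn m} (hζ : LinearIndependent ℝ ζ) :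
    wedgePow κ m (fun k => A (ζ k)) ≠ 0 := by
  obtain ⟨v, d, hd, -, h, -⟩ := exists_unitary_wedgePow (V' := V) h11 hpos hA
  have h2 := wedgePow_comp_basis κ (realBasis m) (A.restrictScalars ℝ) ζ
  simp only [realBasis_apply, LinearMap.coe_restrictScalars] at h2
  rw [h2, h]
  let b := Module.Basis.mk hζ (hζ.span_eq_top_of_card_eq_finrank'
    (by simp [Module.finrank_pi_fintype, mul_comm])).ge
  have h3 := ((realBasis m).isUnit_det b).ne_zero
  rw [Module.Basis.coe_mk] at h3
  exact mul_ne_zero h3 (mul_pos hd (stdVolume_pos m)).ne'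

theorem frame_eq_zero_of_not_injective {m : ℕ} {A : Cn m →ₗ[ℂ] V} (hA : ¬ Function.Injective A)
    (κ' : V' [⋀^Fin 2]→L[ℝ] ℝ) (B : V →ₗ[ℝ] V') :
    wedgePow κ' m (fun k => B (A (realFrame m k))) = 0 := by
  refine wedgePow_eq_zero_of_not_linearIndependent _ fun hli => hA ?_
  have h1 : LinearIndependent ℝ (A.restrictScalars ℝ ∘ realBasis m) := by
    refine LinearIndependent.of_comp B ?_
    convert hli using 1
    funext k
    simp
  refine (injective_iff_map_eq_zero A).2 fun x hx => ?_
  have h2 := Fintype.linearIndependent_iff.1 h1 ((realBasis m).repr x) (by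
    have h3 := congrArg (A.restrictScalars ℝ) ((realBasis m).sum_repr x)
    rw [map_sum] at h3
    simp only [map_smul] at h3
    exact h3.trans hx)
  rw [← (realBasis m).sum_repr x]
  exact Finset.sum_eq_zero fun i _ => by rw [h2 i, zero_smul]

theorem wedgePow_frame_nonneg {κ : V [⋀^Fin 2]→L[ℝ] ℝ}
    (h11 : ∀ v w : V, κ ![Complex.I • v, Complex.I • w] = κ ![v, w])
    (hpos : ∀ v : V, v ≠ 0 → 0 < κ ![v, Complex.I • v]) {m : ℕ} (A : Cn m →ₗ[ℂ] V) :
    0 ≤ wedgePow κ m (fun k => A (realFrame m k)) := by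
  by_cases hA : Function.Injective A
  · obtain ⟨v, d, hd, -, h, -⟩ := exists_unitary_wedgePow (V' := V) h11 hpos hA
    exact h.symm ▸ (mul_pos hd (stdVolume_pos m)).le
  · exact (frame_eq_zero_of_not_injective hA κ LinearMap.id).ge

/-- Comparison of a `2m`-form with the `m`-th power of a positive `(1,1)`-form on complex
frames. -/
theorem abs_wedgePow_frame_le {κ : V [⋀^Fin 2]→L[ℝ] ℝ}
    (h11 : ∀ v w : V, κ ![Complex.I • v, Complex.I • w] = κ ![v, w])
    (hpos : ∀ v : V, v ≠ 0 → 0 < κ ![v, Complex.I • v]) {m : ℕ} (A : Cn m →ₗ[ℂ] V)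
    (κ' : V' [⋀^Fin 2]→L[ℝ] ℝ) (B : V →ₗ[ℝ] V') {C : ℝ}
    (h : ∀ v : Fin (2 * m) → V, (∀ i, κ ![v i, Complex.I • v i] ≤ 1) →
      |wedgePow κ' m fun i => B (v i)| ≤ C) :
    |wedgePow κ' m (fun k => B (A (realFrame m k)))| ≤
      C / stdVolume m * wedgePow κ m (fun k => A (realFrame m k)) := by
  by_cases hA : Function.Injective A
  · obtain ⟨v, d, hd, h1, h2, h3⟩ := exists_unitary_wedgePow (V' := V') h11 hpos hA
    rw [h2, h3, abs_mul, abs_of_pos hd]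
    have h4 := h v fun i => (h1 i).le
    have h5 := (stdVolume_pos m).ne'
    have : C / stdVolume m * (d * stdVolume m) = d * C := by field_simp
    rw [this]
    exact mul_le_mul_of_nonneg_left h4 hd.le
  · rw [frame_eq_zero_of_not_injective hA κ' B]
    have := frame_eq_zero_of_not_injective hA κ LinearMap.id
    simp only [LinearMap.id_apply] at this
    rw [this, mul_zero, abs_zero]

end Positive

end LagrangianFibration

/-! ### Multilinear expansion, and pull-backs of forms in real coordinates -/

namespace LagrangianFibration

/-- In the expansion of `L (a + r b)` every term other than the leading one contains some `a_i`,
hence at most `d - 1` factors `r`; there are at most `2^d` terms. -/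
theorem abs_map_add_smul_sub_le {W : Type*} [AddCommGroup W] [Module ℝ W] {d : ℕ}
    (L : MultilinearMap ℝ (fun _ : Fin d => W) ℝ) (a b : Fin d → W) {C : ℝ}
    (hC : ∀ s : Finset (Fin d), |L (s.piecewise a b)| ≤ C) {r : ℝ} (hr : 1 ≤ r) :
    |L (a + r • b) - r ^ d * L b| ≤ 2 ^ d * C * r ^ (d - 1) := by
  classical
  have hC0 : 0 ≤ C := (abs_nonneg _).trans (hC ∅)
  have h1 : ∀ s : Finset (Fin d),
      L (s.piecewise a (r • b)) = r ^ (d - s.card) * L (s.piecewise a b) := by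
    intro s
    have h2 := L.map_piecewise_smul (fun _ => r) (s.piecewise a b) sᶜ
    rw [Finset.prod_const, Finset.card_compl, Fintype.card_fin, smul_eq_mul] at h2
    rw [← h2]
    congr 1
    funext i
    by_cases hi : i ∈ s <;> simp [Finset.piecewise, hi]
  have h3 : L (a + r • b) - r ^ d * L b =
      ∑ s ∈ Finset.univ.erase (∅ : Finset (Fin d)), r ^ (d - s.card) * L (s.piecewise a b) := by
    rw [L.map_add_univ, ← Finset.add_sum_erase _ _ (Finset.mem_univ ∅)]
    simp only [h1]
    simp
  rw [h3]
  have h4 : ∀ s ∈ Finset.univ.erase (∅ : Finset (Fin d)),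
      |r ^ (d - s.card) * L (s.piecewise a b)| ≤ r ^ (d - 1) * C := by
    intro s hs
    have hs' : 1 ≤ s.card := Finset.card_pos.2 (Finset.nonempty_iff_ne_empty.2 (Finset.ne_of_mem_erase hs))
    rw [abs_mul, abs_of_nonneg (by positivity)]
    exact mul_le_mul (pow_le_pow_right₀ hr (by omega)) (hC s) (abs_nonneg _) (by positivity)
  refine (Finset.abs_sum_le_sum_abs _ _).trans ((Finset.sum_le_sum h4).trans ?_)
  rw [Finset.sum_const, nsmul_eq_mul]
  have h5 : ((Finset.univ.erase (∅ : Finset (Fin d))).card : ℝ) ≤ 2 ^ d := by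
    have := Finset.card_le_card (Finset.erase_subset (∅ : Finset (Fin d)) Finset.univ)
    rw [Finset.card_univ, Fintype.card_finset, Fintype.card_fin] at this
    exact_mod_cast this
  calc _ ≤ 2 ^ d * (r ^ (d - 1) * C) := mul_le_mul_of_nonneg_right h5 (by positivity)
    _ = _ := by ring

section Pull

variable {n : ℕ} {X : Type*} [TopologicalSpace X] [ChartedSpace (Cn n) X] {ι : Type} [Finite ι]
  {V W : Type} [NormedAddCommGroup V] [NormedSpace ℝ V] [NormedAddCommGroup W] [NormedSpace ℝ W]

/-- The pull-back of a function of several tangent vectors. -/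
noncomputable def rpull (Φ : X → (ι → Cn n) → ℝ) (H : W → X) (w : W) (a : ι → W) : ℝ :=
  Φ (H w) fun i => rderiv n H w (a i)

omit [Finite ι] in
theorem rpull_congr (Φ : X → (ι → Cn n) → ℝ) {H K : W → X} {w : W} (h : H =ᶠ[𝓝 w] K) (a : ι → W) :
    rpull Φ H w a = rpull Φ K w a := by
  have h1 : mfderiv 𝓘(ℝ, W) 𝓘(ℝ, Cn n) H w = mfderiv 𝓘(ℝ, W) 𝓘(ℝ, Cn n) K w := h.mfderiv_eq
  have h3 : ∀ i, (rderiv n H w (a i) : Cn n) = rderiv n K w (a i) := fun i =>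
    congrArg (fun T : W →L[ℝ] Cn n => T (a i)) h1
  exact congrArg₂ Φ h.self_of_nhds (funext h3)

omit [Finite ι] in
theorem rpull_comp (Φ : X → (ι → Cn n) → ℝ) {H : V → X} {k : W → V} {w : W} {k' : W →L[ℝ] V}
    (hH : MDifferentiableAt 𝓘(ℝ, V) 𝓘(ℝ, Cn n) H (k w)) (hk : HasFDerivAt k k' w) (a : ι → W) :
    rpull Φ (fun w => H (k w)) w a = rpull Φ H (k w) fun i => k' (a i) := by
  unfold rpull
  rw [rderiv_comp hH hk]
  rfl

/-- Continuity, in charts, of a function of several tangent vectors. -/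
def ContinuousInCharts (Φ : X → (ι → Cn n) → ℝ) : Prop :=
  ∀ x₀ : X, ContinuousOn (fun z : Cn n × (ι → Cn n) => Φ ((chartAt (Cn n) x₀).symm z.1)
    fun i => pderiv n (chartAt (Cn n) x₀).symm z.1 (z.2 i)) ((chartAt (Cn n) x₀).target ×ˢ univ)

/-- Near a given point, `H` and its differential are computed in the fixed chart at its image, which
gives joint continuity in the point and the vectors. -/
theorem ContinuousInCharts.continuousOn_rpull [IsManifold 𝓘(ℂ, Cn n) ω X]
    {Φ : X → (ι → Cn n) → ℝ} (hΦ : ContinuousInCharts Φ) {S : Set W} (hS : IsOpen S) {H : W → X}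
    (hH : ContMDiffOn 𝓘(ℝ, W) 𝓘(ℝ, Cn n) ∞ H S) :
    ContinuousOn (fun z : W × (ι → W) => rpull Φ H z.1 z.2) (S ×ˢ univ) := by
  rintro ⟨w₀, a₀⟩ ⟨hw₀ : w₀ ∈ S, -⟩
  refine ContinuousAt.continuousWithinAt ?_
  set φ := chartAt (Cn n) (H w₀)
  set F : W → Cn n := fun w => φ (H w)
  have hF₀ : ContDiffAt ℝ ∞ F w₀ := contDiffAt_chart_comp (hH.contMDiffAt (hS.mem_nhds hw₀)) rfl
  set S' := S ∩ H ⁻¹' φ.source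
  have hS' : IsOpen S' := hH.continuousOn.isOpen_inter_preimage hS φ.open_source
  have hw₀' : w₀ ∈ S' := ⟨hw₀, mem_chart_source _ _⟩
  have hF1 : ∀ᶠ w in 𝓝 w₀, ContDiffAt ℝ 1 F w :=
    (hF₀.of_le (by exact_mod_cast le_top)).eventually (by simp)
  have hFt : F w₀ ∈ φ.target := φ.map_source (mem_chart_source _ _)
  have heq : (fun z : W × (ι → W) => Φ (φ.symm (F z.1))
      fun i => pderiv n φ.symm (F z.1) (fderiv ℝ F z.1 (z.2 i))) =ᶠ[𝓝 (w₀, a₀)]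
      fun z => rpull Φ H z.1 z.2 := by
    have h1 : ∀ᶠ z : W × (ι → W) in 𝓝 (w₀, a₀), z.1 ∈ S' ∧ ContDiffAt ℝ 1 F z.1 :=
      (continuous_fst.tendsto (w₀, a₀)).eventually (Filter.Eventually.and (hS'.mem_nhds hw₀') hF1)
    filter_upwards [h1] with ⟨w, a⟩ ⟨hw, hFw⟩
    have h2 : (fun w => φ.symm (F w)) =ᶠ[𝓝 w] H := by
      filter_upwards [hS'.mem_nhds hw] with y hy using φ.left_inv hy.2
    have h3 := (chart_mdifferentiable (n := n) (H w₀)).mdifferentiableAt_symm (φ.map_source hw.2)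
    have h4 := rpull_comp Φ (H := φ.symm) (k := F) (w := w)
      (HasMFDerivAt.real h3.hasMFDerivAt).mdifferentiableAt
      (hFw.differentiableAt one_ne_zero).hasFDerivAt a
    simp only
    rw [← rpull_congr Φ h2, h4]
    unfold rpull
    refine congrArg (Φ (φ.symm (F w))) (funext fun i => ?_)
    exact (rderiv_eq_pderiv (n := n) h3 _).symm
  refine ContinuousAt.congr ?_ heq
  have h5 : ContinuousAt (fun z : W × (ι → W) => (F z.1, fun i => fderiv ℝ F z.1 (z.2 i)))
      (w₀, a₀) := by
    refine ContinuousAt.prodMk (ContinuousAt.comp (g := F) hF₀.continuousAt continuousAt_fst)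
      (continuousAt_pi.2 fun i => ?_)
    have h6 : ContinuousAt (fderiv ℝ F) w₀ :=
      (hF₀.fderiv_right (m := 0) (by simp)).continuousAt
    exact (ContinuousAt.comp (g := fderiv ℝ F) (f := fun z : W × (ι → W) => z.1) h6
      continuousAt_fst).clm_apply ((continuous_apply i).comp continuous_snd).continuousAt
  exact ContinuousAt.comp (f := fun z : W × (ι → W) => (F z.1, fun i => fderiv ℝ F z.1 (z.2 i)))
    ((hΦ (H w₀)).continuousAt ((φ.open_target.prod isOpen_univ).mem_nhds ⟨hFt, mem_univ _⟩)) h5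

variable {κ : ∀ x : X, TX n x [⋀^Fin 2]→L[ℝ] ℝ}

/-- The `m`-th power of `κ`, as a function of tangent vectors. -/
noncomputable def wedgeFun (κ : ∀ x : X, TX n x [⋀^Fin 2]→L[ℝ] ℝ) (m : ℕ) (x : X)
    (v : Fin (2 * m) → Cn n) : ℝ :=
  wedgePow (V := TX n x) (κ x) m v

/-- The square of the length of a tangent vector. -/
noncomputable def sqLength (κ : ∀ x : X, TX n x [⋀^Fin 2]→L[ℝ] ℝ) (x : X) (v : Unit → Cn n) : ℝ :=
  κ x ![(v () : TX n x), (Complex.I • v () : TX n x)]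

theorem continuousOn_formInChart (hκ : IsKahlerForm κ) (x₀ : X) (c : ℂ) {A : Type*}
    [TopologicalSpace A] {α β : A → Cn n} (hα : Continuous α) (hβ : Continuous β) :
    ContinuousOn (fun z : Cn n × A => κ ((chartAt (Cn n) x₀).symm z.1)
      ![pderiv n (chartAt (Cn n) x₀).symm z.1 (α z.2),
        c • pderiv n (chartAt (Cn n) x₀).symm z.1 (β z.2)])
      ((chartAt (Cn n) x₀).target ×ˢ univ) := by
  set φ := chartAt (Cn n) x₀
  have h1 : ContinuousOn (fun z : Cn n × A => formInChart κ φ z.1) (φ.target ×ˢ univ) :=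
    ((hκ.smooth φ (chart_mem_atlas _ _)).continuousOn).comp continuousOn_fst fun z hz => hz.1
  have h2 : Continuous fun z : Cn n × A => (![α z.2, c • β z.2] : Fin 2 → Cn n) :=
    continuous_pi fun i => by
      fin_cases i
      · exact hα.comp continuous_snd
      · exact (hβ.comp continuous_snd).const_smul c
  have h3 : ContinuousOn (fun z : Cn n × A => formInChart κ φ z.1 ![α z.2, c • β z.2])
      (φ.target ×ˢ univ) := h1.eval h2.continuousOn
  refine h3.congr fun z _ => ?_
  refine congrArg (κ (φ.symm z.1)) (funext fun i => ?_)
  fin_cases i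
  · rfl
  · exact ((pderiv n φ.symm z.1).map_smul c (β z.2)).symm

theorem continuousInCharts_sqLength (hκ : IsKahlerForm κ) : ContinuousInCharts (sqLength κ) :=
  fun x₀ => continuousOn_formInChart hκ x₀ Complex.I (α := fun a : Unit → Cn n => a ())
    (β := fun a => a ()) (continuous_apply ()) (continuous_apply ())

theorem continuousInCharts_wedgeFun (hκ : IsKahlerForm κ) (m : ℕ) :
    ContinuousInCharts (wedgeFun κ m) := fun x₀ => by
  refine continuousOn_const.mul (continuousOn_finset_sum _ fun τ _ => continuousOn_const.mul
    (continuousOn_finset_prod _ fun i _ => ?_))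
  have h := continuousOn_formInChart hκ x₀ 1
    (α := fun a : Fin (2 * m) → Cn n => a (τ ⟨2 * i, by omega⟩))
    (β := fun a => a (τ ⟨2 * i + 1, by omega⟩)) (continuous_apply _) (continuous_apply _)
  simp only [one_smul] at h
  exact h

end Pull

end LagrangianFibration

namespace LagrangianFibration

/-- The pull-back of `κ^m` by a self-map. -/
noncomputable def pullWedge {n : ℕ} {X : Type*} [TopologicalSpace X] [ChartedSpace (Cn n) X]
    (κ : ∀ x : X, TX n x [⋀^Fin 2]→L[ℝ] ℝ) (m : ℕ) (h : X → X) (y : X)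
    (v : Fin (2 * m) → TX n y) : ℝ :=
  wedgePow (κ (h y)) m fun i => holDeriv n n h y (v i)

theorem mdifferentiable_iterate {n : ℕ} {X : Type*} [TopologicalSpace X] [ChartedSpace (Cn n) X]
    {f : X → X} (hf : MDifferentiable 𝓘(ℂ, Cn n) 𝓘(ℂ, Cn n) f) (k : ℕ) :
    MDifferentiable 𝓘(ℂ, Cn n) 𝓘(ℂ, Cn n) f^[k] := by
  induction k with
  | zero => exact mdifferentiable_id
  | succ k ih => exact ih.comp hf

/-! ### Iterates in Betti coordinates and uniform bounds -/

section Growth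

variable {g : ℕ} {X : Type*} [TopologicalSpace X] [ChartedSpace (Cn (2 * g)) X]
  {σ : ∀ x : X, TX (2 * g) x [⋀^Fin 2]→L[ℂ] ℂ} {O : Set X} {D : Set (Cn g)} {q : X → Cn g}
  {f : X → X} {E : Cn g → (Fin (2 * g) → ℝ) → X} {t : Cn g → Fin (2 * g) → ℝ}
  {κ : ∀ x : X, TX (2 * g) x [⋀^Fin 2]→L[ℝ] ℝ}

theorem IsBettiChart.iterate_eq (h : IsBettiChart O D q f E t) {u : Cn g} (hu : u ∈ D)
    (x : Fin (2 * g) → ℝ) (n : ℕ) : f^[n] (E u x) = E u (x + (n : ℝ) • t u) := by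
  induction n with
  | zero => simp
  | succ n ih =>
    rw [Function.iterate_succ_apply', ih, h.map_eq u hu]
    congr 1
    push_cast
    module

theorem IsBettiChart.mdifferentiableAt (h : IsBettiChart O D q f E t) {u : Cn g} (hu : u ∈ D)
    (x : Fin (2 * g) → ℝ) : MDifferentiableAt 𝓘(ℝ, Cn g × (Fin (2 * g) → ℝ)) 𝓘(ℝ, Cn (2 * g))
      (fun w : Cn g × (Fin (2 * g) → ℝ) => E w.1 w.2) (u, x) :=
  ((h.smooth.contMDiffAt ((h.isOpen.prod isOpen_univ).mem_nhds ⟨hu, mem_univ x⟩)).mdifferentiableAt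
    (by simp))

/-- `E` is invariant under integral translations of `x`, whose differential is the identity.
Estimates over all `x` reduce to the compact unit cube. -/
theorem IsBettiChart.exists_fract (h : IsBettiChart O D q f E t) {u : Cn g} (hu : u ∈ D)
    (x : Fin (2 * g) → ℝ) : ∃ x' ∈ Icc (0 : Fin (2 * g) → ℝ) 1, ∀ {ι : Type}
      (Φ : X → (ι → Cn (2 * g)) → ℝ) (a : ι → Cn g × (Fin (2 * g) → ℝ)),
      rpull Φ (fun w : Cn g × (Fin (2 * g) → ℝ) => E w.1 w.2) (u, x) a =
        rpull Φ (fun w : Cn g × (Fin (2 * g) → ℝ) => E w.1 w.2) (u, x') a := by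
  refine ⟨fun i => Int.fract (x i), ⟨fun i => Int.fract_nonneg _, fun i => (Int.fract_lt_one _).le⟩,
    fun {ι} Φ a => ?_⟩
  set m : Fin (2 * g) → ℝ := fun i => (⌊x i⌋ : ℝ)
  have hx : x = (fun i => Int.fract (x i)) + m := funext fun i => (Int.fract_add_floor (x i)).symm
  have hk : HasFDerivAt (fun w : Cn g × (Fin (2 * g) → ℝ) => (w.1, w.2 + m))
      (ContinuousLinearMap.id ℝ _) (u, fun i => Int.fract (x i)) :=
    (hasFDerivAt_id (u, fun i => Int.fract (x i))).add_const ((0 : Cn g), m) |>.congr_of_eventuallyEq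
      (Eventually.of_forall fun w => by simp [Prod.ext_iff])
  have h1 := rpull_comp Φ (H := fun w : Cn g × (Fin (2 * g) → ℝ) => E w.1 w.2)
    (k := fun w : Cn g × (Fin (2 * g) → ℝ) => (w.1, w.2 + m)) (h.mdifferentiableAt hu _) hk a
  have h2 : (fun w : Cn g × (Fin (2 * g) → ℝ) => E w.1 (w.2 + m)) =ᶠ[𝓝 (u, fun i => Int.fract (x i))]
      fun w => E w.1 w.2 := by
    filter_upwards [(h.isOpen.prod isOpen_univ).mem_nhds
      (⟨hu, mem_univ _⟩ : (u, fun i => Int.fract (x i)) ∈ D ×ˢ univ)] with w hw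
    exact (h.periodic w.1 hw.1 _ _).2 fun i => ⟨⌊x i⌋, by simp [m]⟩
  rw [rpull_congr Φ h2] at h1
  rw [h1]
  simp only [← hx]
  rfl

/-- The chain rule for `(u, x) ↦ (u, x + n t u)`: the iterate disappears in favor of the fixed map
`E`, at a point and on vectors depending on `n`. -/
theorem IsBettiChart.pullWedge_eq (h : IsBettiChart O D q f E t)
    (hf : MDifferentiable 𝓘(ℂ, Cn (2 * g)) 𝓘(ℂ, Cn (2 * g)) f) {u : Cn g} (hu : u ∈ D)
    (x : Fin (2 * g) → ℝ) (a : Fin (2 * g) → Cn g × (Fin (2 * g) → ℝ)) (n : ℕ) :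
    pullWedge κ g f^[n] (E u x)
      (fun i => rderiv (2 * g) (fun w : Cn g × (Fin (2 * g) → ℝ) => E w.1 w.2) (u, x) (a i)) =
    rpull (wedgeFun κ g) (fun w : Cn g × (Fin (2 * g) → ℝ) => E w.1 w.2) (u, x + (n : ℝ) • t u)
      fun i => a i + (n : ℝ) • ((0 : Cn g), fderiv ℝ t u (a i).1) := by
  set H := fun w : Cn g × (Fin (2 * g) → ℝ) => E w.1 w.2
  have ht : HasFDerivAt t (fderiv ℝ t u) u :=
    ((h.contDiffAt u hu).differentiableAt (by simp)).hasFDerivAt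
  have hk : HasFDerivAt (fun w : Cn g × (Fin (2 * g) → ℝ) => (w.1, w.2 + (n : ℝ) • t w.1))
      ((ContinuousLinearMap.fst ℝ (Cn g) (Fin (2 * g) → ℝ)).prod
        (ContinuousLinearMap.snd ℝ (Cn g) (Fin (2 * g) → ℝ) +
          (n : ℝ) • (fderiv ℝ t u).comp (ContinuousLinearMap.fst ℝ (Cn g) (Fin (2 * g) → ℝ))))
      (u, x) :=
    hasFDerivAt_fst.prodMk (hasFDerivAt_snd.add
      ((HasFDerivAt.comp (g := t) (u, x) ht hasFDerivAt_fst).const_smul (n : ℝ)))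
  have h1 := rpull_comp (wedgeFun κ g) (H := H)
    (k := fun w : Cn g × (Fin (2 * g) → ℝ) => (w.1, w.2 + (n : ℝ) • t w.1))
    (h.mdifferentiableAt hu _) hk a
  have h2 : (fun w => f^[n] (H w)) =ᶠ[𝓝 (u, x)] fun w => E w.1 (w.2 + (n : ℝ) • t w.1) := by
    filter_upwards [(h.isOpen.prod isOpen_univ).mem_nhds
      (⟨hu, mem_univ _⟩ : (u, x) ∈ D ×ˢ univ)] with w hw using h.iterate_eq hw.1 w.2 n
  have h3 : rpull (wedgeFun κ g) (fun w => f^[n] (H w)) (u, x) a =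
      pullWedge κ g f^[n] (E u x) (fun i => rderiv (2 * g) H (u, x) (a i)) := by
    unfold rpull wedgeFun pullWedge
    refine congrArg (wedgePow (κ (f^[n] (E u x))) g) (funext fun i => ?_)
    exact rderiv_map (mdifferentiable_iterate hf n _) (h.mdifferentiableAt hu x) (a i)
  rw [← h3, rpull_congr _ h2]
  refine h1.trans ?_
  refine congrArg (rpull (wedgeFun κ g) H _) (funext fun i => ?_)
  simp [Prod.ext_iff]

theorem IsBettiChart.rpull_bounded [IsManifold 𝓘(ℂ, Cn (2 * g)) ω X]
    (h : IsBettiChart O D q f E t) {ι : Type} [Fintype ι]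
    {Φ : X → (ι → Cn (2 * g)) → ℝ} (hΦ : ContinuousInCharts Φ) {K : Set (Cn g)} (hK : IsCompact K)
    (hKD : K ⊆ D) (R : ℝ) : ∃ C, ∀ u ∈ K, ∀ x, ∀ a : ι → Cn g × (Fin (2 * g) → ℝ),
      (∀ i, ‖a i‖ ≤ R) →
      |rpull Φ (fun w : Cn g × (Fin (2 * g) → ℝ) => E w.1 w.2) (u, x) a| ≤ C := by
  have h1 := hΦ.continuousOn_rpull (h.isOpen.prod isOpen_univ) h.smooth
  have h2 : IsCompact ((K ×ˢ Icc (0 : Fin (2 * g) → ℝ) 1) ×ˢ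
      (Set.pi univ fun _ : ι => Metric.closedBall (0 : Cn g × (Fin (2 * g) → ℝ)) R)) :=
    (hK.prod isCompact_Icc).prod (isCompact_univ_pi fun _ => isCompact_closedBall _ _)
  obtain ⟨C, hC⟩ := h2.exists_bound_of_continuousOn
    (h1.mono (prod_mono (prod_mono hKD (subset_univ _)) (subset_univ _)))
  refine ⟨C, fun u hu x a ha => ?_⟩
  obtain ⟨x', hx', hxx⟩ := h.exists_fract (hKD hu) x
  rw [hxx]
  exact hC ((u, x'), a) ⟨⟨hu, hx'⟩, fun i _ => mem_closedBall_zero_iff.2 (ha i)⟩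

theorem rpull_sqLength_smul {W : Type} [NormedAddCommGroup W] [NormedSpace ℝ W]
    (κ : ∀ x : X, TX (2 * g) x [⋀^Fin 2]→L[ℝ] ℝ) (H : W → X) (w : W) (s : ℝ) (b : W) :
    rpull (sqLength κ) H w (fun _ => s • b) = s ^ 2 * rpull (sqLength κ) H w fun _ => b := by
  have h5 : κ (H w) ![s • rderiv (2 * g) H w b, s • Complex.I • rderiv (2 * g) H w b] =
      s ^ 2 * κ (H w) ![rderiv (2 * g) H w b, Complex.I • rderiv (2 * g) H w b] := by
    rw [pair_smul_left, pair_smul_right, smul_eq_mul, smul_eq_mul]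
    ring
  refine Eq.trans ?_ h5
  refine congrArg (κ (H w)) (funext fun i => ?_)
  have h6 := (rderiv (2 * g) H w).map_smul s b
  fin_cases i
  · exact h6
  · refine (congrArg (fun v : TX (2 * g) (H w) => Complex.I • v) h6).trans ?_
    exact smul_comm _ _ _

/-- By homogeneity and periodicity it is enough to minimize over unit vectors and the unit cube,
where the length is positive since `E` is an immersion. -/
theorem IsBettiChart.exists_le_sqLength [IsManifold 𝓘(ℂ, Cn (2 * g)) ω X] (hκ : IsKahlerForm κ)
    (h : IsBettiChart O D q f E t) {K : Set (Cn g)} (hK : IsCompact K) (hKD : K ⊆ D) :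
    ∃ c > 0, ∀ u ∈ K, ∀ x, ∀ a : Cn g × (Fin (2 * g) → ℝ), c * ‖a‖ ^ 2 ≤
      rpull (sqLength κ) (fun w : Cn g × (Fin (2 * g) → ℝ) => E w.1 w.2) (u, x) fun _ => a := by
  set H := fun w : Cn g × (Fin (2 * g) → ℝ) => E w.1 w.2
  have h1 := (continuousInCharts_sqLength hκ).continuousOn_rpull (h.isOpen.prod isOpen_univ) h.smooth
  have h2 : IsCompact ((K ×ˢ Icc (0 : Fin (2 * g) → ℝ) 1) ×ˢ
      Metric.sphere (0 : Cn g × (Fin (2 * g) → ℝ)) 1) :=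
    (hK.prod isCompact_Icc).prod (isCompact_sphere _ _)
  have h3 : ContinuousOn (fun z : (Cn g × (Fin (2 * g) → ℝ)) × (Cn g × (Fin (2 * g) → ℝ)) =>
      rpull (sqLength κ) H z.1 fun _ => z.2) ((K ×ˢ Icc (0 : Fin (2 * g) → ℝ) 1) ×ˢ
      Metric.sphere (0 : Cn g × (Fin (2 * g) → ℝ)) 1) :=
    h1.comp (f := fun z : (Cn g × (Fin (2 * g) → ℝ)) × (Cn g × (Fin (2 * g) → ℝ)) =>
      (z.1, fun _ : Unit => z.2)) (by fun_prop) fun z hz => ⟨⟨hKD hz.1.1, mem_univ _⟩, mem_univ _⟩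
  obtain ⟨c, hc, hcm⟩ := h2.exists_forall_le' h3 (a := 0) fun z hz => by
    refine hκ.pos _ _ fun h0 => ?_
    have h4 : z.2 = 0 := h.immersion z.1.1 (hKD hz.1.1) z.1.2 (h0.trans (map_zero _).symm)
    rw [mem_prod, h4] at hz
    simp at hz
  refine ⟨c, hc, fun u hu x a => ?_⟩
  obtain ⟨x', hx', hxx⟩ := h.exists_fract (hKD hu) x
  rw [hxx]
  rcases eq_or_ne a 0 with rfl | ha
  · have := rpull_sqLength_smul κ H (u, x') 0 0
    rw [zero_smul] at this
    rw [this]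
    simp
  · have h7 := hcm ((u, x'), ‖a‖⁻¹ • a) ⟨⟨hu, hx'⟩, by
      simp [norm_smul, ha]⟩
    have h8 := rpull_sqLength_smul κ H (u, x') ‖a‖ (‖a‖⁻¹ • a)
    rw [smul_smul, mul_inv_cancel₀ (norm_ne_zero_iff.2 ha), one_smul] at h8
    rw [h8, mul_comm]
    exact mul_le_mul_of_nonneg_left h7 (by positivity)

end Growth

end LagrangianFibration

namespace LagrangianFibration

/-! ### The leading coefficient of the growth -/

section Growth

variable {g : ℕ} {X : Type*} [TopologicalSpace X] [ChartedSpace (Cn (2 * g)) X]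
  {σ : ∀ x : X, TX (2 * g) x [⋀^Fin 2]→L[ℂ] ℂ} {O : Set X} {D : Set (Cn g)} {q : X → Cn g}
  {f : X → X} {E : Cn g → (Fin (2 * g) → ℝ) → X} {t : Cn g → Fin (2 * g) → ℝ}
  {κ : ∀ x : X, TX (2 * g) x [⋀^Fin 2]→L[ℝ] ℝ}

theorem IsBettiChart.vderiv_rderiv (T : IsTorusFibration σ O D q) (h : IsBettiChart O D q f E t)
    {u : Cn g} (hu : u ∈ D) (x : Fin (2 * g) → ℝ) (a : Cn g × (Fin (2 * g) → ℝ)) :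
    vderiv (2 * g) q (E u x)
      (rderiv (2 * g) (fun w : Cn g × (Fin (2 * g) → ℝ) => E w.1 w.2) (u, x) a) = a.1 := by
  have h1 := hasFDerivAt_real_comp (n := 2 * g) (e := q)
    (H := fun w : Cn g × (Fin (2 * g) → ℝ) => E w.1 w.2) (w := (u, x))
    (T.mdiff.mdifferentiableAt (T.isOpen.mem_nhds (h.mem u hu x).1)) (h.mdifferentiableAt hu x)
  have h2 : HasFDerivAt (fun w : Cn g × (Fin (2 * g) → ℝ) => q (E w.1 w.2))
      (ContinuousLinearMap.fst ℝ (Cn g) (Fin (2 * g) → ℝ)) (u, x) := by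
    refine hasFDerivAt_fst.congr_of_eventuallyEq ?_
    filter_upwards [(h.isOpen.prod isOpen_univ).mem_nhds
      (⟨hu, mem_univ _⟩ : (u, x) ∈ D ×ˢ univ)] with w hw using (h.mem w.1 hw.1 w.2).2
  exact congrArg (fun L : Cn g × (Fin (2 * g) → ℝ) →L[ℝ] Cn g => L a) (h1.unique h2)

/-- The kernel of `dq` is a complex subspace of dimension `g`, and the vertical Betti vectors form a
real basis of it; the `g`-th power of a positive form does not vanish on such a basis. -/
theorem IsBettiChart.rpull_vertical_ne_zero (hκ : IsKahlerForm κ) (T : IsTorusFibration σ O D q)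
    (h : IsBettiChart O D q f E t) {u : Cn g} (hu : u ∈ D) (x : Fin (2 * g) → ℝ) :
    rpull (wedgeFun κ g) (fun w : Cn g × (Fin (2 * g) → ℝ) => E w.1 w.2) (u, x)
      (fun i => ((0 : Cn g), Pi.single i (1 : ℝ))) ≠ 0 := by
  set H := fun w : Cn g × (Fin (2 * g) → ℝ) => E w.1 w.2
  set y := E u x
  set L : TX (2 * g) y →ₗ[ℂ] Cn g := (vderiv (2 * g) q y).toLinearMap
  have hfin : Module.finrank ℂ (LinearMap.ker L) = Module.finrank ℂ (Cn g) := by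
    have h1 := LinearMap.finrank_range_add_finrank_ker L
    have h2 : LinearMap.range L = ⊤ := LinearMap.range_eq_top.2 (T.submersion y (h.mem u hu x).1)
    have h3 : Module.finrank ℂ (TX (2 * g) y) = 2 * g := by
      refine Eq.trans (b := Module.finrank ℂ (Cn (2 * g))) rfl (by simp)
    rw [h2, finrank_top, h3] at h1
    simp only [Module.finrank_fin_fun] at h1 ⊢
    omega
  let e : LinearMap.ker L ≃ₗ[ℂ] Cn g := LinearEquiv.ofFinrankEq _ _ hfin
  let A : Cn g →ₗ[ℂ] TX (2 * g) y := (LinearMap.ker L).subtype ∘ₗ e.symm.toLinearMap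
  have hA : Function.Injective A := Subtype.val_injective.comp e.symm.injective
  let v : Fin (2 * g) → TX (2 * g) y := fun i =>
    rderiv (2 * g) H (u, x) ((0 : Cn g), Pi.single i (1 : ℝ))
  have hv : ∀ i, v i ∈ LinearMap.ker L := fun i => LinearMap.mem_ker.2 (h.vderiv_rderiv T hu x _)
  have hAv : ∀ i, A (e ⟨v i, hv i⟩) = v i := fun i =>
    congrArg Subtype.val (e.symm_apply_apply ⟨v i, hv i⟩)
  have h1 : LinearIndependent ℝ v := by
    have h2 : LinearIndependent ℝ fun i : Fin (2 * g) => ((0 : Cn g), Pi.single i (1 : ℝ)) := by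
      have := (Pi.basisFun ℝ (Fin (2 * g))).linearIndependent.map'
        (LinearMap.inr ℝ (Cn g) (Fin (2 * g) → ℝ)) (LinearMap.ker_eq_bot.2 LinearMap.inr_injective)
      rwa [show ⇑(LinearMap.inr ℝ (Cn g) (Fin (2 * g) → ℝ)) ∘ ⇑(Pi.basisFun ℝ (Fin (2 * g))) =
        fun i => ((0 : Cn g), Pi.single i (1 : ℝ)) from funext fun i => by simp] at this
    exact h2.map' (rderiv (2 * g) H (u, x)).toLinearMap
      (LinearMap.ker_eq_bot.2 (h.immersion u hu x))
  have h2 : LinearIndependent ℝ fun i => e ⟨v i, hv i⟩ := by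
    refine LinearIndependent.of_comp (A.restrictScalars ℝ) ?_
    have h3 : (A.restrictScalars ℝ) ∘ (fun i => e ⟨v i, hv i⟩) = v := funext hAv
    rw [h3]
    exact h1
  have h3 := wedgePow_ne_zero (κ := κ y) (hκ.type_one_one y) (hκ.pos y) hA h2
  have h4 : (fun i => A (e ⟨v i, hv i⟩)) = v := funext hAv
  rw [h4] at h3
  exact h3

theorem exists_multilinear_rpull {W : Type} [NormedAddCommGroup W] [NormedSpace ℝ W]
    (κ : ∀ x : X, TX (2 * g) x [⋀^Fin 2]→L[ℝ] ℝ) (m : ℕ) (H : W → X) (w : W) :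
    ∃ L : MultilinearMap ℝ (fun _ : Fin (2 * m) => W) ℝ, ∀ a, rpull (wedgeFun κ m) H w a = L a := by
  let A : W [⋀^Fin (2 * m)]→ₗ[ℝ] ℝ :=
    (wedgeAlt (κ (H w)) m).compLinearMap (rderiv (2 * g) H w).toLinearMap
  exact ⟨A.toMultilinearMap, fun a => (wedgeAlt_apply (κ (H w)) m
    fun i => rderiv (2 * g) H w (a i)).symm⟩

/-- Two changes of basis: from `υ` to the standard real frame of `ℂᵍ`, then, through `dt`, to the
canonical basis of `ℝ^{2g}`. -/
theorem rpull_vertical_eq (H : Cn g × (Fin (2 * g) → ℝ) → X) (w : Cn g × (Fin (2 * g) → ℝ)) (u : Cn g)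
    (υ : Fin (2 * g) → Cn g) :
    rpull (wedgeFun κ g) H w (fun i => ((0 : Cn g), fderiv ℝ t u (υ i))) =
      jac t u * (realBasis g).det υ *
        rpull (wedgeFun κ g) H w (fun i => ((0 : Cn g), Pi.single i (1 : ℝ))) := by
  set A : (Fin (2 * g) → ℝ) →ₗ[ℝ] TX (2 * g) (H w) :=
    (rderiv (2 * g) H w).toLinearMap ∘ₗ LinearMap.inr ℝ (Cn g) (Fin (2 * g) → ℝ)
  have h1 := wedgePow_comp_basis (κ (H w)) (realBasis g) (A ∘ₗ (fderiv ℝ t u).toLinearMap) υ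
  have h2 := wedgePow_comp_basis (κ (H w)) (Pi.basisFun ℝ (Fin (2 * g))) A
    fun i => fderiv ℝ t u (realFrame g i)
  rw [Pi.basisFun_det_apply, ← Matrix.det_transpose] at h2
  have h3 : ∀ ξ : Fin (2 * g) → Fin (2 * g) → ℝ, rpull (wedgeFun κ g) H w
    (fun i => ((0 : Cn g), ξ i)) = wedgePow (κ (H w)) g fun i => A (ξ i) := fun _ => rfl
  rw [h3, h3]
  simp only [LinearMap.comp_apply, realBasis_apply] at h1
  simp only [Pi.basisFun_apply] at h2
  refine h1.trans ?_
  rw [mul_comm (jac t u), mul_assoc]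
  congr 1

/-- In Betti coordinates, the pull-back of `κ^g` by the `n`-th iterate of `f` grows like `n^{2g}`,
with a coefficient proportional to the jacobian of the translation vector. -/
theorem IsBettiChart.growth [IsManifold 𝓘(ℂ, Cn (2 * g)) ω X] (hκ : IsKahlerForm κ)
    (T : IsTorusFibration σ O D q) (h : IsBettiChart O D q f E t)
    (hf : MDifferentiable 𝓘(ℂ, Cn (2 * g)) 𝓘(ℂ, Cn (2 * g)) f) {K : Set (Cn g)} (hK : IsCompact K)
    (hKD : K ⊆ D) (R : ℝ) : ∃ c C : ℝ, 0 < c ∧ 0 ≤ C ∧ ∀ u ∈ K, ∀ x,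
      ∀ a : Fin (2 * g) → Cn g × (Fin (2 * g) → ℝ), (∀ i, ‖a i‖ ≤ R) → ∀ n : ℕ, 1 ≤ n →
      ∃ k : ℝ, c ≤ |k| ∧ |jac t u * (realBasis g).det (fun i => (a i).1) * k| ≤ C ∧
        |pullWedge κ g f^[n] (E u x) (fun i =>
        rderiv (2 * g) (fun w : Cn g × (Fin (2 * g) → ℝ) => E w.1 w.2) (u, x) (a i)) -
        (n : ℝ) ^ (2 * g) * (jac t u * (realBasis g).det (fun i => (a i).1) * k)| ≤
          C * (n : ℝ) ^ (2 * g - 1) := by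
  set H := fun w : Cn g × (Fin (2 * g) → ℝ) => E w.1 w.2
  have hcont := continuousInCharts_wedgeFun hκ g
  obtain ⟨L, hL⟩ := hK.exists_bound_of_continuousOn (f := fderiv ℝ t) fun u hu =>
    (((h.contDiffAt u (hKD hu)).fderiv_right (m := 0) (by simp)).continuousAt).continuousWithinAt
  -- A common bound for the vectors `a i` and their vertical images `dt(a i)`, so that every mixed
  -- term of the expansion is controlled by one constant.
  set R' := max R (|L| * |R|)
  obtain ⟨C₁, hC₁⟩ := h.rpull_bounded hcont hK hKD R'
  have hcc : ∃ c > 0, ∀ u ∈ K, ∀ x, c ≤ |rpull (wedgeFun κ g) H (u, x)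
      (fun i => ((0 : Cn g), Pi.single i (1 : ℝ)))| := by
    have h1 := hcont.continuousOn_rpull (h.isOpen.prod isOpen_univ) h.smooth
    have h3 : ContinuousOn (fun z : Cn g × (Fin (2 * g) → ℝ) => |rpull (wedgeFun κ g) H z
        (fun i => ((0 : Cn g), Pi.single i (1 : ℝ)))|) (K ×ˢ Icc (0 : Fin (2 * g) → ℝ) 1) :=
      ContinuousOn.abs (h1.comp (f := fun z : Cn g × (Fin (2 * g) → ℝ) =>
        (z, fun i : Fin (2 * g) => ((0 : Cn g), (Pi.single i (1 : ℝ) : Fin (2 * g) → ℝ))))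
        (by fun_prop) fun z hz => ⟨⟨hKD hz.1, mem_univ _⟩, mem_univ _⟩)
    obtain ⟨c, hc, hcm⟩ := (hK.prod isCompact_Icc).exists_forall_le' h3 (a := 0) fun z hz =>
      abs_pos.2 (h.rpull_vertical_ne_zero hκ T (hKD hz.1) z.2)
    refine ⟨c, hc, fun u hu x => ?_⟩
    obtain ⟨x', hx', hxx⟩ := h.exists_fract (hKD hu) x
    rw [hxx]
    exact hcm (u, x') ⟨hu, hx'⟩
  obtain ⟨c, hc, hcm⟩ := hcc
  -- The number `k` is the value of `κ^g` on the vertical frame at `x + n t u`; it depends on `n`,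
  -- but its modulus is at least `c`.
  refine ⟨c, 2 ^ (2 * g) * |C₁|, hc, by positivity, fun u hu x a ha n hn =>
    ⟨_, hcm u hu (x + (n : ℝ) • t u), ?_⟩⟩
  set b : Fin (2 * g) → Cn g × (Fin (2 * g) → ℝ) := fun i => ((0 : Cn g), fderiv ℝ t u (a i).1)
  have hb : ∀ i, ‖b i‖ ≤ |L| * |R| := fun i => by
    have h1 : ‖b i‖ = ‖fderiv ℝ t u (a i).1‖ := by simp [b, Prod.norm_def]
    rw [h1]
    refine ((fderiv ℝ t u).le_opNorm _).trans (mul_le_mul ((hL u hu).trans (le_abs_self _))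
      (((norm_fst_le _).trans (ha i)).trans (le_abs_self _)) (norm_nonneg _) (abs_nonneg _))
  rw [← rpull_vertical_eq]
  constructor
  · refine (hC₁ u hu _ _ fun i => (hb i).trans (le_max_right _ _)).trans
      ((le_abs_self _).trans (le_mul_of_one_le_left (abs_nonneg _) (one_le_pow₀ one_le_two)))
  · rw [h.pullWedge_eq hf (hKD hu)]
    have h2 : (fun i => a i + (n : ℝ) • ((0 : Cn g), fderiv ℝ t u (a i).1)) = a + (n : ℝ) • b := rfl
    obtain ⟨L', hL'⟩ := exists_multilinear_rpull κ g H (u, x + (n : ℝ) • t u)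
    rw [h2, hL', hL']
    refine (abs_map_add_smul_sub_le _ a b (C := |C₁|) (fun s => ?_) (by exact_mod_cast hn))
    rw [← hL']
    refine (hC₁ u hu _ _ fun i => ?_).trans (le_abs_self _)
    by_cases hi : i ∈ s
    · rw [Finset.piecewise_eq_of_mem _ _ _ hi]
      exact (ha i).trans (le_max_left _ _)
    · rw [Finset.piecewise_eq_of_notMem _ _ _ hi]
      exact (hb i).trans (le_max_right _ _)

end Growth

end LagrangianFibration

namespace LagrangianFibration

/-! ### Slow points, upper bounds, and lower bounds along étale patches -/

section Growth

variable {g : ℕ} {X : Type*} [TopologicalSpace X] [ChartedSpace (Cn (2 * g)) X]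
  {σ : ∀ x : X, TX (2 * g) x [⋀^Fin 2]→L[ℂ] ℂ} {O : Set X} {D : Set (Cn g)} {q : X → Cn g}
  {f : X → X} {E : Cn g → (Fin (2 * g) → ℝ) → X} {t : Cn g → Fin (2 * g) → ℝ}
  {κ : ∀ x : X, TX (2 * g) x [⋀^Fin 2]→L[ℝ] ℝ}

/-- The pull-backs of `κ^g` by the iterates of `f` are `O(n^{2g-1})` at the point `y`. -/
def IsSlow (κ : ∀ x : X, TX (2 * g) x [⋀^Fin 2]→L[ℝ] ℝ) (f : X → X) (y : X) : Prop :=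
  ∃ C : ℝ, ∀ n : ℕ, 1 ≤ n → ∀ v : Fin (2 * g) → TX (2 * g) y,
    (∀ i, κ y ![v i, Complex.I • v i] ≤ 1) →
      |pullWedge κ g f^[n] y v| ≤ C * (n : ℝ) ^ (2 * g - 1)

theorem IsBettiChart.surjective_rderiv (h : IsBettiChart O D q f E t) {u : Cn g} (hu : u ∈ D)
    (x : Fin (2 * g) → ℝ) : Function.Surjective
      (rderiv (2 * g) (fun w : Cn g × (Fin (2 * g) → ℝ) => E w.1 w.2) (u, x)) := by
  let L : Cn g × (Fin (2 * g) → ℝ) →ₗ[ℝ] Cn (2 * g) :=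
    (rderiv (2 * g) (fun w : Cn g × (Fin (2 * g) → ℝ) => E w.1 w.2) (u, x)).toLinearMap
  have hL : Function.Injective L := h.immersion u hu x
  have hfin : Module.finrank ℝ (Cn g × (Fin (2 * g) → ℝ)) = Module.finrank ℝ (Cn (2 * g)) := by
    simp [Module.finrank_pi_fintype, Module.finrank_prod]
    ring
  exact (LinearMap.injective_iff_surjective_of_finrank_eq_finrank (f := L) hfin).1 hL

variable [IsManifold 𝓘(ℂ, Cn (2 * g)) ω X]

/-- Vectors of length at most one have bounded Betti coordinates, by
`IsBettiChart.exists_le_sqLength`, so `IsBettiChart.growth` applies with one radius for all of them.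
The same constant serves at all slow points over `K`: this will turn pointwise slowness into a
uniform estimate. -/
theorem IsBettiChart.exists_upper_bound (hκ : IsKahlerForm κ) (T : IsTorusFibration σ O D q)
    (h : IsBettiChart O D q f E t)
    (hf : MDifferentiable 𝓘(ℂ, Cn (2 * g)) 𝓘(ℂ, Cn (2 * g)) f) {K : Set (Cn g)} (hK : IsCompact K)
    (hKD : K ⊆ D) : ∃ C : ℝ, 0 ≤ C ∧ ∀ y ∈ O, q y ∈ K → ∀ n : ℕ, 1 ≤ n →
      ∀ v : Fin (2 * g) → TX (2 * g) y, (∀ i, κ y ![v i, Complex.I • v i] ≤ 1) →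
      |pullWedge κ g f^[n] y v| ≤ C * (n : ℝ) ^ (2 * g) ∧
      (jac t (q y) = 0 → |pullWedge κ g f^[n] y v| ≤ C * (n : ℝ) ^ (2 * g - 1)) := by
  obtain ⟨c, hc, hcm⟩ := h.exists_le_sqLength hκ hK hKD
  obtain ⟨c', C, -, hC, hgr⟩ := h.growth hκ T hf hK hKD (√c)⁻¹
  refine ⟨2 * C, by positivity, fun y hy hqy n hn v hv => ?_⟩
  obtain ⟨u, rfl⟩ : ∃ u, q y = u := ⟨_, rfl⟩
  obtain ⟨x, hx⟩ := h.surj (q y) (hKD hqy) y hy rfl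
  set u := q y
  clear_value u
  subst hx
  set H := fun w : Cn g × (Fin (2 * g) → ℝ) => E w.1 w.2
  choose a ha using fun i => h.surjective_rderiv (hKD hqy) x (v i)
  have haR : ∀ i, ‖a i‖ ≤ (√c)⁻¹ := fun i => by
    have h1 := hcm u hqy x (a i)
    have h2 : rpull (sqLength κ) H (u, x) (fun _ => a i) ≤ 1 := by
      refine le_trans (le_of_eq ?_) (hv i)
      have h3 : rderiv (2 * g) H (u, x) (a i) = v i := ha i
      exact congrArg (fun w : TX (2 * g) (E u x) => κ (E u x) ![w, Complex.I • w]) h3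
    have h4 := Real.sqrt_pos.2 hc
    rw [← one_div, le_div_iff₀ h4]
    refine (sq_le_one_iff₀ (by positivity)).1 ?_
    rw [mul_pow, Real.sq_sqrt hc.le]
    linarith
  have hv' : (fun i => rderiv (2 * g) H (u, x) (a i)) = v := funext ha
  obtain ⟨k, -, hk, hgk⟩ := hgr u hqy x a haR n hn
  rw [hv'] at hgk
  have hn1 : (1 : ℝ) ≤ n := by exact_mod_cast hn
  have hpow : (n : ℝ) ^ (2 * g - 1) ≤ (n : ℝ) ^ (2 * g) := pow_le_pow_right₀ hn1 (by omega)
  constructor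
  · have h5 := abs_sub_abs_le_abs_sub (pullWedge κ g f^[n] (E u x) v)
      ((n : ℝ) ^ (2 * g) * (jac t u * (realBasis g).det (fun i => (a i).1) * k))
    rw [abs_mul _ (jac t u * _ * k), abs_of_nonneg (by positivity : (0 : ℝ) ≤ (n : ℝ) ^ (2 * g))] at h5
    have h6 := mul_le_mul_of_nonneg_left hk (by positivity : (0 : ℝ) ≤ (n : ℝ) ^ (2 * g))
    have h7 := mul_le_mul_of_nonneg_left hpow hC
    linarith
  · intro hj
    have h8 : jac t u = 0 := hj
    rw [h8, zero_mul, zero_mul, mul_zero, sub_zero] at hgk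
    refine hgk.trans (mul_le_mul_of_nonneg_right (by linarith) (by positivity))

theorem eq_zero_of_pow_mul_le {m : ℕ} (hm : 1 ≤ m) {a C : ℝ} (ha : 0 ≤ a)
    (h : ∀ n : ℕ, 1 ≤ n → (n : ℝ) ^ m * a ≤ C * (n : ℝ) ^ (m - 1)) : a = 0 := by
  by_contra h0
  have hpos : 0 < a := lt_of_le_of_ne ha (Ne.symm h0)
  obtain ⟨n, hn⟩ := exists_nat_gt (C / a)
  have h1 := h (n + 1) (by omega)
  obtain ⟨k, rfl⟩ : ∃ k, m = k + 1 := ⟨m - 1, by omega⟩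
  have h2 : (0 : ℝ) < ((n + 1 : ℕ) : ℝ) ^ k := by positivity
  rw [Nat.add_sub_cancel, pow_succ, mul_assoc, mul_comm C] at h1
  have h3 := le_of_mul_le_mul_left h1 h2
  rw [div_lt_iff₀ hpos] at hn
  push_cast at h3
  nlinarith

/-- Test the slow estimate on a rescaled horizontal frame: the coefficient of `n^{2g}` is the
jacobian of `t` times a quantity bounded away from zero, so the jacobian must vanish. -/
theorem IsBettiChart.isSlow_iff (hg : 1 ≤ g) (hκ : IsKahlerForm κ) (T : IsTorusFibration σ O D q)
    (h : IsBettiChart O D q f E t)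
    (hf : MDifferentiable 𝓘(ℂ, Cn (2 * g)) 𝓘(ℂ, Cn (2 * g)) f) {y : X} (hy : y ∈ O)
    (hyD : q y ∈ D) : IsSlow κ f y ↔ jac t (q y) = 0 := by
  constructor
  swap
  · intro hj
    obtain ⟨C, -, hC⟩ := h.exists_upper_bound hκ T hf (isCompact_singleton (x := q y))
      (singleton_subset_iff.2 hyD)
    exact ⟨C, fun n hn v hv => (hC y hy rfl n hn v hv).2 hj⟩
  rintro ⟨C', hC'⟩
  obtain ⟨x, hx⟩ := h.surj (q y) hyD y hy rfl
  set u := q y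
  clear_value u
  subst hx
  set H := fun w : Cn g × (Fin (2 * g) → ℝ) => E w.1 w.2
  set L : Fin (2 * g) → ℝ := fun i =>
    rpull (sqLength κ) H (u, x) fun _ => (realFrame g i, (0 : Fin (2 * g) → ℝ))
  -- The scale making all vectors of the horizontal frame of length at most one; the summand `1`
  -- avoids a division by zero.
  set s : ℝ := (√(1 + ∑ i, |L i|))⁻¹
  have hsum : 0 < 1 + ∑ i, |L i| := by
    have := Finset.sum_nonneg fun i (_ : i ∈ Finset.univ) => abs_nonneg (L i)
    linarith
  have hs : 0 < s := inv_pos.2 (Real.sqrt_pos.2 hsum)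
  have hs2 : s ^ 2 * (1 + ∑ i, |L i|) = 1 := by
    rw [inv_pow, Real.sq_sqrt hsum.le, inv_mul_cancel₀ hsum.ne']
  set a : Fin (2 * g) → Cn g × (Fin (2 * g) → ℝ) := fun i =>
    s • (realFrame g i, (0 : Fin (2 * g) → ℝ))
  obtain ⟨c, C, hc, hC, hgr⟩ := h.growth hκ T hf (isCompact_singleton (x := u))
    (singleton_subset_iff.2 hyD) ‖a‖
  have hdet : (realBasis g).det (fun i => (a i).1) = s ^ (2 * g) := by
    have h1 := (realBasis g).det.toMultilinearMap.map_smul_univ (fun _ => s) (realBasis g)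
    rw [Finset.prod_const, Finset.card_univ, Fintype.card_fin] at h1
    have h2 : (fun i => (a i).1) = fun i => s • realBasis g i := funext fun i => by simp [a]
    rw [h2]
    refine h1.trans ?_
    rw [AlternatingMap.coe_multilinearMap, Module.Basis.det_self, smul_eq_mul, mul_one]
  have hlen : ∀ i, κ (E u x) ![rderiv (2 * g) H (u, x) (a i),
      Complex.I • rderiv (2 * g) H (u, x) (a i)] ≤ 1 := fun i => by
    have h1 := rpull_sqLength_smul κ H (u, x) s (realFrame g i, (0 : Fin (2 * g) → ℝ))
    have h2 : L i ≤ 1 + ∑ i, |L i| := by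
      have := Finset.single_le_sum (fun j (_ : j ∈ Finset.univ) => abs_nonneg (L j)) (Finset.mem_univ i)
      have := le_abs_self (L i)
      linarith
    refine (le_of_eq h1).trans ?_
    rw [← hs2]
    exact mul_le_mul_of_nonneg_left h2 (by positivity)
  have h0 := eq_zero_of_pow_mul_le (m := 2 * g) (by omega) (a := |jac t u| * s ^ (2 * g) * c)
    (C := C' + C) (by positivity) fun n hn => by
      obtain ⟨k, hk, -, hgk⟩ := hgr u rfl x a (norm_le_pi_norm a) n hn
      have h1 := hC' n hn _ hlen
      have h2 := abs_sub_abs_le_abs_sub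
        ((n : ℝ) ^ (2 * g) * (jac t u * (realBasis g).det (fun i => (a i).1) * k))
        (pullWedge κ g f^[n] (E u x) fun i => rderiv (2 * g) H (u, x) (a i))
      rw [abs_sub_comm] at hgk
      rw [hdet] at h2 hgk
      have h3 : (n : ℝ) ^ (2 * g) * (|jac t u| * s ^ (2 * g) * c) ≤
          |(n : ℝ) ^ (2 * g) * (jac t u * s ^ (2 * g) * k)| := by
        rw [abs_mul, abs_mul, abs_mul, abs_of_nonneg (by positivity : (0 : ℝ) ≤ (n : ℝ) ^ (2 * g)),
          abs_of_nonneg (by positivity : (0 : ℝ) ≤ s ^ (2 * g))]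
        gcongr
      linarith
  have h4 : s ^ (2 * g) ≠ 0 := by positivity
  simpa [hc.ne', h4] using h0

/-- On the compact set `Z` the leading coefficient, formed of the jacobian of `t`, the squared
modulus of the determinant of `d(q ∘ φ)`, and the vertical value of `κ^g`, is bounded away from
zero. For large `n` half of the leading term exceeds the remainder; positivity of `κ^g` on complex
frames removes the absolute value. -/
theorem IsBettiChart.exists_lower_bound (hg : 1 ≤ g) (hκ : IsKahlerForm κ)
    (T : IsTorusFibration σ O D q) (h : IsBettiChart O D q f E t)
    (hf : MDifferentiable 𝓘(ℂ, Cn (2 * g)) 𝓘(ℂ, Cn (2 * g)) f) {S Z : Set (Cn g)} {φ : Cn g → X}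
    (hS : IsOpen S) (hφ : MDifferentiableOn 𝓘(ℂ, Cn g) 𝓘(ℂ, Cn (2 * g)) φ S) (hφO : MapsTo φ S O)
    (hZ : IsCompact Z) (hZS : Z ⊆ S) (hjac : ∀ z ∈ Z, jac t (q (φ z)) ≠ 0)
    (hinj : ∀ z ∈ Z, Function.Injective (fderiv ℂ (fun z => q (φ z)) z)) :
    ∃ c > 0, ∀ᶠ n : ℕ in atTop, ∀ z ∈ Z, c * (n : ℝ) ^ (2 * g) ≤
      wedgePow (κ (f^[n] (φ z))) g
        fun i => holDeriv g (2 * g) (fun z => f^[n] (φ z)) z (realFrame g i) := by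
  set K := (fun z => q (φ z)) '' Z
  have hder : ∀ z ∈ S, HasFDerivAt (fun z => q (φ z))
      ((vderiv (2 * g) q (φ z)).comp (pderiv (2 * g) φ z)) z := fun z hz =>
    hasFDerivAt_comp (T.mdiff.mdifferentiableAt (T.isOpen.mem_nhds (hφO hz)))
      (hφ.mdifferentiableAt (hS.mem_nhds hz))
  have hd : DifferentiableOn ℂ (fun z => q (φ z)) S := fun z hz =>
    (hder z hz).differentiableAt.differentiableWithinAt
  have hK : IsCompact K := hZ.image_of_continuousOn (hd.continuousOn.mono hZS)
  have hKD : K ⊆ D := by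
    rintro _ ⟨z, hz, rfl⟩
    exact T.mapsTo (hφO (hZS hz))
  obtain ⟨c₀, hc₀, hcm⟩ := h.exists_le_sqLength hκ hK hKD
  have hφr : ContMDiffOn 𝓘(ℝ, Cn g) 𝓘(ℝ, Cn (2 * g)) ∞ φ S := fun z hz =>
    (contMDiffAt_of_mdifferentiableOn hS hφ hz).contMDiffWithinAt
  have hlen : ∃ B, ∀ z ∈ Z, ∀ i, |rpull (sqLength κ) φ z fun _ => realFrame g i| ≤ B := by
    have h1 := (continuousInCharts_sqLength hκ).continuousOn_rpull hS hφr
    have h2 : ∀ i, ∃ B, ∀ z ∈ Z, |rpull (sqLength κ) φ z fun _ => realFrame g i| ≤ B := fun i =>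
      hZ.exists_bound_of_continuousOn (h1.comp (f := fun z : Cn g => (z, fun _ : Unit => realFrame g i))
        (by fun_prop) fun z hz => ⟨hZS hz, mem_univ _⟩)
    choose B hB using h2
    exact ⟨∑ i, |B i|, fun z hz i => (hB i z hz).trans ((le_abs_self _).trans
      (Finset.single_le_sum (fun j (_ : j ∈ Finset.univ) => abs_nonneg (B j)) (Finset.mem_univ i)))⟩
  obtain ⟨B, hB⟩ := hlen
  obtain ⟨c, C, hc, hC, hgr⟩ := h.growth hκ T hf hK hKD √(B / c₀)
  set Q : Cn g → ℝ := fun z => jac t (q (φ z)) *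
    Complex.normSq (fderiv ℂ (fun z => q (φ z)) z).det
  have hQc : ContinuousOn (fun z => |Q z|) Z := by
    have h1 : ContinuousOn (fun z => jac t (q (φ z))) Z := by
      have h2 : ContinuousOn (jac t) D := fun u hu => by
        have h3 : ContinuousAt (fderiv ℝ t) u :=
          ((h.contDiffAt u hu).fderiv_right (m := 0) (by simp)).continuousAt
        refine ContinuousAt.continuousWithinAt ?_
        refine (Continuous.continuousAt (f := Matrix.det (R := ℝ) (n := Fin (2 * g)))
          continuous_id.matrix_det).comp
          (f := fun u => Matrix.of fun i k => fderiv ℝ t u (realFrame g k) i) ?_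
        refine continuousAt_pi.2 fun i => continuousAt_pi.2 fun k => ?_
        exact (continuousAt_pi.1 (h3.clm_apply continuousAt_const)) i
      exact h2.comp (hd.continuousOn.mono hZS) fun z hz => hKD ⟨z, hz, rfl⟩
    have h4 : ContinuousOn (fun z => fderiv ℂ (fun z => q (φ z)) z) S :=
      (contDiffOn_infty_of_differentiableOn hS hd).continuousOn_fderiv_of_isOpen hS (by simp)
    exact (h1.mul (Complex.continuous_normSq.comp_continuousOn
      (ContinuousLinearMap.continuous_det.comp_continuousOn (h4.mono hZS)))).abs
  obtain ⟨c₁, hc₁, hQm⟩ := hZ.exists_forall_le' hQc (a := 0) fun z hz => by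
    refine abs_pos.2 (mul_ne_zero (hjac z hz) (Complex.normSq_pos.2 ?_).ne')
    exact fun h0 => by
      have h1 := LinearMap.bot_lt_ker_of_det_eq_zero (f := (fderiv ℂ (fun z => q (φ z)) z).toLinearMap) h0
      rw [LinearMap.ker_eq_bot.2 (hinj z hz)] at h1
      exact lt_irrefl _ h1
  refine ⟨c₁ * c / 2, by positivity, ?_⟩
  -- Beyond `n₀` the remainder `C n^{2g-1}` is at most half of `c₁ c n^{2g}`.
  obtain ⟨n₀, hn₀⟩ := exists_nat_gt (2 * C / (c₁ * c))
  filter_upwards [eventually_ge_atTop (n₀ + 1)] with n hn z hz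
  obtain ⟨x, hx⟩ := h.surj _ (hKD ⟨z, hz, rfl⟩) _ (hφO (hZS hz)) rfl
  set H := fun w : Cn g × (Fin (2 * g) → ℝ) => E w.1 w.2
  obtain ⟨u, hu⟩ : ∃ u, q (φ z) = u := ⟨_, rfl⟩
  have huK : u ∈ K := ⟨z, hz, hu⟩
  simp only [hu] at hx
  -- The point `y` is kept variable because the type of tangent vectors depends on it; the equality
  -- `φ z = E u x` can then be substituted.
  have hex : ∀ y, y = E u x → ∀ v : Fin (2 * g) → TX (2 * g) y, (∀ i, vderiv (2 * g) q y (v i) =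
      fderiv ℂ (fun z => q (φ z)) z (realFrame g i)) → (∀ i, κ y ![v i, Complex.I • v i] ≤ B) →
      c₁ * c / 2 * (n : ℝ) ^ (2 * g) ≤ |pullWedge κ g f^[n] y v| := by
    rintro _ rfl v hv hvB
    choose a ha using fun i => h.surjective_rderiv (hKD huK) x (v i)
    have haR : ∀ i, ‖a i‖ ≤ √(B / c₀) := fun i => by
      have h1 := hcm u huK x (a i)
      have h2 : rpull (sqLength κ) H (u, x) (fun _ => a i) ≤ B := by
        refine le_trans (le_of_eq ?_) (hvB i)
        have h3 : rderiv (2 * g) H (u, x) (a i) = v i := ha i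
        exact congrArg (fun w : TX (2 * g) (E u x) => κ (E u x) ![w, Complex.I • w]) h3
      refine Real.le_sqrt_of_sq_le ?_
      rw [le_div_iff₀ hc₀]
      linarith
    have hv' : (fun i => rderiv (2 * g) H (u, x) (a i)) = v := funext ha
    have hdet : (realBasis g).det (fun i => (a i).1) =
        Complex.normSq (fderiv ℂ (fun z => q (φ z)) z).det := by
      have h3 := (realBasis g).det_comp
        ((fderiv ℂ (fun z => q (φ z)) z).toLinearMap.restrictScalars ℝ) (realBasis g)
      rw [Module.Basis.det_self, mul_one, LinearMap.det_restrictScalars,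
        Algebra.norm_complex_apply] at h3
      refine Eq.trans ?_ h3
      refine congrArg _ (funext fun i => ?_)
      rw [← h.vderiv_rderiv T (hKD huK) x (a i), ha, hv i]
      simp
    obtain ⟨k, hk, -, hgk⟩ := hgr u huK x a haR n (by omega)
    rw [hv', hdet, abs_sub_comm] at hgk
    have h2 := abs_sub_abs_le_abs_sub ((n : ℝ) ^ (2 * g) * (jac t u *
      Complex.normSq (fderiv ℂ (fun z => q (φ z)) z).det * k)) (pullWedge κ g f^[n] (E u x) v)
    have h3 := hQm z hz
    simp only [Q, hu] at h3
    have h4 : (n : ℝ) ^ (2 * g) * (c₁ * c) ≤ |(n : ℝ) ^ (2 * g) * (jac t u *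
        Complex.normSq (fderiv ℂ (fun z => q (φ z)) z).det * k)| := by
      rw [abs_mul, abs_mul _ k, abs_of_nonneg (by positivity : (0 : ℝ) ≤ (n : ℝ) ^ (2 * g))]
      exact mul_le_mul_of_nonneg_left (mul_le_mul h3 hk hc.le (abs_nonneg _)) (by positivity)
    have h5 : C * (n : ℝ) ^ (2 * g - 1) ≤ c₁ * c / 2 * (n : ℝ) ^ (2 * g) := by
      have h6 : (n : ℝ) ^ (2 * g) = n * (n : ℝ) ^ (2 * g - 1) := by
        rw [← pow_succ']
        congr 1
        omega
      have h7 : C ≤ c₁ * c / 2 * n := by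
        rw [div_lt_iff₀ (by positivity)] at hn₀
        have h8 : ((n₀ + 1 : ℕ) : ℝ) ≤ n := by exact_mod_cast hn
        push_cast at h8
        nlinarith [mul_pos hc₁ hc]
      rw [h6, ← mul_assoc]
      exact mul_le_mul_of_nonneg_right h7 (by positivity)
    linarith
  have h1 := hex (φ z) hx.symm (fun i => pderiv (2 * g) φ z (realFrame g i))
    (fun i => by rw [(hder z (hZS hz)).fderiv]; rfl) fun i => by
      refine le_trans (le_of_eq ?_) ((le_abs_self _).trans (hB z hz i))
      have h3 := rderiv_eq_pderiv (n := 2 * g) (hφ.mdifferentiableAt (hS.mem_nhds (hZS hz))) (realFrame g i)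
      exact (congrArg (fun w : TX (2 * g) (φ z) => κ (φ z) ![w, Complex.I • w]) h3).symm
  have h2 : ∀ a, holDeriv g (2 * g) (fun z => f^[n] (φ z)) z a =
      holDeriv (2 * g) (2 * g) f^[n] (φ z) (pderiv (2 * g) φ z a) := fun a =>
    congrArg (fun L : Cn g →L[ℂ] Cn (2 * g) => L a)
      ((mdifferentiable_iterate hf n (φ z)).hasMFDerivAt.comp z
        (hφ.mdifferentiableAt (hS.mem_nhds (hZS hz))).hasMFDerivAt).mfderiv
  have h3 := wedgePow_frame_nonneg (κ := κ (f^[n] (φ z))) (hκ.type_one_one _) (hκ.pos _) (m := g)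
    (holDeriv g (2 * g) (fun z => f^[n] (φ z)) z).toLinearMap
  refine h1.trans (le_of_eq ?_)
  have h4 : pullWedge κ g f^[n] (φ z) (fun i => pderiv (2 * g) φ z (realFrame g i)) =
      wedgePow (κ (f^[n] (φ z))) g
        fun i => holDeriv g (2 * g) (fun z => f^[n] (φ z)) z (realFrame g i) :=
    congrArg (wedgePow (κ (f^[n] (φ z))) g) (funext fun i => (h2 (realFrame g i)).symm)
  rw [h4]
  exact abs_of_nonneg h3

end Growth

end LagrangianFibration

namespace LagrangianFibration

/-! ### Propagation of slow growth over the regular values -/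

section Global

variable {g N : ℕ} {X : Type*} [TopologicalSpace X] [ChartedSpace (Cn (2 * g)) X]
  [IsManifold 𝓘(ℂ, Cn (2 * g)) ω X] [T2Space X]
  {P : Type*} [TopologicalSpace P] [ChartedSpace (Cn N) P] [IsManifold 𝓘(ℂ, Cn N) ω P]
  {σ : ∀ x : X, TX (2 * g) x [⋀^Fin 2]→L[ℂ] ℂ} {κ : ∀ x : X, TX (2 * g) x [⋀^Fin 2]→L[ℝ] ℝ}
  {p : X → P} {f : X → X}

-- The definition of maximal variation allows arbitrary local parametrizations; this turns any of
-- them, near a point, into a base chart.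
omit [T2Space X] [IsManifold 𝓘(ℂ, Cn (2 * g)) ω X] in
theorem IsLocalParam.exists_baseChart {D : Set (Cn g)} {ψ : Cn g → P}
    (h : IsLocalParam N g (range p) D ψ) {z : Cn g} (hz : z ∈ D)
    (hsub : ψ '' D ⊆ regularValues g N p) {D' : Set (Cn g)} (hD' : D' ∈ 𝓝 z) :
    ∃ δ ρ W, Metric.ball z δ ⊆ D ∩ D' ∧ BaseChart N p z δ ψ ρ W := by
  obtain ⟨ρ, W, D₀, hW, hzW, hρ, hD₀, hz₀, hD₀D, hleft, -⟩ := h.exists_leftInverse hz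
  have h1 : ∀ᶠ w in 𝓝 z, w ∈ D₀ ∧ ψ w ∈ W ∧ w ∈ D' := by
    filter_upwards [hD₀.mem_nhds hz₀, (h.holomorphic.continuousOn.continuousAt
      (h.isOpen.mem_nhds hz)).eventually_mem (hW.mem_nhds hzW), hD'] with w h1 h2 h3
    exact ⟨h1, h2, h3⟩
  obtain ⟨δ, hδ, hδs⟩ := Metric.eventually_nhds_iff_ball.1 h1
  have hsD : Metric.ball z δ ⊆ D := fun w hw => hD₀D (hδs w hw).1
  exact ⟨δ, ρ, W, fun w hw => ⟨hsD hw, (hδs w hw).2.2⟩, hδ,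
    isLocalParam_mono h Metric.isOpen_ball hsD,
    (image_mono hsD).trans hsub, hW, hρ, fun u hu => (hδs u hu).2.1,
    fun u hu => hleft u (hδs u hu).1⟩

omit [T2Space X] in
theorem exists_baseChart_of_mem [CompactSpace X] [ConnectedSpace X] [T2Space P]
    (hp : IsLagrangianFibration g N σ p) {b : P}
    (hb : b ∈ regularValues g N p) : ∃ (c : Cn g) (δ : ℝ) (ψ : Cn g → P) (ρ : P → Cn g) (W : Set P),
      BaseChart N p c δ ψ ρ W ∧ ψ c = b := by
  have hle := rk_le_of_mem_regularValues hp.holomorphic hb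
  have h1 := ((mem_regularValues_iff hp.holomorphic hp.connected hle).1 hb).2
  obtain ⟨x₀, rfl⟩ := regularValues_subset_range hb
  exact exists_baseChart hp.holomorphic hp.connected hle h1

theorem exists_bettiDatum_of_mem [CompactSpace X] [ConnectedSpace X] [T2Space P]
    (hp : IsLagrangianFibration g N σ p) (hσ : IsHolomorphicSymplectic σ)
    (hf : MDifferentiable 𝓘(ℂ, Cn (2 * g)) 𝓘(ℂ, Cn (2 * g)) f) (hpf : ∀ x, p (f x) = p x)
    (hfσ : ∀ x, (σ (f x)).compContinuousLinearMap (holDeriv (2 * g) (2 * g) f x) = σ x)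
    {b : P} (hb : b ∈ regularValues g N p) :
    ∃ (c : Cn g) (δ : ℝ) (ψ : Cn g → P) (ρ : P → Cn g) (W : Set P) (β : BettiDatum g N p)
      (t : P → Fin (2 * g) → ℝ), BaseChart N p c δ ψ ρ W ∧ ψ c = b ∧
      IsTranslationVector β f t ∧
      IsBettiChart (p ⁻¹' (ψ '' Metric.ball c δ)) (Metric.ball c δ) (ρ ∘ p) f
        (fun u => β.E (ψ u)) (t ∘ ψ) ∧
      ∀ u₁ ∈ Metric.ball c δ, (∀ᶠ u in 𝓝 u₁, jac (t ∘ ψ) u = 0) →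
        ∀ u ∈ Metric.ball c δ, jac (t ∘ ψ) u = 0 := by
  obtain ⟨c, δ, ψ, ρ, W, hbc, hc⟩ := exists_baseChart_of_mem hp hb
  obtain ⟨ε, hε, hεδ, β, t, hV, ht, ℓ, α, hℓ, hα, hind, hsum⟩ :=
    hbc.exists_bettiDatum hp hσ hf hpf hfσ (Metric.mem_ball_self hbc.pos)
  have hbc' := hbc.mono hε hεδ
  have hB := ht.isBettiChart hp hσ hbc' hf hV.ge
  exact ⟨c, ε, ψ, ρ, W, β, t, hbc', hc, ht, hB, fun u₁ hu₁ h0 =>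
    jac_eq_zero_of_eventually hℓ hα hind (fun u hu => (hB.contDiffAt u hu).differentiableAt (by simp))
      hsum hu₁ h0⟩

omit [T2Space X] in
/-- In a Betti chart, slowness is detected by the jacobian of the translation vector. -/
theorem isSlow_iff_of_bettiChart (hg : 1 ≤ g) (hκ : IsKahlerForm κ)
    (hp : IsLagrangianFibration g N σ p)
    (hf : MDifferentiable 𝓘(ℂ, Cn (2 * g)) 𝓘(ℂ, Cn (2 * g)) f) {c : Cn g} {δ : ℝ} {ψ : Cn g → P}
    {ρ : P → Cn g} {W : Set P} (hb : BaseChart N p c δ ψ ρ W)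
    {E : Cn g → (Fin (2 * g) → ℝ) → X} {t : Cn g → Fin (2 * g) → ℝ}
    (hB : IsBettiChart (p ⁻¹' (ψ '' Metric.ball c δ)) (Metric.ball c δ) (ρ ∘ p) f E t) {x : X}
    {u : Cn g} (hu : u ∈ Metric.ball c δ) (hx : p x = ψ u) : IsSlow κ f x ↔ jac t u = 0 := by
  have h1 : (ρ ∘ p) x = u := by
    rw [Function.comp_apply, hx, hb.left_inv u hu]
  have h2 := hB.isSlow_iff hg hκ (hb.isTorusFibration hp) hf (y := x)
    ⟨u, hu, hx.symm⟩ (by rw [h1]; exact hu)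
  rwa [h1] at h2

/-- If the growth is slow over a non-empty open subset of the set of regular values, it is slow
over all regular values. -/
theorem forall_isSlow [CompactSpace X] [ConnectedSpace X] [T2Space P] [SecondCountableTopology X]
    (hg : 1 ≤ g) (hκ : IsKahlerForm κ) (hp : IsLagrangianFibration g N σ p)
    (hσ : IsHolomorphicSymplectic σ)
    (hf : MDifferentiable 𝓘(ℂ, Cn (2 * g)) 𝓘(ℂ, Cn (2 * g)) f) (hpf : ∀ x, p (f x) = p x)
    (hfσ : ∀ x, (σ (f x)).compContinuousLinearMap (holDeriv (2 * g) (2 * g) f x) = σ x)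
    {W : Set P} (hW : IsOpen W) (hne : (regularValues g N p ∩ W).Nonempty)
    (hslow : ∀ x, p x ∈ regularValues g N p → p x ∈ W → IsSlow κ f x) :
    ∀ x, p x ∈ regularValues g N p → IsSlow κ f x := by
  have hpre : PreconnectedSpace (regularValues g N p) :=
    isPreconnected_iff_preconnectedSpace.1 (isPreconnected_regularValues hg hp.holomorphic hp.connected)
  set S : Set (regularValues g N p) := {b | ∀ x, p x = b → IsSlow κ f x}
  -- A chart around a limit point meets the interior of the slow set. There the jacobian vanishes on
  -- an open set, hence on the whole chart by the identity theorem. Connectedness of `B°` then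
  -- concludes.
  have hclosed : IsClosed (interior S) := by
    refine isClosed_of_closure_subset fun b hb => ?_
    obtain ⟨c, δ, ψ, ρ, W', β, t, hbc, hcb, -, hB, hjac⟩ := exists_bettiDatum_of_mem hp hσ hf hpf hfσ b.2
    have hopen : ∀ D' ⊆ Metric.ball c δ, IsOpen D' →
        IsOpen {b : regularValues g N p | (b : P) ∈ ψ '' D'} := fun D' hD' hD'o => by
      obtain ⟨V, hV, hVe⟩ := hbc.isLocalParam.isOpen_image D' hD' hD'o
      have h1 : {b : regularValues g N p | (b : P) ∈ ψ '' D'} = Subtype.val ⁻¹' V := by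
        ext b
        rw [mem_setOf_eq, hVe]
        exact and_iff_right (regularValues_subset_range b.2)
      rw [h1]
      exact hV.preimage continuous_subtype_val
    have hball := hopen _ subset_rfl Metric.isOpen_ball
    obtain ⟨b', hb', hb'S⟩ := mem_closure_iff.1 hb _ hball ⟨c, Metric.mem_ball_self hbc.pos, hcb⟩
    obtain ⟨u₁, hu₁, hub'⟩ := hb'
    have h0 : ∀ᶠ u in 𝓝 u₁, jac (t ∘ ψ) u = 0 := by
      obtain ⟨V, hV, hVe⟩ := isOpen_induced_iff.1 (isOpen_interior (s := S))
      have h1 : ψ u₁ ∈ V := by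
        rw [hub']
        exact (hVe ▸ hb'S : b' ∈ Subtype.val ⁻¹' V)
      filter_upwards [Metric.isOpen_ball.mem_nhds hu₁,
        (hbc.isLocalParam.holomorphic.continuousOn.continuousAt
          (Metric.isOpen_ball.mem_nhds hu₁)).eventually_mem (hV.mem_nhds h1)] with u hu huV
      have hreg := hbc.subset_regular ⟨u, hu, rfl⟩
      have h2 : (⟨ψ u, hreg⟩ : regularValues g N p) ∈ Subtype.val ⁻¹' V := huV
      rw [hVe] at h2
      obtain ⟨x, hx⟩ := regularValues_subset_range hreg
      exact (isSlow_iff_of_bettiChart hg hκ hp hf hbc hB hu hx).1 (interior_subset h2 x hx)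
    refine mem_interior.2 ⟨_, fun b'' hb'' x hx => ?_, hball, ⟨c, Metric.mem_ball_self hbc.pos, hcb⟩⟩
    obtain ⟨u, hu, hub⟩ := hb''
    exact (isSlow_iff_of_bettiChart hg hκ hp hf hbc hB hu (hx.trans hub.symm)).2
      (hjac u₁ hu₁ h0 u hu)
  obtain ⟨b₀, hb₀, hb₀W⟩ := hne
  have h1 := IsClopen.eq_univ ⟨hclosed, isOpen_interior⟩ (⟨⟨b₀, hb₀⟩, mem_interior.2
    ⟨Subtype.val ⁻¹' W, fun b hb x hx => hslow x (hx ▸ b.2) (hx ▸ hb),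
      hW.preimage continuous_subtype_val, hb₀W⟩⟩ : (interior S).Nonempty)
  intro x hx
  have h2 : (⟨p x, hx⟩ : regularValues g N p) ∈ interior S := h1 ▸ mem_univ _
  exact interior_subset h2 x rfl

/-- If the translation vector does not have maximal variation, for some Betti datum, the growth is
slow. -/
theorem forall_isSlow_of_not_hasMaximalVariation [CompactSpace X] [ConnectedSpace X] [T2Space P]
    [SecondCountableTopology X]
    (hg : 1 ≤ g) (hκ : IsKahlerForm κ) (hp : IsLagrangianFibration g N σ p)
    (hσ : IsHolomorphicSymplectic σ)
    (hf : MDifferentiable 𝓘(ℂ, Cn (2 * g)) 𝓘(ℂ, Cn (2 * g)) f) (hpf : ∀ x, p (f x) = p x)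
    (hfσ : ∀ x, (σ (f x)).compContinuousLinearMap (holDeriv (2 * g) (2 * g) f x) = σ x)
    {β : BettiDatum g N p} {t : P → Fin (2 * g) → ℝ} (ht : IsTranslationVector β f t)
    (hmax : ¬ HasMaximalVariation β t) : ∀ x, p x ∈ regularValues g N p → IsSlow κ f x := by
  obtain ⟨b, hbV, hb⟩ := not_subset.1 hmax
  -- The failure of density provides an open set on which `dt` is nowhere surjective, that is, where
  -- the jacobian vanishes identically.
  obtain ⟨W₁, hW₁, hbW₁, hdisj⟩ : ∃ W₁, IsOpen W₁ ∧ b ∈ W₁ ∧ ∀ b' ∈ W₁, b' ∉ {u | ∃ (D : Set (Cn g))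
      (ψ : Cn g → P), IsLocalParam N g (range p) D ψ ∧ ψ '' D ⊆ β.V ∧
      ∃ z ∈ D, ψ z = u ∧ Function.Surjective (fderiv ℝ (t ∘ ψ) z)} :=
    ⟨_, isClosed_closure.isOpen_compl, hb, fun b' h1 h2 => h1 (subset_closure h2)⟩
  obtain ⟨W₂, hW₂, hVW₂⟩ := β.isOpen
  have hbW₂ : b ∈ W₂ := (hVW₂ ▸ hbV : b ∈ range p ∩ W₂).2
  obtain ⟨c, δ, ψ, ρ, W, hbc, rfl⟩ := exists_baseChart_of_mem hp (β.subset_regular hbV)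
  have hcont : ContinuousAt ψ c := hbc.isLocalParam.holomorphic.continuousOn.continuousAt
    (Metric.ball_mem_nhds _ hbc.pos)
  obtain ⟨δ', ρ', W', hsub, hbc'⟩ := hbc.isLocalParam.exists_baseChart
    (Metric.mem_ball_self hbc.pos) hbc.subset_regular
    (hcont.preimage_mem_nhds ((hW₁.inter hW₂).mem_nhds ⟨hbW₁, hbW₂⟩))
  have hV : ψ '' Metric.ball c δ' ⊆ β.V := by
    rintro _ ⟨u, hu, rfl⟩
    rw [hVW₂]
    exact ⟨regularValues_subset_range (hbc'.subset_regular ⟨u, hu, rfl⟩), (hsub hu).2.2⟩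
  have hB := ht.isBettiChart hp hσ hbc' hf hV
  have hjac : ∀ u ∈ Metric.ball c δ', jac (t ∘ ψ) u = 0 := fun u hu => by
    by_contra h0
    exact hdisj _ (hsub hu).2.1 ⟨_, ψ, hbc'.isLocalParam, hV, u, hu, rfl, jac_ne_zero_iff.1 h0⟩
  obtain ⟨V, hVo, hVe⟩ := hbc'.isLocalParam.isOpen_image _ subset_rfl Metric.isOpen_ball
  have hcV : ψ c ∈ range p ∩ V := hVe ▸ ⟨c, Metric.mem_ball_self hbc'.pos, rfl⟩
  refine forall_isSlow hg hκ hp hσ hf hpf hfσ hVo ⟨ψ c, β.subset_regular hbV, hcV.2⟩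
    fun x hx hxV => ?_
  obtain ⟨u, hu, hux⟩ : p x ∈ ψ '' Metric.ball c δ' := hVe ▸ ⟨mem_range_self x, hxV⟩
  exact (isSlow_iff_of_bettiChart hg hκ hp hf hbc' hB hu hux.symm).2 (hjac u hu)

/-- If the growth is slow, the translation vectors do not have maximal variation. -/
theorem not_hasMaximalVariation_of_isSlow
    (hg : 1 ≤ g) (hκ : IsKahlerForm κ) (hp : IsLagrangianFibration g N σ p)
    (hσ : IsHolomorphicSymplectic σ)
    (hf : MDifferentiable 𝓘(ℂ, Cn (2 * g)) 𝓘(ℂ, Cn (2 * g)) f)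
    (hslow : ∀ x, p x ∈ regularValues g N p → IsSlow κ f x)
    {β : BettiDatum g N p} {t : P → Fin (2 * g) → ℝ} (ht : IsTranslationVector β f t) :
    ¬ HasMaximalVariation β t := by
  intro hmax
  -- Simply connected spaces are non-empty, so the density in the definition of maximal variation
  -- yields an actual point where `dt` is onto.
  have := β.simplyConnected
  obtain ⟨⟨b, hb⟩⟩ : Nonempty β.V := inferInstance
  obtain ⟨_, D, ψ, hψ, hDV, z, hz, rfl, hsurj⟩ := closure_nonempty_iff.1 ⟨b, hmax hb⟩
  obtain ⟨δ, ρ, W, hsub, hbc⟩ := hψ.exists_baseChart hz (hDV.trans β.subset_regular) univ_mem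
  have hV : ψ '' Metric.ball z δ ⊆ β.V := (image_mono fun u hu => (hsub hu).1).trans hDV
  have hB := ht.isBettiChart hp hσ hbc hf hV
  have hz' := Metric.mem_ball_self (x := z) hbc.pos
  obtain ⟨x, hx⟩ := regularValues_subset_range (hbc.subset_regular ⟨z, hz', rfl⟩)
  exact jac_ne_zero_iff.2 hsurj ((isSlow_iff_of_bettiChart hg hκ hp hf hbc hB hz' hx).1
    (hslow x (hx ▸ hbc.subset_regular ⟨z, hz', rfl⟩)))

/-- The pull-backs of `κ^g` by the iterates of `f` are `O(n^{2g})`, uniformly over compact sets of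
regular values. -/
theorem exists_uniform_bound [CompactSpace X] [ConnectedSpace X] [T2Space P]
    (hg : 1 ≤ g) (hκ : IsKahlerForm κ) (hp : IsLagrangianFibration g N σ p)
    (hσ : IsHolomorphicSymplectic σ)
    (hf : MDifferentiable 𝓘(ℂ, Cn (2 * g)) 𝓘(ℂ, Cn (2 * g)) f) (hpf : ∀ x, p (f x) = p x)
    (hfσ : ∀ x, (σ (f x)).compContinuousLinearMap (holDeriv (2 * g) (2 * g) f x) = σ x)
    {K : Set P} (hK : IsCompact K) (hKr : K ⊆ regularValues g N p) : ∃ C : ℝ, 0 ≤ C ∧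
      ∀ y, p y ∈ K → ∀ n : ℕ, 1 ≤ n →
      ∀ v : Fin (2 * g) → TX (2 * g) y, (∀ i, κ y ![v i, Complex.I • v i] ≤ 1) →
      |pullWedge κ g f^[n] y v| ≤ C * (n : ℝ) ^ (2 * g) ∧
      (IsSlow κ f y → |pullWedge κ g f^[n] y v| ≤ C * (n : ℝ) ^ (2 * g - 1)) := by
  -- The slow alternative is phrased with `IsSlow`, not with the jacobian, so that constants coming
  -- from different Betti charts can be combined.
  refine hK.induction_on (p := fun K => ∃ C : ℝ, 0 ≤ C ∧ ∀ y, p y ∈ K → ∀ n : ℕ, 1 ≤ n →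
      ∀ v : Fin (2 * g) → TX (2 * g) y, (∀ i, κ y ![v i, Complex.I • v i] ≤ 1) →
      |pullWedge κ g f^[n] y v| ≤ C * (n : ℝ) ^ (2 * g) ∧
      (IsSlow κ f y → |pullWedge κ g f^[n] y v| ≤ C * (n : ℝ) ^ (2 * g - 1)))
    ⟨0, le_rfl, fun y hy => hy.elim⟩ ?_ ?_ ?_
  · rintro s t hst ⟨C, hC, h⟩
    exact ⟨C, hC, fun y hy => h y (hst hy)⟩
  · rintro s t ⟨C, hC, h⟩ ⟨C', hC', h'⟩
    refine ⟨C + C', by positivity, fun y hy n hn v hv => ?_⟩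
    have h1 : (0 : ℝ) ≤ (n : ℝ) ^ (2 * g) := by positivity
    have h2 : (0 : ℝ) ≤ (n : ℝ) ^ (2 * g - 1) := by positivity
    rcases hy with hy | hy
    · obtain ⟨h3, h4⟩ := h y hy n hn v hv
      exact ⟨h3.trans (mul_le_mul_of_nonneg_right (by linarith) h1),
        fun hs => (h4 hs).trans (mul_le_mul_of_nonneg_right (by linarith) h2)⟩
    · obtain ⟨h3, h4⟩ := h' y hy n hn v hv
      exact ⟨h3.trans (mul_le_mul_of_nonneg_right (by linarith) h1),
        fun hs => (h4 hs).trans (mul_le_mul_of_nonneg_right (by linarith) h2)⟩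
  · intro b hb
    obtain ⟨c, δ, ψ, ρ, W, β, t, hbc, rfl, -, hB, -⟩ :=
      exists_bettiDatum_of_mem hp hσ hf hpf hfσ (hKr hb)
    have T := hbc.isTorusFibration hp
    have hsub : Metric.closedBall c (δ / 2) ⊆ Metric.ball c δ :=
      Metric.closedBall_subset_ball (by linarith [hbc.pos])
    obtain ⟨C, hC, h⟩ := hB.exists_upper_bound hκ T hf (isCompact_closedBall c (δ / 2)) hsub
    have hnhds := hbc.isLocalParam.image_mem_nhdsWithin (Metric.mem_ball_self hbc.pos)
      (Metric.closedBall_mem_nhds c (by linarith [hbc.pos] : 0 < δ / 2))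
    refine ⟨_, nhdsWithin_mono _ (hKr.trans regularValues_subset_range) hnhds, C, hC, ?_⟩
    rintro y ⟨u, hu, hyu⟩ n hn v hv
    have hyO : y ∈ p ⁻¹' (ψ '' Metric.ball c δ) := ⟨u, hsub hu, hyu⟩
    have hq : (ρ ∘ p) y = u := by rw [Function.comp_apply, ← hyu, hbc.left_inv u (hsub hu)]
    obtain ⟨h1, h2⟩ := h y hyO (by rw [hq]; exact hu) n hn v hv
    exact ⟨h1, fun hs => h2 (by
      rw [hq]
      exact (isSlow_iff_of_bettiChart hg hκ hp hf hbc hB (hsub hu) hyu.symm).1 hs)⟩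

end Global

end LagrangianFibration

namespace LagrangianFibration

/-! ### Volumes of submanifolds and of their images -/

section Volume

variable {m n : ℕ} {X : Type*} [TopologicalSpace X] [ChartedSpace (Cn n) X]
  {κ : ∀ x : X, TX n x [⋀^Fin 2]→L[ℝ] ℝ}

/-- The density of the pull-back of `κ^m` by a parametrization. -/
noncomputable def volDensity (κ : ∀ x : X, TX n x [⋀^Fin 2]→L[ℝ] ℝ) (m : ℕ) (ψ : Cn m → X)
    (z : Cn m) : ℝ≥0∞ :=
  ENNReal.ofReal (wedgePow (κ (ψ z)) m fun k => holDeriv m n ψ z (realFrame m k))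

theorem volDensity_eq_rpull {ψ : Cn m → X} {z : Cn m}
    (hψ : MDifferentiableAt 𝓘(ℂ, Cn m) 𝓘(ℂ, Cn n) ψ z) :
    volDensity κ m ψ z = ENNReal.ofReal (rpull (wedgeFun κ m) ψ z (realFrame m)) :=
  congrArg (fun v => ENNReal.ofReal (wedgeFun κ m (ψ z) v))
    (funext fun k => (rderiv_eq_pderiv (n := n) hψ (realFrame m k)).symm)

/-- The change of variables formula for densities; no sign appears because the real determinant of a
complex linear map is non-negative. -/
theorem volDensity_eq_of_comp {ψ φ : Cn m → X} {h : Cn m → Cn m} {z : Cn m} {h' : Cn m →L[ℂ] Cn m}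
    (hφ : MDifferentiableAt 𝓘(ℂ, Cn m) 𝓘(ℂ, Cn n) φ (h z)) (hh : HasFDerivAt h h' z)
    (he : (fun z => φ (h z)) =ᶠ[𝓝 z] ψ) :
    volDensity κ m ψ z =
      ENNReal.ofReal |(h'.restrictScalars ℝ).det| * volDensity κ m φ (h z) := by
  have h1 : MDifferentiableAt 𝓘(ℂ, Cn m) 𝓘(ℂ, Cn n) (fun z => φ (h z)) z :=
    hφ.comp z hh.differentiableAt.mdifferentiableAt
  rw [volDensity_eq_rpull (h1.congr_of_eventuallyEq he.symm), volDensity_eq_rpull hφ,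
    ← rpull_congr _ he, ← ENNReal.ofReal_mul (abs_nonneg _)]
  congr 1
  rw [rpull_comp (wedgeFun κ m) (HasMFDerivAt.real hφ.hasMFDerivAt).mdifferentiableAt
    (hh.restrictScalars ℝ)]
  have h2 := wedgePow_frame_comp (κ (φ (h z))) (rderiv n φ (h z)).toLinearMap h'.toLinearMap
  have h3 : (h'.restrictScalars ℝ).det = Complex.normSq (LinearMap.det h'.toLinearMap) := by
    have := LinearMap.det_restrictScalars (R := ℝ) (f := h'.toLinearMap)
    rw [Algebra.norm_complex_apply] at this
    exact this
  rw [h3, abs_of_nonneg (Complex.normSq_nonneg _)]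
  exact h2

theorem volDensity_comp_le (hκ : IsKahlerForm κ) {F : X → X} {χ : Cn m → X} {z : Cn m}
    (hF : MDifferentiableAt 𝓘(ℂ, Cn n) 𝓘(ℂ, Cn n) F (χ z))
    (hχ : MDifferentiableAt 𝓘(ℂ, Cn m) 𝓘(ℂ, Cn n) χ z) {C : ℝ} (hC : 0 ≤ C)
    (h : ∀ v : Fin (2 * m) → TX n (χ z), (∀ i, κ (χ z) ![v i, Complex.I • v i] ≤ 1) →
      |pullWedge κ m F (χ z) v| ≤ C) :
    volDensity κ m (fun z => F (χ z)) z ≤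
      ENNReal.ofReal (C / stdVolume m) * volDensity κ m χ z := by
  have h1 := abs_wedgePow_frame_le (κ := κ (χ z)) (hκ.type_one_one _) (hκ.pos _)
    (holDeriv m n χ z).toLinearMap (κ (F (χ z)))
    ((holDeriv n n F (χ z)).restrictScalars ℝ).toLinearMap h
  have h2 : ∀ a, holDeriv m n (fun z => F (χ z)) z a =
      holDeriv n n F (χ z) (holDeriv m n χ z a) := fun a =>
    congrArg (fun L : Cn m →L[ℂ] Cn n => L a) (hF.hasMFDerivAt.comp z hχ.hasMFDerivAt).mfderiv
  have h3 : volDensity κ m (fun z => F (χ z)) z = ENNReal.ofReal (wedgePow (κ (F (χ z))) m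
      fun k => holDeriv n n F (χ z) (holDeriv m n χ z (realFrame m k))) :=
    congrArg (fun v => ENNReal.ofReal (wedgePow (κ (F (χ z))) m v))
      (funext fun k => h2 (realFrame m k))
  rw [h3, volDensity, ← ENNReal.ofReal_mul (div_nonneg hC (stdVolume_pos m).le)]
  exact ENNReal.ofReal_le_ofReal ((le_abs_self _).trans h1)

/-- The volume of the image of a compact part of a parametrization bounds the volume of families of
disjoint patches. -/
theorem sum_lintegral_volDensity_le [IsManifold 𝓘(ℂ, Cn n) ω X] {M : Set X} {B : Set (Cn m)}
    {D : Set (Cn m)} {φ : Cn m → X}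
    (hφ : IsLocalParam n m M D φ) (hB : IsOpen B) (hBD : B ⊆ D) {k : ℕ} {A : Fin k → Set (Cn m)}
    {ψ : Fin k → Cn m → X} (hA : ∀ i, IsOpen (A i))
    (hψ : ∀ i, MDifferentiableOn 𝓘(ℂ, Cn m) 𝓘(ℂ, Cn n) (ψ i) (A i))
    (hinj : ∀ i, InjOn (ψ i) (A i)) (hsub : ∀ i, ψ i '' A i ⊆ φ '' B)
    (hdisj : ∀ i j, i ≠ j → Disjoint (ψ i '' A i) (ψ j '' A j)) :
    ∑ i, ∫⁻ z in A i, volDensity κ m (ψ i) z ≤ ∫⁻ z in B, volDensity κ m φ z := by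
  have hφB : φ '' B ⊆ M := by
    obtain ⟨W, -, hWe⟩ := hφ.isOpen_image B hBD hB
    rw [hWe]
    exact inter_subset_left
  -- The transition maps from the patches to the parametrization `φ`. They are holomorphic, as seen
  -- with the local left inverses of `φ`, and have disjoint images, so the change of variables
  -- bounds the sum by a single integral.
  set h : Fin k → Cn m → Cn m := fun i z => Function.invFunOn φ B (ψ i z)
  have hφh : ∀ i, ∀ z ∈ A i, φ (h i z) = ψ i z := fun i z hz =>
    Function.invFunOn_eq (hsub i ⟨z, hz, rfl⟩)
  have hhB : ∀ i, ∀ z ∈ A i, h i z ∈ B := fun i z hz =>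
    Function.invFunOn_mem (hsub i ⟨z, hz, rfl⟩)
  have hhd : ∀ i, DifferentiableOn ℂ (h i) (A i) := by
    intro i z hz
    obtain ⟨ρ, W, D₀, hW, hzW, hρ, -, -, hD₀D, -, hright⟩ := hφ.exists_leftInverse (hBD (hhB i z hz))
    rw [hφh i z hz] at hzW
    have h1 : MDifferentiableAt 𝓘(ℂ, Cn m) 𝓘(ℂ, Cn n) (ψ i) z :=
      (hψ i).mdifferentiableAt ((hA i).mem_nhds hz)
    have h2 : MDifferentiableAt 𝓘(ℂ, Cn m) 𝓘(ℂ, Cn m) (fun z => ρ (ψ i z)) z :=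
      (hρ.mdifferentiableAt (hW.mem_nhds hzW)).comp z h1
    refine (h2.differentiableAt.congr_of_eventuallyEq ?_).differentiableWithinAt
    filter_upwards [(hA i).mem_nhds hz, h1.continuousAt.eventually_mem (hW.mem_nhds hzW)] with y hy hyW
    obtain ⟨h3, h4⟩ := hright (ψ i y) ⟨hφB (hsub i ⟨y, hy, rfl⟩), hyW⟩
    exact hφ.injOn (hBD (hhB i y hy)) (hD₀D h3) ((hφh i y hy).trans h4.symm)
  have hhinj : ∀ i, InjOn (h i) (A i) := fun i y hy z hz hyz =>
    hinj i hy hz (by rw [← hφh i y hy, hyz, hφh i z hz])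
  have key : ∀ i, ∫⁻ z in A i, volDensity κ m (ψ i) z = ∫⁻ z in h i '' A i, volDensity κ m φ z := by
    intro i
    have hd : ∀ z ∈ A i, HasFDerivAt (h i) (fderiv ℂ (h i) z) z := fun z hz =>
      ((hhd i).differentiableAt ((hA i).mem_nhds hz)).hasFDerivAt
    rw [lintegral_image_eq_lintegral_abs_det_fderiv_mul volume (hA i).measurableSet
      (fun z hz => ((hd z hz).restrictScalars ℝ).hasFDerivWithinAt) (hhinj i)]
    refine setLIntegral_congr_fun (hA i).measurableSet fun z hz => ?_
    refine volDensity_eq_of_comp (hφ.holomorphic.mdifferentiableAt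
      (hφ.isOpen.mem_nhds (hBD (hhB i z hz)))) (hd z hz) ?_
    filter_upwards [(hA i).mem_nhds hz] with y hy using hφh i y hy
  have hmeas : ∀ i, MeasurableSet (h i '' A i) := fun i =>
    measurable_image_of_fderivWithin (hA i).measurableSet
      (fun z hz => (((hhd i).differentiableAt ((hA i).mem_nhds hz)).hasFDerivAt.restrictScalars
        ℝ).hasFDerivWithinAt) (hhinj i)
  have hdisj' : Pairwise (Function.onFun Disjoint fun i => h i '' A i) := by
    intro i j hij
    refine disjoint_left.2 ?_
    rintro _ ⟨z, hz, rfl⟩ ⟨y, hy, hyz⟩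
    refine disjoint_left.1 (hdisj i j hij) ⟨z, hz, rfl⟩ ⟨y, hy, ?_⟩
    rw [← hφh i z hz, ← hyz, hφh j y hy]
  rw [Finset.sum_congr rfl fun i _ => key i, ← tsum_fintype (L := .unconditional _), ← lintegral_iUnion hmeas hdisj']
  refine lintegral_mono_set (iUnion_subset fun i => ?_)
  rintro _ ⟨z, hz, rfl⟩
  exact hhB i z hz

/-- A compact submanifold has finite volume. -/
theorem vol_lt_top [IsManifold 𝓘(ℂ, Cn n) ω X] (hκ : IsKahlerForm κ) {M : Set X} (hM : IsCompact M)
    (hsub : ∀ x ∈ M, ∃ (D : Set (Cn m)) (φ : Cn m → X), IsLocalParam n m M D φ ∧ x ∈ φ '' D) :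
    vol κ m M < ⊤ := by
  have hloc : ∀ x ∈ M, ∃ (D B : Set (Cn m)) (φ : Cn m → X) (W : Set X), IsLocalParam n m M D φ ∧
      IsOpen B ∧ B ⊆ D ∧ IsOpen W ∧ x ∈ W ∧ φ '' B = M ∩ W ∧
      ∫⁻ z in B, volDensity κ m φ z < ⊤ := by
    intro x hx
    obtain ⟨D, φ, hφ, z, hz, rfl⟩ := hsub x hx
    obtain ⟨r, hr, hrD⟩ := Metric.nhds_basis_closedBall.mem_iff.1 (hφ.isOpen.mem_nhds hz)
    have hBD : Metric.ball z r ⊆ D := Metric.ball_subset_closedBall.trans hrD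
    obtain ⟨W, hW, hWe⟩ := hφ.isOpen_image _ hBD Metric.isOpen_ball
    refine ⟨D, Metric.ball z r, φ, W, hφ, Metric.isOpen_ball, hBD, hW,
      (hWe ▸ (⟨z, Metric.mem_ball_self hr, rfl⟩ : φ z ∈ φ '' Metric.ball z r) :
        φ z ∈ M ∩ W).2, hWe, ?_⟩
    have h1 := (continuousInCharts_wedgeFun hκ m).continuousOn_rpull hφ.isOpen (H := φ) fun z hz =>
      (contMDiffAt_of_mdifferentiableOn hφ.isOpen hφ.holomorphic hz).contMDiffWithinAt
    obtain ⟨C, hC⟩ := (isCompact_closedBall z r).exists_bound_of_continuousOn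
      (h1.comp (f := fun z : Cn m => (z, realFrame m)) (by fun_prop)
        fun z hz => ⟨hrD hz, mem_univ _⟩)
    refine (setLIntegral_mono' measurableSet_ball (g := fun _ => ENNReal.ofReal C)
      fun y hy => ?_).trans_lt ?_
    · rw [volDensity_eq_rpull (hφ.holomorphic.mdifferentiableAt (hφ.isOpen.mem_nhds (hBD hy)))]
      exact ENNReal.ofReal_le_ofReal
        ((le_abs_self _).trans (hC y (Metric.ball_subset_closedBall hy)))
    · rw [setLIntegral_const]
      exact ENNReal.mul_lt_top ENNReal.ofReal_lt_top measure_ball_lt_top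
  choose! D B φ W hφ hB hBD hW hxW hWe hfin using hloc
  obtain ⟨s, hsM, hcov⟩ := hM.elim_nhds_subcover W fun x hx => (hW x hx).mem_nhds (hxW x hx)
  refine lt_of_le_of_lt (b := ∑ x ∈ s, ∫⁻ z in B x, volDensity κ m (φ x) z) ?_
    (ENNReal.sum_lt_top.2 fun x hx => hfin x (hsM x hx))
  refine iSup_le fun k => iSup_le fun A => iSup_le fun ψ => iSup_le fun h1 => iSup_le fun h2 => ?_
  -- Each patch is cut along a finite cover of `M` by parametrized pieces of finite volume; overlaps
  -- only increase the bound.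
  have h3 : ∀ i, ∫⁻ z in A i, volDensity κ m (ψ i) z ≤
      ∑ x ∈ s, ∫⁻ z in A i ∩ ψ i ⁻¹' W x, volDensity κ m (ψ i) z := by
    intro i
    have h4 : A i ⊆ ⋃ x : s, A i ∩ ψ i ⁻¹' W x := fun z hz => by
      have := hcov ((h1 i).2.2.2 ⟨z, hz, rfl⟩)
      simp only [mem_iUnion] at this ⊢
      obtain ⟨x, hx, hxz⟩ := this
      exact ⟨⟨x, hx⟩, hz, hxz⟩
    refine (lintegral_mono_set h4).trans ((lintegral_iUnion_le _ _).trans (le_of_eq ?_))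
    rw [tsum_fintype, Finset.sum_coe_sort s fun x => ∫⁻ z in A i ∩ ψ i ⁻¹' W x, volDensity κ m (ψ i) z]
  have h5 : ∑ i, ∫⁻ z in A i, volDensity κ m (ψ i) z ≤
      ∑ x ∈ s, ∫⁻ z in B x, volDensity κ m (φ x) z := by
    refine (Finset.sum_le_sum fun i _ => h3 i).trans ?_
    rw [Finset.sum_comm]
    refine Finset.sum_le_sum fun x hx => ?_
    have hx' := hsM x hx
    refine sum_lintegral_volDensity_le (hφ x hx') (hB x hx') (hBD x hx')
      (fun i => (h1 i).2.1.continuousOn.isOpen_inter_preimage (h1 i).1 (hW x hx'))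
      (fun i => (h1 i).2.1.mono inter_subset_left) (fun i => (h1 i).2.2.1.mono inter_subset_left)
      (fun i => ?_) fun i j hij => (h2 i j hij).mono (image_mono inter_subset_left)
        (image_mono inter_subset_left)
    rintro _ ⟨z, ⟨hz, hzW⟩, rfl⟩
    rw [hWe x hx']
    exact ⟨(h1 i).2.2.2 ⟨z, hz, rfl⟩, hzW⟩
  exact h5

/-- Volumes are controlled by the uniform norms of the pull-backs of `κ^m`. -/
theorem vol_image_le (hκ : IsKahlerForm κ) {M S : Set X} {F G : X → X}
    (hF : MDifferentiable 𝓘(ℂ, Cn n) 𝓘(ℂ, Cn n) F) (hG : MDifferentiable 𝓘(ℂ, Cn n) 𝓘(ℂ, Cn n) G)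
    (hFG : Function.LeftInverse F G) (hGF : Function.LeftInverse G F) {C : ℝ} (hC : 0 ≤ C)
    (h : ∀ y, F y ∈ S → ∀ v : Fin (2 * m) → TX n y, (∀ i, κ y ![v i, Complex.I • v i] ≤ 1) →
      |pullWedge κ m F y v| ≤ C) :
    vol κ m (F '' M ∩ S) ≤ ENNReal.ofReal (C / stdVolume m) * vol κ m M := by
  refine iSup_le fun k => iSup_le fun A => iSup_le fun ψ => iSup_le fun h1 => iSup_le fun h2 => ?_
  -- The inverse `G` carries disjoint patches of `F '' M` to disjoint patches of `M`, an admissible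
  -- family for the volume of `M`.
  have h3 : ∑ i, ∫⁻ z in A i, volDensity κ m (fun z => G (ψ i z)) z ≤ vol κ m M := by
    refine le_iSup_of_le k (le_iSup_of_le A (le_iSup_of_le (fun i z => G (ψ i z))
      (le_iSup_of_le (fun i => ⟨(h1 i).1, hG.comp_mdifferentiableOn (h1 i).2.1,
        hFG.injective.comp_injOn (h1 i).2.2.1, ?_⟩) (le_iSup_of_le ?_ le_rfl))))
    · rintro _ ⟨z, hz, rfl⟩
      obtain ⟨y, hy, hyz⟩ := ((h1 i).2.2.2 ⟨z, hz, rfl⟩).1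
      simp only
      rwa [← hyz, hGF y]
    · intro i j hij
      have h4 : ∀ i, (fun z => G (ψ i z)) '' A i = G '' (ψ i '' A i) := fun i =>
        (image_image G (ψ i) (A i)).symm
      rw [h4, h4]
      exact disjoint_image_of_injective hFG.injective (h2 i j hij)
  refine le_trans ?_ (mul_le_mul_right h3 _)
  rw [Finset.mul_sum]
  refine Finset.sum_le_sum fun i _ => ?_
  rw [← lintegral_const_mul' _ _ ENNReal.ofReal_ne_top]
  refine setLIntegral_mono' (h1 i).1.measurableSet fun z hz => ?_
  have h5 : ψ i = fun z => F (G (ψ i z)) := funext fun z => (hFG _).symm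
  have h6 := volDensity_comp_le hκ (F := F) (χ := fun z => G (ψ i z)) (z := z) (hF _)
    ((hG _).comp z ((h1 i).2.1.mdifferentiableAt ((h1 i).1.mem_nhds hz))) hC
    (h _ (by rw [hFG]; exact ((h1 i).2.2.2 ⟨z, hz, rfl⟩).2))
  rw [← h5] at h6
  exact h6

theorem le_vol_of_patch {M : Set X} {A : Set (Cn m)} {ψ : Cn m → X} (hA : IsOpen A)
    (hψ : MDifferentiableOn 𝓘(ℂ, Cn m) 𝓘(ℂ, Cn n) ψ A) (hinj : InjOn ψ A) (hsub : ψ '' A ⊆ M)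
    {c : ℝ} (h : ∀ z ∈ A, c ≤ wedgePow (κ (ψ z)) m fun k => holDeriv m n ψ z (realFrame m k)) :
    ENNReal.ofReal c * volume A ≤ vol κ m M := by
  refine le_trans ?_ (le_iSup_of_le 1 (le_iSup_of_le (fun _ => A) (le_iSup_of_le (fun _ => ψ)
    (le_iSup_of_le (fun _ => ⟨hA, hψ, hinj, hsub⟩)
      (le_iSup_of_le (fun i j hij => (hij (Subsingleton.elim i j)).elim) le_rfl)))))
  rw [Fin.sum_univ_one, ← setLIntegral_const]
  exact setLIntegral_mono' hA.measurableSet fun z hz => ENNReal.ofReal_le_ofReal (h z hz)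

end Volume

end LagrangianFibration

/-! ### Étale points of multisections -/

namespace LagrangianFibration

theorem eventually_injective_fderiv {g : ℕ} {Ω : Set (Cn g)} (hΩ : IsOpen Ω) {h : Cn g → Cn g}
    (hh : DifferentiableOn ℂ h Ω) {z : Cn g} (hz : z ∈ Ω) (hinj : Function.Injective (fderiv ℂ h z)) :
    ∀ᶠ w in 𝓝 z, Function.Injective (fderiv ℂ h w) := by
  have h0 : ∀ w, (fderiv ℂ h w).det ≠ 0 ↔ Function.Injective (fderiv ℂ h w) := fun w => by
    refine ⟨fun h1 => ?_, fun h1 h2 => ?_⟩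
    · exact LinearMap.ker_eq_bot.1 (LinearMap.isUnit_iff_ker_eq_bot _ |>.1
        ((LinearMap.isUnit_iff_isUnit_det _).2 (isUnit_iff_ne_zero.2 h1)))
    · have h3 := LinearMap.bot_lt_ker_of_det_eq_zero (f := (fderiv ℂ h w).toLinearMap) h2
      rw [LinearMap.ker_eq_bot.2 h1] at h3
      exact lt_irrefl _ h3
  have h1 : ContinuousAt (fderiv ℂ h) z :=
    ((contDiffOn_infty_of_differentiableOn hΩ hh).continuousOn_fderiv_of_isOpen hΩ
      (by simp)).continuousAt (hΩ.mem_nhds hz)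
  have h2 := (ContinuousLinearMap.continuous_det.continuousAt.comp h1).eventually_ne ((h0 z).2 hinj)
  filter_upwards [h2] with w hw using (h0 w).1 hw

theorem image_mem_nhds_of_injective_fderiv {g : ℕ} {Ω : Set (Cn g)} (hΩ : IsOpen Ω)
    {h : Cn g → Cn g} (hh : DifferentiableOn ℂ h Ω) {z : Cn g} (hz : z ∈ Ω)
    (hinj : Function.Injective (fderiv ℂ h z)) {D : Set (Cn g)} (hD : D ∈ 𝓝 z) :
    h '' D ∈ 𝓝 (h z) := by
  have h1 : ContDiffAt ℂ 1 h z :=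
    ((contDiffOn_infty_of_differentiableOn hΩ hh).contDiffAt (hΩ.mem_nhds hz)).of_le (by simp)
  have h2 := (h1.hasStrictFDerivAt one_ne_zero).map_nhds_eq_of_surj
    (LinearMap.range_eq_top.2 (LinearMap.injective_iff_surjective.1 hinj))
  rw [← h2]
  exact image_mem_map hD

section Etale

variable {g N : ℕ} {X : Type*} [TopologicalSpace X] [ChartedSpace (Cn (2 * g)) X]
  {P : Type*} [TopologicalSpace P] [ChartedSpace (Cn N) P] {p : X → P} {M : Set X}

/-- `M` is étale over the base of the fibration at the point `y`. -/
def IsEtale (N : ℕ) {P : Type*} [TopologicalSpace P] [ChartedSpace (Cn N) P] (p : X → P) (M : Set X)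
    (y : X) : Prop :=
  ∃ (D : Set (Cn g)) (φ : Cn g → X), IsLocalParam (2 * g) g M D φ ∧
    ∃ z ∈ D, φ z = y ∧ Function.Injective (holDeriv g N (p ∘ φ) z)

/-- At an étale point `ρ ∘ p ∘ φ` is a local biholomorphism. The factorization `p = ψ ∘ ρ ∘ p` is
required only along `φ`, so that the statement also applies at points which may lie over critical
values. -/
theorem exists_etale_neighborhood (hp : MDifferentiable 𝓘(ℂ, Cn (2 * g)) 𝓘(ℂ, Cn N) p)
    {D : Set (Cn g)} {φ : Cn g → X}
    (hφ : IsLocalParam (2 * g) g M D φ) {z : Cn g} (hz : z ∈ D)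
    (hinj : Function.Injective (holDeriv g N (p ∘ φ) z)) {ρ : P → Cn g} {W : Set P} (hW : IsOpen W)
    (hρ : MDifferentiableOn 𝓘(ℂ, Cn N) 𝓘(ℂ, Cn g) ρ W) (hzW : p (φ z) ∈ W) {ψ : Cn g → P}
    (hψ : MDifferentiableAt 𝓘(ℂ, Cn g) 𝓘(ℂ, Cn N) ψ (ρ (p (φ z))))
    (he : ∀ᶠ w in 𝓝 z, p (φ w) = ψ (ρ (p (φ w)))) :
    ∃ Ω, IsOpen Ω ∧ z ∈ Ω ∧ Ω ⊆ D ∧ DifferentiableOn ℂ (fun w => ρ (p (φ w))) Ω ∧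
      (∀ w ∈ Ω, p (φ w) ∈ W ∧ p (φ w) = ψ (ρ (p (φ w))) ∧
        Function.Injective (fderiv ℂ (fun w => ρ (p (φ w))) w) ∧ IsEtale (g := g) N p M (φ w)) := by
  have hpφ : MDifferentiableOn 𝓘(ℂ, Cn g) 𝓘(ℂ, Cn N) (p ∘ φ) D := hp.comp_mdifferentiableOn hφ.holomorphic
  set Ω₀ := D ∩ (p ∘ φ) ⁻¹' W
  have hΩ₀ : IsOpen Ω₀ := hpφ.continuousOn.isOpen_inter_preimage hφ.isOpen hW
  have hd : ∀ w ∈ Ω₀, HasMFDerivAt 𝓘(ℂ, Cn g) 𝓘(ℂ, Cn g) (fun w => ρ (p (φ w))) w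
      ((mfderiv 𝓘(ℂ, Cn N) 𝓘(ℂ, Cn g) ρ (p (φ w))).comp (holDeriv g N (p ∘ φ) w)) := fun w hw =>
    (hρ.mdifferentiableAt (hW.mem_nhds hw.2)).hasMFDerivAt.comp w
      (hpφ.mdifferentiableAt (hφ.isOpen.mem_nhds hw.1)).hasMFDerivAt
  have hdiff : DifferentiableOn ℂ (fun w => ρ (p (φ w))) Ω₀ := fun w hw =>
    (hd w hw).mdifferentiableAt.differentiableAt.differentiableWithinAt
  have hz₀ : z ∈ Ω₀ := ⟨hz, hzW⟩
  have h1 : Function.Injective (fderiv ℂ (fun w => ρ (p (φ w))) z) := by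
    have h2 : HasMFDerivAt 𝓘(ℂ, Cn g) 𝓘(ℂ, Cn N) (p ∘ φ) z ((holDeriv g N ψ (ρ (p (φ z)))).comp
        (mfderiv 𝓘(ℂ, Cn g) 𝓘(ℂ, Cn g) (fun w => ρ (p (φ w))) z)) :=
      (hψ.hasMFDerivAt.comp z (hd z hz₀).mdifferentiableAt.hasMFDerivAt).congr_of_eventuallyEq he
    intro a b hab
    refine hinj ?_
    have h3 : mfderiv 𝓘(ℂ, Cn g) 𝓘(ℂ, Cn g) (fun w => ρ (p (φ w))) z a =
        mfderiv 𝓘(ℂ, Cn g) 𝓘(ℂ, Cn g) (fun w => ρ (p (φ w))) z b := by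
      rw [mfderiv_eq_fderiv]
      exact hab
    have h4 : ∀ a, holDeriv g N (p ∘ φ) z a = holDeriv g N ψ (ρ (p (φ z)))
        (mfderiv 𝓘(ℂ, Cn g) 𝓘(ℂ, Cn g) (fun w => ρ (p (φ w))) z a) := fun a =>
      congrArg (fun L : Cn g →L[ℂ] Cn N => L a) h2.mfderiv
    exact (h4 a).trans ((congrArg (holDeriv g N ψ (ρ (p (φ z)))) h3).trans (h4 b).symm)
  obtain ⟨Ω₁, hΩ₁, hΩ₁o, hzΩ₁⟩ := eventually_nhds_iff.1
    ((eventually_injective_fderiv hΩ₀ hdiff hz₀ h1).and he)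
  refine ⟨Ω₀ ∩ Ω₁, hΩ₀.inter hΩ₁o, ⟨hz₀, hzΩ₁⟩, inter_subset_left.trans inter_subset_left,
    hdiff.mono inter_subset_left, fun w hw => ⟨hw.1.2, (hΩ₁ w hw.2).2, (hΩ₁ w hw.2).1,
      D, φ, hφ, w, hw.1.1, rfl, fun a b hab => (hΩ₁ w hw.2).1 ?_⟩⟩
  have h5 := (hd w hw.1).mfderiv
  rw [mfderiv_eq_fderiv] at h5
  rw [h5]
  exact congrArg (mfderiv 𝓘(ℂ, Cn N) 𝓘(ℂ, Cn g) ρ (p (φ w))) hab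

theorem exists_notMem_of_thin (hg : 1 ≤ g) {Ω : Set (Cn g)} (hΩ : IsOpen Ω) {h : Cn g → Cn g}
    (hh : DifferentiableOn ℂ h Ω) {z : Cn g} (hz : z ∈ Ω) (hinj : Function.Injective (fderiv ℂ h z))
    {S : Set (Cn g)} (hS : Thin (g - 1) S) : ∃ w ∈ Ω, h w ∉ S := by
  have h1 := image_mem_nhds_of_injective_fderiv hΩ hh hz hinj (hΩ.mem_nhds hz)
  obtain ⟨_, hwS, ⟨w, hw, rfl⟩⟩ := (hS.dense_compl (by omega)).inter_nhds_nonempty h1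
  exact ⟨w, hw, hwS⟩

/-- In a parametrization of `M`, the non-étale points over `W` lie on the zero set of the
determinant of `d(ρ ∘ p ∘ φ)`, where the rank is at most `g - 1`. -/
theorem thin_image_not_isEtale [SecondCountableTopology X]
    (hp : MDifferentiable 𝓘(ℂ, Cn (2 * g)) 𝓘(ℂ, Cn N) p)
    (hM : ∀ x ∈ M, ∃ (D : Set (Cn g)) (ψ : Cn g → X), IsLocalParam (2 * g) g M D ψ ∧ x ∈ ψ '' D)
    {ρ : P → Cn g} {W : Set P} (hW : IsOpen W) (hρ : MDifferentiableOn 𝓘(ℂ, Cn N) 𝓘(ℂ, Cn g) ρ W) :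
    Thin (g - 1) ((ρ ∘ p) '' ({y | y ∈ M ∧ ¬ IsEtale (g := g) N p M y} ∩ p ⁻¹' W)) := by
  refine Thin.image_of_locally fun y ⟨⟨hyM, hy⟩, hyW⟩ => ?_
  obtain ⟨D, φ, hφ, z, hz, rfl⟩ := hM y hyM
  obtain ⟨V, hV, hVe⟩ := hφ.isOpen_image D subset_rfl hφ.isOpen
  have hpφ : MDifferentiableOn 𝓘(ℂ, Cn g) 𝓘(ℂ, Cn N) (p ∘ φ) D := hp.comp_mdifferentiableOn hφ.holomorphic
  set Ω := D ∩ (p ∘ φ) ⁻¹' W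
  have hΩ : IsOpen Ω := hpφ.continuousOn.isOpen_inter_preimage hφ.isOpen hW
  have hd : ∀ w ∈ Ω, HasMFDerivAt 𝓘(ℂ, Cn g) 𝓘(ℂ, Cn g) (ρ ∘ p ∘ φ) w
      ((mfderiv 𝓘(ℂ, Cn N) 𝓘(ℂ, Cn g) ρ (p (φ w))).comp (holDeriv g N (p ∘ φ) w)) := fun w hw =>
    (hρ.mdifferentiableAt (hW.mem_nhds hw.2)).hasMFDerivAt.comp w
      (hpφ.mdifferentiableAt (hφ.isOpen.mem_nhds hw.1)).hasMFDerivAt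
  have hdiff : DifferentiableOn ℂ (ρ ∘ p ∘ φ) Ω := fun w hw =>
    (hd w hw).mdifferentiableAt.differentiableAt.differentiableWithinAt
  have hdet : DifferentiableOn ℂ (fun w => LinearMap.det (fderiv ℂ (ρ ∘ p ∘ φ) w).toLinearMap) Ω := by
    have h1 : ∀ w, LinearMap.det (fderiv ℂ (ρ ∘ p ∘ φ) w).toLinearMap =
        ∑ τ : Equiv.Perm (Fin g), ((Equiv.Perm.sign τ : ℤ) : ℂ) *
          ∏ i, fderiv ℂ (ρ ∘ p ∘ φ) w (Pi.single i 1) (τ i) := fun w => by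
      rw [← LinearMap.det_toMatrix', Matrix.det_apply']
      simp [LinearMap.toMatrix'_apply]
    simp only [h1]
    refine DifferentiableOn.fun_sum fun τ _ => DifferentiableOn.const_mul
      (fun w hw => ?_) _
    exact (HasFDerivWithinAt.finsetProd fun i _ => (differentiableOn_pi.1
      (differentiableOn_fderiv_apply hΩ hdiff (Pi.single i 1)) (τ i) w hw).hasFDerivWithinAt).differentiableWithinAt
  refine ⟨V, hV.mem_nhds (hVe ▸ (⟨z, hz, rfl⟩ : φ z ∈ φ '' D) : φ z ∈ M ∩ V).2, ?_⟩
  refine (imagesThin g (g - 1) Ω (ρ ∘ p ∘ φ)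
    {fun w => LinearMap.det (fderiv ℂ (ρ ∘ p ∘ φ) w).toLinearMap} hΩ hdiff
    (fun χ hχ => by rw [mem_singleton_iff.1 hχ]; exact hdet) fun w hw h0 => ?_).mono ?_
  · have h1 := LinearMap.bot_lt_ker_of_det_eq_zero (h0 _ (mem_singleton _))
    have h2 := LinearMap.finrank_range_add_finrank_ker (fderiv ℂ (ρ ∘ p ∘ φ) w).toLinearMap
    have h3 := Submodule.one_le_finrank_iff.2 h1.ne'
    rw [Module.finrank_fin_fun] at h2
    omega
  · rintro _ ⟨x, ⟨⟨⟨hxM, hx⟩, hxW⟩, hxV⟩, rfl⟩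
    obtain ⟨w, hw, rfl⟩ : x ∈ φ '' D := hVe ▸ ⟨hxM, hxV⟩
    refine ⟨w, ⟨⟨hw, hxW⟩, fun χ hχ => ?_⟩, rfl⟩
    rw [mem_singleton_iff.1 hχ]
    simp only
    by_contra hne
    refine hx ⟨D, φ, hφ, w, hw, rfl, fun a b hab => ?_⟩
    have h1 : Function.Injective (fderiv ℂ (ρ ∘ p ∘ φ) w) :=
      LinearMap.ker_eq_bot.1 (LinearMap.isUnit_iff_ker_eq_bot _ |>.1
        ((LinearMap.isUnit_iff_isUnit_det _).2 (isUnit_iff_ne_zero.2 hne)))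
    refine h1 ?_
    have h5 := (hd w ⟨hw, hxW⟩).mfderiv
    rw [mfderiv_eq_fderiv] at h5
    rw [h5]
    exact congrArg (mfderiv 𝓘(ℂ, Cn N) 𝓘(ℂ, Cn g) ρ (p (φ w))) hab

end Etale

end LagrangianFibration

namespace LagrangianFibration

section Etale

variable {g N : ℕ} {X : Type*} [TopologicalSpace X] [ChartedSpace (Cn (2 * g)) X]
  {P : Type*} [TopologicalSpace P] [ChartedSpace (Cn N) P] {p : X → P} {M : Set X}
  {D : Set (Cn g)} {φ : Cn g → X} {z : Cn g}

theorem IsLocalParam.le_rk (hp : MDifferentiable 𝓘(ℂ, Cn (2 * g)) 𝓘(ℂ, Cn N) p)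
    (hφ : IsLocalParam (2 * g) g M D φ) (hz : z ∈ D)
    (hinj : Function.Injective (holDeriv g N (p ∘ φ) z)) : g ≤ rk (2 * g) N p (φ z) := by
  have h1 : mfderiv 𝓘(ℂ, Cn g) 𝓘(ℂ, Cn N) (p ∘ φ) z =
      (holDeriv (2 * g) N p (φ z)).comp (holDeriv g (2 * g) φ z) :=
    ((hp (φ z)).hasMFDerivAt.comp z
      (hφ.holomorphic.mdifferentiableAt (hφ.isOpen.mem_nhds hz)).hasMFDerivAt).mfderiv
  have h2 : Module.finrank ℂ (LinearMap.range (holDeriv g N (p ∘ φ) z).toLinearMap) = g :=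
    (LinearMap.finrank_range_of_inj hinj).trans (Module.finrank_fin_fun ℂ)
  have h3 : Module.finrank ℂ (LinearMap.range ((holDeriv (2 * g) N p (φ z)).toLinearMap ∘ₗ
      (holDeriv g (2 * g) φ z).toLinearMap)) = g :=
    (congrArg (fun L : Cn g →L[ℂ] Cn N => Module.finrank ℂ (LinearMap.range L.toLinearMap))
      h1.symm).trans h2
  have h4 := Submodule.finrank_mono (LinearMap.range_comp_le_range
    (holDeriv g (2 * g) φ z).toLinearMap (holDeriv (2 * g) N p (φ z)).toLinearMap)
  exact h3.symm.le.trans h4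

theorem IsEtale.mem {y : X} (h : IsEtale (g := g) N p M y) : y ∈ M := by
  obtain ⟨D, φ, hφ, z, hz, hy, -⟩ := h
  obtain ⟨W, -, hW⟩ := hφ.isOpen_image D subset_rfl hφ.isOpen
  exact (hW ▸ hy ▸ mem_image_of_mem φ hz : y ∈ M ∩ W).1

/-- A patch of `M`, étale over the domain of a chart of the base. -/
theorem BaseChart.exists_etale_patch (hp : MDifferentiable 𝓘(ℂ, Cn (2 * g)) 𝓘(ℂ, Cn N) p)
    {c : Cn g} {δ : ℝ} {ψ : Cn g → P} {ρ : P → Cn g} {W : Set P} (h : BaseChart N p c δ ψ ρ W)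
    (hφ : IsLocalParam (2 * g) g M D φ) (hz : z ∈ D)
    (hinj : Function.Injective (holDeriv g N (p ∘ φ) z)) {V : Set P} (hV : IsOpen V)
    (hzV : p (φ z) ∈ V) (hVψ : range p ∩ V ⊆ ψ '' Metric.ball c δ) :
    ∃ Ω, IsOpen Ω ∧ z ∈ Ω ∧ Ω ⊆ D ∧ DifferentiableOn ℂ (fun w => ρ (p (φ w))) Ω ∧
      (∀ w ∈ Ω, p (φ w) ∈ V ∧ p (φ w) = ψ (ρ (p (φ w))) ∧ ρ (p (φ w)) ∈ Metric.ball c δ ∧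
        Function.Injective (fderiv ℂ (fun w => ρ (p (φ w))) w) ∧ IsEtale (g := g) N p M (φ w)) := by
  have h1 : ∀ y, p y ∈ V → p y ∈ W ∧ ψ (ρ (p y)) = p y ∧ ρ (p y) ∈ Metric.ball c δ := fun y hy => by
    obtain ⟨u, hu, huy⟩ := hVψ ⟨mem_range_self y, hy⟩
    rw [← huy, h.left_inv u hu]
    exact ⟨h.mem_W u hu, rfl, hu⟩
  have hcont : ContinuousAt (p ∘ φ) z := hp.continuous.continuousAt.comp
    (hφ.holomorphic.mdifferentiableAt (hφ.isOpen.mem_nhds hz)).continuousAt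
  obtain ⟨Ω, hΩ, hzΩ, hΩD, hd, hall⟩ := exists_etale_neighborhood hp hφ hz hinj (h.isOpen_W.inter hV)
    (h.mdiff.mono inter_subset_left) ⟨(h1 _ hzV).1, hzV⟩
    (h.isLocalParam.holomorphic.mdifferentiableAt (Metric.isOpen_ball.mem_nhds (h1 _ hzV).2.2))
    ((hcont.eventually (hV.mem_nhds hzV)).mono fun w hw => (h1 (φ w) hw).2.1.symm)
  exact ⟨Ω, hΩ, hzΩ, hΩD, hd, fun w hw => ⟨(hall w hw).1.2, (hall w hw).2.1,
    (h1 _ (hall w hw).1.2).2.2, (hall w hw).2.2⟩⟩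

variable [IsManifold 𝓘(ℂ, Cn (2 * g)) ω X] [IsManifold 𝓘(ℂ, Cn N) ω P] [T2Space P]
  [CompactSpace X] [ConnectedSpace X] [SecondCountableTopology X]
  {σ : ∀ x : X, TX (2 * g) x [⋀^Fin 2]→L[ℂ] ℂ}

/-- The given étale point may lie over a critical value. The projection of `M` near it covers an
open set of the local parameters, while critical values form a thin set there: a nearby étale point
lies over `B°`. -/
theorem IsLocalParam.exists_regular (hg : 1 ≤ g) (hp : IsLagrangianFibration g N σ p)
    (hR : (regularValues g N p).Nonempty)
    (hφ : IsLocalParam (2 * g) g M D φ) (hz : z ∈ D)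
    (hinj : Function.Injective (holDeriv g N (p ∘ φ) z)) :
    ∃ y, IsEtale (g := g) N p M y ∧ p y ∈ regularValues g N p := by
  obtain ⟨b, hb⟩ := hR
  have hle := rk_le_of_mem_regularValues hp.holomorphic hb
  obtain ⟨e, ρ, W, ψ, δ, hδ, hW, hρ, hxe, he, htgt, hex, hψ, hψW, hall⟩ :=
    exists_local_structure hp.holomorphic hle (hφ.le_rk hp.holomorphic hz hinj)
  have hcont := (hφ.holomorphic.mdifferentiableAt (hφ.isOpen.mem_nhds hz)).continuousAt
  have hb0 : ρ (p (φ z)) ∈ Metric.ball (ρ (p (φ z))) δ := Metric.mem_ball_self hδ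
  have hval : ∀ x ∈ e.source, p x = ψ (ρ (p x)) := fun x hx =>
    (hall x hx).2.1.trans (congrArg ψ (hall x hx).1)
  obtain ⟨Ω, hΩ, hzΩ, -, hd, hΩall⟩ := exists_etale_neighborhood hp.holomorphic hφ hz hinj hW hρ
    (by rw [hval _ hxe]; exact (hψW _ hb0).1)
    (hψ.mdifferentiableAt (Metric.isOpen_ball.mem_nhds hb0))
    ((hcont.eventually (e.open_source.mem_nhds hxe)).mono fun w hw => hval _ hw)
  obtain ⟨w, hw, hwS⟩ := exists_notMem_of_thin hg hΩ hd hzΩ (hΩall z hzΩ).2.2.1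
    (thin_image_crit hg hp.holomorphic hW hρ)
  refine ⟨φ w, (hΩall w hw).2.2.2, (mem_regularValues_iff hp.holomorphic hp.connected hle).2
    ⟨mem_range_self _, fun x hx => ?_⟩⟩
  by_contra hlt
  refine hwS ⟨x, ⟨not_le.1 hlt, ?_⟩, congrArg ρ hx⟩
  show p x ∈ W
  rw [hx]
  exact (hΩall w hw).1

/-- A multisection has étale points over each non-empty open subset of the regular values. -/
theorem IsMultisection.exists_etale (hg : 1 ≤ g) (hp : IsLagrangianFibration g N σ p)
    (hM : IsMultisection g N p M) {V : Set P} (hV : IsOpen V) (hne : (regularValues g N p ∩ V).Nonempty) :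
    ∃ y, IsEtale (g := g) N p M y ∧ p y ∈ regularValues g N p ∩ V := by
  set R := regularValues g N p
  -- The branch values of `M`. In base charts they form a thin set, so `R \ K` is dense in `R` and
  -- connected.
  set K := p '' {y | y ∈ M ∧ ¬ IsEtale (g := g) N p M y}
  obtain ⟨b₀, hb₀, hb₀V⟩ := hne
  have hpc := hp.holomorphic.continuous
  have hthin : ∀ {c : Cn g} {δ : ℝ} {ψ : Cn g → P} {ρ : P → Cn g} {W : Set P},
      BaseChart N p c δ ψ ρ W → Thin (g - 1) {u | u ∈ Metric.ball c δ ∧ ψ u ∈ K} := by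
    intro c δ ψ ρ W hbc
    refine (thin_image_not_isEtale hp.holomorphic hM.submanifold hbc.isOpen_W hbc.mdiff).mono ?_
    rintro u ⟨hu, y, hy, hyu⟩
    refine ⟨y, ⟨hy, ?_⟩, ?_⟩
    · show p y ∈ W
      rw [hyu]; exact hbc.mem_W u hu
    · show ρ (p y) = u
      rw [hyu]; exact hbc.left_inv u hu
  have hdense : R ⊆ closure (R \ K) := by
    intro b hb
    obtain ⟨c, δ, ψ, ρ, W, hbc, rfl⟩ := exists_baseChart_of_mem hp hb
    have h1 : c ∈ closure (Metric.ball c δ ∩ {u | u ∈ Metric.ball c δ ∧ ψ u ∈ K}ᶜ) :=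
      ((hthin hbc).dense_compl (by omega)).open_subset_closure_inter Metric.isOpen_ball
        (Metric.mem_ball_self hbc.pos)
    refine closure_mono ?_ ((hbc.isLocalParam.holomorphic.mdifferentiableAt
      (Metric.isOpen_ball.mem_nhds (Metric.mem_ball_self hbc.pos))).continuousAt.continuousWithinAt.mem_closure_image h1)
    rintro _ ⟨u, ⟨hu, hu'⟩, rfl⟩
    exact ⟨hbc.subset_regular ⟨u, hu, rfl⟩, fun h => hu' ⟨hu, h⟩⟩
  have hpre : IsPreconnected (R \ K) := by
    refine isPreconnected_diff_of_locally (isPreconnected_regularValues hg hp.holomorphic hp.connected)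
      (fun b hb => ?_) hdense
    obtain ⟨c, δ, ψ, ρ, W, hbc, rfl⟩ := exists_baseChart_of_mem hp hb
    refine ⟨ψ '' Metric.ball c δ, hbc.subset_regular, nhdsWithin_mono _ regularValues_subset_range
      (hbc.isLocalParam.image_mem_nhdsWithin (Metric.mem_ball_self hbc.pos)
        (Metric.ball_mem_nhds c hbc.pos)), ?_⟩
    have h1 : ψ '' Metric.ball c δ \ K =
        ψ '' (Metric.ball c δ \ {u | u ∈ Metric.ball c δ ∧ ψ u ∈ K}) := by
      ext y
      constructor
      · rintro ⟨⟨u, hu, rfl⟩, h⟩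
        exact ⟨u, ⟨hu, fun h' => h h'.2⟩, rfl⟩
      · rintro ⟨u, ⟨hu, h⟩, rfl⟩
        exact ⟨⟨u, hu, rfl⟩, fun h' => h ⟨hu, h'⟩⟩
    rw [h1]
    exact ((hthin hbc).isPreconnected_diff (by omega) Metric.isOpen_ball (convex_ball c δ)).image _
      (hbc.isLocalParam.holomorphic.continuousOn.mono diff_subset)
  have hpatch : ∀ y, IsEtale (g := g) N p M y → p y ∈ R → p '' M ∈ 𝓝[R] (p y) ∧ ∃ y', IsEtale (g := g) N p M y' ∧
      p y' ∈ R \ K := by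
    rintro _ ⟨D, φ, hφ, z, hz, rfl, hinj⟩ hy
    obtain ⟨c, δ, ψ, ρ, W, hbc, hc⟩ := exists_baseChart_of_mem hp hy
    obtain ⟨V', hV', hVe⟩ := hbc.isLocalParam.isOpen_image _ subset_rfl Metric.isOpen_ball
    have hzV : p (φ z) ∈ V' := (hVe ▸ hc ▸ mem_image_of_mem ψ (Metric.mem_ball_self hbc.pos) :
      p (φ z) ∈ range p ∩ V').2
    obtain ⟨Ω, hΩ, hzΩ, hΩD, hd, hall⟩ := hbc.exists_etale_patch hp.holomorphic hφ hz hinj hV' hzV hVe.ge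
    refine ⟨?_, ?_⟩
    · have h1 := image_mem_nhds_of_injective_fderiv hΩ hd hzΩ (hall z hzΩ).2.2.2.1 (hΩ.mem_nhds hzΩ)
      have h2 := hbc.isLocalParam.image_mem_nhdsWithin (hall z hzΩ).2.2.1 h1
      rw [← (hall z hzΩ).2.1] at h2
      refine mem_of_superset (nhdsWithin_mono _ regularValues_subset_range h2) ?_
      rintro _ ⟨_, ⟨w, hw, rfl⟩, rfl⟩
      exact ⟨φ w, (hall w hw).2.2.2.2.mem, (hall w hw).2.1⟩
    · obtain ⟨w, hw, hwS⟩ := exists_notMem_of_thin hg hΩ hd hzΩ (hall z hzΩ).2.2.2.1 (hthin hbc)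
      refine ⟨φ w, (hall w hw).2.2.2.2, ?_, fun h => hwS ⟨(hall w hw).2.2.1, ?_⟩⟩
      · rw [(hall w hw).2.1]
        exact hbc.subset_regular ⟨_, (hall w hw).2.2.1, rfl⟩
      · rw [← (hall w hw).2.1]; exact h
  obtain ⟨y₀, hy₀⟩ := hM.connected.nonempty
  obtain ⟨_, ⟨D, φ, hφ, z, hz, -, hinj⟩⟩ := closure_nonempty_iff.1 ⟨y₀, hM.transverse hy₀⟩
  obtain ⟨y₁, hy₁, hy₁R⟩ := hφ.exists_regular hg hp ⟨b₀, hb₀⟩ hz hinj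
  obtain ⟨-, y₂, hy₂, hy₂R⟩ := hpatch y₁ hy₁ hy₁R
  have hclosed : IsClosed (p '' M) := (hM.isClosed.isCompact.image hpc).isClosed
  have hnot : ∀ y ∈ M, p y ∉ K → IsEtale (g := g) N p M y := fun y hy h => by
    by_contra h'
    exact h ⟨y, ⟨hy, h'⟩, rfl⟩
  -- The image of `M` is closed by compactness, and it is a neighborhood in `R` of each of its
  -- points outside `K`, since `M` is étale there. It meets `R \ K`, hence contains this connected
  -- set.
  have hcov : R \ K ⊆ p '' M := by
    have h1 := isPreconnected_iff_subset_of_disjoint.1 hpre {b | ∃ W, IsOpen W ∧ b ∈ W ∧ W ∩ R ⊆ p '' M}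
      (p '' M)ᶜ (isOpen_iff_forall_mem_open.2 fun b ⟨W, hW, hbW, h⟩ =>
        ⟨W, fun b' hb' => ⟨W, hW, hb', h⟩, hW, hbW⟩) hclosed.isOpen_compl ?_ ?_
    · rcases h1 with h1 | h1
      · intro b hb
        obtain ⟨W, -, hbW, h⟩ := h1 hb
        exact h ⟨hbW, hb.1⟩
      · exact absurd (mem_image_of_mem p hy₂.mem) (h1 hy₂R)
    · rintro b ⟨hbR, hbK⟩
      by_cases hbM : b ∈ p '' M
      · obtain ⟨y, hy, rfl⟩ := hbM
        exact Or.inl (mem_nhdsWithin.1 (hpatch y (hnot y hy hbK) hbR).1)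
      · exact Or.inr hbM
    · ext b
      constructor
      · rintro ⟨hb, ⟨W, -, hbW, h⟩, h'⟩
        exact h' (h ⟨hbW, hb.1⟩)
      · simp
  obtain ⟨b, hbV, hb⟩ := mem_closure_iff.1 (hdense hb₀) V hV hb₀V
  obtain ⟨y, hy, rfl⟩ := hcov hb
  exact ⟨y, hnot y hy hb.2, hb.1, hbV⟩

end Etale

end LagrangianFibration

/-! ### Growth of volumes and conclusion -/

namespace LagrangianFibration

theorem continuousAt_jac {g : ℕ} {t : Cn g → Fin (2 * g) → ℝ} {u : Cn g} (h : ContDiffAt ℝ ∞ t u) :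
    ContinuousAt (jac t) u := by
  have h1 : ContinuousAt (fderiv ℝ t) u := (h.fderiv_right (m := 0) (by simp)).continuousAt
  have h2 : ContinuousAt (fun u => Matrix.of fun i k => fderiv ℝ t u (realFrame g k) i) u :=
    continuousAt_pi.2 fun i => continuousAt_pi.2 fun k =>
      (continuous_apply i).continuousAt.comp (h1.clm_apply continuousAt_const)
  exact (Continuous.matrix_det continuous_id).continuousAt.comp h2

theorem not_isBigOPow_of_le {a : ℕ → ℝ≥0∞} {m : ℕ} (hm : 1 ≤ m) {c : ℝ} (hc : 0 < c) {v : ℝ≥0∞}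
    (hv : v ≠ 0) (h : ∀ᶠ n : ℕ in atTop, ENNReal.ofReal (c * (n : ℝ) ^ m) * v ≤ a n) :
    ¬ IsBigOPow a (m - 1) := by
  rintro ⟨C, hC⟩
  obtain ⟨k, rfl⟩ : ∃ k, m = k + 1 := ⟨m - 1, by omega⟩
  -- `v` may be infinite; replacing it by `min v 1` allows the comparison of real numbers.
  have hv' : 0 < min v 1 := lt_min (pos_iff_ne_zero.2 hv) one_pos
  have hvt : min v 1 ≠ ⊤ := (min_le_right v 1).trans_lt ENNReal.one_lt_top |>.ne
  set s := (min v 1).toReal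
  have hs : 0 < s := ENNReal.toReal_pos hv'.ne' hvt
  obtain ⟨n, hn, h1, h2, h3⟩ := ((eventually_gt_atTop ⌈(C : ℝ) / (c * s)⌉₊).and
    (h.and (hC.and (eventually_ge_atTop 1)))).exists
  have h4 : ENNReal.ofReal (c * (n : ℝ) ^ (k + 1) * s) ≤ ENNReal.ofReal (C * (n : ℝ) ^ k) := by
    calc ENNReal.ofReal (c * (n : ℝ) ^ (k + 1) * s)
        = ENNReal.ofReal (c * (n : ℝ) ^ (k + 1)) * min v 1 := by
          rw [ENNReal.ofReal_mul (by positivity), ENNReal.ofReal_toReal hvt]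
      _ ≤ ENNReal.ofReal (c * (n : ℝ) ^ (k + 1)) * v := mul_le_mul_right (min_le_left v 1) _
      _ ≤ (C : ℝ≥0∞) * (n : ℝ≥0∞) ^ k := h1.trans h2
      _ = ENNReal.ofReal (C * (n : ℝ) ^ k) := by
          rw [ENNReal.ofReal_mul (NNReal.coe_nonneg C), ENNReal.ofReal_pow (by positivity), ENNReal.ofReal_natCast,
            ENNReal.ofReal_coe_nnreal]
  have h5 := (ENNReal.ofReal_le_ofReal_iff (by positivity)).1 h4
  have hn' : (C : ℝ) / (c * s) < n := Nat.lt_of_ceil_lt hn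
  rw [div_lt_iff₀ (by positivity)] at hn'
  have hn1 : (0 : ℝ) < n := by exact_mod_cast h3
  have h6 : c * s * n ≤ C := le_of_mul_le_mul_right (a := (n : ℝ) ^ k)
    (by rw [pow_succ] at h5; linarith) (by positivity)
  linarith

section Final

variable {g N : ℕ} {X : Type*} [TopologicalSpace X] [ChartedSpace (Cn (2 * g)) X]
  [IsManifold 𝓘(ℂ, Cn (2 * g)) ω X] [T2Space X]
  {P : Type*} [TopologicalSpace P] [ChartedSpace (Cn N) P] [IsManifold 𝓘(ℂ, Cn N) ω P]
  {σ : ∀ x : X, TX (2 * g) x [⋀^Fin 2]→L[ℂ] ℂ} {κ : ∀ x : X, TX (2 * g) x [⋀^Fin 2]→L[ℝ] ℝ}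
  {p : X → P} {f : X → X} {M : Set X}

/-- If the volume of the images of a multisection over an open subset of the base grows slowly,
the differentials grow slowly over all regular values. -/
theorem forall_isSlow_of_isBigOPow_vol [CompactSpace X] [ConnectedSpace X] [T2Space P]
    [SecondCountableTopology X]
    (hg : 1 ≤ g) (hκ : IsKahlerForm κ) (hp : IsLagrangianFibration g N σ p)
    (hσ : IsHolomorphicSymplectic σ)
    (hf : MDifferentiable 𝓘(ℂ, Cn (2 * g)) 𝓘(ℂ, Cn (2 * g)) f) (hfinj : Function.Injective f)
    (hpf : ∀ x, p (f x) = p x)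
    (hfσ : ∀ x, (σ (f x)).compContinuousLinearMap (holDeriv (2 * g) (2 * g) f x) = σ x)
    (hM : IsMultisection g N p M) {V : Set P} (hV : IsOpen V) (hne : (regularValues g N p ∩ V).Nonempty)
    (hvol : IsBigOPow (fun n => vol κ g (f^[n] '' M ∩ p ⁻¹' V)) (2 * g - 1)) :
    ∀ x, p x ∈ regularValues g N p → IsSlow κ f x := by
  refine forall_isSlow hg hκ hp hσ hf hpf hfσ hV hne fun x hxR hxV => ?_
  by_contra hx
  obtain ⟨c, δ, ψ, ρ, W, β, t, hbc, hc, -, hB, -⟩ := exists_bettiDatum_of_mem hp hσ hf hpf hfσ hxR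
  have hc₀ := Metric.mem_ball_self (x := c) hbc.pos
  have hjac : jac (t ∘ ψ) c ≠ 0 := fun h0 =>
    hx ((isSlow_iff_of_bettiChart hg hκ hp hf hbc hB hc₀ hc.symm).2 h0)
  -- If `x` is not slow, the jacobian is non-zero on a smaller ball of the base, whose image lies in
  -- `V`. An étale patch of `M` over this ball contributes a volume of order `n^{2g}`.
  obtain ⟨δ', hδ', hδs⟩ := Metric.eventually_nhds_iff_ball.1
    ((Metric.isOpen_ball.eventually_mem hc₀).and (((continuousAt_jac (hB.contDiffAt c hc₀)).eventually_ne hjac).and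
      ((hbc.isLocalParam.holomorphic.mdifferentiableAt
        (Metric.ball_mem_nhds c hbc.pos)).continuousAt.eventually_mem (hV.mem_nhds (hc ▸ hxV)))))
  have hbc' := hbc.mono hδ' fun u hu => (hδs u hu).1
  obtain ⟨V', hV', hVe⟩ := hbc'.isLocalParam.isOpen_image _ subset_rfl Metric.isOpen_ball
  have hcV' : p x ∈ V' := (hVe ▸ hc ▸ mem_image_of_mem ψ (Metric.mem_ball_self hδ') :
    p x ∈ range p ∩ V').2
  obtain ⟨_, ⟨D, φ, hφ, z, hz, rfl, hinj⟩, hyR, hyV⟩ := hM.exists_etale hg hp hV' ⟨_, hxR, hcV'⟩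
  obtain ⟨Ω, hΩ, hzΩ, hΩD, hd, hall⟩ :=
    hbc'.exists_etale_patch hp.holomorphic hφ hz hinj hV' hyV hVe.ge
  obtain ⟨r, hr, hrΩ⟩ := Metric.nhds_basis_closedBall.mem_iff.1 (hΩ.mem_nhds hzΩ)
  obtain ⟨a, ha, hlow⟩ := hB.exists_lower_bound hg hκ (hbc.isTorusFibration hp) hf hΩ
    (hφ.holomorphic.mono hΩD)
    (fun w hw => ⟨ρ (p (φ w)), (hδs _ (hall w hw).2.2.1).1, (hall w hw).2.1.symm⟩)
    (isCompact_closedBall z r) hrΩ (fun w hw => (hδs _ (hall w (hrΩ hw)).2.2.1).2.1)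
    (fun w hw => (hall w (hrΩ hw)).2.2.2.1)
  have hball : Metric.ball z r ⊆ Ω := Metric.ball_subset_closedBall.trans hrΩ
  have hpf' : ∀ n x, p (f^[n] x) = p x := fun n => by
    induction n with
    | zero => exact fun x => rfl
    | succ n ih => exact fun x => by rw [Function.iterate_succ_apply, ih, hpf]
  refine not_isBigOPow_of_le (by omega) ha (Metric.measure_ball_pos volume z hr).ne'
    (hlow.mono fun n hn => le_vol_of_patch Metric.isOpen_ball
      ((mdifferentiable_iterate hf n).comp_mdifferentiableOn (hφ.holomorphic.mono (hball.trans hΩD)))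
      ((hfinj.iterate n).comp_injOn (hφ.injOn.mono (hball.trans hΩD))) ?_
      fun w hw => hn w (Metric.ball_subset_closedBall hw)) hvol
  rintro _ ⟨w, hw, rfl⟩
  refine ⟨⟨φ w, (hall w (hball hw)).2.2.2.2.mem, rfl⟩, ?_⟩
  show p (f^[n] (φ w)) ∈ V
  rw [hpf', (hall w (hball hw)).2.1]
  exact (hδs _ (hall w (hball hw)).2.2.1).2.2

/-- Points of `f^n(M)` in `S` come from points of `M` in `S`, by backward invariance, so the norm
over `S` is enough to apply `vol_image_le`. -/
theorem isBigOPow_vol_of_pullWedge_le (hκ : IsKahlerForm κ) {G : X → X}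
    (hf : MDifferentiable 𝓘(ℂ, Cn (2 * g)) 𝓘(ℂ, Cn (2 * g)) f)
    (hG : MDifferentiable 𝓘(ℂ, Cn (2 * g)) 𝓘(ℂ, Cn (2 * g)) G)
    (hfG : Function.LeftInverse f G) (hGf : Function.LeftInverse G f)
    (hM : vol κ g M < ⊤) {S : Set X} (hS : ∀ x, f x ∈ S → x ∈ S) {C : ℝ} (hC : 0 ≤ C) {k : ℕ}
    (h : ∀ᶠ n : ℕ in atTop, ∀ y ∈ S, ∀ v : Fin (2 * g) → TX (2 * g) y,
      (∀ i, κ y ![v i, Complex.I • v i] ≤ 1) → |pullWedge κ g f^[n] y v| ≤ C * (n : ℝ) ^ k) :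
    IsBigOPow (fun n => vol κ g (f^[n] '' M ∩ S)) k := by
  refine ⟨(C / stdVolume g).toNNReal * (vol κ g M).toNNReal, h.mono fun n hn => ?_⟩
  have hS' : ∀ n x, f^[n] x ∈ S → x ∈ S := fun n => by
    induction n with
    | zero => exact fun x hx => hx
    | succ n ih => exact fun x hx => hS x (ih (f x) hx)
  have h1 := vol_image_le (M := M) (S := S) hκ (mdifferentiable_iterate hf n)
    (mdifferentiable_iterate hG n) (hfG.iterate n) (hGf.iterate n)
    (by positivity : (0 : ℝ) ≤ C * (n : ℝ) ^ k) fun y hy v hv => hn y (hS' n y hy) v hv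
  refine h1.trans_eq ?_
  rw [mul_div_right_comm, ENNReal.ofReal_mul (div_nonneg hC (stdVolume_pos g).le),
    ENNReal.ofReal_pow (by positivity), ENNReal.ofReal_natCast, ENNReal.coe_mul,
    ENNReal.coe_toNNReal hM.ne, mul_right_comm]
  rfl

theorem isBigOPow_pullbackNorm_iff {S : Set X} {k : ℕ} :
    IsBigOPow (fun n => pullbackNorm κ g f^[n] S) k ↔ ∃ C : ℝ, 0 ≤ C ∧ ∀ᶠ n : ℕ in atTop, ∀ y ∈ S,
      ∀ v : Fin (2 * g) → TX (2 * g) y, (∀ i, κ y ![v i, Complex.I • v i] ≤ 1) →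
        |pullWedge κ g f^[n] y v| ≤ C * (n : ℝ) ^ k := by
  have hcast : ∀ (C : ℝ≥0) (n : ℕ), (C : ℝ≥0∞) * (n : ℝ≥0∞) ^ k = ENNReal.ofReal (C * (n : ℝ) ^ k) :=
    fun C n => by
      rw [ENNReal.ofReal_mul (NNReal.coe_nonneg C), ENNReal.ofReal_pow (by positivity),
        ENNReal.ofReal_natCast, ENNReal.ofReal_coe_nnreal]
  constructor
  · rintro ⟨C, hC⟩
    refine ⟨C, C.coe_nonneg, hC.mono fun n hn y hy v hv => ?_⟩
    rw [hcast] at hn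
    exact (ENNReal.ofReal_le_ofReal_iff (by positivity)).1
      (((le_iSup₂_of_le y hy (le_iSup₂_of_le v hv le_rfl) :
        ENNReal.ofReal |pullWedge κ g f^[n] y v| ≤ pullbackNorm κ g f^[n] S)).trans hn)
  · rintro ⟨C, hC, h⟩
    lift C to ℝ≥0 using hC
    refine ⟨C, h.mono fun n hn => ?_⟩
    rw [hcast]
    exact iSup₂_le fun y hy => iSup₂_le fun v hv => ENNReal.ofReal_le_ofReal (hn y hy v hv)

end Final

end LagrangianFibration

theorem mainTheorem6 {g N : ℕ} (hg : 1 ≤ g)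
    {X : Type*} [TopologicalSpace X] [T2Space X] [CompactSpace X] [ConnectedSpace X]
    [ChartedSpace (Cn (2 * g)) X]
    [IsManifold 𝓘(ℂ, Cn (2 * g)) ω X]
    {P : Type*} [TopologicalSpace P] [T2Space P]
    [ChartedSpace (Cn N) P]
    [IsManifold 𝓘(ℂ, Cn N) ω P]
    (σ : ∀ x : X, TX (2 * g) x [⋀^Fin 2]→L[ℂ] ℂ)
    (hσ : IsHolomorphicSymplectic σ)
    (p : X → P) (hp : IsLagrangianFibration g N σ p)
    (f : Diffeomorph 𝓘(ℂ, Cn (2 * g)) 𝓘(ℂ, Cn (2 * g))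
      X X ω)
    (hpf : ∀ x, p (f x) = p x)
    (hfσ : ∀ x, (σ (f x)).compContinuousLinearMap
      (holDeriv (2 * g) (2 * g) f x) = σ x)
    (κ : ∀ x : X, TX (2 * g) x [⋀^Fin 2]→L[ℝ] ℝ)
    (hκ : IsKahlerForm κ)
    (U : Set P) (hUne : U.Nonempty) (hUopen : ∃ W : Set P, IsOpen W ∧ U = range p ∩ W)
    (hU : closure U ⊆ regularValues g N p)
    (M : Set X) (hM : IsMultisection g N p M) :
    IsBigOPow
      (fun n => vol κ g ((f : X → X)^[n] '' M ∩ p ⁻¹' U)) (2 * g) ∧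
    List.TFAE [
      ∃ (β : BettiDatum g N p) (t : P → Fin (2 * g) → ℝ),
        IsTranslationVector β f t ∧
          ¬ HasMaximalVariation β t,
      ∀ (β : BettiDatum g N p) (t : P → Fin (2 * g) → ℝ),
        IsTranslationVector β f t →
          ¬ HasMaximalVariation β t,
      IsBigOPow
        (fun n => vol κ g ((f : X → X)^[n] '' M ∩ p ⁻¹' U)) (2 * g - 1),
      IsBigOPow
        (fun n => pullbackNorm κ g ((f : X → X)^[n]) (p ⁻¹' U))
        (2 * g - 1)] := by
  have : SecondCountableTopology X := ChartedSpace.secondCountable_of_sigmaCompact (Cn (2 * g)) X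
  have hf : MDifferentiable 𝓘(ℂ, Cn (2 * g)) 𝓘(ℂ, Cn (2 * g)) f := f.contMDiff.mdifferentiable (by simp)
  have hG : MDifferentiable 𝓘(ℂ, Cn (2 * g)) 𝓘(ℂ, Cn (2 * g)) f.symm :=
    f.symm.contMDiff.mdifferentiable (by simp)
  have hvolM : vol κ g M < ⊤ := vol_lt_top hκ hM.isClosed.isCompact hM.submanifold
  have hUreg : U ⊆ regularValues g N p := subset_closure.trans hU
  -- `P` need not be compact, but the range of `p` is, and it contains the closure of `U`.
  have hcpt : IsCompact (closure U) := (isCompact_range hp.holomorphic.continuous).of_isClosed_subset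
    isClosed_closure (hU.trans regularValues_subset_range)
  have hvol : ∀ {C : ℝ} {k : ℕ}, 0 ≤ C → (∀ᶠ n : ℕ in atTop, ∀ y ∈ p ⁻¹' U,
      ∀ v : Fin (2 * g) → TX (2 * g) y, (∀ i, κ y ![v i, Complex.I • v i] ≤ 1) →
        |pullWedge κ g (f : X → X)^[n] y v| ≤ C * (n : ℝ) ^ k) →
      IsBigOPow (fun n => vol κ g ((f : X → X)^[n] '' M ∩ p ⁻¹' U)) k := fun hC h =>
    isBigOPow_vol_of_pullWedge_le hκ hf hG f.apply_symm_apply f.symm_apply_apply hvolM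
      (fun x (hx : p (f x) ∈ U) => (hpf x ▸ hx : p x ∈ U)) hC h
  obtain ⟨C, hC, hbound⟩ := exists_uniform_bound hg hκ hp hσ hf hpf hfσ hcpt hU
  refine ⟨hvol hC ((eventually_ge_atTop 1).mono fun n hn y hy v hv =>
    (hbound y (subset_closure hy) n hn v hv).1), ?_⟩
  tfae_have 1 → 4 := by
    rintro ⟨β, t, ht, hmax⟩
    have hslow := forall_isSlow_of_not_hasMaximalVariation hg hκ hp hσ hf hpf hfσ ht hmax
    exact isBigOPow_pullbackNorm_iff.2 ⟨C, hC, (eventually_ge_atTop 1).mono fun n hn y hy v hv =>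
      (hbound y (subset_closure hy) n hn v hv).2 (hslow y (hUreg hy))⟩
  tfae_have 4 → 3 := fun h => by
    obtain ⟨C', hC', h'⟩ := isBigOPow_pullbackNorm_iff.1 h
    exact hvol hC' h'
  tfae_have 3 → 2 := fun h β t ht => by
    obtain ⟨W, hW, hUW⟩ := hUopen
    -- `U` is open only in `B`; its preimage is that of an open subset of `P`.
    have hpre : p ⁻¹' U = p ⁻¹' W := by
      rw [hUW, preimage_inter, preimage_range, univ_inter]
    rw [hpre] at h
    have hne : (regularValues g N p ∩ W).Nonempty :=
      hUne.mono fun b hb => ⟨hUreg hb, (hUW ▸ hb : b ∈ range p ∩ W).2⟩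
    exact not_hasMaximalVariation_of_isSlow hg hκ hp hσ hf
      (forall_isSlow_of_isBigOPow_vol hg hκ hp hσ hf f.injective hpf hfσ hM hW hne h) ht
  -- The universal statement would be empty without a Betti datum admitting a translation vector;
  -- one is constructed near a point of `U`.
  tfae_have 2 → 1 := fun h => by
    obtain ⟨b, hb⟩ := hUne
    obtain ⟨-, -, -, -, -, β, t, -, -, ht, -⟩ := exists_bettiDatum_of_mem hp hσ hf hpf hfσ (hUreg hb)
    exact ⟨β, t, ht, h β t ht⟩
  tfae_finish
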